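/- Let $k \ge 3$ be an integer and let $w:\mathbb{R}\to\mathbb{R}$ be a smooth function supported in $[1,2]$ with $\int w(y)^2\,dy = 1$. Let $\tau_k(n)$ be the number of ordered $k$-tuples of positive integers with product $n$. For integers $d \ge 1$ and $a$ with $(a,d)=1$, and for real $X>0$, put $$\Delta_w(\tau_k;X,d,a) = \sum_{n\equiv a\ (\mathrm{mod}\ d)} \tau_k(n)\, w\!\left(\frac nX\right) - \frac{1}{\varphi(d)} \sum_{(n,d)=1} \tau_k(n)\, w\!\left(\frac nX\right),$$ $n$ running over the positive integers. Put $$a_k(d) = \lim_{s\to 1^+} (s-1)^{k^2} \sum_{\substack{n\ge 1\\ (n,d)=1}} \frac{\tau_k(n)^2}{n^s}, \qquad \gamma_k(c) = \frac{(k-c)^{k^2-1}}{(k^2-1)!} \quad (k-1 \le c < k),$$ where the series converges for $s>1$ and the limit exists for every $d\ge 1$. Then, with $X = d^c$, $$\sum_{\substack{1\le a\le d\\ (a,d)=1}} \left|\Delta_w(\tau_k;X,d,a)\right|^2 \sim a_k(d)\,\gamma_k(c)\, X\, (\log d)^{k^2-1}$$ as $d\to\infty$ through all positive integers, for $c \in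 (k-1,k)$, uniformly in $c$ on compact subsets of $(k-1,k)$. That is, for all $\delta>0$ and $\varepsilon>0$ there is $D$, depending only on $k, w, \delta, \varepsilon$, such that for all $d\ge D$ and all $c\in[k-1+\delta,\,k-\delta]$ the two sides differ by at most $\varepsilon\, a_k(d)\gamma_k(c)X(\log d)^{k^2-1}$. -/

import Mathlib

open Filter Topology
open scoped ContDiff Nat

noncomputable section

/-- The `k`-fold divisor function: the number of ordered `k`-tuples of positive integers with
product `n` (and `0` for `n = 0`). -/
def tauK (k n : ℕ) : ℕ := (Nat.finMulAntidiag k n).card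

/-- The smoothed discrepancy
`∑_{n ≡ a (d)} g(n) w(n/X) - (1/φ(d)) ∑_{(n,d)=1} g(n) w(n/X)`.
For `w` compactly supported in the positive reals and `X > 0` both series have only finitely many
nonzero terms, and the term `n = 0` vanishes. -/
def smoothDelta (w : ℝ → ℝ) (g : ℕ → ℝ) (X : ℝ) (d a : ℕ) : ℝ :=
  (∑' n : ℕ, if n ≡ a [MOD d] then g n * w (n / X) else 0)
    - 1 / (Nat.totient d : ℝ) * ∑' n : ℕ, if n.Coprime d then g n * w (n / X) else 0

/-- The variance `∑_{1 ≤ a ≤ d, (a,d)=1} |Δ_w(τ_k; X, d, a)|²`. -/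
def smoothVariance (w : ℝ → ℝ) (k : ℕ) (X : ℝ) (d : ℕ) : ℝ :=
  ∑ a ∈ (Finset.Icc 1 d).filter (fun a => a.Coprime d),
    |smoothDelta w (fun n => (tauK k n : ℝ)) X d a| ^ 2

/-- The `n`-th term of the Dirichlet series `∑_{n ≥ 1, (n,d)=1} τ_k(n)² / n^s`, `s` real (it is `0`
at `n = 0`). -/
def tauSqTerm (k d : ℕ) (s : ℝ) (n : ℕ) : ℝ :=
  if n.Coprime d then (tauK k n : ℝ) ^ 2 / (n : ℝ) ^ s else 0

/-- The arithmetic constant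
`a_k(d) = lim_{s → 1⁺} (s-1)^{k²} ∑_{n ≥ 1, (n,d)=1} τ_k(n)² / n^s`. -/
def arithConst (k d : ℕ) : ℝ :=
  limUnder (𝓝[>] (1 : ℝ)) (fun s : ℝ => (s - 1) ^ (k ^ 2) * ∑' n : ℕ, tauSqTerm k d s n)

/-- `γ_k(c) = (k-c)^{k²-1} / (k²-1)!`, for `k - 1 ≤ c < k`. -/
def gammaK (k : ℕ) (c : ℝ) : ℝ :=
  ((k : ℝ) - c) ^ (k ^ 2 - 1) / ((k ^ 2 - 1)! : ℝ)

end

open Filter Topology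
open scoped ContDiff Nat

open ArithmeticFunction in
/-- The `k`-fold divisor function as a real arithmetic function, i.e. the `k`-th Dirichlet power
of the constant function. -/
noncomputable def divK (k : ℕ) : ArithmeticFunction ℝ := ((zeta : ArithmeticFunction ℕ) : ArithmeticFunction ℝ) ^ k

section DivisorFunctions

theorem tauK_succ (k n : ℕ) (hn : n ≠ 0) :
    tauK (k + 1) n = ∑ p ∈ n.divisorsAntidiagonal, tauK k p.2 := by
  classical
  unfold tauK
  rw [← Finset.card_sigma]
  refine Finset.card_bij' (fun f _ => ⟨(f 0, ∏ i : Fin k, f i.succ), Fin.tail f⟩)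
    (fun x _ => Fin.cons x.1.1 x.2) ?_ ?_ ?_ ?_
  · intro f hf
    have h := Nat.mem_finMulAntidiag.1 hf
    simp only [Finset.mem_sigma, Nat.mem_divisorsAntidiagonal, Nat.mem_finMulAntidiag]
    rw [Fin.prod_univ_succ] at h
    refine ⟨⟨h.1, hn⟩, rfl, ?_⟩
    intro h0
    rw [h0, mul_zero] at h
    exact hn h.1.symm
  · rintro ⟨⟨a, b⟩, g⟩ hx
    simp only [Finset.mem_sigma, Nat.mem_divisorsAntidiagonal, Nat.mem_finMulAntidiag] at hx
    simp only [Nat.mem_finMulAntidiag, Fin.prod_univ_succ, Fin.cons_zero, Fin.cons_succ]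
    exact ⟨by rw [hx.2.1]; exact hx.1.1, hn⟩
  · intro f hf
    simp
  · rintro ⟨⟨a, b⟩, g⟩ hx
    simp only [Finset.mem_sigma, Nat.mem_divisorsAntidiagonal, Nat.mem_finMulAntidiag] at hx
    simp [hx.2.1]

open ArithmeticFunction in
theorem divK_succ_apply (k n : ℕ) :
    divK (k + 1) n = ∑ d ∈ n.divisors, divK k d := by
  rw [divK, pow_succ, mul_comm, coe_zeta_mul_apply]; rfl

theorem divK_add (i j : ℕ) : divK (i + j) = divK i * divK j := by
  simp [divK, pow_add]

theorem tauK_eq_divK (k n : ℕ) : (tauK k n : ℝ) = divK k n := by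
  induction k generalizing n with
  | zero =>
    rcases eq_or_ne n 0 with rfl | h0
    · simp [tauK, divK]
    by_cases h : n = 1
    · subst h
      have : Nat.finMulAntidiag 0 1 = {Fin.elim0} := by
        ext f; simp [Nat.mem_finMulAntidiag, eq_iff_true_of_subsingleton]
      simp [tauK, divK, this]
    · simp [tauK, divK, Nat.finMulAntidiag_zero_left h, ArithmeticFunction.one_apply_ne h]
  | succ k ih =>
    rcases eq_or_ne n 0 with rfl | h0
    · simp [tauK]
    rw [tauK_succ k n h0, divK_succ_apply, ← Nat.sum_divisorsAntidiagonal' (f := fun _ b => divK k b)]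
    push_cast
    exact Finset.sum_congr rfl fun p _ => ih p.2

theorem divK_nonneg (k n : ℕ) : 0 ≤ divK k n := by
  rw [← tauK_eq_divK]; positivity

theorem divK_one_right (k : ℕ) : divK k 1 = 1 := by
  induction k with
  | zero => simp [divK]
  | succ k ih => rw [divK_succ_apply]; simp [ih]

theorem divK_one_left {n : ℕ} (hn : n ≠ 0) : divK 1 n = 1 := by
  simp [divK, hn]

theorem divK_isMultiplicative (k : ℕ) : (divK k).IsMultiplicative :=
  (ArithmeticFunction.isMultiplicative_zeta.natCast).pow

theorem divK_prime (k : ℕ) {p : ℕ} (hp : p.Prime) : divK k p = k := by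
  induction k with
  | zero => simp [divK, ArithmeticFunction.one_apply_ne hp.ne_one]
  | succ k ih => rw [divK_succ_apply, hp.sum_divisors, ih, divK_one_right]; push_cast; ring

open scoped Pointwise in
theorem divK_mul_le (k m n : ℕ) : divK k (m * n) ≤ divK k m * divK k n := by
  induction k generalizing m n with
  | zero =>
    simp only [divK, pow_zero, ArithmeticFunction.one_apply]
    by_cases hm : m = 1 <;> by_cases hn : n = 1 <;> simp [hm, hn]
  | succ k ih =>
    classical
    simp only [divK_succ_apply, Finset.sum_mul_sum]
    rw [Nat.divisors_mul, ← Finset.sum_product']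
    calc ∑ d ∈ m.divisors * n.divisors, divK k d
        ≤ ∑ x ∈ m.divisors ×ˢ n.divisors, divK k (x.1 * x.2) := by
          rw [← Finset.image_mul_product]
          exact Finset.sum_image_le_of_nonneg (fun d _ => divK_nonneg k d)
      _ ≤ _ := Finset.sum_le_sum fun x _ => ih _ _

theorem divK_mul_divK_le (k l n : ℕ) : divK k n * divK l n ≤ divK (k * l) n := by
  induction k generalizing n with
  | zero =>
    simp only [divK, pow_zero, zero_mul]
    by_cases hn : n = 1
    · subst hn; simpa [divK] using (divK_one_right l).le
    · simp [ArithmeticFunction.one_apply_ne hn]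
  | succ k ih =>
    rw [add_mul, one_mul, divK_succ_apply, divK_add, ArithmeticFunction.mul_apply,
      ← Nat.sum_divisorsAntidiagonal (f := fun a _ => divK k a), Finset.sum_mul]
    refine Finset.sum_le_sum fun x hx => ?_
    obtain ⟨hx, -⟩ := Nat.mem_divisorsAntidiagonal.1 hx
    calc divK k x.1 * divK l n ≤ divK k x.1 * (divK l x.1 * divK l x.2) := by
          rw [← hx]; exact mul_le_mul_of_nonneg_left (divK_mul_le _ _ _) (divK_nonneg _ _)
      _ = (divK k x.1 * divK l x.1) * divK l x.2 := by ring
      _ ≤ _ := mul_le_mul_of_nonneg_right (ih _) (divK_nonneg _ _)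

theorem divK_sq_le (k n : ℕ) : divK k n ^ 2 ≤ divK (k ^ 2) n := by
  rw [sq, sq]; exact divK_mul_divK_le k k n

/-- The divisor bound. -/
theorem exists_card_divisors_le {ε : ℝ} (hε : 0 < ε) :
    ∃ C : ℝ, 1 ≤ C ∧ ∀ n : ℕ, n ≠ 0 → (n.divisors.card : ℝ) ≤ C * (n : ℝ) ^ ε := by
  -- a prime `p` with exponent `a` contributes at most `B`, and at most `p ^ (a ε)` if `p > P`
  set B : ℝ := 1 + 1 / (ε * Real.log 2) with hB
  have hl2 : 0 < Real.log 2 := Real.log_pos (by norm_num)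
  have hB1 : 1 ≤ B := by rw [hB]; have : 0 < 1 / (ε * Real.log 2) := by positivity
                         linarith
  obtain ⟨P, hP⟩ := exists_nat_gt ((2 : ℝ) ^ (1 / ε))
  have key : ∀ p : ℕ, p.Prime → ∀ a : ℕ, ((a + 1 : ℕ) : ℝ) ≤ (if p < P then B else 1) * ((p : ℝ) ^ a) ^ ε := by
    intro p hp a
    have hp0 : (0 : ℝ) < p := by exact_mod_cast hp.pos
    have e1 : ((p : ℝ) ^ a) ^ ε = Real.exp (a * (ε * Real.log p)) := by
      rw [← Real.rpow_natCast, ← Real.rpow_mul hp0.le, Real.rpow_def_of_pos hp0]; ring_nf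
    split_ifs with h
    · have h1 : Real.log 2 ≤ Real.log p := Real.log_le_log (by norm_num) (by exact_mod_cast hp.two_le)
      have h2 : 1 + a * (ε * Real.log 2) ≤ ((p : ℝ) ^ a) ^ ε := by
        rw [e1]
        have := Real.add_one_le_exp (a * (ε * Real.log p))
        have h3 : a * (ε * Real.log 2) ≤ a * (ε * Real.log p) := by gcongr
        linarith
      calc ((a + 1 : ℕ) : ℝ) ≤ B * (1 + a * (ε * Real.log 2)) := by
            rw [hB]; push_cast
            have : 1 / (ε * Real.log 2) * (a * (ε * Real.log 2)) = a := by field_simp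
            have h4 : 0 ≤ 1 / (ε * Real.log 2) := by positivity
            have h5 : 0 ≤ a * (ε * Real.log 2) := by positivity
            nlinarith
        _ ≤ _ := by gcongr
    · have h1 : (2 : ℝ) ≤ (p : ℝ) ^ ε := by
        have h2 : (2 : ℝ) ^ (1 / ε) ≤ p := hP.le.trans (by exact_mod_cast not_lt.1 h)
        calc (2 : ℝ) = ((2 : ℝ) ^ (1 / ε)) ^ ε := by
              rw [← Real.rpow_mul (by norm_num)]; field_simp; simp
          _ ≤ _ := by gcongr
      rw [one_mul, ← Real.rpow_natCast, ← Real.rpow_mul hp0.le, mul_comm, Real.rpow_mul hp0.le,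
        Real.rpow_natCast]
      calc ((a + 1 : ℕ) : ℝ) ≤ (2 : ℝ) ^ a := by exact_mod_cast Nat.succ_le_of_lt Nat.lt_two_pow_self
        _ ≤ _ := by gcongr
  refine ⟨B ^ P, one_le_pow₀ hB1, fun n hn => ?_⟩
  rw [Nat.card_divisors hn]
  push_cast
  have e2 : (n : ℝ) ^ ε = ∏ p ∈ n.primeFactors, ((p : ℝ) ^ n.factorization p) ^ ε := by
    conv_lhs => rw [← Nat.prod_factorization_pow_eq_self hn]
    rw [Finsupp.prod, Nat.support_factorization, Real.finsetProd_rpow _ _ (fun i _ => by positivity)]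
    push_cast; rfl
  calc ∏ p ∈ n.primeFactors, ((n.factorization p : ℝ) + 1)
      ≤ ∏ p ∈ n.primeFactors, ((if p < P then B else 1) * ((p : ℝ) ^ n.factorization p) ^ ε) := by
        refine Finset.prod_le_prod (fun i _ => by positivity) fun p hp => ?_
        have := key p (Nat.prime_of_mem_primeFactors hp) (n.factorization p)
        push_cast at this; exact this
    _ = (∏ p ∈ n.primeFactors, (if p < P then B else 1)) * (n : ℝ) ^ ε := by
        rw [Finset.prod_mul_distrib, e2]
    _ ≤ B ^ P * (n : ℝ) ^ ε := by
        gcongr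
        rw [Finset.prod_ite, Finset.prod_const, Finset.prod_const_one, mul_one]
        refine pow_le_pow_right₀ hB1 ?_
        calc _ ≤ (Finset.range P).card := Finset.card_le_card fun x hx => by
              simp at hx ⊢; exact hx.2
          _ = P := by simp

theorem exists_divK_le (k : ℕ) {ε : ℝ} (hε : 0 < ε) :
    ∃ C : ℝ, 1 ≤ C ∧ ∀ n : ℕ, n ≠ 0 → divK k n ≤ C * (n : ℝ) ^ ε := by
  induction k generalizing ε with
  | zero =>
    refine ⟨1, le_rfl, fun n hn => ?_⟩
    by_cases h : n = 1
    · subst h; simp [divK]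
    · simp [divK, ArithmeticFunction.one_apply_ne h]; positivity
  | succ k ih =>
    obtain ⟨C, hC, h⟩ := ih (half_pos hε)
    obtain ⟨C', hC', h'⟩ := exists_card_divisors_le (half_pos hε)
    refine ⟨C' * C, one_le_mul_of_one_le_of_one_le hC' hC, fun n hn => ?_⟩
    rw [divK_succ_apply]
    have hn' : (0 : ℝ) < n := by positivity
    calc ∑ d ∈ n.divisors, divK k d ≤ ∑ d ∈ n.divisors, C * (n : ℝ) ^ (ε / 2) := by
          refine Finset.sum_le_sum fun d hd => (h d (Nat.pos_of_mem_divisors hd).ne').trans ?_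
          have : (d : ℝ) ≤ n := by exact_mod_cast Nat.divisor_le hd
          gcongr
      _ = n.divisors.card * (C * (n : ℝ) ^ (ε / 2)) := by simp
      _ ≤ C' * (n : ℝ) ^ (ε / 2) * (C * (n : ℝ) ^ (ε / 2)) := by gcongr; exact h' n hn
      _ = C' * C * ((n : ℝ) ^ (ε / 2) * (n : ℝ) ^ (ε / 2)) := by ring
      _ = _ := by rw [← Real.rpow_add hn']; ring_nf

end DivisorFunctions

section Convolution

theorem hasSum_mul_arith {𝕜 : Type*} [RCLike 𝕜] (A B : ArithmeticFunction 𝕜) (g₀ : ℕ → 𝕜)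
    (h : Summable fun x : ℕ × ℕ => A x.1 * B x.2 * g₀ (x.1 * x.2)) :
    HasSum (fun n => (A * B) n * g₀ n) (∑' x : ℕ × ℕ, A x.1 * B x.2 * g₀ (x.1 * x.2)) := by
  have h1 := h.hasSum.tsum_fiberwise (fun x : ℕ × ℕ => x.1 * x.2)
  refine h1.congr_fun ?_
  intro n
  rcases eq_or_ne n 0 with rfl | hn
  · rw [ArithmeticFunction.map_zero, zero_mul]
    symm
    convert tsum_zero with x
    obtain ⟨⟨a, b⟩, hx⟩ := x
    simp only [Set.mem_preimage, Set.mem_singleton_iff, mul_eq_zero] at hx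
    rcases hx with rfl | rfl <;> simp
  · have hfin : (fun x : ℕ × ℕ => x.1 * x.2) ⁻¹' {n} = ↑(n.divisorsAntidiagonal) := by
      ext x; simp [hn]
    rw [ArithmeticFunction.mul_apply, Finset.sum_mul, ← Finset.tsum_subtype' n.divisorsAntidiagonal
      (fun x : ℕ × ℕ => A x.1 * B x.2 * g₀ n), ← hfin]
    refine tsum_congr fun x => ?_
    rw [show x.1.1 * x.1.2 = n from x.2]

theorem hasSum_mul_arith_rpow {A B : ArithmeticFunction ℝ} {σ a b : ℝ}
    (hA : HasSum (fun n => A n * (n : ℝ) ^ (-σ)) a) (hB : HasSum (fun n => B n * (n : ℝ) ^ (-σ)) b) :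
    HasSum (fun n => (A * B) n * (n : ℝ) ^ (-σ)) (a * b) := by
  have e : (fun x : ℕ × ℕ => A x.1 * B x.2 * (fun n : ℕ => (n : ℝ) ^ (-σ)) (x.1 * x.2)) =
      fun x => (A x.1 * (x.1 : ℝ) ^ (-σ)) * (B x.2 * (x.2 : ℝ) ^ (-σ)) := by
    ext x
    simp only [Nat.cast_mul]
    rw [Real.mul_rpow (by positivity) (by positivity)]; ring
  have hs := summable_mul_of_summable_norm hA.summable.norm hB.summable.norm
  have := hasSum_mul_arith A B (fun n : ℕ => (n : ℝ) ^ (-σ)) (by rw [e]; exact hs)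
  rw [e, ← tsum_mul_tsum_of_summable_norm hA.summable.norm hB.summable.norm, hA.tsum_eq,
    hB.tsum_eq] at this
  exact this

theorem abs_mul_arith_le {f g F G : ArithmeticFunction ℝ} (hf : ∀ n, |f n| ≤ F n)
    (hg : ∀ n, |g n| ≤ G n) (n : ℕ) : |(f * g) n| ≤ (F * G) n := by
  simp only [ArithmeticFunction.mul_apply]
  refine (Finset.abs_sum_le_sum_abs _ _).trans (Finset.sum_le_sum fun x _ => ?_)
  rw [abs_mul]
  exact mul_le_mul (hf _) (hg _) (abs_nonneg _) ((abs_nonneg _).trans (hf _))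

theorem abs_pow_arith_le {f F : ArithmeticFunction ℝ} (hf : ∀ n, |f n| ≤ F n) (k n : ℕ) :
    |(f ^ k) n| ≤ (F ^ k) n := by
  induction k generalizing n with
  | zero => simp only [pow_zero, ArithmeticFunction.one_apply]; split_ifs <;> simp
  | succ k ih => rw [pow_succ, pow_succ]; exact abs_mul_arith_le ih hf n

open Classical in
/-- The restriction of an arithmetic function to a set of positive integers. -/
noncomputable def restr (P : ℕ → Prop) (f : ArithmeticFunction ℝ) : ArithmeticFunction ℝ :=
  ⟨fun n => if P n then f n else 0, by simp⟩

open Classical in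
theorem restr_apply (P : ℕ → Prop) (f : ArithmeticFunction ℝ) (n : ℕ) :
    restr P f n = if P n then f n else 0 := rfl

theorem restr_of {P : ℕ → Prop} (f : ArithmeticFunction ℝ) {n : ℕ} (h : P n) : restr P f n = f n := by
  simp [restr_apply, h]

theorem restr_of_not {P : ℕ → Prop} (f : ArithmeticFunction ℝ) {n : ℕ} (h : ¬ P n) :
    restr P f n = 0 := by
  simp [restr_apply, h]

open Classical in
theorem restr_mul {P : ℕ → Prop} (hP : ∀ a b, a ≠ 0 → b ≠ 0 → (P (a * b) ↔ P a ∧ P b))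
    (f g : ArithmeticFunction ℝ) : restr P (f * g) = restr P f * restr P g := by
  ext n
  rw [restr_apply, ArithmeticFunction.mul_apply, ArithmeticFunction.mul_apply,
    show ∀ c : ℝ, (if P n then c else 0) = c * (if P n then 1 else 0) by simp, Finset.sum_mul]
  refine Finset.sum_congr rfl fun x hx => ?_
  obtain ⟨hx, hn⟩ := Nat.mem_divisorsAntidiagonal.1 hx
  rw [← hx] at hn
  have := hP x.1 x.2 (left_ne_zero_of_mul hn) (right_ne_zero_of_mul hn)
  rw [hx] at this
  by_cases h1 : P x.1 <;> by_cases h2 : P x.2 <;> simp [restr_apply, this, h1, h2]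

theorem restr_pow {P : ℕ → Prop} (hP : ∀ a b, a ≠ 0 → b ≠ 0 → (P (a * b) ↔ P a ∧ P b)) (h1 : P 1)
    (f : ArithmeticFunction ℝ) (k : ℕ) : restr P (f ^ k) = restr P f ^ k := by
  induction k with
  | zero =>
    ext n
    simp only [restr_apply, pow_zero, ArithmeticFunction.one_apply]
    by_cases h : n = 1
    · subst h; simp [h1]
    · simp [h]
  | succ k ih => rw [pow_succ, pow_succ, restr_mul hP, ih]

theorem restr_isMultiplicative {P : ℕ → Prop}
    (hP : ∀ a b, a ≠ 0 → b ≠ 0 → (P (a * b) ↔ P a ∧ P b)) (h1 : P 1)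
    {f : ArithmeticFunction ℝ} (hf : f.IsMultiplicative) : (restr P f).IsMultiplicative := by
  rw [ArithmeticFunction.IsMultiplicative.iff_ne_zero]
  refine ⟨by rw [restr_of _ h1, hf.map_one], fun {m n} hm hn hmn => ?_⟩
  simp only [restr_apply, hf.map_mul_of_coprime hmn]
  by_cases h1 : P m <;> by_cases h2 : P n <;> simp [h1, h2, hP m n hm hn]

theorem coprime_mul_iff' (d : ℕ) (a b : ℕ) (_ : a ≠ 0) (_ : b ≠ 0) :
    (Nat.Coprime (a * b) d ↔ Nat.Coprime a d ∧ Nat.Coprime b d) := Nat.coprime_mul_iff_left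

theorem mem_factoredNumbers_mul_iff (s : Finset ℕ) (a b : ℕ) (_ : a ≠ 0) (_ : b ≠ 0) :
    a * b ∈ Nat.factoredNumbers s ↔ a ∈ Nat.factoredNumbers s ∧ b ∈ Nat.factoredNumbers s := 
  ⟨fun h => ⟨Nat.mem_factoredNumbers_of_dvd h (dvd_mul_right _ _),
    Nat.mem_factoredNumbers_of_dvd h (dvd_mul_left _ _)⟩, fun h => Nat.mul_mem_factoredNumbers h.1 h.2⟩

/-- Splitting an integer according to a property of its prime factors. -/
theorem exists_coprime_split (Q : ℕ → Prop) {n : ℕ} (hn : n ≠ 0) :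
    ∃ a b, a * b = n ∧ a.Coprime b ∧ (∀ p, p.Prime → p ∣ a → Q p) ∧ (∀ p, p.Prime → p ∣ b → ¬ Q p) := by
  classical
  set a := ∏ p ∈ n.primeFactors.filter Q, p ^ n.factorization p
  set b := ∏ p ∈ n.primeFactors.filter (fun p => ¬ Q p), p ^ n.factorization p
  have hab : a * b = n := by
    rw [Finset.prod_filter_mul_prod_filter_not, ← Nat.support_factorization]
    exact Nat.prod_factorization_pow_eq_self hn
  have aux : ∀ (R : ℕ → Prop) [DecidablePred R] (p : ℕ), p.Prime →
      p ∣ ∏ q ∈ n.primeFactors.filter R, q ^ n.factorization q → R p := by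
    intro R _ p hp hd
    obtain ⟨q, hq, hpq⟩ := (hp.prime.dvd_finsetProd_iff _).1 hd
    rw [Finset.mem_filter] at hq
    rw [(Nat.prime_dvd_prime_iff_eq hp (Nat.prime_of_mem_primeFactors hq.1)).1 (hp.dvd_of_dvd_pow hpq)]
    exact hq.2
  refine ⟨a, b, hab, Nat.coprime_of_dvd fun p hp h1 h2 =>
    aux (fun p => ¬ Q p) p hp h2 (aux Q p hp h1), aux Q, aux (fun p => ¬ Q p)⟩

end Convolution

section Squareful

/-- Every prime outside `d` that divides `b` divides it at least twice. -/
def SquarefulOutside (d b : ℕ) : Prop := ∀ p, p.Prime → p ∣ b → ¬ p ∣ d → p ^ 2 ∣ b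

theorem exists_sq_mul_cube {b : ℕ} (hb0 : b ≠ 0) (hb : SquarefulOutside 1 b) :
    ∃ w v : ℕ, b = w ^ 2 * v ^ 3 := by
  obtain ⟨v, u, hvu, hv⟩ := Nat.sq_mul_squarefree b
  have h : v ∣ u := by
    rw [← Nat.factorization_le_iff_dvd hv.ne_zero (by rintro rfl; simp at hvu; exact hb0 hvu.symm)]
    intro p
    by_cases hp : p.Prime
    swap
    · simp [Nat.factorization_eq_zero_of_not_prime, hp]
    have hv1 := hv.natFactorization_le_one p
    rcases Nat.eq_zero_or_pos (v.factorization p) with h0 | h0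
    · omega
    have hpv : p ∣ v := Nat.dvd_of_factorization_pos h0.ne'
    have h2 := hb p hp (hvu ▸ hpv.mul_left _) (by simpa using hp.ne_one)
    have h3 := (hp.pow_dvd_iff_le_factorization hb0).1 h2
    have hu0 : u ≠ 0 := by rintro rfl; simp at hvu; exact hb0 hvu.symm
    rw [← hvu, Nat.factorization_mul (by positivity) hv.ne_zero, Nat.factorization_pow] at h3
    simp at h3
    omega
  obtain ⟨w, rfl⟩ := h
  exact ⟨w, v, by rw [← hvu]; ring⟩

theorem divK_mul_rpow_le_of_eq {J : ℕ} {C : ℝ}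
    (h : ∀ n : ℕ, n ≠ 0 → divK J n ≤ C * (n : ℝ) ^ (1 / 32 : ℝ)) {b w v : ℕ} (hb : b ≠ 0)
    (e : b = w ^ 2 * v ^ 3) :
    divK J b * (b : ℝ) ^ (-(3 / 4 : ℝ)) ≤
      C * ((w : ℝ) ^ (-(23 / 16 : ℝ)) * (v : ℝ) ^ (-(69 / 32 : ℝ))) := by
  have hb0 : (0 : ℝ) < b := by positivity
  have e' : (b : ℝ) = (w : ℝ) ^ (2 : ℝ) * (v : ℝ) ^ (3 : ℝ) := by rw [e]; norm_num
  calc divK J b * (b : ℝ) ^ (-(3 / 4 : ℝ))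
      ≤ C * (b : ℝ) ^ (1 / 32 : ℝ) * (b : ℝ) ^ (-(3 / 4 : ℝ)) := by gcongr; exact h b hb
    _ = C * (b : ℝ) ^ (-(23 / 32) : ℝ) := by rw [mul_assoc, ← Real.rpow_add hb0]; norm_num
    _ = _ := by
      rw [e', Real.mul_rpow (by positivity) (by positivity),
        ← Real.rpow_mul (by positivity), ← Real.rpow_mul (by positivity)]
      norm_num

theorem summable_squareful (J : ℕ) :
    Summable fun b : ℕ => restr (SquarefulOutside 1) (divK J) b * (b : ℝ) ^ (-(3 / 4 : ℝ)) := by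
  obtain ⟨C, hC, h⟩ := exists_divK_le J (ε := 1 / 32) (by norm_num)
  set S : Set ℕ := {b | b ≠ 0 ∧ SquarefulOutside 1 b}
  have hch : ∀ b : S, ∃ x : ℕ × ℕ, b.1 = x.1 ^ 2 * x.2 ^ 3 := fun b => by
    obtain ⟨w, v, h⟩ := exists_sq_mul_cube b.2.1 b.2.2; exact ⟨(w, v), h⟩
  choose f hf using hch
  have hinj : Function.Injective f := fun a b hab => Subtype.ext (by rw [hf, hf, hab])
  have hsum : Summable fun x : ℕ × ℕ =>
      C * ((x.1 : ℝ) ^ (-(23 / 16 : ℝ)) * (x.2 : ℝ) ^ (-(69 / 32 : ℝ))) := by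
    have s1 : Summable fun n : ℕ => (n : ℝ) ^ (-(23 / 16 : ℝ)) :=
      Real.summable_nat_rpow.2 (by norm_num)
    have s2 : Summable fun n : ℕ => (n : ℝ) ^ (-(69 / 32 : ℝ)) :=
      Real.summable_nat_rpow.2 (by norm_num)
    exact (s1.mul_of_nonneg s2 (fun n => Real.rpow_nonneg n.cast_nonneg _)
      (fun n => Real.rpow_nonneg n.cast_nonneg _)).mul_left C
  have h1 : Summable fun b : S =>
      restr (SquarefulOutside 1) (divK J) b.1 * (b.1 : ℝ) ^ (-(3 / 4 : ℝ)) := by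
    have hs2 : Summable fun b : S =>
        C * (((f b).1 : ℝ) ^ (-(23 / 16 : ℝ)) * ((f b).2 : ℝ) ^ (-(69 / 32 : ℝ))) :=
      hsum.comp_injective hinj
    refine Summable.of_nonneg_of_le (fun b => ?_) (fun b => ?_) hs2
    · rw [restr_of _ b.2.2]; exact mul_nonneg (divK_nonneg _ _) (by positivity)
    · rw [restr_of _ b.2.2]
      exact divK_mul_rpow_le_of_eq h b.2.1 (hf b)
  set F : ℕ → ℝ := fun b => restr (SquarefulOutside 1) (divK J) b * (b : ℝ) ^ (-(3 / 4 : ℝ)) with hF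
  have h2 : Summable (S.indicator F) := by
    rw [← summable_subtype_iff_indicator]
    exact h1
  suffices h3 : S.indicator F = F by
    rwa [h3] at h2
  funext b
  by_cases hb : b ∈ S
  · rw [Set.indicator_of_mem hb]
  · rw [Set.indicator_of_notMem hb, hF]
    by_cases h0 : b = 0
    · simp [h0]
    · simp only
      rw [restr_of_not _ fun h => hb ⟨h0, h⟩, zero_mul]

theorem hasSum_smooth (s : Finset ℕ) {σ : ℝ} (hσ : 0 < σ) (J : ℕ) :
    HasSum (fun b : ℕ => restr (· ∈ Nat.factoredNumbers s) (divK J) b * (b : ℝ) ^ (-σ))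
      ((∏ p ∈ s.filter Nat.Prime, (1 - (p : ℝ) ^ (-σ))⁻¹) ^ J) := by
  induction J with
  | zero =>
    rw [pow_zero]
    convert hasSum_ite_eq (1 : ℕ) (1 : ℝ) using 2 with b
    by_cases h : b = 1
    · subst h
      rw [restr_of _ (by rw [Nat.mem_factoredNumbers']; intro p hp h1; exact absurd (Nat.dvd_one.1 h1) hp.ne_one)]
      simp [divK]
    · simp [restr_apply, divK, h]
  | succ J ih =>
    rw [divK_add, restr_mul (mem_factoredNumbers_mul_iff s), pow_succ]
    refine hasSum_mul_arith_rpow ih ?_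
    let F : ℕ →* ℝ := ⟨⟨fun n => (n : ℝ) ^ (-σ), by simp⟩, fun a b => by
      simp only [Nat.cast_mul]; exact Real.mul_rpow (by positivity) (by positivity)⟩
    have := (EulerProduct.summable_and_hasSum_factoredNumbers_prod_filter_prime_geometric (f := F)
      (fun {p} hp => by
        change ‖(p : ℝ) ^ (-σ)‖ < 1
        rw [Real.norm_of_nonneg (by positivity)]
        exact Real.rpow_lt_one_of_one_lt_of_neg (by exact_mod_cast hp.one_lt) (by linarith)) s).2
    refine (hasSum_subtype_iff_indicator.1 this).congr_fun fun b => ?_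
    by_cases hb : b ∈ Nat.factoredNumbers s
    · rw [Set.indicator_of_mem hb, restr_of _ hb, divK_one_left (Nat.ne_zero_of_mem_factoredNumbers hb), one_mul]
      rfl
    · rw [Set.indicator_of_notMem hb, restr_of_not _ hb, zero_mul]

theorem restr_squarefulOutside_le (J d b : ℕ) (hd : d ≠ 0) : restr (SquarefulOutside d) (divK J) b ≤
    (restr (· ∈ Nat.factoredNumbers d.primeFactors) (divK J) * restr (SquarefulOutside 1) (divK J)) b := by
  rcases eq_or_ne b 0 with rfl | hb0
  · simp
  have hnn : ∀ P n, 0 ≤ restr P (divK J) n := fun P n => by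
    rw [restr_apply]; split_ifs; exacts [divK_nonneg _ _, le_rfl]
  rw [ArithmeticFunction.mul_apply]
  by_cases hb : SquarefulOutside d b
  swap
  · rw [restr_of_not _ hb]; exact Finset.sum_nonneg fun x _ => mul_nonneg (hnn _ _) (hnn _ _)
  obtain ⟨x, y, hxy, hc, hx, hy⟩ := exists_coprime_split (· ∣ d) hb0
  have hx' : x ∈ Nat.factoredNumbers d.primeFactors := by
    rw [Nat.mem_factoredNumbers']
    exact fun p hp hpx => Nat.mem_primeFactors.2 ⟨hp, hx p hp hpx, hd⟩
  have hy' : SquarefulOutside 1 y := by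
    intro p hp hpy _
    have h1 := hb p hp (hxy ▸ hpy.mul_left x) (hy p hp hpy)
    rw [← hxy] at h1
    refine Nat.Coprime.dvd_of_dvd_mul_left ?_ h1
    exact Nat.Coprime.pow_left _ ((hp.coprime_iff_not_dvd).2 fun h => hy p hp hpy (hx p hp h))
  calc restr (SquarefulOutside d) (divK J) b
      = restr (· ∈ Nat.factoredNumbers d.primeFactors) (divK J) x * restr (SquarefulOutside 1) (divK J) y := by
        rw [restr_of _ hb, restr_of (P := (· ∈ Nat.factoredNumbers d.primeFactors)) _ hx', restr_of _ hy', ← hxy,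
          (divK_isMultiplicative J).map_mul_of_coprime hc]
    _ ≤ _ := Finset.single_le_sum (f := fun x : ℕ × ℕ => restr (· ∈ Nat.factoredNumbers d.primeFactors) (divK J) x.1 *
        restr (SquarefulOutside 1) (divK J) x.2) (fun x _ => mul_nonneg (hnn _ _) (hnn _ _))
        (a := (x, y)) (Nat.mem_divisorsAntidiagonal.2 ⟨hxy, hb0⟩)

theorem exists_tsum_squarefulOutside_le (J : ℕ) : ∃ C : ℝ, 0 < C ∧ ∀ d : ℕ, d ≠ 0 → ∀ σ : ℝ, 3 / 4 ≤ σ →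
    Summable (fun b : ℕ => restr (SquarefulOutside d) (divK J) b * (b : ℝ) ^ (-σ)) ∧
    ∑' b : ℕ, restr (SquarefulOutside d) (divK J) b * (b : ℝ) ^ (-σ) ≤
      C * (∏ p ∈ d.primeFactors, (1 - (p : ℝ) ^ (-σ))⁻¹) ^ J := by
  have hnn : ∀ P n, 0 ≤ restr P (divK J) n := fun P n => by
    rw [restr_apply]; split_ifs; exacts [divK_nonneg _ _, le_rfl]
  have h0 := summable_squareful J
  refine ⟨1 + ∑' b : ℕ, restr (SquarefulOutside 1) (divK J) b * (b : ℝ) ^ (-(3 / 4 : ℝ)), ?_, fun d hd σ hσ => ?_⟩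
  · have : 0 ≤ ∑' b : ℕ, restr (SquarefulOutside 1) (divK J) b * (b : ℝ) ^ (-(3 / 4 : ℝ)) :=
      tsum_nonneg fun b => mul_nonneg (hnn _ _) (by positivity)
    linarith
  have hle : ∀ b : ℕ, restr (SquarefulOutside 1) (divK J) b * (b : ℝ) ^ (-σ) ≤
      restr (SquarefulOutside 1) (divK J) b * (b : ℝ) ^ (-(3 / 4 : ℝ)) := fun b => by
    rcases Nat.eq_zero_or_pos b with rfl | hb
    · simp
    · have : (1 : ℝ) ≤ b := by exact_mod_cast hb
      exact mul_le_mul_of_nonneg_left (Real.rpow_le_rpow_of_exponent_le this (by linarith)) (hnn _ _)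
  have h1 : Summable fun b : ℕ => restr (SquarefulOutside 1) (divK J) b * (b : ℝ) ^ (-σ) :=
    Summable.of_nonneg_of_le (fun b => mul_nonneg (hnn _ _) (by positivity)) hle h0
  have h2 := hasSum_mul_arith_rpow (hasSum_smooth d.primeFactors (σ := σ) (by linarith) J) h1.hasSum
  have hle2 : ∀ b : ℕ, restr (SquarefulOutside d) (divK J) b * (b : ℝ) ^ (-σ) ≤
      (restr (· ∈ Nat.factoredNumbers d.primeFactors) (divK J) * restr (SquarefulOutside 1) (divK J)) b
        * (b : ℝ) ^ (-σ) := fun b =>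
    mul_le_mul_of_nonneg_right (restr_squarefulOutside_le J d b hd) (by positivity)
  have h3 := Summable.of_nonneg_of_le (fun b => mul_nonneg (hnn _ _) (by positivity)) hle2 h2.summable
  refine ⟨h3, (h3.tsum_le_tsum hle2 h2.summable).trans ?_⟩
  rw [h2.tsum_eq, mul_comm, Finset.filter_true_of_mem fun p hp => Nat.prime_of_mem_primeFactors hp]
  have hprod : 0 ≤ ∏ p ∈ d.primeFactors, (1 - (p : ℝ) ^ (-σ))⁻¹ := Finset.prod_nonneg fun p hp => by
    have : (p : ℝ) ^ (-σ) ≤ 1 := Real.rpow_le_one_of_one_le_of_nonpos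
      (by exact_mod_cast (Nat.prime_of_mem_primeFactors hp).one_lt.le) (by linarith)
    exact inv_nonneg.2 (by linarith)
  gcongr
  linarith [h1.tsum_le_tsum hle h0]

end Squareful

section ArithmeticConstant

open ArithmeticFunction in
/-- The square of the `k`-fold divisor function on the integers coprime to `d`. -/
noncomputable def tauSq (k d : ℕ) : ArithmeticFunction ℝ :=
  restr (·.Coprime d) (pmul (divK k) (divK k))

open ArithmeticFunction in
/-- The quotient (for Dirichlet convolution) of `tauSq k d` by the `k ^ 2`-fold divisor function. -/
noncomputable def corrK (k d : ℕ) : ArithmeticFunction ℝ :=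
  tauSq k d * ((moebius : ArithmeticFunction ℤ) : ArithmeticFunction ℝ) ^ (k ^ 2)

/-- The majorant `∑ τ_J(b) b^{-σ}` over the integers `b` that are squareful outside `d`. -/
noncomputable def sqfSum (J d : ℕ) (σ : ℝ) : ℝ :=
  ∑' b : ℕ, restr (SquarefulOutside d) (divK J) b * (b : ℝ) ^ (-σ)

theorem tauSq_nonneg (k d n : ℕ) : 0 ≤ tauSq k d n := by
  rw [tauSq, restr_apply, ArithmeticFunction.pmul_apply]
  split_ifs
  · exact mul_self_nonneg _
  · exact le_rfl

theorem tauSq_le (k d n : ℕ) : tauSq k d n ≤ divK (k ^ 2) n := by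
  rw [tauSq, restr_apply, ArithmeticFunction.pmul_apply]
  split_ifs
  · rw [← sq]; exact divK_sq_le k n
  · exact divK_nonneg _ _

theorem tauSq_eq (k d n : ℕ) : tauSq k d n = if n.Coprime d then (tauK k n : ℝ) ^ 2 else 0 := by
  rw [tauSq, tauK_eq_divK]
  by_cases h : n.Coprime d
  · rw [restr_of (P := (·.Coprime d)) _ h, if_pos h, ArithmeticFunction.pmul_apply, sq]
  · rw [restr_of_not (P := (·.Coprime d)) _ h, if_neg h]

theorem tauSqTerm_eq (k d : ℕ) (s : ℝ) (n : ℕ) :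
    tauSqTerm k d s n = tauSq k d n * (n : ℝ) ^ (-s) := by
  rw [tauSqTerm, tauSq_eq]
  split_ifs
  · rw [Real.rpow_neg (by positivity), div_eq_mul_inv]
  · simp

theorem divK_mul_corrK (k d : ℕ) : divK (k ^ 2) * corrK k d = tauSq k d := by
  rw [corrK, mul_comm, mul_assoc, divK, ← mul_pow, ArithmeticFunction.coe_moebius_mul_coe_zeta,
    one_pow, mul_one]

theorem abs_corrK_le (k d n : ℕ) : |corrK k d n| ≤ divK (2 * k ^ 2) n := by
  rw [corrK, two_mul, divK_add]
  refine abs_mul_arith_le (fun n => ?_) (fun n => abs_pow_arith_le (fun n => ?_) _ n) n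
  · rw [abs_of_nonneg (tauSq_nonneg _ _ _)]; exact tauSq_le _ _ _
  · rcases eq_or_ne n 0 with rfl | hn
    · simp
    · simp only [ArithmeticFunction.intCoe_apply, ArithmeticFunction.natCoe_apply,
        ArithmeticFunction.zeta_apply_ne hn]
      exact_mod_cast ArithmeticFunction.abs_moebius_le_one

theorem tauSq_isMultiplicative (k d : ℕ) : (tauSq k d).IsMultiplicative :=
  restr_isMultiplicative (P := (·.Coprime d)) (coprime_mul_iff' d) (Nat.coprime_one_left d)
    ((divK_isMultiplicative k).pmul (divK_isMultiplicative k))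

theorem mul_arith_prime (f g : ArithmeticFunction ℝ) {p : ℕ} (hp : p.Prime) :
    (f * g) p = f 1 * g p + f p * g 1 := by
  rw [ArithmeticFunction.mul_apply, Nat.sum_divisorsAntidiagonal (f := fun a b => f a * g b),
    hp.sum_divisors, Nat.div_self hp.pos, Nat.div_one, add_comm]

theorem moebius_pow_prime (K : ℕ) {p : ℕ} (hp : p.Prime) :
    ((((ArithmeticFunction.moebius : ArithmeticFunction ℤ) : ArithmeticFunction ℝ) ^ K) p = -K) ∧
    ((((ArithmeticFunction.moebius : ArithmeticFunction ℤ) : ArithmeticFunction ℝ) ^ K) 1 = 1) := by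
  have hm : ∀ K : ℕ, (((ArithmeticFunction.moebius : ArithmeticFunction ℤ) : ArithmeticFunction ℝ) ^ K) 1 = 1 :=
    fun K => ((ArithmeticFunction.isMultiplicative_moebius.intCast (R := ℝ)).pow (k := K)).map_one
  refine ⟨?_, hm K⟩
  induction K with
  | zero => simp [ArithmeticFunction.one_apply_ne hp.ne_one]
  | succ K ih =>
    rw [pow_succ, mul_arith_prime _ _ hp]
    simp [ih, hm, ArithmeticFunction.moebius_apply_prime hp]

theorem corrK_isMultiplicative (k d : ℕ) : (corrK k d).IsMultiplicative :=
  (tauSq_isMultiplicative k d).mul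
    ((ArithmeticFunction.isMultiplicative_moebius.intCast).pow)

theorem corrK_prime (k d : ℕ) {p : ℕ} (hp : p.Prime) (hpd : ¬ p ∣ d) : corrK k d p = 0 := by
  have h1 := moebius_pow_prime (k ^ 2) hp
  have h2 : tauSq k d p = (k : ℝ) ^ 2 := by
    rw [tauSq, restr_of (P := (·.Coprime d)) _ ((hp.coprime_iff_not_dvd).2 hpd), ArithmeticFunction.pmul_apply,
      divK_prime k hp, sq]
  rw [corrK, mul_arith_prime _ _ hp]
  simp only [h1, h2, (tauSq_isMultiplicative k d).map_one]
  push_cast; ring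

theorem corrK_eq_zero (k d : ℕ) {b : ℕ} (hb : ¬ SquarefulOutside d b) : corrK k d b = 0 := by
  simp only [SquarefulOutside, not_forall] at hb
  obtain ⟨p, hp, ⟨c, rfl⟩, hpd, h2⟩ := hb
  have : p.Coprime c := (hp.coprime_iff_not_dvd).2 fun ⟨e, he⟩ => h2 ⟨e, by rw [he]; ring⟩
  rw [(corrK_isMultiplicative k d).map_mul_of_coprime this, corrK_prime k d hp hpd, zero_mul]

theorem abs_corrK_le_restr (k d b : ℕ) :
    |corrK k d b| ≤ restr (SquarefulOutside d) (divK (2 * k ^ 2)) b := by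
  by_cases hb : SquarefulOutside d b
  · rw [restr_of _ hb]; exact abs_corrK_le k d b
  · rw [restr_of_not _ hb, corrK_eq_zero k d hb, abs_zero]

theorem restr_divK_nonneg (P : ℕ → Prop) (J n : ℕ) : 0 ≤ restr P (divK J) n := by
  rw [restr_apply]; split_ifs; exacts [divK_nonneg _ _, le_rfl]

theorem summable_sqf (J : ℕ) {d : ℕ} (hd : d ≠ 0) {σ : ℝ} (hσ : 3 / 4 ≤ σ) :
    Summable (fun b : ℕ => restr (SquarefulOutside d) (divK J) b * (b : ℝ) ^ (-σ)) := by
  obtain ⟨C, -, h⟩ := exists_tsum_squarefulOutside_le J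
  exact (h d hd σ hσ).1

theorem rpow_neg_anti (b : ℕ) {σ τ : ℝ} (h : σ ≤ τ) (hσ : 0 < σ) :
    (b : ℝ) ^ (-τ) ≤ (b : ℝ) ^ (-σ) := by
  rcases Nat.eq_zero_or_pos b with rfl | hb
  · rw [Nat.cast_zero, Real.zero_rpow (by linarith), Real.zero_rpow (by linarith)]
  · exact Real.rpow_le_rpow_of_exponent_le (by exact_mod_cast hb) (by linarith)

theorem sqfSum_anti (J : ℕ) {d : ℕ} (hd : d ≠ 0) {σ τ : ℝ} (hσ : 3 / 4 ≤ σ) (h : σ ≤ τ) :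
    sqfSum J d τ ≤ sqfSum J d σ :=
  (summable_sqf J hd (hσ.trans h)).tsum_le_tsum (fun b => mul_le_mul_of_nonneg_left
    (rpow_neg_anti b h (by linarith)) (restr_divK_nonneg _ _ _)) (summable_sqf J hd hσ)

theorem abs_corrK_mul_rpow_le (k d b : ℕ) {s : ℝ} (hs : 3 / 4 ≤ s) : ‖corrK k d b * (b : ℝ) ^ (-s)‖ ≤
    restr (SquarefulOutside d) (divK (2 * k ^ 2)) b * (b : ℝ) ^ (-(3 / 4 : ℝ)) := by
  rw [Real.norm_eq_abs, abs_mul, abs_of_nonneg (a := (b : ℝ) ^ (-s)) (by positivity)]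
  exact mul_le_mul (abs_corrK_le_restr k d b) (rpow_neg_anti b hs (by norm_num)) (by positivity)
    (restr_divK_nonneg _ _ _)

theorem summable_corrK (k : ℕ) {d : ℕ} (hd : d ≠ 0) {s : ℝ} (hs : 3 / 4 ≤ s) :
    Summable fun b : ℕ => corrK k d b * (b : ℝ) ^ (-s) :=
  Summable.of_norm_bounded (summable_sqf (2 * k ^ 2) hd le_rfl)
    fun b => abs_corrK_mul_rpow_le k d b hs

theorem hasSum_divK (J : ℕ) {s : ℝ} (hs : 1 < s) :
    HasSum (fun n : ℕ => divK J n * (n : ℝ) ^ (-s)) ((∑' n : ℕ, 1 / (n : ℝ) ^ s) ^ J) := by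
  induction J with
  | zero =>
    rw [pow_zero]
    convert hasSum_ite_eq (1 : ℕ) (1 : ℝ) using 2 with b
    by_cases h : b = 1
    · subst h; simp [divK]
    · simp [divK, h]
  | succ J ih =>
    rw [divK_add, pow_succ]
    refine hasSum_mul_arith_rpow ih ?_
    have h1 : (fun n : ℕ => divK 1 n * (n : ℝ) ^ (-s)) = fun n : ℕ => 1 / (n : ℝ) ^ s := by
      funext n
      rcases eq_or_ne n 0 with rfl | hn
      · rw [ArithmeticFunction.map_zero, Nat.cast_zero, Real.zero_rpow (by linarith),
          Real.zero_rpow (by linarith)]; simp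
      · rw [divK_one_left hn, one_mul, Real.rpow_neg (by positivity), one_div]
    rw [h1]
    exact (Real.summable_one_div_nat_rpow.2 hs).hasSum

theorem hasSum_tauSq (k : ℕ) {d : ℕ} (hd : d ≠ 0) {s : ℝ} (hs : 1 < s) :
    HasSum (fun n : ℕ => tauSq k d n * (n : ℝ) ^ (-s))
      ((∑' n : ℕ, 1 / (n : ℝ) ^ s) ^ (k ^ 2) * ∑' b : ℕ, corrK k d b * (b : ℝ) ^ (-s)) := by
  rw [← divK_mul_corrK]
  exact hasSum_mul_arith_rpow (hasSum_divK _ hs) (summable_corrK k hd (by linarith)).hasSum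

theorem tendsto_sub_pow_mul_zeta (K : ℕ) :
    Tendsto (fun s : ℝ => ((s - 1) ^ K * (∑' n : ℕ, 1 / (n : ℝ) ^ s) ^ K)) (𝓝[>] 1) (𝓝 1) := by
  have := tendsto_sub_mul_tsum_nat_rpow.pow K
  simpa only [mul_pow, one_pow] using this

theorem tendsto_tsum_corrK (k : ℕ) {d : ℕ} (hd : d ≠ 0) :
    Tendsto (fun s : ℝ => ∑' b : ℕ, corrK k d b * (b : ℝ) ^ (-s)) (𝓝[>] 1)
      (𝓝 (∑' b : ℕ, corrK k d b * (b : ℝ) ^ (-(1 : ℝ)))) := by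
  refine tendsto_tsum_of_dominated_convergence (summable_sqf (2 * k ^ 2) hd le_rfl) (fun b => ?_) ?_
  · rcases eq_or_ne b 0 with rfl | hb
    · simp
    · refine Tendsto.const_mul _ (Tendsto.mono_left ?_ nhdsWithin_le_nhds)
      exact (Real.continuous_const_rpow (by positivity : (b : ℝ) ≠ 0)).continuousAt.tendsto.comp
        (continuous_neg.tendsto 1)
  · filter_upwards [self_mem_nhdsWithin] with s hs b
    exact abs_corrK_mul_rpow_le k d b (by linarith [Set.mem_Ioi.1 hs])

theorem tendsto_tauSqTerm (k : ℕ) {d : ℕ} (hd : d ≠ 0) :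
    Tendsto (fun s : ℝ => (s - 1) ^ (k ^ 2) * ∑' n : ℕ, tauSqTerm k d s n) (𝓝[>] (1 : ℝ))
      (𝓝 (∑' b : ℕ, corrK k d b * (b : ℝ) ^ (-(1 : ℝ)))) := by
  have h := (tendsto_sub_pow_mul_zeta (k ^ 2)).mul (tendsto_tsum_corrK k hd)
  rw [one_mul] at h
  refine h.congr' ?_
  filter_upwards [self_mem_nhdsWithin] with s hs
  simp only [tauSqTerm_eq, (hasSum_tauSq k hd hs).tsum_eq, mul_assoc]

theorem arithConst_eq (k : ℕ) {d : ℕ} (hd : d ≠ 0) :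
    arithConst k d = ∑' b : ℕ, corrK k d b * (b : ℝ) ^ (-(1 : ℝ)) :=
  (tendsto_tauSqTerm k hd).limUnder_eq

theorem divK_sq_le_tauSq_mul (k d n : ℕ) :
    divK (k ^ 2) n ≤ (tauSq k d * restr (SquarefulOutside d) (divK (k ^ 2))) n := by
  rcases eq_or_ne n 0 with rfl | hn
  · simp
  obtain ⟨x, y, hxy, hc, hx, hy⟩ := exists_coprime_split (fun p => ¬ p ∣ d ∧ ¬ p ^ 2 ∣ n) hn
  have hx0 : x ≠ 0 := by rintro rfl; simp at hxy; exact hn hxy.symm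
  have hxs : Squarefree x := by
    rw [Nat.squarefree_iff_prime_squarefree]
    intro p hp h
    exact (hx p hp ((dvd_mul_right p p).trans h)).2 (by rw [sq]; exact h.trans (hxy ▸ dvd_mul_right x y))
  have hxd : x.Coprime d := Nat.coprime_of_dvd fun p hp h1 h2 => (hx p hp h1).1 h2
  have hyd : SquarefulOutside d y := by
    intro p hp hpy hpd
    have h1 : p ^ 2 ∣ n := by
      by_contra h; exact hy p hp hpy ⟨hpd, h⟩
    rw [← hxy] at h1
    exact Nat.Coprime.dvd_of_dvd_mul_left (Nat.Coprime.pow_left _ ((hp.coprime_iff_not_dvd).2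
      fun h => hy p hp hpy (hx p hp h))) h1
  have hsf : divK (k ^ 2) x = tauSq k d x := by
    rw [tauSq, restr_of (P := (·.Coprime d)) _ hxd, ArithmeticFunction.pmul_apply, ← tauK_eq_divK, ← tauK_eq_divK]
    unfold tauK
    rw [Nat.card_finMulAntidiag_of_squarefree hxs, Nat.card_finMulAntidiag_of_squarefree hxs]
    push_cast
    rw [← mul_pow, sq]
  rw [ArithmeticFunction.mul_apply]
  calc divK (k ^ 2) n = tauSq k d x * restr (SquarefulOutside d) (divK (k ^ 2)) y := by
        rw [restr_of _ hyd, ← hxy, (divK_isMultiplicative _).map_mul_of_coprime hc, hsf]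
    _ ≤ _ := Finset.single_le_sum (f := fun x : ℕ × ℕ => tauSq k d x.1 *
        restr (SquarefulOutside d) (divK (k ^ 2)) x.2)
        (fun x _ => mul_nonneg (tauSq_nonneg _ _ _) (restr_divK_nonneg _ _ _))
        (a := (x, y)) (Nat.mem_divisorsAntidiagonal.2 ⟨hxy, hn⟩)

theorem one_le_arithConst_mul (k : ℕ) {d : ℕ} (hd : d ≠ 0) :
    1 ≤ arithConst k d * sqfSum (k ^ 2) d 1 := by
  have h1 := (tendsto_tauSqTerm k hd).mul_const (sqfSum (k ^ 2) d 1)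
  rw [← arithConst_eq k hd] at h1
  refine le_of_tendsto_of_tendsto (tendsto_sub_pow_mul_zeta (k ^ 2)) h1 ?_
  filter_upwards [self_mem_nhdsWithin] with s hs
  have hs1 : 1 < s := hs
  have h2 := hasSum_tauSq k hd hs1
  have h3 := (summable_sqf (k ^ 2) hd (σ := s) (by linarith)).hasSum
  have h4 := hasSum_mul_arith_rpow h2 h3
  have h5 := (hasSum_divK (k ^ 2) hs1).tsum_eq ▸ h4.tsum_eq ▸ (hasSum_divK (k ^ 2) hs1).summable.tsum_le_tsum
    (fun n => mul_le_mul_of_nonneg_right (divK_sq_le_tauSq_mul k d n) (by positivity)) h4.summable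
  rw [mul_assoc]
  refine mul_le_mul_of_nonneg_left ?_ (pow_nonneg (by linarith) _)
  simp only [tauSqTerm_eq]
  rw [h2.tsum_eq]
  refine h5.trans (mul_le_mul_of_nonneg_left (sqfSum_anti (k ^ 2) hd (by norm_num) hs1.le) ?_)
  rw [← h2.tsum_eq]
  exact tsum_nonneg fun n => mul_nonneg (tauSq_nonneg _ _ _) (by positivity)

theorem arithConst_pos (k : ℕ) {d : ℕ} (hd : d ≠ 0) : 0 < arithConst k d := by
  have h := one_le_arithConst_mul k hd
  have h2 : 0 ≤ sqfSum (k ^ 2) d 1 := tsum_nonneg fun n =>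
    mul_nonneg (restr_divK_nonneg _ _ _) (by positivity)
  by_contra hneg
  have := mul_nonpos_of_nonpos_of_nonneg (not_lt.1 hneg) h2
  linarith

end ArithmeticConstant

section PrimeSums

theorem sum_log_div_prime_le (j : ℕ) :
    ∑ p ∈ (Finset.Icc 0 (2 ^ j)).filter Nat.Prime, Real.log p / p ≤ 2 * Real.log 4 * j := by
  induction j with
  | zero =>
    rw [Finset.filter_false_of_mem]
    · simp
    · intro p hp h; simp at hp; have := h.two_le; omega
  | succ j ih =>
    have hsub : (Finset.Icc 0 (2 ^ j)).filter Nat.Prime ⊆ (Finset.Icc 0 (2 ^ (j + 1))).filter Nat.Prime := by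
      refine Finset.filter_subset_filter _ (Finset.Icc_subset_Icc le_rfl ?_)
      exact Nat.pow_le_pow_right (by norm_num) (by omega)
    rw [← Finset.sum_sdiff hsub]
    have h1 : ∑ p ∈ (Finset.Icc 0 (2 ^ (j + 1))).filter Nat.Prime \ (Finset.Icc 0 (2 ^ j)).filter Nat.Prime,
        Real.log p / p ≤ 2 * Real.log 4 := by
      calc _ ≤ ∑ p ∈ (Finset.Icc 0 (2 ^ (j + 1))).filter Nat.Prime \ (Finset.Icc 0 (2 ^ j)).filter Nat.Prime,
            Real.log p / 2 ^ j := by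
            refine Finset.sum_le_sum fun p hp => ?_
            simp only [Finset.mem_sdiff, Finset.mem_filter, Finset.mem_Icc, not_and] at hp
            have hp2 : 2 ^ j < p := by
              by_contra h; exact hp.2 ⟨by omega, by omega⟩ hp.1.2
            have hp3 : (2 : ℝ) ^ j ≤ p := by exact_mod_cast hp2.le
            have hl : 0 ≤ Real.log p := Real.log_nonneg (by exact_mod_cast hp.1.2.one_lt.le)
            gcongr
        _ ≤ ∑ p ∈ (Finset.Icc 0 (2 ^ (j + 1))).filter Nat.Prime, Real.log p / 2 ^ j := by
            refine Finset.sum_le_sum_of_subset_of_nonneg Finset.sdiff_subset fun p hp _ => ?_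
            have hl : 0 ≤ Real.log p := Real.log_nonneg (by
              exact_mod_cast (Finset.mem_filter.1 hp).2.one_lt.le)
            positivity
        _ = Chebyshev.theta ((2 ^ (j + 1) : ℕ) : ℝ) / 2 ^ j := by
            rw [Chebyshev.theta_eq_sum_Icc, Nat.floor_natCast, Finset.sum_div]
        _ ≤ (Real.log 4 * ((2 ^ (j + 1) : ℕ) : ℝ)) / 2 ^ j := by
            gcongr; exact Chebyshev.theta_le_log4_mul_x (by positivity)
        _ = 2 * Real.log 4 := by push_cast; field_simp; ring
    push_cast
    linarith

theorem exists_sum_inv_prime_le {ε : ℝ} (hε : 0 < ε) : ∃ C : ℝ, 0 ≤ C ∧ ∀ y : ℝ, 1 ≤ y →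
    ∀ S : Finset ℕ, (∀ p ∈ S, p.Prime ∧ (p : ℝ) ≤ y) → ∑ p ∈ S, 1 / (p : ℝ) ≤ ε * Real.log y + C := by
  have hl2 : 0 < Real.log 2 := Real.log_pos (by norm_num)
  have hl4 : 0 < Real.log 4 := Real.log_pos (by norm_num)
  set A : ℝ := 2 * Real.log 4 / (ε * Real.log 2) with hA
  have hApos : 0 < A := by positivity
  obtain ⟨P, hP⟩ := exists_nat_gt (Real.exp A)
  refine ⟨P + 2 * Real.log 4 / A, by positivity, fun y hy S hS => ?_⟩
  rw [← Finset.sum_filter_add_sum_filter_not S (· < P)]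
  have h1 : ∑ p ∈ S.filter (· < P), 1 / (p : ℝ) ≤ P := by
    calc _ ≤ ∑ p ∈ S.filter (· < P), (1 : ℝ) := by
          refine Finset.sum_le_sum fun p hp => ?_
          have := (hS p (Finset.mem_filter.1 hp).1).1.one_lt.le
          have : (1 : ℝ) ≤ p := by exact_mod_cast this
          exact div_le_one_of_le₀ this (by positivity)
      _ = ((S.filter (· < P)).card : ℝ) := by simp
      _ ≤ ((Finset.range P).card : ℝ) := by
          exact_mod_cast Finset.card_le_card fun x hx => by simp at hx ⊢; exact hx.2
      _ = P := by simp
  set j := ⌊Real.log y / Real.log 2⌋₊ + 1 with hj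
  have hyj : y ≤ 2 ^ j := by
    have h := (Nat.lt_floor_add_one (Real.log y / Real.log 2)).le
    rw [div_le_iff₀ hl2] at h
    rw [← Real.log_le_log_iff (by linarith) (by positivity), Real.log_pow, hj]
    push_cast; exact h
  have hj' : (j : ℝ) ≤ Real.log y / Real.log 2 + 1 := by
    rw [hj]; push_cast
    have := Nat.floor_le (div_nonneg (Real.log_nonneg hy) hl2.le)
    linarith
  have h2 : ∑ p ∈ S.filter (fun p => ¬ p < P), 1 / (p : ℝ) ≤ (2 * Real.log 4 * j) / A := by
    rw [le_div_iff₀ hApos, Finset.sum_mul]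
    refine le_trans ?_ (sum_log_div_prime_le j)
    calc _ ≤ ∑ p ∈ S.filter (fun p => ¬ p < P), Real.log p / p := by
          refine Finset.sum_le_sum fun p hp => ?_
          rw [Finset.mem_filter, not_lt] at hp
          have hp1 : Real.exp A ≤ p := hP.le.trans (by exact_mod_cast hp.2)
          have hp0 : (0 : ℝ) < p := (Real.exp_pos A).trans_le hp1
          have := (Real.le_log_iff_exp_le hp0).2 hp1
          rw [one_div_mul_eq_div]; gcongr
      _ ≤ _ := by
          refine Finset.sum_le_sum_of_subset_of_nonneg (fun p hp => ?_) fun p hp _ => ?_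
          · rw [Finset.mem_filter] at hp
            have := hS p hp.1
            have h3 : (p : ℝ) ≤ 2 ^ j := this.2.trans hyj
            simp only [Finset.mem_filter, Finset.mem_Icc]
            exact ⟨⟨by omega, by exact_mod_cast h3⟩, this.1⟩
          · have hl : 0 ≤ Real.log p := Real.log_nonneg (by
              exact_mod_cast (Finset.mem_filter.1 hp).2.one_lt.le)
            positivity
  have h3 : (2 * Real.log 4 * j) / A ≤ ε * Real.log y + 2 * Real.log 4 / A := by
    calc (2 * Real.log 4 * j) / A ≤ (2 * Real.log 4 * (Real.log y / Real.log 2 + 1)) / A := by gcongr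
      _ = _ := by rw [hA]; field_simp
  linarith

theorem two_pow_card_primeFactors_le {d : ℕ} (hd : d ≠ 0) : 2 ^ d.primeFactors.card ≤ d := by
  calc 2 ^ d.primeFactors.card = ∏ p ∈ d.primeFactors, 2 := by simp
    _ ≤ ∏ p ∈ d.primeFactors, p :=
      Finset.prod_le_prod' fun p hp => (Nat.prime_of_mem_primeFactors hp).two_le
    _ ≤ d := Nat.le_of_dvd (Nat.pos_of_ne_zero hd) (Nat.prod_primeFactors_dvd d)

theorem card_primeFactors_le_log {d : ℕ} (hd : d ≠ 0) : (d.primeFactors.card : ℝ) ≤ 2 * Real.log d := by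
  have h : ((2 : ℝ) ^ d.primeFactors.card) ≤ d := by exact_mod_cast two_pow_card_primeFactors_le hd
  have h2 := Real.log_le_log (by positivity) h
  rw [Real.log_pow] at h2
  have := Real.log_two_gt_d9
  nlinarith [(Nat.cast_nonneg d.primeFactors.card : (0 : ℝ) ≤ _)]

theorem two_rpow_le : (2 : ℝ) ^ (-(3 / 4) : ℝ) ≤ 2 / 3 := by
  have h : ((2 : ℝ) ^ (-(3 / 4) : ℝ)) ^ 4 ≤ (2 / 3) ^ 4 := by
    rw [← Real.rpow_natCast, ← Real.rpow_mul (by norm_num)]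
    norm_num
  exact le_of_pow_le_pow_left₀ (by norm_num) (by norm_num) h

theorem prod_inv_one_sub_le (S : Finset ℕ) (hS : ∀ p ∈ S, p.Prime) {σ : ℝ} (hσ : 3 / 4 ≤ σ) :
    ∏ p ∈ S, (1 - (p : ℝ) ^ (-σ))⁻¹ ≤ Real.exp (3 * ∑ p ∈ S, (p : ℝ) ^ (-σ)) := by
  rw [Finset.mul_sum, Real.exp_sum]
  have hx : ∀ p ∈ S, (p : ℝ) ^ (-σ) ≤ 2 / 3 := fun p hp => by
    calc (p : ℝ) ^ (-σ) ≤ (2 : ℝ) ^ (-σ) := Real.rpow_le_rpow_of_nonpos (by norm_num)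
          (by exact_mod_cast (hS p hp).two_le) (by linarith)
      _ ≤ (2 : ℝ) ^ (-(3 / 4) : ℝ) := Real.rpow_le_rpow_of_exponent_le (by norm_num) (by linarith)
      _ ≤ 2 / 3 := two_rpow_le
  refine Finset.prod_le_prod (fun p hp => inv_nonneg.2 (by linarith [hx p hp])) fun p hp => ?_
  have h1 := hx p hp
  have h0 : 0 ≤ (p : ℝ) ^ (-σ) := by positivity
  set x := (p : ℝ) ^ (-σ)
  rw [inv_le_iff_one_le_mul₀ (by linarith)]
  have := Real.add_one_le_exp (3 * x)
  nlinarith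

theorem exists_sum_primeFactors_rpow_le {ε : ℝ} (hε : 0 < ε) : ∃ C : ℝ, ∀ d : ℕ, d ≠ 0 →
    ∑ p ∈ d.primeFactors, (p : ℝ) ^ (-(1 - 1 / (4 * Real.log (4 + Real.log d)))) ≤
      ε * Real.log (4 + Real.log d) + C := by
  obtain ⟨C, hC, h⟩ := exists_sum_inv_prime_le (half_pos hε)
  refine ⟨2 * C + 8, fun d hd => ?_⟩
  have hld : 0 ≤ Real.log d := Real.log_natCast_nonneg d
  set l := 4 + Real.log d with hl
  have hl4 : 4 ≤ l := by linarith
  have hll : 1 < Real.log l := by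
    rw [Real.lt_log_iff_exp_lt (by linarith)]
    linarith [Real.exp_one_lt_d9]
  set α := 1 / (4 * Real.log l) with hα
  have hα0 : 0 < α := by positivity
  have hα1 : α ≤ 1 / 4 := by rw [hα]; gcongr; linarith
  have hlα : l ^ α ≤ 2 := by
    rw [Real.rpow_def_of_pos (by linarith)]
    have : Real.log l * α = 1 / 4 := by rw [hα]; field_simp
    rw [this]
    have h1 : Real.exp (1 / 4) ^ 4 = Real.exp 1 := by rw [← Real.exp_nat_mul]; norm_num
    have h2 := Real.exp_one_lt_d9
    by_contra hcon
    have : (2 : ℝ) ^ 4 ≤ Real.exp (1 / 4) ^ 4 := by gcongr; exact (not_le.1 hcon).le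
    linarith
  rw [← Finset.sum_filter_add_sum_filter_not _ (fun p : ℕ => (p : ℝ) ≤ l)]
  have h1 : ∑ p ∈ d.primeFactors.filter (fun p : ℕ => (p : ℝ) ≤ l), (p : ℝ) ^ (-(1 - α)) ≤
      2 * (ε / 2 * Real.log l + C) := by
    refine le_trans ?_ (mul_le_mul_of_nonneg_left (h l (by linarith)
      (d.primeFactors.filter (fun p : ℕ => (p : ℝ) ≤ l)) fun p hp => ?_) (by norm_num))
    · rw [Finset.mul_sum]
      refine Finset.sum_le_sum fun p hp => ?_
      rw [Finset.mem_filter] at hp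
      have hp0 : (0 : ℝ) < p := by exact_mod_cast (Nat.prime_of_mem_primeFactors hp.1).pos
      rw [neg_sub, Real.rpow_sub hp0, Real.rpow_one, mul_one_div]
      gcongr
      exact (Real.rpow_le_rpow hp0.le hp.2 hα0.le).trans hlα
    · rw [Finset.mem_filter] at hp
      exact ⟨Nat.prime_of_mem_primeFactors hp.1, hp.2⟩
  have h2 : ∑ p ∈ d.primeFactors.filter (fun p : ℕ => ¬ (p : ℝ) ≤ l), (p : ℝ) ^ (-(1 - α)) ≤ 8 := by
    calc _ ≤ ∑ p ∈ d.primeFactors.filter (fun p : ℕ => ¬ (p : ℝ) ≤ l), 2 / l := by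
          refine Finset.sum_le_sum fun p hp => ?_
          rw [Finset.mem_filter, not_le] at hp
          calc (p : ℝ) ^ (-(1 - α)) ≤ l ^ (-(1 - α)) :=
                Real.rpow_le_rpow_of_nonpos (by linarith) hp.2.le (by linarith)
            _ = l ^ α / l := by rw [neg_sub, Real.rpow_sub (by linarith), Real.rpow_one]
            _ ≤ _ := by gcongr
      _ = (d.primeFactors.filter (fun p : ℕ => ¬ (p : ℝ) ≤ l)).card * (2 / l) := by simp
      _ ≤ d.primeFactors.card * (2 / l) := by gcongr; exact Finset.filter_subset _ _
      _ ≤ (2 * l) * (2 / l) := by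
          gcongr
          have := card_primeFactors_le_log hd
          linarith
      _ ≤ 8 := by field_simp; norm_num
  linarith

theorem exists_sqfSum_le {J : ℕ} : ∃ C : ℝ, 0 < C ∧ ∀ d : ℕ, d ≠ 0 →
    sqfSum J d (1 - 1 / (4 * Real.log (4 + Real.log d))) ≤ C * (4 + Real.log d) ^ (1 / 8 : ℝ) := by
  obtain ⟨C, hC, h⟩ := exists_tsum_squarefulOutside_le J
  obtain ⟨C', h'⟩ := exists_sum_primeFactors_rpow_le (ε := 1 / (24 * (J + 1))) (by positivity)
  refine ⟨C * Real.exp (3 * J * C'), by positivity, fun d hd => ?_⟩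
  have hld : 0 ≤ Real.log d := Real.log_natCast_nonneg d
  have h2 := h' d hd
  set l := 4 + Real.log d with hl
  have hl4 : 4 ≤ l := by linarith
  have hll : 1 < Real.log l := by
    rw [Real.lt_log_iff_exp_lt (by linarith)]
    linarith [Real.exp_one_lt_d9]
  set α := 1 / (4 * Real.log l) with hα
  have hα1 : α ≤ 1 / 4 := by rw [hα]; gcongr; linarith
  refine (h d hd (1 - α) (by linarith)).2.trans ?_
  rw [mul_assoc]
  refine mul_le_mul_of_nonneg_left ?_ hC.le
  have h3 := prod_inv_one_sub_le d.primeFactors (fun p hp => Nat.prime_of_mem_primeFactors hp)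
    (σ := 1 - α) (by linarith)
  have h0 : 0 ≤ ∏ p ∈ d.primeFactors, (1 - (p : ℝ) ^ (-(1 - α)))⁻¹ := Finset.prod_nonneg fun p hp => by
    have : (p : ℝ) ^ (-(1 - α)) ≤ 1 := Real.rpow_le_one_of_one_le_of_nonpos
      (by exact_mod_cast (Nat.prime_of_mem_primeFactors hp).one_lt.le) (by linarith)
    exact inv_nonneg.2 (by linarith)
  calc _ ≤ Real.exp (3 * ∑ p ∈ d.primeFactors, (p : ℝ) ^ (-(1 - α))) ^ J := pow_le_pow_left₀ h0 h3 J
    _ = Real.exp (3 * J * ∑ p ∈ d.primeFactors, (p : ℝ) ^ (-(1 - α))) := by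
        rw [← Real.exp_nat_mul]; ring_nf
    _ ≤ Real.exp (3 * J * (1 / (24 * (J + 1)) * Real.log l + C')) := by gcongr
    _ ≤ Real.exp (3 * J * C' + Real.log l * (1 / 8)) := by
        gcongr
        have : 3 * (J : ℝ) * (1 / (24 * (J + 1))) ≤ 1 / 8 := by
          rw [mul_one_div, div_le_div_iff₀ (by positivity) (by norm_num)]; linarith
        nlinarith
    _ = _ := by rw [Real.exp_add, Real.rpow_def_of_pos (by linarith)]

theorem exists_sqfLogSum_le (J : ℕ) : ∃ C : ℝ, 0 < C ∧ ∀ d : ℕ, d ≠ 0 →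
    Summable (fun b : ℕ => restr (SquarefulOutside d) (divK J) b * (1 + Real.log b) * (b : ℝ)⁻¹) ∧
    ∑' b : ℕ, restr (SquarefulOutside d) (divK J) b * (1 + Real.log b) * (b : ℝ)⁻¹ ≤
      C * (4 + Real.log d) ^ (1 / 4 : ℝ) := by
  obtain ⟨C, hC, h⟩ := exists_sqfSum_le (J := J)
  refine ⟨C * 40, by positivity, fun d hd => ?_⟩
  have hld : 0 ≤ Real.log d := Real.log_natCast_nonneg d
  have h2 := h d hd
  set l := 4 + Real.log d with hl
  have hl4 : 4 ≤ l := by linarith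
  have hll : 1 < Real.log l := by
    rw [Real.lt_log_iff_exp_lt (by linarith)]
    linarith [Real.exp_one_lt_d9]
  set α := 1 / (4 * Real.log l) with hα
  have hα0 : 0 < α := by positivity
  have hα1 : α ≤ 1 / 4 := by rw [hα]; gcongr; linarith
  have hle : ∀ b : ℕ, restr (SquarefulOutside d) (divK J) b * (1 + Real.log b) * (b : ℝ)⁻¹ ≤
      (1 + 1 / α) * (restr (SquarefulOutside d) (divK J) b * (b : ℝ) ^ (-(1 - α))) := by
    intro b
    rcases Nat.eq_zero_or_pos b with rfl | hb
    · simp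
    have hb1 : (1 : ℝ) ≤ b := by exact_mod_cast hb
    have hb0 : (0 : ℝ) < b := by linarith
    have e1 : 1 + Real.log b ≤ (1 + 1 / α) * (b : ℝ) ^ α := by
      have h3 := Real.log_le_rpow_div hb0.le hα0
      have h4 := Real.one_le_rpow hb1 hα0.le
      rw [add_mul, one_mul, one_div_mul_eq_div]; linarith
    rw [neg_sub, Real.rpow_sub hb0, Real.rpow_one, div_eq_mul_inv]
    calc _ ≤ restr (SquarefulOutside d) (divK J) b * ((1 + 1 / α) * (b : ℝ) ^ α) * (b : ℝ)⁻¹ := by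
          gcongr; exact restr_divK_nonneg _ _ _
      _ = _ := by ring
  have hs : Summable fun b : ℕ => (1 + 1 / α) * (restr (SquarefulOutside d) (divK J) b * (b : ℝ) ^ (-(1 - α))) :=
    (summable_sqf J hd (by linarith)).mul_left _
  have hs2 : Summable (fun b : ℕ => restr (SquarefulOutside d) (divK J) b * (1 + Real.log b) * (b : ℝ)⁻¹) := by
    refine Summable.of_nonneg_of_le (fun b => ?_) hle hs
    have := Real.log_natCast_nonneg b
    have := restr_divK_nonneg (SquarefulOutside d) J b
    positivity
  refine ⟨hs2, (hs2.tsum_le_tsum hle hs).trans ?_⟩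
  rw [tsum_mul_left]
  have h5 : 1 + 1 / α ≤ 40 * l ^ (1 / 8 : ℝ) := by
    have := Real.log_le_rpow_div (x := l) (by linarith) (ε := 1 / 8) (by norm_num)
    have h6 : 1 / α = 4 * Real.log l := by rw [hα]; field_simp
    have h7 := Real.one_le_rpow (x := l) (z := 1 / 8) (by linarith) (by norm_num)
    rw [h6]
    linarith
  calc _ ≤ (40 * l ^ (1 / 8 : ℝ)) * (C * l ^ (1 / 8 : ℝ)) := by
        refine mul_le_mul h5 h2 ?_ (by positivity)
        exact tsum_nonneg fun b => mul_nonneg (restr_divK_nonneg _ _ _) (by positivity)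
    _ = C * 40 * (l ^ (1 / 8 : ℝ) * l ^ (1 / 8 : ℝ)) := by ring
    _ = _ := by rw [← Real.rpow_add (by linarith)]; norm_num

theorem exists_one_le_arithConst_mul (k : ℕ) : ∃ C : ℝ, 0 < C ∧ ∀ d : ℕ, d ≠ 0 →
    1 ≤ C * (4 + Real.log d) ^ (1 / 4 : ℝ) * arithConst k d := by
  obtain ⟨C, hC, h⟩ := exists_sqfLogSum_le (k ^ 2)
  refine ⟨C, hC, fun d hd => (one_le_arithConst_mul k hd).trans ?_⟩
  rw [mul_comm]
  refine mul_le_mul_of_nonneg_right (le_trans ?_ (h d hd).2) (arithConst_pos k hd).le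
  refine (summable_sqf _ hd (by norm_num)).tsum_le_tsum (fun b => ?_) (h d hd).1
  rw [Real.rpow_neg_one]
  have := Real.log_natCast_nonneg b
  have h2 := restr_divK_nonneg (SquarefulOutside d) (k ^ 2) b
  gcongr
  nlinarith

theorem exists_corrK_log_sum_le (k : ℕ) : ∃ C : ℝ, 0 < C ∧ ∀ d : ℕ, d ≠ 0 →
    Summable (fun b : ℕ => |corrK k d b| * (1 + Real.log b) * (b : ℝ)⁻¹) ∧
    ∑' b : ℕ, |corrK k d b| * (1 + Real.log b) * (b : ℝ)⁻¹ ≤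
      C * (4 + Real.log d) ^ (1 / 2 : ℝ) * arithConst k d := by
  obtain ⟨C, hC, h⟩ := exists_sqfLogSum_le (2 * k ^ 2)
  obtain ⟨C', hC', h'⟩ := exists_one_le_arithConst_mul k
  refine ⟨C * C', by positivity, fun d hd => ?_⟩
  have hle : ∀ b : ℕ, |corrK k d b| * (1 + Real.log b) * (b : ℝ)⁻¹ ≤
      restr (SquarefulOutside d) (divK (2 * k ^ 2)) b * (1 + Real.log b) * (b : ℝ)⁻¹ := fun b => by
    have := Real.log_natCast_nonneg b
    gcongr
    exact abs_corrK_le_restr k d b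
  have hs := Summable.of_nonneg_of_le (fun b => by
    have := Real.log_natCast_nonneg b; positivity) hle (h d hd).1
  refine ⟨hs, ((hs.tsum_le_tsum hle (h d hd).1).trans (h d hd).2).trans ?_⟩
  have hld : 0 ≤ Real.log d := Real.log_natCast_nonneg d
  calc C * (4 + Real.log d) ^ (1 / 4 : ℝ) ≤
      C * (4 + Real.log d) ^ (1 / 4 : ℝ) * (C' * (4 + Real.log d) ^ (1 / 4 : ℝ) * arithConst k d) :=
        le_mul_of_one_le_right (by positivity) (h' d hd)
    _ = C * C' * ((4 + Real.log d) ^ (1 / 4 : ℝ) * (4 + Real.log d) ^ (1 / 4 : ℝ)) * arithConst k d := by ring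
    _ = _ := by rw [← Real.rpow_add (by linarith)]; norm_num

end PrimeSums

section Summatory

/-- The summatory function of an arithmetic function. -/
noncomputable def summatory (f : ArithmeticFunction ℝ) (x : ℝ) : ℝ := ∑ n ∈ Finset.Ioc 0 ⌊x⌋₊, f n

theorem summatory_mul (f g : ArithmeticFunction ℝ) (x : ℝ) :
    summatory (f * g) x = ∑ n ∈ Finset.Ioc 0 ⌊x⌋₊, f n * summatory g (x / n) := by
  unfold summatory
  rw [ArithmeticFunction.sum_Ioc_mul_eq_sum_sum]
  refine Finset.sum_congr rfl fun n _ => ?_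
  rw [Nat.floor_div_natCast]

theorem pow_succ_sub_le {u v : ℝ} (hv : 0 ≤ v) (huv : v ≤ u) (j : ℕ) :
    (u - v) * v ^ j ≤ (u ^ (j + 1) - v ^ (j + 1)) / (j + 1) ∧
    (u ^ (j + 1) - v ^ (j + 1)) / (j + 1) ≤ (u - v) * u ^ j := by
  have h := (Commute.all u v).geom_sum₂_mul (j + 1)
  rw [← h]
  have hs1 : ∑ i ∈ Finset.range (j + 1), u ^ i * v ^ (j + 1 - 1 - i) ≤ (j + 1) * u ^ j := by
    calc _ ≤ ∑ i ∈ Finset.range (j + 1), u ^ j := by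
          refine Finset.sum_le_sum fun i hi => ?_
          have hi' : i ≤ j := by simp at hi; omega
          calc u ^ i * v ^ (j + 1 - 1 - i) ≤ u ^ i * u ^ (j - i) := by
                have : 0 ≤ u := hv.trans huv
                simp only [Nat.add_sub_cancel]; gcongr
            _ = u ^ j := by rw [← pow_add]; congr 1; omega
      _ = _ := by simp
  have hs2 : (j + 1) * v ^ j ≤ ∑ i ∈ Finset.range (j + 1), u ^ i * v ^ (j + 1 - 1 - i) := by
    calc _ = ∑ i ∈ Finset.range (j + 1), v ^ j := by simp
      _ ≤ _ := by
          refine Finset.sum_le_sum fun i hi => ?_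
          have hi' : i ≤ j := by simp at hi; omega
          calc v ^ j = v ^ i * v ^ (j - i) := by rw [← pow_add]; congr 1; omega
            _ ≤ _ := by simp only [Nat.add_sub_cancel]; gcongr
  have hj : (0 : ℝ) < j + 1 := by positivity
  constructor
  · rw [le_div_iff₀ hj]; nlinarith
  · rw [div_le_iff₀ hj]; nlinarith

theorem log_div_succ_bounds {y : ℝ} (hy : 0 < y) {n : ℕ} (hn : 1 ≤ n) :
    1 / ((n + 1 : ℕ) : ℝ) ≤ Real.log (y / n) - Real.log (y / (n + 1 : ℕ)) ∧
    Real.log (y / n) - Real.log (y / (n + 1 : ℕ)) ≤ 1 / n := by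
  have hn0 : (0 : ℝ) < n := by exact_mod_cast hn
  have e : Real.log (y / n) - Real.log (y / (n + 1 : ℕ)) = Real.log ((n + 1) / n) := by
    rw [← Real.log_div (by positivity) (by positivity)]
    congr 1
    push_cast
    field_simp
  rw [e]
  constructor
  · have h := Real.one_sub_inv_le_log_of_pos (x := ((n : ℝ) + 1) / n) (by positivity)
    refine le_trans (le_of_eq ?_) h
    push_cast; field_simp; ring
  · have h := Real.log_le_sub_one_of_pos (x := ((n : ℝ) + 1) / n) (by positivity)
    refine h.trans (le_of_eq ?_)
    field_simp; ring

theorem sum_log_pow_partial {y : ℝ} (j : ℕ) {m : ℕ} (hm : 1 ≤ m) (hmy : (m : ℝ) ≤ y) :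
    ((Real.log y) ^ (j + 1) - (Real.log (y / m)) ^ (j + 1)) / (j + 1) ≤
      ∑ n ∈ Finset.Ioc 0 m, 1 / (n : ℝ) * Real.log (y / n) ^ j - 1 / (m : ℝ) * Real.log (y / m) ^ j ∧
    ∑ n ∈ Finset.Ioc 0 m, 1 / (n : ℝ) * Real.log (y / n) ^ j - Real.log y ^ j ≤
      ((Real.log y) ^ (j + 1) - (Real.log (y / m)) ^ (j + 1)) / (j + 1) := by
  induction m, hm using Nat.le_induction with
  | base => simp
  | succ m hm ih =>
    have hm0 : (0 : ℝ) < m := by exact_mod_cast hm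
    have hm1 : (m : ℝ) ≤ y := le_trans (by push_cast; linarith) hmy
    have hy : 0 < y := hm0.trans_le hm1
    obtain ⟨ih1, ih2⟩ := ih hm1
    obtain ⟨b1, b2⟩ := log_div_succ_bounds hy hm
    rw [Finset.sum_Ioc_succ_top (by omega)]
    have hv : 0 ≤ Real.log (y / (m + 1 : ℕ)) := Real.log_nonneg (by rw [one_le_div (by positivity)]; exact hmy)
    set u := Real.log (y / m)
    set v := Real.log (y / (m + 1 : ℕ))
    set L := Real.log y
    set S := ∑ n ∈ Finset.Ioc 0 m, 1 / (n : ℝ) * Real.log (y / n) ^ j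
    have hpos : 0 < 1 / ((m + 1 : ℕ) : ℝ) := by positivity
    have huv : v ≤ u := by linarith
    obtain ⟨c1, c2⟩ := pow_succ_sub_le hv huv j
    have hu : 0 ≤ u := hv.trans huv
    have d1 : (u - v) * u ^ j ≤ 1 / m * u ^ j := mul_le_mul_of_nonneg_right b2 (by positivity)
    have d2 : 1 / ((m + 1 : ℕ) : ℝ) * v ^ j ≤ (u - v) * v ^ j := mul_le_mul_of_nonneg_right b1 (by positivity)
    have e : (L ^ (j + 1) - v ^ (j + 1)) / (j + 1) =
      (L ^ (j + 1) - u ^ (j + 1)) / (j + 1) + (u ^ (j + 1) - v ^ (j + 1)) / (j + 1) := by ring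
    rw [e]
    constructor <;> linarith

theorem abs_sum_log_pow_sub_le {y : ℝ} (hy : 1 ≤ y) (j : ℕ) :
    |∑ n ∈ Finset.Ioc 0 ⌊y⌋₊, 1 / (n : ℝ) * Real.log (y / n) ^ j - Real.log y ^ (j + 1) / (j + 1)| ≤
      Real.log y ^ j := by
  have hN : 1 ≤ ⌊y⌋₊ := by rwa [Nat.one_le_floor_iff]
  have hNy : (⌊y⌋₊ : ℝ) ≤ y := Nat.floor_le (by linarith)
  obtain ⟨h1, h2⟩ := sum_log_pow_partial j hN hNy
  set N := ⌊y⌋₊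
  have hN0 : (0 : ℝ) < N := by exact_mod_cast hN
  have hu : 0 ≤ Real.log (y / N) := Real.log_nonneg (by rwa [one_le_div hN0])
  have hu1 : Real.log (y / N) ≤ 1 / N := by
    refine (Real.log_le_sub_one_of_pos (by positivity)).trans ?_
    rw [div_sub_one hN0.ne']
    gcongr
    linarith [Nat.lt_floor_add_one y]
  set u := Real.log (y / N)
  have hL : 0 ≤ Real.log y := Real.log_nonneg hy
  have h3 : u ^ (j + 1) / (j + 1) ≤ 1 / N * u ^ j := by
    rw [pow_succ', div_le_iff₀ (by positivity)]
    have : u * u ^ j ≤ 1 / N * u ^ j := mul_le_mul_of_nonneg_right hu1 (by positivity)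
    have h4 : 0 ≤ 1 / (N : ℝ) * u ^ j := by positivity
    nlinarith [(Nat.cast_nonneg j : (0 : ℝ) ≤ j)]
  have h5 : 0 ≤ u ^ (j + 1) / (j + 1) := by positivity
  have h6 : 0 ≤ Real.log y ^ j := by positivity
  rw [sub_div] at h1 h2
  rw [abs_le]
  constructor <;> linarith

theorem sum_inv_le {y : ℝ} (hy : 1 ≤ y) : ∑ n ∈ Finset.Ioc 0 ⌊y⌋₊, 1 / (n : ℝ) ≤ 1 + Real.log y := by
  have := abs_le.1 (abs_sum_log_pow_sub_le hy 0)
  simp at this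
  simp
  linarith [this.2]

theorem exists_abs_summatory_divK_sub_le (j : ℕ) : ∃ C : ℝ, 0 < C ∧ ∀ y : ℝ, 1 ≤ y →
    |summatory (divK (j + 2)) y - y * Real.log y ^ (j + 1) / (j + 1)!| ≤ C * y * (1 + Real.log y) ^ j := by
  induction j with
  | zero =>
    refine ⟨2, by norm_num, fun y hy => ?_⟩
    have e : summatory (divK (0 + 2)) y = ∑ n ∈ Finset.Ioc 0 ⌊y⌋₊, (⌊y / n⌋₊ : ℝ) := by
      rw [show 0 + 2 = 1 + 1 from rfl, divK_add, summatory_mul]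
      refine Finset.sum_congr rfl fun n hn => ?_
      rw [divK_one_left (by simp at hn; omega), one_mul, summatory]
      rw [Finset.sum_congr rfl fun m hm => divK_one_left (by simp at hm; omega)]
      simp
    have h1 := abs_sum_log_pow_sub_le hy 0
    have h2 : |summatory (divK (0 + 2)) y - ∑ n ∈ Finset.Ioc 0 ⌊y⌋₊, y / n| ≤ y := by
      rw [e, ← Finset.sum_sub_distrib]
      calc _ ≤ ∑ n ∈ Finset.Ioc 0 ⌊y⌋₊, |(⌊y / n⌋₊ : ℝ) - y / n| := Finset.abs_sum_le_sum_abs _ _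
        _ ≤ ∑ n ∈ Finset.Ioc 0 ⌊y⌋₊, (1 : ℝ) := by
            refine Finset.sum_le_sum fun n _ => ?_
            have h3 := Nat.floor_le (a := y / n) (by positivity)
            have h4 := Nat.lt_floor_add_one (y / n)
            rw [abs_le]; constructor <;> linarith
        _ = ⌊y⌋₊ := by simp
        _ ≤ y := Nat.floor_le (by linarith)
    have h3 : |∑ n ∈ Finset.Ioc 0 ⌊y⌋₊, y / n - y * Real.log y| ≤ y := by
      have e2 : ∑ n ∈ Finset.Ioc 0 ⌊y⌋₊, y / (n : ℝ) - y * Real.log y =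
          y * (∑ n ∈ Finset.Ioc 0 ⌊y⌋₊, 1 / (n : ℝ) - Real.log y) := by
        rw [mul_sub, Finset.mul_sum]
        simp only [mul_one_div]
      rw [e2, abs_mul, abs_of_nonneg (by linarith : 0 ≤ y)]
      simp at h1
      simp only [one_div]
      nlinarith
    have h4 := (abs_add_le _ _).trans (add_le_add h2 h3)
    rw [sub_add_sub_cancel] at h4
    simp at h4 ⊢
    linarith
  | succ j ih =>
    obtain ⟨C, hC, ih⟩ := ih
    refine ⟨C + 1, by positivity, fun y hy => ?_⟩
    have hy0 : 0 < y := by linarith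
    have hL : 0 ≤ Real.log y := Real.log_nonneg hy
    have e : summatory (divK (j + 1 + 2)) y = ∑ n ∈ Finset.Ioc 0 ⌊y⌋₊, summatory (divK (j + 2)) (y / n) := by
      rw [show j + 1 + 2 = 1 + (j + 2) by ring, divK_add, summatory_mul]
      refine Finset.sum_congr rfl fun n hn => ?_
      rw [divK_one_left (by simp at hn; omega), one_mul]
    have h2 : |summatory (divK (j + 1 + 2)) y -
        ∑ n ∈ Finset.Ioc 0 ⌊y⌋₊, y / n * Real.log (y / n) ^ (j + 1) / (j + 1)!| ≤
          C * y * (1 + Real.log y) ^ (j + 1) := by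
      rw [e, ← Finset.sum_sub_distrib]
      calc _ ≤ ∑ n ∈ Finset.Ioc 0 ⌊y⌋₊, |summatory (divK (j + 2)) (y / n) -
              y / n * Real.log (y / n) ^ (j + 1) / (j + 1)!| := Finset.abs_sum_le_sum_abs _ _
        _ ≤ ∑ n ∈ Finset.Ioc 0 ⌊y⌋₊, C * y * (1 + Real.log y) ^ j * (1 / n) := by
            refine Finset.sum_le_sum fun n hn => ?_
            simp only [Finset.mem_Ioc] at hn
            have hn1 : (1 : ℝ) ≤ n := by exact_mod_cast hn.1
            have hny : (n : ℝ) ≤ y := (Nat.cast_le.2 hn.2).trans (Nat.floor_le hy0.le)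
            have hyn : 1 ≤ y / n := by rwa [one_le_div (by linarith)]
            refine (ih (y / n) hyn).trans ?_
            have h5 : Real.log (y / n) ≤ Real.log y :=
              Real.log_le_log (by positivity) (div_le_self hy0.le hn1)
            have h6 : 0 ≤ Real.log (y / n) := Real.log_nonneg hyn
            calc C * (y / n) * (1 + Real.log (y / n)) ^ j ≤ C * (y / n) * (1 + Real.log y) ^ j := by gcongr
              _ = _ := by ring
        _ = C * y * (1 + Real.log y) ^ j * ∑ n ∈ Finset.Ioc 0 ⌊y⌋₊, 1 / (n : ℝ) := by rw [Finset.mul_sum]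
        _ ≤ C * y * (1 + Real.log y) ^ j * (1 + Real.log y) := by gcongr; exact sum_inv_le hy
        _ = _ := by ring
    have h3 : |∑ n ∈ Finset.Ioc 0 ⌊y⌋₊, y / n * Real.log (y / n) ^ (j + 1) / (j + 1)! -
        y * Real.log y ^ (j + 1 + 1) / (j + 1 + 1)!| ≤ 1 * y * (1 + Real.log y) ^ (j + 1) := by
      have e2 : ∑ n ∈ Finset.Ioc 0 ⌊y⌋₊, y / (n : ℝ) * Real.log (y / n) ^ (j + 1) / (j + 1)! -
          y * Real.log y ^ (j + 1 + 1) / (j + 1 + 1)! = y / (j + 1)! *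
          (∑ n ∈ Finset.Ioc 0 ⌊y⌋₊, 1 / (n : ℝ) * Real.log (y / n) ^ (j + 1) -
            Real.log y ^ (j + 1 + 1) / ((j + 1 : ℕ) + 1)) := by
        rw [mul_sub, Finset.mul_sum, Nat.factorial_succ (j + 1)]
        congr 1
        · refine Finset.sum_congr rfl fun n _ => ?_
          ring
        · push_cast
          field_simp
      rw [e2, abs_mul, abs_of_nonneg (by positivity)]
      have h7 := abs_sum_log_pow_sub_le hy (j + 1)
      have h8 : Real.log y ^ (j + 1) ≤ (1 + Real.log y) ^ (j + 1) := by gcongr; linarith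
      have h9 : y / (j + 1)! ≤ 1 * y := by
        rw [one_mul]; exact div_le_self hy0.le (by exact_mod_cast Nat.one_le_iff_ne_zero.2 (Nat.factorial_ne_zero _))
      exact mul_le_mul h9 (h7.trans h8) (abs_nonneg _) (by positivity)
    have h4 := (abs_add_le _ _).trans (add_le_add h2 h3)
    rw [sub_add_sub_cancel] at h4
    linarith

theorem summatory_eq_zero (f : ArithmeticFunction ℝ) {x : ℝ} (hx : x < 1) : summatory f x = 0 := by
  rw [summatory, Nat.floor_eq_zero.2 hx]; simp

/-- The error in replacing `T_J(x / b)` by `(x / b) (log x)^{J-1} / (J-1)!`. -/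
theorem exists_abs_summatory_div_sub_le (j : ℕ) : ∃ C : ℝ, 0 < C ∧ ∀ x : ℝ, 1 ≤ x → ∀ b : ℕ, 1 ≤ b →
    |summatory (divK (j + 2)) (x / b) - (b : ℝ)⁻¹ * (x * Real.log x ^ (j + 1) / (j + 1)!)| ≤
      C * x * (1 + Real.log x) ^ j * ((1 + Real.log b) * (b : ℝ)⁻¹) := by
  obtain ⟨C, hC, h⟩ := exists_abs_summatory_divK_sub_le j
  refine ⟨C + 1, by positivity, fun x hx b hb => ?_⟩
  have hb1 : (1 : ℝ) ≤ b := by exact_mod_cast hb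
  have hx0 : 0 < x := by linarith
  have hL : 0 ≤ Real.log x := Real.log_nonneg hx
  have hlb : 0 ≤ Real.log b := Real.log_nonneg hb1
  have hf1 : (1 : ℝ) ≤ (j + 1)! := by exact_mod_cast Nat.one_le_iff_ne_zero.2 (Nat.factorial_ne_zero _)
  rcases lt_or_ge (x / b) 1 with hlt | hge
  · rw [summatory_eq_zero _ hlt, zero_sub, abs_neg, abs_of_nonneg (by positivity)]
    rw [div_lt_one (by linarith)] at hlt
    have h1 : Real.log x ≤ Real.log b := Real.log_le_log hx0 hlt.le
    calc (b : ℝ)⁻¹ * (x * Real.log x ^ (j + 1) / (j + 1)!) ≤ (b : ℝ)⁻¹ * (x * Real.log x ^ (j + 1)) := by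
          gcongr; exact div_le_self (by positivity) hf1
      _ = x * Real.log x ^ j * (Real.log x * (b : ℝ)⁻¹) := by ring
      _ ≤ ((C + 1) * x) * (1 + Real.log x) ^ j * ((1 + Real.log b) * (b : ℝ)⁻¹) := by
          gcongr
          · nlinarith
          · linarith
          · linarith
  · have h1 := h (x / b) hge
    have h6 : 0 ≤ Real.log (x / b) := Real.log_nonneg hge
    have hlog : Real.log (x / b) = Real.log x - Real.log b := Real.log_div hx0.ne' (by positivity)
    have h5 : Real.log (x / b) ≤ Real.log x := by linarith
    have h2 : C * (x / b) * (1 + Real.log (x / b)) ^ j ≤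
        C * x * (1 + Real.log x) ^ j * ((1 + Real.log b) * (b : ℝ)⁻¹) := by
      calc C * (x / b) * (1 + Real.log (x / b)) ^ j ≤ C * (x / b) * (1 + Real.log x) ^ j := by gcongr
        _ = C * x * (1 + Real.log x) ^ j * (1 * (b : ℝ)⁻¹) := by ring
        _ ≤ _ := by gcongr; linarith
    have h3 : |x / b * Real.log (x / b) ^ (j + 1) / (j + 1)! -
        (b : ℝ)⁻¹ * (x * Real.log x ^ (j + 1) / (j + 1)!)| ≤
        1 * x * (1 + Real.log x) ^ j * ((1 + Real.log b) * (b : ℝ)⁻¹) := by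
      have e : x / b * Real.log (x / b) ^ (j + 1) / (j + 1)! -
        (b : ℝ)⁻¹ * (x * Real.log x ^ (j + 1) / (j + 1)!) =
        -(x * (b : ℝ)⁻¹ * ((Real.log x ^ (j + 1) - Real.log (x / b) ^ (j + 1)) / (j + 1)!)) := by ring
      have h7 := (pow_succ_sub_le h6 h5 j).2
      have h8 : 0 ≤ Real.log x ^ (j + 1) - Real.log (x / b) ^ (j + 1) :=
        sub_nonneg.2 (pow_le_pow_left₀ h6 h5 _)
      rw [e, abs_neg, abs_of_nonneg (by positivity)]
      have h9 : (Real.log x ^ (j + 1) - Real.log (x / b) ^ (j + 1)) / (j + 1)! ≤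
          Real.log b * Real.log x ^ j := by
        refine le_trans ?_ (h7.trans (le_of_eq (by rw [hlog]; ring)))
        gcongr
        exact_mod_cast Nat.self_le_factorial (j + 1)
      calc _ ≤ x * (b : ℝ)⁻¹ * (Real.log b * Real.log x ^ j) := by gcongr
        _ = 1 * x * Real.log x ^ j * (Real.log b * (b : ℝ)⁻¹) := by ring
        _ ≤ _ := by gcongr <;> linarith
    have h4 := (abs_add_le _ _).trans (add_le_add (h1.trans h2) h3)
    rw [sub_add_sub_cancel] at h4
    linarith

theorem exists_abs_summatory_tauSq_sub_le {k : ℕ} (hk : 2 ≤ k) : ∃ C : ℝ, 0 < C ∧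
    ∀ d : ℕ, d ≠ 0 → ∀ x : ℝ, 1 ≤ x →
      |summatory (tauSq k d) x - arithConst k d * (x * Real.log x ^ (k ^ 2 - 1) / (k ^ 2 - 1)!)| ≤
        C * (4 + Real.log d) ^ (1 / 2 : ℝ) * arithConst k d * (x * (1 + Real.log x) ^ (k ^ 2 - 2)) := by
  have hk2 : 2 ≤ k ^ 2 := by nlinarith
  obtain ⟨j, hj⟩ : ∃ j, k ^ 2 = j + 2 := ⟨k ^ 2 - 2, by omega⟩
  obtain ⟨C, hC, h⟩ := exists_abs_summatory_div_sub_le j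
  obtain ⟨C', hC', h'⟩ := exists_corrK_log_sum_le k
  refine ⟨C * C', by positivity, fun d hd x hx => ?_⟩
  rw [show k ^ 2 - 1 = j + 1 by omega, show k ^ 2 - 2 = j by omega]
  obtain ⟨hs, hsum⟩ := h' d hd
  have hL : 0 ≤ Real.log x := Real.log_nonneg hx
  set X := x * Real.log x ^ (j + 1) / (j + 1)!
  have hA : HasSum (fun b : ℕ => corrK k d b * summatory (divK (k ^ 2)) (x / b)) (summatory (tauSq k d) x) := by
    rw [← divK_mul_corrK, mul_comm, summatory_mul]
    refine hasSum_sum_of_ne_finset_zero fun b hb => ?_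
    rcases Nat.eq_zero_or_pos b with rfl | hb0
    · simp
    have hb1 : (0 : ℝ) < b := by exact_mod_cast hb0
    rw [summatory_eq_zero _, mul_zero]
    rw [div_lt_one hb1]
    simp only [Finset.mem_Ioc, not_and, not_le] at hb
    exact (Nat.floor_lt (by linarith)).1 (hb hb0)
  have ha : HasSum (fun b : ℕ => corrK k d b * (b : ℝ) ^ (-(1 : ℝ)) * X) (arithConst k d * X) := by
    rw [arithConst_eq k hd]
    exact ((summable_corrK k hd (by norm_num)).hasSum).mul_right X
  have hle : ∀ b : ℕ, ‖corrK k d b * summatory (divK (k ^ 2)) (x / b) - corrK k d b * (b : ℝ) ^ (-(1 : ℝ)) * X‖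
      ≤ C * x * (1 + Real.log x) ^ j * (|corrK k d b| * (1 + Real.log b) * (b : ℝ)⁻¹) := by
    intro b
    rcases Nat.eq_zero_or_pos b with rfl | hb
    · simp
    have h1 := h x hx b hb
    rw [Real.rpow_neg_one, mul_assoc, ← mul_sub, Real.norm_eq_abs, abs_mul, hj]
    calc _ ≤ |corrK k d b| * (C * x * (1 + Real.log x) ^ j * ((1 + Real.log b) * (b : ℝ)⁻¹)) := by gcongr
      _ = _ := by ring
  have h2 := tsum_of_norm_bounded (hs.mul_left (C * x * (1 + Real.log x) ^ j)).hasSum hle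
  rw [(hA.sub ha).tsum_eq, Real.norm_eq_abs, tsum_mul_left] at h2
  refine h2.trans ?_
  calc _ ≤ C * x * (1 + Real.log x) ^ j * (C' * (4 + Real.log d) ^ (1 / 2 : ℝ) * arithConst k d) := by
        gcongr
    _ = _ := by ring

end Summatory

section WeightedSum
open MeasureTheory Set

theorem exists_one_add_abs_log_pow_le (n : ℕ) : ∃ C : ℝ, 0 < C ∧ ∀ y : ℝ, 0 < y →
    (1 + |Real.log y|) ^ n ≤ C * (y ^ (1 / 4 : ℝ) + y ^ (-(1 / 4) : ℝ)) := by
  set a : ℝ := 1 / (4 * (n + 1)) with ha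
  have ha0 : 0 < a := by positivity
  have key : ∀ u : ℝ, 0 ≤ u → (1 + u) ^ n ≤ (1 + 1 / a) ^ n * Real.exp (u / 4) := by
    intro u hu
    have h1 : 1 + u ≤ (1 + 1 / a) * Real.exp (a * u) := by
      have h2 := Real.add_one_le_exp (a * u)
      have h3 : u = 1 / a * (a * u) := by field_simp
      have h4 : 0 < 1 / a := by positivity
      have h5 : 0 ≤ a * u := by positivity
      nlinarith
    calc (1 + u) ^ n ≤ ((1 + 1 / a) * Real.exp (a * u)) ^ n := by gcongr
      _ = (1 + 1 / a) ^ n * Real.exp (n * (a * u)) := by rw [mul_pow, ← Real.exp_nat_mul]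
      _ ≤ _ := by
          gcongr
          have : (n : ℝ) * a ≤ 1 / 4 := by
            rw [ha, mul_one_div, div_le_div_iff₀ (by positivity) (by norm_num)]; linarith
          nlinarith
  refine ⟨(1 + 1 / a) ^ n, by positivity, fun y hy => (key _ (abs_nonneg _)).trans ?_⟩
  gcongr
  rw [Real.rpow_def_of_pos hy, Real.rpow_def_of_pos hy]
  rcases abs_cases (Real.log y) with ⟨h, _⟩ | ⟨h, _⟩
  · rw [h]
    have : Real.log y / 4 = Real.log y * (1 / 4) := by ring
    rw [this]; linarith [Real.exp_pos (Real.log y * -(1 / 4))]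
  · rw [h]
    have : -Real.log y / 4 = Real.log y * -(1 / 4) := by ring
    rw [this]; linarith [Real.exp_pos (Real.log y * (1 / 4))]

theorem integrableOn_min_rpow {a b : ℝ} (ha : -1 < a) (hb : b < -1) {g : ℝ → ℝ}
    (hg : AEStronglyMeasurable g (volume.restrict (Ioi 0))) {B : ℝ}
    (h1 : ∀ y, 0 < y → |g y| ≤ B * y ^ a) (h2 : ∀ y, 0 < y → |g y| ≤ B * y ^ b) :
    IntegrableOn g (Ioi 0) := by
  rw [← Ioc_union_Ioi_eq_Ioi zero_le_one, integrableOn_union]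
  constructor
  · have h3 : IntegrableOn (fun y : ℝ => B * y ^ a) (Ioc 0 1) := by
      have := (intervalIntegral.intervalIntegrable_rpow' ha (a := 0) (b := 1)).const_mul B
      rwa [intervalIntegrable_iff_integrableOn_Ioc_of_le zero_le_one] at this
    refine Integrable.mono' h3 (hg.mono_measure (Measure.restrict_mono Ioc_subset_Ioi_self le_rfl)) ?_
    filter_upwards [ae_restrict_mem measurableSet_Ioc] with y hy
    exact h1 y hy.1
  · have h3 : IntegrableOn (fun y : ℝ => B * y ^ b) (Ioi 1) :=
      (integrableOn_Ioi_rpow_of_lt hb one_pos).const_mul B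
    refine Integrable.mono' h3 (hg.mono_measure (Measure.restrict_mono (Ioi_subset_Ioi zero_le_one) le_rfl)) ?_
    filter_upwards [ae_restrict_mem measurableSet_Ioi] with y hy
    exact h2 y (zero_lt_one.trans hy)

variable {f f' : ℝ → ℝ} {B : ℝ}

theorem integral_eq_neg_integral_mul_deriv (hf : ∀ y, 0 < y → HasDerivAt f (f' y) y)
    (hc : ContinuousOn f' (Ioi 0))
    (h1 : ∀ y, 0 < y → |f y| ≤ B * y ^ (-(1 / 2) : ℝ)) (h2 : ∀ y, 0 < y → |f y| ≤ B * y ^ (-4 : ℝ))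
    (h3 : ∀ y, 0 < y → |f' y| ≤ B * y ^ (-(3 / 2) : ℝ)) (h4 : ∀ y, 0 < y → |f' y| ≤ B * y ^ (-5 : ℝ)) :
    IntegrableOn f (Ioi 0) ∧ IntegrableOn (fun y => y * f' y) (Ioi 0) ∧
    ∫ y in Ioi 0, f y = -∫ y in Ioi 0, y * f' y := by
  have hfc : ContinuousOn f (Ioi 0) := fun y hy => (hf y hy).continuousAt.continuousWithinAt
  have i1 : IntegrableOn f (Ioi 0) := integrableOn_min_rpow (by norm_num) (by norm_num)
    (hfc.aestronglyMeasurable measurableSet_Ioi) h1 h2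
  have i2 : IntegrableOn (fun y => y * f' y) (Ioi 0) := by
    refine integrableOn_min_rpow (a := -(1 / 2)) (b := -4) (B := B) (by norm_num) (by norm_num)
      ((continuousOn_id.mul hc).aestronglyMeasurable measurableSet_Ioi) (fun y hy => ?_) (fun y hy => ?_)
    · rw [abs_mul, abs_of_pos hy]
      calc y * |f' y| ≤ y * (B * y ^ (-(3 / 2) : ℝ)) := by gcongr; exact h3 y hy
        _ = B * (y ^ (1 : ℝ) * y ^ (-(3 / 2) : ℝ)) := by rw [Real.rpow_one]; ring
        _ = _ := by rw [← Real.rpow_add hy]; norm_num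
    · rw [abs_mul, abs_of_pos hy]
      calc y * |f' y| ≤ y * (B * y ^ (-5 : ℝ)) := by gcongr; exact h4 y hy
        _ = B * (y ^ (1 : ℝ) * y ^ (-5 : ℝ)) := by rw [Real.rpow_one]; ring
        _ = _ := by rw [← Real.rpow_add hy]; norm_num
  refine ⟨i1, i2, ?_⟩
  have hd : ∀ y ∈ Ioi (0 : ℝ), HasDerivAt (fun y => y * f y) (f y + y * f' y) y := fun y hy => by
    have := (hasDerivAt_id' y).fun_mul (hf y hy)
    simpa using this
  have t0 : Tendsto (fun y : ℝ => B * y ^ (1 / 2 : ℝ)) (𝓝[≥] 0) (𝓝 0) := by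
    have : Tendsto (fun y : ℝ => B * y ^ (1 / 2 : ℝ)) (𝓝 0) (𝓝 (B * 0 ^ (1 / 2 : ℝ))) :=
      ((Real.continuous_rpow_const (by norm_num)).tendsto 0).const_mul B
    rw [Real.zero_rpow (by norm_num), mul_zero] at this
    exact this.mono_left nhdsWithin_le_nhds
  have hc0 : ContinuousWithinAt (fun y => y * f y) (Ici 0) 0 := by
    rw [ContinuousWithinAt, zero_mul]
    refine squeeze_zero_norm' ?_ t0
    filter_upwards [self_mem_nhdsWithin] with y hy
    rcases eq_or_lt_of_le (show (0 : ℝ) ≤ y from hy) with rfl | hy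
    · simp
    · rw [Real.norm_eq_abs, abs_mul, abs_of_pos hy]
      calc y * |f y| ≤ y * (B * y ^ (-(1 / 2) : ℝ)) := by gcongr; exact h1 y hy
        _ = B * (y ^ (1 : ℝ) * y ^ (-(1 / 2) : ℝ)) := by rw [Real.rpow_one]; ring
        _ = _ := by rw [← Real.rpow_add hy]; norm_num
  have hinf : Tendsto (fun y => y * f y) atTop (𝓝 0) := by
    have : Tendsto (fun y : ℝ => B * y ^ (-3 : ℝ)) atTop (𝓝 0) := by
      simpa using (tendsto_rpow_neg_atTop (y := 3) (by norm_num)).const_mul B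
    refine squeeze_zero_norm' ?_ this
    filter_upwards [eventually_gt_atTop 0] with y hy
    rw [Real.norm_eq_abs, abs_mul, abs_of_pos hy]
    calc y * |f y| ≤ y * (B * y ^ (-4 : ℝ)) := by gcongr; exact h2 y hy
      _ = B * (y ^ (1 : ℝ) * y ^ (-4 : ℝ)) := by rw [Real.rpow_one]; ring
      _ = _ := by rw [← Real.rpow_add hy]; norm_num
  have := integral_Ioi_of_hasDerivAt_of_tendsto hc0 hd (i1.add i2) hinf
  rw [integral_add i1 i2] at this
  simp at this
  linarith

theorem eq_neg_integral_Ici_deriv (hf : ∀ y, 0 < y → HasDerivAt f (f' y) y)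
    (hc : ContinuousOn f' (Ioi 0)) (h2 : ∀ y, 0 < y → |f y| ≤ B * y ^ (-4 : ℝ))
    (h4 : ∀ y, 0 < y → |f' y| ≤ B * y ^ (-5 : ℝ)) {a : ℝ} (ha : 0 < a) :
    IntegrableOn f' (Ici a) ∧ f a = -∫ y in Ici a, f' y ∧ ∫ y in Ici a, |f' y| ≤ B / 4 * a ^ (-4 : ℝ) := by
  have i0 : IntegrableOn (fun y : ℝ => B * y ^ (-5 : ℝ)) (Ioi a) :=
    (integrableOn_Ioi_rpow_of_lt (by norm_num) ha).const_mul B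
  have i1 : IntegrableOn f' (Ioi a) := by
    refine Integrable.mono' i0 ((hc.mono (Ioi_subset_Ioi ha.le)).aestronglyMeasurable measurableSet_Ioi) ?_
    filter_upwards [ae_restrict_mem measurableSet_Ioi] with y hy
    exact h4 y (ha.trans hy)
  have hinf : Tendsto f atTop (𝓝 0) := by
    have : Tendsto (fun y : ℝ => B * y ^ (-4 : ℝ)) atTop (𝓝 0) := by
      simpa using (tendsto_rpow_neg_atTop (y := 4) (by norm_num)).const_mul B
    refine squeeze_zero_norm' ?_ this
    filter_upwards [eventually_gt_atTop 0] with y hy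
    exact h2 y hy
  refine ⟨(integrableOn_Ici_iff_integrableOn_Ioi' (by simp)).2 i1, ?_, ?_⟩
  · rw [integral_Ici_eq_integral_Ioi,
      integral_Ioi_of_hasDerivAt_of_tendsto (hf a ha).continuousAt.continuousWithinAt
      (fun y hy => hf y (ha.trans hy)) i1 hinf]
    simp
  · rw [integral_Ici_eq_integral_Ioi]
    calc ∫ y in Ioi a, |f' y| ≤ ∫ y in Ioi a, B * y ^ (-5 : ℝ) := by
          refine setIntegral_mono_on i1.abs i0 measurableSet_Ioi fun y hy => h4 y (ha.trans hy)
      _ = _ := by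
          rw [integral_const_mul, integral_Ioi_rpow_of_lt (by norm_num) ha]
          norm_num; ring

theorem integrable_of_hasSum_of_summable_integral_norm {α E : Type*} [NormedAddCommGroup E]
    [MeasurableSpace α] {μ : Measure α} {F : ℕ → α → E} {f : α → E}
    (hF : ∀ i, Integrable (F i) μ) (hs : Summable fun i => ∫ a, ‖F i a‖ ∂μ)
    (hf : ∀ᵐ a ∂μ, HasSum (fun i => F i a) (f a)) : Integrable f μ := by
  have hm : AEStronglyMeasurable f μ :=
    aestronglyMeasurable_of_tendsto_ae atTop (f := fun N a => ∑ i ∈ Finset.range N, F i a)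
      (fun N => Finset.aestronglyMeasurable_fun_sum _ fun i _ => (hF i).1)
      (hf.mono fun a ha => ha.tendsto_sum_nat)
  refine ⟨hm, ?_⟩
  have key : ∀ i, ∫⁻ a, ‖F i a‖ₑ ∂μ = ENNReal.ofReal (∫ a, ‖F i a‖ ∂μ) := fun i =>
    (ofReal_integral_norm_eq_lintegral_enorm (hF i)).symm
  calc ∫⁻ a, ‖f a‖ₑ ∂μ ≤ ∫⁻ a, ∑' i, ‖F i a‖ₑ ∂μ := by
        refine lintegral_mono_ae (hf.mono fun a ha => ?_)
        rw [← ha.tsum_eq]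
        exact enorm_tsum_le_tsum_enorm
    _ = ∑' i, ∫⁻ a, ‖F i a‖ₑ ∂μ := lintegral_tsum fun i => (hF i).1.enorm
    _ = ∑' i, ENNReal.ofReal (∫ a, ‖F i a‖ ∂μ) := by simp only [key]
    _ < ⊤ := by
        rw [← ENNReal.ofReal_tsum_of_nonneg (fun i => integral_nonneg fun a => norm_nonneg _) hs]
        exact ENNReal.ofReal_lt_top

theorem tsum_eq_neg_integral_summatory {t : ArithmeticFunction ℝ} (ht : ∀ n, 0 ≤ t n)
    (hts : Summable fun n : ℕ => t n * (n : ℝ) ^ (-4 : ℝ))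
    (hf : ∀ y, 0 < y → HasDerivAt f (f' y) y)
    (hc : ContinuousOn f' (Ioi 0)) (h2 : ∀ y, 0 < y → |f y| ≤ B * y ^ (-4 : ℝ))
    (h4 : ∀ y, 0 < y → |f' y| ≤ B * y ^ (-5 : ℝ)) {Y : ℝ} (hY : 0 < Y) :
    IntegrableOn (fun y => summatory t (y * Y) * f' y) (Ioi 0) ∧
    ∑' n : ℕ, t n * f (n / Y) = -∫ y in Ioi 0, summatory t (y * Y) * f' y := by
  set F : ℕ → ℝ → ℝ := fun n y => t n * (Ici ((n : ℝ) / Y)).indicator f' y with hF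
  have hFi : ∀ n, IntegrableOn (F n) (Ioi 0) ∧ t n * f (n / Y) = -∫ y in Ioi 0, F n y ∧
      ∫ y in Ioi 0, ‖F n y‖ ≤ B / 4 * Y ^ (4 : ℝ) * (t n * (n : ℝ) ^ (-4 : ℝ)) := by
    intro n
    rcases Nat.eq_zero_or_pos n with rfl | hn
    · simp [hF]
    have hn0 : (0 : ℝ) < n := by exact_mod_cast hn
    obtain ⟨a1, a2, a3⟩ := eq_neg_integral_Ici_deriv hf hc h2 h4 (a := n / Y) (by positivity)
    have hsub : Ici ((n : ℝ) / Y) ⊆ Ioi 0 := fun y hy => lt_of_lt_of_le (by positivity : (0 : ℝ) < n / Y) hy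
    have e1 : ∀ g : ℝ → ℝ, ∫ y in Ioi 0, (Ici ((n : ℝ) / Y)).indicator g y = ∫ y in Ici ((n : ℝ) / Y), g y := by
      intro g
      rw [setIntegral_indicator measurableSet_Ici, inter_eq_right.2 hsub]
    refine ⟨?_, ?_, ?_⟩
    · refine Integrable.const_mul ?_ _
      exact (a1.integrable_indicator measurableSet_Ici).integrableOn
    · simp only [hF]
      rw [integral_const_mul, e1, a2]; ring
    · simp only [hF, norm_mul, Real.norm_eq_abs, abs_of_nonneg (ht n)]
      rw [integral_const_mul]
      have e2 : ∀ y, |(Ici ((n : ℝ) / Y)).indicator f' y| = (Ici ((n : ℝ) / Y)).indicator (fun y => |f' y|) y :=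
        fun y => by by_cases h : y ∈ Ici ((n : ℝ) / Y) <;> simp [h]
      simp only [e2]
      rw [e1]
      calc t n * ∫ y in Ici ((n : ℝ) / Y), |f' y| ≤ t n * (B / 4 * ((n : ℝ) / Y) ^ (-4 : ℝ)) :=
            mul_le_mul_of_nonneg_left a3 (ht n)
        _ = _ := by
            rw [Real.div_rpow hn0.le hY.le, Real.rpow_neg hY.le, div_inv_eq_mul]; ring
  have hsumN : Summable fun n => ∫ y in Ioi 0, ‖F n y‖ :=
    Summable.of_nonneg_of_le (fun n => integral_nonneg fun y => norm_nonneg _) (fun n => (hFi n).2.2)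
      (hts.mul_left _)
  have hs := hasSum_integral_of_summable_integral_norm (μ := volume.restrict (Ioi 0)) (fun n => (hFi n).1) hsumN
  have hpt : ∀ y ∈ Ioi (0 : ℝ), HasSum (fun n => F n y) (summatory t (y * Y) * f' y) := by
    intro y hy
    rw [summatory, Finset.sum_mul]
    have : ∀ n : ℕ, n ∉ Finset.Ioc 0 ⌊y * Y⌋₊ → F n y = 0 := by
      intro n hn
      rcases Nat.eq_zero_or_pos n with rfl | hn0
      · simp [hF]
      simp only [Finset.mem_Ioc, not_and, not_le] at hn
      have h5 := (Nat.floor_lt (mul_pos hy hY).le).1 (hn hn0)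
      have : y ∉ Ici ((n : ℝ) / Y) := by
        rw [mem_Ici, not_le, lt_div_iff₀ hY]; exact h5
      simp [hF, this]
    have hs : HasSum (fun n => F n y) (∑ n ∈ Finset.Ioc 0 ⌊y * Y⌋₊, F n y) := hasSum_sum_of_ne_finset_zero this
    refine Finset.sum_congr (M := ℝ) rfl (fun n hn => ?_) ▸ hs
    simp only [Finset.mem_Ioc] at hn
    have h5 := (Nat.le_floor_iff (mul_pos hy hY).le).1 hn.2
    have : y ∈ Ici ((n : ℝ) / Y) := by
      rw [mem_Ici, div_le_iff₀ hY]; exact h5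
    simp [hF, this]
  have e3 : ∫ y in Ioi 0, ∑' n, F n y = ∫ y in Ioi 0, summatory t (y * Y) * f' y :=
    setIntegral_congr_fun measurableSet_Ioi fun y hy => (hpt y hy).tsum_eq
  constructor
  · refine integrable_of_hasSum_of_summable_integral_norm (fun n => (hFi n).1) hsumN ?_
    filter_upwards [ae_restrict_mem measurableSet_Ioi] with y hy using hpt y hy
  · rw [← e3, ← hs.tsum_eq, ← tsum_neg]
    exact tsum_congr fun n => (hFi n).2.1

theorem summable_tauSq_rpow (k d : ℕ) : Summable fun n : ℕ => tauSq k d n * (n : ℝ) ^ (-4 : ℝ) := by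
  obtain ⟨C, hC, h⟩ := exists_divK_le (k ^ 2) (ε := 1) one_pos
  refine Summable.of_nonneg_of_le (fun n => mul_nonneg (tauSq_nonneg _ _ _) (by positivity)) (fun n => ?_)
    ((Real.summable_nat_rpow (p := -3).2 (by norm_num)).mul_left C)
  rcases Nat.eq_zero_or_pos n with rfl | hn
  · simp
  have hn0 : (0 : ℝ) < n := by exact_mod_cast hn
  calc tauSq k d n * (n : ℝ) ^ (-4 : ℝ) ≤ (C * (n : ℝ) ^ (1 : ℝ)) * (n : ℝ) ^ (-4 : ℝ) := by
        gcongr; exact (tauSq_le k d n).trans (h n hn.ne')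
    _ = _ := by rw [mul_assoc, ← Real.rpow_add hn0]; norm_num

theorem abs_pow_succ_sub_le {u v M : ℝ} (hu : 0 ≤ u) (hv : 0 ≤ v) (huM : u ≤ M) (hvM : v ≤ M) (j : ℕ) :
    |u ^ (j + 1) - v ^ (j + 1)| ≤ (j + 1) * |u - v| * M ^ j := by
  wlog h : v ≤ u generalizing u v
  · rw [abs_sub_comm, abs_sub_comm u]; exact this hv hu hvM huM (le_of_not_ge h)
  rw [abs_of_nonneg (sub_nonneg.2 (pow_le_pow_left₀ hv h _)), abs_of_nonneg (sub_nonneg.2 h)]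
  have := (pow_succ_sub_le hv h j).2
  rw [div_le_iff₀ (by positivity)] at this
  calc _ ≤ (u - v) * u ^ j * (j + 1) := this
    _ ≤ (u - v) * M ^ j * (j + 1) := by
        have := sub_nonneg.2 h
        gcongr
    _ = _ := by ring

theorem exists_abs_summatory_scaled_sub_le {k : ℕ} (hk : 2 ≤ k) : ∃ C : ℝ, 0 < C ∧
    ∀ d : ℕ, d ≠ 0 → ∀ Y : ℝ, 1 ≤ Y → ∀ y : ℝ, 0 < y →
      |summatory (tauSq k d) (y * Y) - arithConst k d * (Y * Real.log Y ^ (k ^ 2 - 1) / (k ^ 2 - 1)!) * y| ≤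
        C * (4 + Real.log d) ^ (1 / 2 : ℝ) * arithConst k d * (Y * (1 + Real.log Y) ^ (k ^ 2 - 2)) *
          (y * (1 + |Real.log y|) ^ (k ^ 2 - 1)) := by
  have hk2 : 2 ≤ k ^ 2 := by nlinarith
  obtain ⟨j, hj⟩ : ∃ j, k ^ 2 = j + 2 := ⟨k ^ 2 - 2, by omega⟩
  obtain ⟨C, hC, h⟩ := exists_abs_summatory_tauSq_sub_le hk
  rw [show k ^ 2 - 1 = j + 1 by omega, show k ^ 2 - 2 = j by omega] at *
  refine ⟨C + 1 + j, by positivity, fun d hd Y hY y hy => ?_⟩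
  have ha := (arithConst_pos k hd).le
  set a := arithConst k d
  have hld : 0 ≤ Real.log d := Real.log_natCast_nonneg d
  set R := (4 + Real.log d) ^ (1 / 2 : ℝ)
  have hR : 1 ≤ R := Real.one_le_rpow (by linarith) (by norm_num)
  have hY0 : 0 < Y := by linarith
  have hL : 0 ≤ Real.log Y := Real.log_nonneg hY
  set L := Real.log Y
  set u := |Real.log y| with hu
  have hu0 : 0 ≤ u := abs_nonneg _
  have hf1 : (1 : ℝ) ≤ (j + 1)! := by exact_mod_cast Nat.one_le_iff_ne_zero.2 (Nat.factorial_ne_zero _)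
  have hM : L ≤ (1 + L) * (1 + u) := by nlinarith
  rcases lt_or_ge (y * Y) 1 with hlt | hge
  · rw [summatory_eq_zero _ hlt, zero_sub, abs_neg, abs_of_nonneg (by positivity)]
    have h1 : L ≤ u := by
      have : Real.log (y * Y) ≤ 0 := Real.log_nonpos (by positivity) hlt.le
      rw [Real.log_mul hy.ne' hY0.ne'] at this
      have := neg_abs_le (Real.log y)
      linarith [neg_le_abs (Real.log y)]
    calc a * (Y * L ^ (j + 1) / (j + 1)!) * y ≤ a * (Y * L ^ (j + 1)) * y := by
          gcongr; exact div_le_self (by positivity) hf1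
      _ = 1 * 1 * a * (Y * L ^ j) * (y * (L * 1)) := by ring
      _ ≤ (C + 1 + j) * R * a * (Y * (1 + L) ^ j) * (y * ((1 + u) * (1 + u) ^ j)) := by
          gcongr
          · linarith [(Nat.cast_nonneg j : (0 : ℝ) ≤ j)]
          · linarith
          · linarith
          · exact one_le_pow₀ (by linarith)
      _ = _ := by ring
  · have h1 := h d hd (y * Y) hge
    have hlog : Real.log (y * Y) = Real.log y + L := Real.log_mul hy.ne' hY0.ne'
    have hx0 : 0 ≤ Real.log (y * Y) := Real.log_nonneg hge
    have hxM : 1 + Real.log (y * Y) ≤ (1 + L) * (1 + u) := by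
      rw [hlog]; nlinarith [le_abs_self (Real.log y)]
    have h2 : C * R * a * (y * Y * (1 + Real.log (y * Y)) ^ j) ≤
        C * R * a * (Y * (1 + L) ^ j) * (y * (1 + u) ^ (j + 1)) := by
      calc _ ≤ C * R * a * (y * Y * ((1 + L) * (1 + u)) ^ j) := by gcongr
        _ = C * R * a * (Y * (1 + L) ^ j) * (y * (1 + u) ^ j) := by rw [mul_pow]; ring
        _ ≤ _ := by gcongr <;> linarith
    have h3 : |a * (y * Y * Real.log (y * Y) ^ (j + 1) / (j + 1)!) - a * (Y * L ^ (j + 1) / (j + 1)!) * y| ≤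
        (1 + j) * R * a * (Y * (1 + L) ^ j) * (y * (1 + u) ^ (j + 1)) := by
      have e : a * (y * Y * Real.log (y * Y) ^ (j + 1) / (j + 1)!) - a * (Y * L ^ (j + 1) / (j + 1)!) * y
          = a * Y * y * ((Real.log (y * Y) ^ (j + 1) - L ^ (j + 1)) / (j + 1)!) := by ring
      have h4 := abs_pow_succ_sub_le hx0 hL (by linarith) hM j
      rw [hlog, add_sub_cancel_right, ← hlog] at h4
      rw [e, abs_mul, abs_of_nonneg (by positivity), abs_div, abs_of_nonneg (by positivity : (0:ℝ) ≤ (j+1)!)]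
      calc a * Y * y * (|Real.log (y * Y) ^ (j + 1) - L ^ (j + 1)| / (j + 1)!)
          ≤ a * Y * y * ((j + 1) * u * ((1 + L) * (1 + u)) ^ j) := by
            gcongr
            exact (div_le_self (abs_nonneg _) hf1).trans h4
        _ = (1 + j) * 1 * a * (Y * (1 + L) ^ j) * (y * ((1 + u) ^ j * u)) := by rw [mul_pow]; ring
        _ ≤ (1 + j) * R * a * (Y * (1 + L) ^ j) * (y * ((1 + u) ^ j * (1 + u))) := by gcongr; linarith
        _ = _ := by ring
    have h5 := (abs_add_le _ _).trans (add_le_add (h1.trans h2) h3)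
    rw [sub_add_sub_cancel] at h5
    linarith

/-- Asymptotics for the smoothly weighted sum of `τ_k²` over the integers coprime to `d`, with an
error term that is uniform in `d`. -/
theorem exists_abs_tsum_tauSq_sub_le {k : ℕ} (hk : 2 ≤ k) (hf : ∀ y, 0 < y → HasDerivAt f (f' y) y)
    (hc : ContinuousOn f' (Ioi 0))
    (h1 : ∀ y, 0 < y → |f y| ≤ B * y ^ (-(1 / 2) : ℝ)) (h2 : ∀ y, 0 < y → |f y| ≤ B * y ^ (-4 : ℝ))
    (h3 : ∀ y, 0 < y → |f' y| ≤ B * y ^ (-(3 / 2) : ℝ)) (h4 : ∀ y, 0 < y → |f' y| ≤ B * y ^ (-5 : ℝ)) :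
    ∃ C : ℝ, 0 < C ∧ ∀ d : ℕ, d ≠ 0 → ∀ Y : ℝ, 1 ≤ Y →
      |∑' n : ℕ, tauSq k d n * f (n / Y) -
          arithConst k d * (Y * Real.log Y ^ (k ^ 2 - 1) / (k ^ 2 - 1)!) * ∫ y in Ioi 0, f y| ≤
        C * (4 + Real.log d) ^ (1 / 2 : ℝ) * arithConst k d * (Y * (1 + Real.log Y) ^ (k ^ 2 - 2)) := by
  obtain ⟨C, hC, h⟩ := exists_abs_summatory_scaled_sub_le hk
  obtain ⟨C', hC', h'⟩ := exists_one_add_abs_log_pow_le (k ^ 2 - 1)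
  obtain ⟨-, i2, e1⟩ := integral_eq_neg_integral_mul_deriv hf hc h1 h2 h3 h4
  have hB : 0 ≤ B := by
    have := (abs_nonneg _).trans (h1 1 one_pos); simpa using this
  set g : ℝ → ℝ := fun y => y * (1 + |Real.log y|) ^ (k ^ 2 - 1) * |f' y| with hg
  have hlogc : ContinuousOn Real.log (Ioi 0) := Real.continuousOn_log.mono fun y hy => ne_of_gt hy
  have hgi : IntegrableOn g (Ioi 0) := by
    have hb : ∀ (e a b : ℝ), e + 5 / 4 = a → e + 3 / 4 = b → (∀ y, 0 < y → |f' y| ≤ B * y ^ e) → ∀ y, 0 < y →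
        |g y| ≤ C' * B * (y ^ a + y ^ b) := by
      intro e a b ha hb he y hy
      have hnn : 0 ≤ g y := by positivity
      rw [abs_of_nonneg hnn, hg]
      calc y * (1 + |Real.log y|) ^ (k ^ 2 - 1) * |f' y|
          ≤ y * (C' * (y ^ (1 / 4 : ℝ) + y ^ (-(1 / 4) : ℝ))) * (B * y ^ e) := by
            gcongr
            · exact h' y hy
            · exact he y hy
        _ = C' * B * (y ^ (1 : ℝ) * y ^ (1 / 4 : ℝ) * y ^ e + y ^ (1 : ℝ) * y ^ (-(1 / 4) : ℝ) * y ^ e) := by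
            rw [Real.rpow_one]; ring
        _ = _ := by
            rw [← Real.rpow_add hy, ← Real.rpow_add hy, ← Real.rpow_add hy, ← Real.rpow_add hy]
            rw [← ha, ← hb]; ring_nf
    have hm : AEStronglyMeasurable g (volume.restrict (Ioi 0)) := by
      refine ContinuousOn.aestronglyMeasurable ?_ measurableSet_Ioi
      exact (continuousOn_id.mul ((continuousOn_const.add hlogc.abs).pow _)).mul hc.abs
    have b1 := hb (-(3 / 2)) (-(1 / 4)) (-(3 / 4)) (by norm_num) (by norm_num) h3
    have b2 := hb (-5) (-(15 / 4)) (-(17 / 4)) (by norm_num) (by norm_num) h4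
    have c1 : ∀ y : ℝ, 0 < y → |g y| ≤ 2 * (C' * B) * y ^ (-(3 / 4) : ℝ) := by
      intro y hy
      rcases le_total y 1 with h | h
      · have : y ^ (-(1 / 4) : ℝ) ≤ y ^ (-(3 / 4) : ℝ) :=
          Real.rpow_le_rpow_of_exponent_ge hy h (by norm_num)
        calc _ ≤ _ := b1 y hy
          _ ≤ C' * B * (y ^ (-(3 / 4) : ℝ) + y ^ (-(3 / 4) : ℝ)) := by gcongr
          _ = _ := by ring
      · have a1 : y ^ (-(15 / 4) : ℝ) ≤ y ^ (-(3 / 4) : ℝ) :=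
          Real.rpow_le_rpow_of_exponent_le h (by norm_num)
        have a2 : y ^ (-(17 / 4) : ℝ) ≤ y ^ (-(3 / 4) : ℝ) :=
          Real.rpow_le_rpow_of_exponent_le h (by norm_num)
        calc _ ≤ _ := b2 y hy
          _ ≤ C' * B * (y ^ (-(3 / 4) : ℝ) + y ^ (-(3 / 4) : ℝ)) := by gcongr
          _ = _ := by ring
    have c2 : ∀ y : ℝ, 0 < y → |g y| ≤ 2 * (C' * B) * y ^ (-(15 / 4) : ℝ) := by
      intro y hy
      rcases le_total y 1 with h | h
      · have a1 : y ^ (-(1 / 4) : ℝ) ≤ y ^ (-(15 / 4) : ℝ) :=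
          Real.rpow_le_rpow_of_exponent_ge hy h (by norm_num)
        have a2 : y ^ (-(3 / 4) : ℝ) ≤ y ^ (-(15 / 4) : ℝ) :=
          Real.rpow_le_rpow_of_exponent_ge hy h (by norm_num)
        calc _ ≤ _ := b1 y hy
          _ ≤ C' * B * (y ^ (-(15 / 4) : ℝ) + y ^ (-(15 / 4) : ℝ)) := by gcongr
          _ = _ := by ring
      · have a1 : y ^ (-(17 / 4) : ℝ) ≤ y ^ (-(15 / 4) : ℝ) :=
          Real.rpow_le_rpow_of_exponent_le h (by norm_num)
        calc _ ≤ _ := b2 y hy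
          _ ≤ C' * B * (y ^ (-(15 / 4) : ℝ) + y ^ (-(15 / 4) : ℝ)) := by gcongr
          _ = _ := by ring
    exact integrableOn_min_rpow (by norm_num) (by norm_num) hm c1 c2
  refine ⟨C * (1 + ∫ y in Ioi 0, g y), ?_, fun d hd Y hY => ?_⟩
  · have : 0 ≤ ∫ y in Ioi 0, g y := setIntegral_nonneg measurableSet_Ioi fun y hy => by
      have : (0 : ℝ) < y := hy
      positivity
    positivity
  have ha := (arithConst_pos k hd).le
  obtain ⟨i3, e2⟩ := tsum_eq_neg_integral_summatory (tauSq_nonneg k d) (summable_tauSq_rpow k d) hf hc h2 h4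
    (Y := Y) (by linarith)
  rw [e1, e2]
  set M := arithConst k d * (Y * Real.log Y ^ (k ^ 2 - 1) / (k ^ 2 - 1)!)
  rw [mul_neg, sub_neg_eq_add, ← integral_const_mul, neg_add_eq_sub, ← integral_sub (i2.const_mul M) i3]
  set D := C * (4 + Real.log d) ^ (1 / 2 : ℝ) * arithConst k d * (Y * (1 + Real.log Y) ^ (k ^ 2 - 2)) with hD
  have hL : 0 ≤ Real.log Y := Real.log_nonneg hY
  have hld : 0 ≤ Real.log d := Real.log_natCast_nonneg d
  have hD0 : 0 ≤ D := by positivity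
  calc _ ≤ ∫ y in Ioi 0, D * g y := by
        rw [← Real.norm_eq_abs]
        refine norm_integral_le_of_norm_le (hgi.const_mul D) ?_
        filter_upwards [ae_restrict_mem measurableSet_Ioi] with y hy
        have h5 := h d hd Y hY y hy
        rw [show M * (y * f' y) - summatory (tauSq k d) (y * Y) * f' y =
          -((summatory (tauSq k d) (y * Y) - M * y) * f' y) by ring, norm_neg, norm_mul, Real.norm_eq_abs,
          Real.norm_eq_abs]
        calc _ ≤ D * (y * (1 + |Real.log y|) ^ (k ^ 2 - 1)) * |f' y| := by gcongr
          _ = _ := by rw [hg]; ring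
    _ = D * ∫ y in Ioi 0, g y := integral_const_mul _ _
    _ ≤ D * (1 + ∫ y in Ioi 0, g y) := by gcongr; linarith
    _ = _ := by rw [hD]; ring

end WeightedSum

section Strip
open MeasureTheory Set Complex

/-- `f` is holomorphic on a closed vertical strip and decays there faster than any power of the
imaginary part. -/
structure StripRapid (a b : ℝ) (f : ℂ → ℂ) : Prop where
  diff : DifferentiableOn ℂ f (re ⁻¹' Icc a b)
  decay : ∀ N : ℕ, ∃ C : ℝ, ∀ s : ℂ, s.re ∈ Icc a b → ‖f s‖ * (1 + s.im ^ 2) ^ N ≤ C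

/-- `f` is holomorphic on a closed vertical strip and grows there at most polynomially. -/
structure StripPoly (a b : ℝ) (f : ℂ → ℂ) : Prop where
  diff : DifferentiableOn ℂ f (re ⁻¹' Icc a b)
  growth : ∃ N : ℕ, ∃ C : ℝ, ∀ s : ℂ, s.re ∈ Icc a b → ‖f s‖ ≤ C * (1 + s.im ^ 2) ^ N

variable {a b σ : ℝ} {f g : ℂ → ℂ}

theorem StripRapid.mul (hf : StripRapid a b f) (hg : StripPoly a b g) :
    StripRapid a b fun s => f s * g s := by
  refine ⟨hf.diff.mul hg.diff, fun N => ?_⟩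
  obtain ⟨M, C, h⟩ := hg.growth
  obtain ⟨D, h'⟩ := hf.decay (N + M)
  refine ⟨D * |C|, fun s hs => ?_⟩
  calc ‖f s * g s‖ * (1 + s.im ^ 2) ^ N = ‖f s‖ * ‖g s‖ * (1 + s.im ^ 2) ^ N := by rw [norm_mul]
    _ ≤ ‖f s‖ * (|C| * (1 + s.im ^ 2) ^ M) * (1 + s.im ^ 2) ^ N := by
        gcongr; exact (h s hs).trans (by gcongr; exact le_abs_self C)
    _ = ‖f s‖ * (1 + s.im ^ 2) ^ (N + M) * |C| := by rw [pow_add]; ring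
    _ ≤ D * |C| := by gcongr; exact h' s hs

theorem StripPoly.mul (hf : StripPoly a b f) (hg : StripPoly a b g) :
    StripPoly a b fun s => f s * g s := by
  refine ⟨hf.diff.mul hg.diff, ?_⟩
  obtain ⟨M, C, h⟩ := hg.growth
  obtain ⟨N, D, h'⟩ := hf.growth
  refine ⟨N + M, |D| * |C|, fun s hs => ?_⟩
  calc ‖f s * g s‖ = ‖f s‖ * ‖g s‖ := norm_mul _ _
    _ ≤ (|D| * (1 + s.im ^ 2) ^ N) * (|C| * (1 + s.im ^ 2) ^ M) := by
        gcongr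
        · exact (h' s hs).trans (by gcongr; exact le_abs_self D)
        · exact (h s hs).trans (by gcongr; exact le_abs_self C)
    _ = _ := by rw [pow_add]; ring

theorem StripPoly.const (c : ℂ) : StripPoly a b fun _ => c :=
  ⟨differentiableOn_const _, 0, ‖c‖, fun s _ => by simp⟩

theorem StripPoly.pow (hf : StripPoly a b f) (k : ℕ) : StripPoly a b fun s => f s ^ k := by
  induction k with
  | zero => simpa using StripPoly.const 1
  | succ k ih => simpa only [pow_succ] using ih.mul hf

theorem StripPoly.prod {ι : Type*} (t : Finset ι) {F : ι → ℂ → ℂ} (h : ∀ i ∈ t, StripPoly a b (F i)) :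
    StripPoly a b fun s => ∏ i ∈ t, F i s := by
  classical
  induction t using Finset.induction_on with
  | empty => simpa using StripPoly.const 1
  | insert i t hi ih =>
    simp only [Finset.prod_insert hi]
    exact (h i (Finset.mem_insert_self _ _)).mul (ih fun j hj => h j (Finset.mem_insert_of_mem hj))

theorem StripPoly.sub (hf : StripPoly a b f) (hg : StripPoly a b g) :
    StripPoly a b fun s => f s - g s := by
  refine ⟨hf.diff.sub hg.diff, ?_⟩
  obtain ⟨M, C, h⟩ := hg.growth
  obtain ⟨N, D, h'⟩ := hf.growth
  refine ⟨N + M, |D| + |C|, fun s hs => ?_⟩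
  have h1 : (1 : ℝ) ≤ 1 + s.im ^ 2 := by nlinarith [sq_nonneg s.im]
  calc ‖f s - g s‖ ≤ ‖f s‖ + ‖g s‖ := norm_sub_le _ _
    _ ≤ |D| * (1 + s.im ^ 2) ^ (N + M) + |C| * (1 + s.im ^ 2) ^ (N + M) := by
        refine add_le_add ((h' s hs).trans ?_) ((h s hs).trans ?_)
        · exact mul_le_mul (le_abs_self D) (pow_le_pow_right₀ h1 (by omega)) (by positivity) (abs_nonneg _)
        · exact mul_le_mul (le_abs_self C) (pow_le_pow_right₀ h1 (by omega)) (by positivity) (abs_nonneg _)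
    _ = _ := by ring

theorem StripPoly.id : StripPoly a b fun s => s := by
  refine ⟨differentiableOn_id, 1, |a| + |b| + 1, fun s hs => ?_⟩
  have h1 : ‖s‖ ≤ |s.re| + |s.im| := norm_le_abs_re_add_abs_im s
  have h2 : |s.re| ≤ |a| + |b| := abs_le.2 ⟨by linarith [neg_abs_le a, abs_nonneg b, hs.1],
    by linarith [le_abs_self b, abs_nonneg a, hs.2]⟩
  have h3 : |s.im| ≤ 1 + s.im ^ 2 := by nlinarith [sq_abs s.im, sq_nonneg (|s.im| - 1)]
  rw [pow_one]
  nlinarith [abs_nonneg a, abs_nonneg b, sq_nonneg s.im]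

/-- Powers with a positive real base are bounded on vertical strips. -/
theorem StripPoly.const_cpow {x : ℝ} (hx : 0 < x) {l : ℂ → ℂ} (hl : Differentiable ℂ l)
    (hre : ∃ B, ∀ s : ℂ, s.re ∈ Icc a b → |(l s).re| ≤ B) : StripPoly a b fun s => (x : ℂ) ^ l s := by
  have hx0 : (x : ℂ) ≠ 0 := ofReal_ne_zero.2 hx.ne'
  refine ⟨(hl.const_cpow (Or.inl hx0)).differentiableOn, 0, ?_⟩
  obtain ⟨B, hB⟩ := hre
  refine ⟨Real.exp (|Real.log x| * B), fun s hs => ?_⟩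
  rw [norm_cpow_eq_rpow_re_of_pos hx, Real.rpow_def_of_pos hx, pow_zero, mul_one, Real.exp_le_exp]
  calc _ ≤ |Real.log x * (l s).re| := le_abs_self _
    _ = |Real.log x| * |(l s).re| := abs_mul _ _
    _ ≤ _ := by gcongr; exact hB s hs

theorem StripRapid.mono {a' b' : ℝ} (hf : StripRapid a b f) (h1 : a ≤ a') (h2 : b' ≤ b) :
    StripRapid a' b' f :=
  ⟨hf.diff.mono (preimage_mono (Icc_subset_Icc h1 h2)), fun N => by
    obtain ⟨C, h⟩ := hf.decay N
    exact ⟨C, fun s hs => h s (Icc_subset_Icc h1 h2 hs)⟩⟩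

theorem StripRapid.one_sub (hf : StripRapid a b f) : StripRapid (1 - b) (1 - a) fun s => f (1 - s) := by
  have hm : ∀ s : ℂ, s.re ∈ Icc (1 - b) (1 - a) → (1 - s).re ∈ Icc a b := fun s hs => by
    simp only [sub_re, one_re, mem_Icc] at hs ⊢
    constructor <;> linarith [hs.1, hs.2]
  refine ⟨hf.diff.comp (differentiableOn_const 1 |>.sub differentiableOn_id) fun s hs => hm s hs, fun N => ?_⟩
  obtain ⟨C, h⟩ := hf.decay N
  refine ⟨C, fun s hs => ?_⟩
  simpa using h (1 - s) (hm s hs)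

theorem re_add_ofReal_mul_I (σ t : ℝ) : ((σ : ℂ) + t * I).re = σ := by simp
theorem im_add_ofReal_mul_I (σ t : ℝ) : ((σ : ℂ) + t * I).im = t := by simp

theorem StripRapid.continuous_vertical (hf : StripRapid a b f) (hσ : σ ∈ Icc a b) :
    Continuous fun t : ℝ => f (σ + t * I) := by
  refine hf.diff.continuousOn.comp_continuous (by fun_prop) fun t => ?_
  rw [mem_preimage, re_add_ofReal_mul_I]; exact hσ

theorem StripRapid.exists_norm_le (hf : StripRapid a b f) : ∃ C : ℝ, 0 ≤ C ∧
    ∀ σ ∈ Icc a b, ∀ t : ℝ, ‖f (σ + t * I)‖ ≤ C * (1 + t ^ 2)⁻¹ := by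
  obtain ⟨C, h⟩ := hf.decay 1
  refine ⟨|C|, abs_nonneg _, fun σ hσ t => ?_⟩
  have := h (σ + t * I) (by rwa [re_add_ofReal_mul_I])
  rw [im_add_ofReal_mul_I, pow_one] at this
  rw [← div_eq_mul_inv, le_div_iff₀ (by positivity)]
  exact this.trans (le_abs_self C)

theorem StripRapid.verticalIntegrable (hf : StripRapid a b f) (hσ : σ ∈ Icc a b) :
    VerticalIntegrable f σ := by
  obtain ⟨C, hC, h⟩ := hf.exists_norm_le
  exact Integrable.mono' (integrable_inv_one_add_sq.const_mul C)
    (hf.continuous_vertical hσ).aestronglyMeasurable (.of_forall fun t => h σ hσ t)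

/-- Shifting the line of integration. -/
theorem StripRapid.integral_eq (hf : StripRapid a b f) (hab : a ≤ b) :
    ∫ t : ℝ, f (a + t * I) = ∫ t : ℝ, f (b + t * I) := by
  obtain ⟨C, hC, h⟩ := hf.exists_norm_le
  have ha : a ∈ Icc a b := ⟨le_rfl, hab⟩
  have hb : b ∈ Icc a b := ⟨hab, le_rfl⟩
  have hrect : ∀ T : ℝ, (∫ y in (-T)..T, f (b + y * I)) - ∫ y in (-T)..T, f (a + y * I) =
      I * ((∫ x in a..b, f (x + (-T : ℝ) * I)) - ∫ x in a..b, f (x + T * I)) := by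
    intro T
    have := integral_boundary_rect_eq_zero_of_differentiableOn f (a + (-T : ℝ) * I) (b + T * I) ?_
    · simp only [re_add_ofReal_mul_I, im_add_ofReal_mul_I, smul_eq_mul] at this
      linear_combination (-I) * this + ((∫ y in (-T)..T, f (b + y * I)) - ∫ y in (-T)..T, f (a + y * I)) * I_mul_I
    · refine hf.diff.mono fun s hs => ?_
      have := hs.1
      rw [mem_preimage, re_add_ofReal_mul_I, re_add_ofReal_mul_I, uIcc_of_le hab] at this
      exact this
  have l1 : Tendsto (fun T : ℝ => (∫ y in (-T)..T, f (b + y * I)) - ∫ y in (-T)..T, f (a + y * I)) atTop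
      (𝓝 ((∫ t : ℝ, f (b + t * I)) - ∫ t : ℝ, f (a + t * I))) :=
    (intervalIntegral_tendsto_integral (hf.verticalIntegrable hb) tendsto_neg_atTop_atBot tendsto_id).sub
      (intervalIntegral_tendsto_integral (hf.verticalIntegrable ha) tendsto_neg_atTop_atBot tendsto_id)
  have hsmall : ∀ T : ℝ, ‖∫ x in a..b, f (x + T * I)‖ ≤ C * (1 + T ^ 2)⁻¹ * |b - a| := fun T =>
    intervalIntegral.norm_integral_le_of_norm_le_const fun x hx => by
      rw [uIoc_of_le hab] at hx
      exact h x (Ioc_subset_Icc_self hx) T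
  have l2 : Tendsto (fun T : ℝ => I * ((∫ x in a..b, f (x + (-T : ℝ) * I)) - ∫ x in a..b, f (x + T * I))) atTop
      (𝓝 0) := by
    have l3 : Tendsto (fun T : ℝ => 2 * (C * (1 + T ^ 2)⁻¹ * |b - a|)) atTop (𝓝 0) := by
      have : Tendsto (fun T : ℝ => (1 + T ^ 2)⁻¹) atTop (𝓝 0) :=
        tendsto_inv_atTop_zero.comp (tendsto_atTop_add_const_left _ _ (tendsto_pow_atTop (by norm_num)))
      simpa using ((this.const_mul C).mul_const |b - a|).const_mul 2
    refine squeeze_zero_norm (fun T => ?_) l3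
    rw [norm_mul, norm_I, one_mul]
    have := hsmall (-T)
    rw [neg_sq] at this
    calc _ ≤ _ := norm_sub_le _ _
      _ ≤ _ := add_le_add this (hsmall T)
      _ = _ := by ring
  simp only [hrect] at l1
  exact (sub_eq_zero.1 (tendsto_nhds_unique l1 l2)).symm

theorem StripRapid.cpow_mul (hf : StripRapid a b f) {x : ℝ} (hx : 0 < x) :
    StripRapid a b fun s => (x : ℂ) ^ (-s) * f s := by
  simp only [mul_comm]
  refine hf.mul (StripPoly.const_cpow hx differentiable_id.neg ⟨|a| + |b|, fun s hs => ?_⟩)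
  simp only [neg_re, abs_neg]
  exact abs_le.2 ⟨by linarith [neg_abs_le a, abs_nonneg b, hs.1], by linarith [le_abs_self b, abs_nonneg a, hs.2]⟩

theorem StripRapid.mellinInv_eq (hf : StripRapid a b f) {σ₁ σ₂ : ℝ} (h1 : σ₁ ∈ Icc a b) (h2 : σ₂ ∈ Icc a b)
    {x : ℝ} (hx : 0 < x) : mellinInv σ₁ f x = mellinInv σ₂ f x := by
  wlog h : σ₁ ≤ σ₂ generalizing σ₁ σ₂
  · exact (this h2 h1 (le_of_not_ge h)).symm
  simp only [mellinInv, smul_eq_mul]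
  congr 1
  exact ((hf.mono h1.1 h2.2).cpow_mul hx).integral_eq h

theorem StripRapid.exists_norm_mellinInv_le (hf : StripRapid a b f) : ∃ C : ℝ, 0 ≤ C ∧
    ∀ σ ∈ Icc a b, ∀ x : ℝ, 0 < x → ‖mellinInv σ f x‖ ≤ C * x ^ (-σ) := by
  obtain ⟨C, hC, h⟩ := hf.exists_norm_le
  have hI : 0 ≤ ∫ t : ℝ, (1 + t ^ 2)⁻¹ := integral_nonneg fun t => by positivity
  refine ⟨(1 / (2 * Real.pi)) * (C * ∫ t : ℝ, (1 + t ^ 2)⁻¹), by positivity, fun σ hσ x hx => ?_⟩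
  rw [mellinInv, norm_smul, Real.norm_of_nonneg (by positivity), mul_assoc]
  gcongr
  rw [mul_right_comm, ← integral_const_mul]
  refine norm_integral_le_of_norm_le (integrable_inv_one_add_sq.const_mul _) (.of_forall fun t => ?_)
  rw [norm_smul, norm_cpow_eq_rpow_re_of_pos hx, neg_re, re_add_ofReal_mul_I]
  calc x ^ (-σ) * ‖f (σ + t * I)‖ ≤ x ^ (-σ) * (C * (1 + t ^ 2)⁻¹) := by gcongr; exact h σ hσ t
    _ = _ := by ring

theorem StripRapid.hasDerivAt_mellinInv (hf : StripRapid a b f) (hσ : σ ∈ Icc a b) {x : ℝ} (hx : 0 < x) :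
    HasDerivAt (mellinInv σ f) (-(x : ℂ)⁻¹ * mellinInv σ (fun s => f s * s) x) x := by
  obtain ⟨C, hC, h⟩ := (hf.mul StripPoly.id).exists_norm_le
  set F' : ℝ → ℝ → ℂ := fun y t => -(σ + t * I) * (y : ℂ) ^ (-(σ + t * I) - 1) * f (σ + t * I) with hF'
  have hc : ∀ y : ℝ, 0 < y → Continuous fun t : ℝ => (y : ℂ) ^ (-((σ : ℂ) + t * I)) * f (σ + t * I) := by
    intro y hy
    refine Continuous.mul ?_ (hf.continuous_vertical hσ)
    exact Continuous.const_cpow (by fun_prop) (Or.inl (ofReal_ne_zero.2 hy.ne'))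
  have hc' : Continuous fun t : ℝ => F' x t := by
    refine Continuous.mul (Continuous.mul (by fun_prop) ?_) (hf.continuous_vertical hσ)
    exact Continuous.const_cpow (by fun_prop) (Or.inl (ofReal_ne_zero.2 hx.ne'))
  obtain ⟨K, hK⟩ : ∃ K : ℝ, ∀ y ∈ Icc (x / 2) (2 * x), y ^ (-σ - 1) ≤ K := by
    have : ContinuousOn (fun y : ℝ => y ^ (-σ - 1)) (Icc (x / 2) (2 * x)) := fun y hy =>
      (Real.continuousAt_rpow_const _ _ (Or.inl (by linarith [hy.1]))).continuousWithinAt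
    obtain ⟨K, hK⟩ := isCompact_Icc.exists_bound_of_continuousOn this
    exact ⟨K, fun y hy => (le_abs_self _).trans (hK y hy)⟩
  have key := hasDerivAt_integral_of_dominated_loc_of_deriv_le (μ := volume)
    (F := fun (y : ℝ) (t : ℝ) => (y : ℂ) ^ (-((σ : ℂ) + t * I)) * f (σ + t * I)) (F' := F') (x₀ := x)
    (s := Ioo (x / 2) (2 * x)) (bound := fun t => K * (C * (1 + t ^ 2)⁻¹))
    (Ioo_mem_nhds (by linarith) (by linarith))
    (by
      filter_upwards [eventually_gt_nhds hx] with y hy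
      exact (hc y hy).aestronglyMeasurable)
    ((hf.cpow_mul hx).verticalIntegrable hσ)
    hc'.aestronglyMeasurable
    (.of_forall fun t y hy => by
      have hy0 : 0 < y := by linarith [hy.1]
      rw [hF', norm_mul, norm_mul, norm_cpow_eq_rpow_re_of_pos hy0, norm_neg, sub_re, neg_re,
        re_add_ofReal_mul_I, one_re]
      have h1 := h σ hσ t
      rw [norm_mul] at h1
      calc _ = y ^ (-σ - 1) * (‖f (σ + t * I)‖ * ‖(σ : ℂ) + t * I‖) := by ring
        _ ≤ K * (C * (1 + t ^ 2)⁻¹) := by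
            have := hK y (Ioo_subset_Icc_self hy)
            have : 0 ≤ y ^ (-σ - 1) := by positivity
            gcongr
            linarith)
    ((integrable_inv_one_add_sq.const_mul C).const_mul K)
    (.of_forall fun t y hy => by
      have hy0 : 0 < y := by linarith [hy.1]
      refine HasDerivAt.mul_const ?_ _
      have := (hasDerivAt_id (y : ℂ)).cpow_const (c := -((σ : ℂ) + t * I)) (ofReal_mem_slitPlane.2 hy0)
      simpa using this.comp_ofReal)
  have := key.2.const_smul (1 / (2 * Real.pi))
  refine HasDerivAt.congr_deriv (f := mellinInv σ f) this ?_
  simp only [mellinInv, hF']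
  rw [mul_smul_comm, ← integral_const_mul]
  congr 2
  ext t
  rw [cpow_sub _ _ (ofReal_ne_zero.2 hx.ne'), cpow_one, smul_eq_mul]
  field_simp

theorem hasSum_mellinInv {c : ℕ → ℂ} (hc : LSeriesSummable c σ) (hc0 : c 0 = 0)
    (hf : VerticalIntegrable f σ) {M : ℝ} (hM : 0 < M) :
    HasSum (fun m : ℕ => c m * mellinInv σ f (m / M)) (mellinInv σ (fun s => f s * LSeries c s) M⁻¹) := by
  set F : ℕ → ℝ → ℂ := fun m t => (M : ℂ) ^ ((σ : ℂ) + t * I) * f (σ + t * I) * LSeries.term c (σ + t * I) m with hF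
  have hFn : ∀ m t, ‖F m t‖ = (M ^ σ * ‖LSeries.term c σ m‖) * ‖f (σ + t * I)‖ := by
    intro m t
    rw [hF, norm_mul, norm_mul, norm_cpow_eq_rpow_re_of_pos hM, re_add_ofReal_mul_I,
      LSeries.norm_term_eq, LSeries.norm_term_eq, re_add_ofReal_mul_I, ofReal_re]
    ring
  have hFc : ∀ m, Continuous fun t : ℝ => (M : ℂ) ^ ((σ : ℂ) + t * I) * LSeries.term c (σ + t * I) m := by
    intro m
    refine Continuous.mul (Continuous.const_cpow (by fun_prop) (Or.inl (ofReal_ne_zero.2 hM.ne'))) ?_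
    rcases Nat.eq_zero_or_pos m with rfl | hm
    · simpa using continuous_const
    · simp only [LSeries.term_of_ne_zero hm.ne']
      have hm0 : (m : ℂ) ≠ 0 := by exact_mod_cast hm.ne'
      refine Continuous.div continuous_const (Continuous.const_cpow (by fun_prop) (Or.inl hm0)) fun t => ?_
      simp [cpow_eq_zero_iff, hm0]
  have hFi : ∀ m, Integrable (F m) := by
    intro m
    refine Integrable.mono' (hf.norm.const_mul (M ^ σ * ‖LSeries.term c σ m‖)) ?_ (.of_forall fun t => (hFn m t).le)
    have := ((hFc m).aestronglyMeasurable (μ := volume)).mul hf.aestronglyMeasurable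
    refine this.congr (.of_forall fun t => ?_)
    simp only [hF, Pi.mul_apply]; ring
  have hs : Summable fun m => ∫ t, ‖F m t‖ := by
    simp only [hFn, integral_const_mul]
    exact (hc.norm.mul_left _).mul_right _
  have h := (hasSum_integral_of_summable_integral_norm hFi hs).const_smul (1 / (2 * Real.pi) : ℝ)
  have e1 : ∀ m : ℕ, c m * mellinInv σ f (m / M) = (1 / (2 * Real.pi) : ℝ) • ∫ t, F m t := by
    intro m
    rcases Nat.eq_zero_or_pos m with rfl | hm
    · simp [hc0, hF]
    rw [mellinInv, mul_smul_comm, ← integral_const_mul]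
    congr 2
    ext t
    simp only [hF, smul_eq_mul, LSeries.term_of_ne_zero hm.ne']
    have hm0 : (0 : ℝ) < m := by exact_mod_cast hm
    rw [ofReal_div, div_eq_mul_inv, ← ofReal_inv, mul_cpow_ofReal_nonneg hm0.le (by positivity), ofReal_inv,
      inv_cpow _ _ (by rw [arg_ofReal_of_nonneg hM.le]; exact Real.pi_ne_zero.symm), cpow_neg (M : ℂ), inv_inv,
      cpow_neg, ofReal_natCast]
    ring
  have e2 : mellinInv σ (fun s => f s * LSeries c s) M⁻¹ = (1 / (2 * Real.pi) : ℝ) • ∫ t, ∑' m, F m t := by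
    rw [mellinInv]
    congr 2
    ext t
    simp only [hF]
    rw [tsum_mul_left, LSeries, ofReal_inv,
      inv_cpow _ _ (by rw [arg_ofReal_of_nonneg hM.le]; exact Real.pi_ne_zero.symm), cpow_neg (M : ℂ), inv_inv,
      smul_eq_mul]
    ring
  rw [e2]
  simpa only [e1] using h

end Strip

section MellinBump
open MeasureTheory Set Complex

variable {g : ℝ → ℂ}

theorem support_subset_Ioo {E : Type*} [NormedAddCommGroup E] {g : ℝ → E} (hg : Continuous g)
    (hs : Function.support g ⊆ Icc 1 2) : Function.support g ⊆ Ioo 1 2 := by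
  rw [← interior_Icc]
  exact interior_maximal hs (isOpen_ne_fun hg continuous_const)

theorem support_deriv_subset_Icc (hs : Function.support g ⊆ Icc 1 2) :
    Function.support (deriv g) ⊆ Icc 1 2 := by
  refine support_deriv_subset.trans ?_
  exact closure_minimal hs isClosed_Icc

theorem mellin_eq_intervalIntegral (hs : Function.support g ⊆ Icc 1 2) (s : ℂ) :
    mellin g s = ∫ x in (1 : ℝ)..2, (x : ℂ) ^ (s - 1) * g x := by
  rw [mellin, intervalIntegral.integral_of_le (by norm_num), ← integral_Icc_eq_integral_Ioc]
  refine (setIntegral_eq_of_subset_of_forall_sdiff_eq_zero measurableSet_Ioi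
    (fun x hx => lt_of_lt_of_le one_pos hx.1) fun x hx => ?_)
  have : g x = 0 := by
    by_contra h
    exact hx.2 (hs h)
  simp [this]

theorem mellin_mul_self (hg : ContDiff ℝ ∞ g) (hs : Function.support g ⊆ Icc 1 2) (s : ℂ) :
    mellin g s * s = -mellin (deriv g) (s + 1) := by
  rw [mellin_eq_intervalIntegral hs, mellin_eq_intervalIntegral (support_deriv_subset_Icc hs)]
  have hz : ∀ x, x ∉ Ioo (1 : ℝ) 2 → g x = 0 := fun x hx => by
    by_contra h
    exact hx (support_subset_Ioo hg.continuous hs h)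
  have hd : Continuous (deriv g) := hg.continuous_deriv (by norm_num)
  have hu : uIcc (1 : ℝ) 2 = Icc 1 2 := uIcc_of_le (by norm_num)
  have hc : ∀ r : ℂ, ContinuousOn (fun x : ℝ => (x : ℂ) ^ r) (Icc 1 2) := fun r x hx =>
    (continuousAt_ofReal_cpow_const x r (Or.inr (by linarith [hx.1]))).continuousWithinAt
  have := intervalIntegral.integral_mul_deriv_eq_deriv_mul (a := 1) (b := 2)
    (u := fun x : ℝ => (x : ℂ) ^ s) (u' := fun x : ℝ => s * (x : ℂ) ^ (s - 1)) (v := g) (v' := deriv g)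
    (fun x hx => by
      rw [hu] at hx
      have := (hasDerivAt_id (x : ℂ)).cpow_const (c := s) (ofReal_mem_slitPlane.2 (by linarith [hx.1]))
      simpa using this.comp_ofReal)
    (fun x _ => (hg.differentiable (by simp) x).hasDerivAt)
    (by
      refine ContinuousOn.intervalIntegrable ?_
      rw [hu]
      exact continuousOn_const.mul (hc _))
    (hd.intervalIntegrable _ _)
  rw [hz 1 (by simp), hz 2 (by simp)] at this
  simp only [add_sub_cancel_right]
  rw [this, ← intervalIntegral.integral_mul_const]
  simp only [mul_zero, sub_zero, zero_sub, neg_neg]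
  congr 1
  ext x
  ring

theorem exists_norm_mellin_mul_pow_le (N : ℕ) : ∀ {g : ℝ → ℂ}, ContDiff ℝ ∞ g → Function.support g ⊆ Icc 1 2 →
    ∀ a b : ℝ, ∃ C : ℝ, ∀ s : ℂ, s.re ∈ Icc a b → ‖mellin g s‖ * |s.im| ^ N ≤ C := by
  induction N with
  | zero =>
    intro g hg hs a b
    obtain ⟨C, hC⟩ := isCompact_Icc.exists_bound_of_continuousOn (s := Icc (1 : ℝ) 2) hg.continuous.continuousOn
    refine ⟨2 ^ |b - 1| * C, fun s hsab => ?_⟩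
    rw [pow_zero, mul_one, mellin_eq_intervalIntegral hs]
    have h0 : 0 ≤ C := (norm_nonneg _).trans (hC 1 (by simp))
    have : ∀ x ∈ Set.uIoc (1 : ℝ) 2, ‖(x : ℂ) ^ (s - 1) * g x‖ ≤ 2 ^ |b - 1| * C := by
      intro x hx
      rw [uIoc_of_le (by norm_num)] at hx
      rw [norm_mul, norm_cpow_eq_rpow_re_of_pos (by linarith [hx.1])]
      gcongr
      · calc x ^ (s - 1).re ≤ x ^ |b - 1| := by
              refine Real.rpow_le_rpow_of_exponent_le hx.1.le ?_
              rw [sub_re, one_re]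
              exact (sub_le_sub_right hsab.2 1).trans (le_abs_self _)
          _ ≤ 2 ^ |b - 1| := Real.rpow_le_rpow (by linarith [hx.1]) hx.2 (abs_nonneg _)
      · exact hC x (Ioc_subset_Icc_self hx)
    have := intervalIntegral.norm_integral_le_of_norm_le_const this
    norm_num at this ⊢
    exact this
  | succ N ih =>
    intro g hg hs a b
    obtain ⟨C, hC⟩ := ih ((contDiff_infty_iff_deriv.1 hg).2) (support_deriv_subset_Icc hs) (a + 1) (b + 1)
    refine ⟨C, fun s hsab => ?_⟩
    have h1 := hC (s + 1) (by simpa using hsab)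
    rw [← norm_neg, ← mellin_mul_self hg hs, norm_mul] at h1
    calc ‖mellin g s‖ * |s.im| ^ (N + 1) = ‖mellin g s‖ * |s.im| * |s.im| ^ N := by ring
      _ ≤ ‖mellin g s‖ * ‖s‖ * |s.im| ^ N := by gcongr; exact abs_im_le_norm s
      _ ≤ C := by simpa using h1

theorem mellinConvergent_of_support (hg : Continuous g) (hs : Function.support g ⊆ Icc 1 2) (s : ℂ) :
    MellinConvergent g s ∧ DifferentiableAt ℂ (mellin g) s := by
  have hl : LocallyIntegrableOn g (Ioi 0) := (hg.locallyIntegrable).locallyIntegrableOn _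
  have ht : g =O[atTop] (· ^ (-(s.re + 1)) : ℝ → ℝ) := by
    refine (EventuallyEq.isBigO (f₂ := fun _ => (0 : ℂ)) ?_).trans (Asymptotics.isBigO_zero _ _)
    filter_upwards [eventually_gt_atTop 2] with x hx
    by_contra h
    linarith [(hs h).2]
  have hb : g =O[𝓝[>] 0] (· ^ (-(s.re - 1)) : ℝ → ℝ) := by
    refine (EventuallyEq.isBigO (f₂ := fun _ => (0 : ℂ)) ?_).trans (Asymptotics.isBigO_zero _ _)
    filter_upwards [nhdsWithin_le_nhds (eventually_lt_nhds one_pos)] with x hx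
    by_contra h
    linarith [(hs h).1]
  exact ⟨mellinConvergent_of_isBigO_rpow hl ht (by linarith) hb (by linarith),
    mellin_differentiableAt_of_isBigO_rpow hl ht (by linarith) hb (by linarith)⟩

theorem stripRapid_mellin (hg : ContDiff ℝ ∞ g) (hs : Function.support g ⊆ Icc 1 2) (a b : ℝ) :
    StripRapid a b (mellin g) := by
  refine ⟨fun s _ => (mellinConvergent_of_support hg.continuous hs s).2.differentiableWithinAt, fun N => ?_⟩
  obtain ⟨C, hC⟩ := exists_norm_mellin_mul_pow_le 0 hg hs a b
  obtain ⟨D, hD⟩ := exists_norm_mellin_mul_pow_le (2 * N) hg hs a b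
  refine ⟨2 ^ N * (C + D), fun s hsab => ?_⟩
  have h1 := hC s hsab
  have h2 := hD s hsab
  rw [pow_zero, mul_one] at h1
  have h3 : (1 + s.im ^ 2) ^ N ≤ 2 ^ N * (1 + |s.im| ^ (2 * N)) := by
    have := add_pow_le (zero_le_one) (sq_nonneg s.im) N
    rw [one_pow, ← pow_mul] at this
    refine this.trans ?_
    rw [(even_two_mul N).pow_abs s.im]
    have h4 : 0 ≤ s.im ^ (2 * N) := (even_two_mul N).pow_nonneg _
    have : (2 : ℝ) ^ (N - 1) ≤ 2 ^ N := pow_le_pow_right₀ (by norm_num) (by omega)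
    gcongr
  calc ‖mellin g s‖ * (1 + s.im ^ 2) ^ N ≤ ‖mellin g s‖ * (2 ^ N * (1 + |s.im| ^ (2 * N))) := by gcongr
    _ = 2 ^ N * (‖mellin g s‖ + ‖mellin g s‖ * |s.im| ^ (2 * N)) := by ring
    _ ≤ _ := by gcongr

end MellinBump

section GammaRatio
open MeasureTheory Set Complex

theorem norm_betaIntegral_le (v : ℂ) (b : ℝ) :
    ‖betaIntegral v b‖ ≤ ‖betaIntegral v.re b‖ := by
  have h : betaIntegral v.re b = ((∫ x in (0 : ℝ)..1, x ^ (v.re - 1) * (1 - x) ^ (b - 1) : ℝ) : ℂ) := by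
    rw [betaIntegral, ← intervalIntegral.integral_ofReal]
    refine intervalIntegral.integral_congr fun x hx => ?_
    rw [uIcc_of_le zero_le_one] at hx
    rw [ofReal_mul, ofReal_cpow hx.1, ofReal_cpow (by linarith [hx.2])]
    push_cast; rfl
  have hnn : ∀ x ∈ Icc (0 : ℝ) 1, 0 ≤ x ^ (v.re - 1) * (1 - x) ^ (b - 1) := fun x hx =>
    mul_nonneg (Real.rpow_nonneg hx.1 _) (Real.rpow_nonneg (by linarith [hx.2]) _)
  rw [h, norm_real, Real.norm_of_nonneg (intervalIntegral.integral_nonneg zero_le_one hnn), betaIntegral,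
    intervalIntegral.integral_of_le zero_le_one, intervalIntegral.integral_of_le zero_le_one]
  refine (norm_integral_le_integral_norm _).trans (le_of_eq ?_)
  refine setIntegral_congr_ae measurableSet_Ioc ?_
  have hne : ∀ᵐ x : ℝ, x ≠ 1 := by simp [ae_iff]
  filter_upwards [hne] with x hx1 hx
  have hx' : x < 1 := lt_of_le_of_ne hx.2 hx1
  rw [norm_mul, norm_cpow_eq_rpow_re_of_pos hx.1, ← ofReal_one, ← ofReal_sub,
    norm_cpow_eq_rpow_re_of_pos (by linarith)]
  simp

theorem norm_Gamma_mul_Gamma_le {v : ℂ} (hv : 0 < v.re) {b : ℝ} (hb : 0 < b) :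
    ‖Gamma v‖ * Real.Gamma (v.re + b) ≤ ‖Gamma (v + b)‖ * Real.Gamma v.re := by
  have h1 := Gamma_mul_Gamma_eq_betaIntegral hv (t := b) (by simpa using hb)
  have h2 := Gamma_mul_Gamma_eq_betaIntegral (s := v.re) (by simpa using hv) (t := b) (by simpa using hb)
  have p1 := Real.Gamma_pos_of_pos hv
  have p2 := Real.Gamma_pos_of_pos hb
  have p3 := Real.Gamma_pos_of_pos (add_pos hv hb)
  have n1 := congrArg norm h1
  have n2 := congrArg norm h2
  rw [← ofReal_add] at n2
  simp only [Gamma_ofReal, norm_mul, norm_real, Real.norm_of_nonneg p1.le, Real.norm_of_nonneg p2.le,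
    Real.norm_of_nonneg p3.le] at n1 n2
  have h3 := norm_betaIntegral_le v b
  have : ‖Gamma v‖ * Real.Gamma (v.re + b) * Real.Gamma b ≤ ‖Gamma (v + b)‖ * Real.Gamma v.re * Real.Gamma b := by
    calc _ = ‖Gamma v‖ * Real.Gamma b * Real.Gamma (v.re + b) := by ring
      _ = ‖Gamma (v + b)‖ * ‖betaIntegral v b‖ * Real.Gamma (v.re + b) := by rw [n1]
      _ ≤ ‖Gamma (v + b)‖ * ‖betaIntegral v.re b‖ * Real.Gamma (v.re + b) := by gcongr
      _ = ‖Gamma (v + b)‖ * (Real.Gamma (v.re + b) * ‖betaIntegral v.re b‖) := by ring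
      _ = _ := by rw [← n2]; ring
  exact le_of_mul_le_mul_right this p2

theorem norm_Gammaℝ (u : ℂ) : ‖Gammaℝ u‖ = Real.pi ^ (-u.re / 2) * ‖Gamma (u / 2)‖ := by
  rw [Gammaℝ_def, norm_mul, norm_cpow_eq_rpow_re_of_pos Real.pi_pos]
  simp

theorem norm_Gammaℝ_conj (u : ℂ) : ‖Gammaℝ (starRingEnd ℂ u)‖ = ‖Gammaℝ u‖ := by
  have h : starRingEnd ℂ u / 2 = starRingEnd ℂ (u / 2) := by
    rw [map_div₀, map_ofNat]
  rw [norm_Gammaℝ, norm_Gammaℝ, conj_re, h, Gamma_conj, norm_conj]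

/-- The quotient of archimedean factors in the functional equation of an L-function of parity `κ`. -/
noncomputable def gammaRatio (κ : ℕ) (z : ℂ) : ℂ := Gammaℝ (z + κ) * (Gammaℝ (1 - z + κ))⁻¹

theorem norm_gammaRatio_of_re_eq_half (κ : ℕ) {z : ℂ} (hz : z.re = 1 / 2) : ‖gammaRatio κ z‖ = 1 := by
  have h1 : 1 - z + κ = starRingEnd ℂ (z + κ) := by
    apply Complex.ext
    · simp; linarith
    · simp
  rw [gammaRatio, h1, norm_mul, norm_inv, norm_Gammaℝ_conj]
  refine mul_inv_cancel₀ (norm_ne_zero_iff.2 (Gammaℝ_ne_zero_of_re_pos ?_))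
  rw [add_re, natCast_re, hz]; positivity

theorem stripPoly_gammaRatio (κ : ℕ) : StripPoly (1 / 4) 2 (gammaRatio κ) := by
  constructor
  · intro z hz
    have hz1 : (1 / 4 : ℝ) ≤ z.re := hz.1
    refine DifferentiableAt.differentiableWithinAt ?_
    refine DifferentiableAt.mul ?_ ?_
    · have h1 : DifferentiableAt ℂ (fun z : ℂ => ((Gammaℝ (z + κ))⁻¹)⁻¹) z := by
        refine DifferentiableAt.inv ?_ ?_
        · exact (differentiable_Gammaℝ_inv _).comp z (by fun_prop)
        · refine inv_ne_zero (Gammaℝ_ne_zero_of_re_pos ?_)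
          rw [add_re, natCast_re]; positivity
      simpa using h1
    · exact (differentiable_Gammaℝ_inv _).comp z (f := fun z : ℂ => 1 - z + κ) (by fun_prop)
  · have hcont : ContinuousOn (fun x : ℝ => Real.pi ^ (1 / 2 - x) *
        (Real.Gamma ((x + κ) / 2) / Real.Gamma ((5 - x + κ) / 2))) (Icc (1 / 4) 2) := by
      have hG : ∀ {y : ℝ}, 0 < y → ContinuousAt Real.Gamma y := fun {y} hy =>
        (Real.differentiableAt_Gamma fun m hm => by
          have : (0 : ℝ) ≤ m := m.cast_nonneg
          linarith).continuousAt
      intro x hx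
      refine ContinuousAt.continuousWithinAt ?_
      have p1 : 0 < (x + κ) / 2 := by have := hx.1; positivity
      have p2 : 0 < (5 - x + κ) / 2 := by
        have := hx.2
        have : 0 < 5 - x := by linarith
        positivity
      refine ContinuousAt.mul ?_ (ContinuousAt.div ?_ ?_ (Real.Gamma_pos_of_pos p2).ne')
      · exact (Real.continuous_const_rpow Real.pi_ne_zero).continuousAt.comp
          (f := fun x : ℝ => 1 / 2 - x) (by fun_prop)
      · exact (hG p1).comp (f := fun x : ℝ => (x + κ) / 2) (by fun_prop)
      · exact (hG p2).comp (f := fun x : ℝ => (5 - x + κ) / 2) (by fun_prop)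
    obtain ⟨C, hC⟩ := isCompact_Icc.exists_bound_of_continuousOn hcont
    refine ⟨1, C * (2 * (3 + κ) ^ 2), fun z hz => ?_⟩
    set x := z.re with hx
    have hx1 := hz.1
    have hx2 := hz.2
    have hC0 : 0 ≤ C := (norm_nonneg _).trans (hC x hz)
    set u : ℂ := (1 - starRingEnd ℂ z + κ) / 2 with hu
    have huc : (1 - z + κ) / 2 = starRingEnd ℂ u := by
      rw [hu, map_div₀, map_ofNat, map_add, map_sub, conj_conj, map_one, map_natCast]
    have hκ : (0 : ℝ) ≤ κ := κ.cast_nonneg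
    have hure : u.re = (1 - x + κ) / 2 := by simp [hu, hx]
    have huim : u.im = z.im / 2 := by simp [hu]
    have hden : ‖Gammaℝ (1 - z + κ)‖ = Real.pi ^ (-(1 - x + κ) / 2) * ‖Gamma u‖ := by
      rw [norm_Gammaℝ, huc, Gamma_conj, norm_conj]
      simp [hx]
    have hun : ‖u‖ ≤ 2 + κ + |z.im| := by
      refine (norm_le_abs_re_add_abs_im u).trans ?_
      rw [hure, huim, abs_div, abs_div, abs_two]
      have : |1 - x + κ| ≤ 2 + κ := abs_le.2 ⟨by linarith, by linarith⟩
      linarith [abs_nonneg z.im, abs_nonneg (1 - x + κ)]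
    by_cases h0 : Gamma u = 0
    · have : Gammaℝ (1 - z + κ) = 0 := by
        rw [← norm_eq_zero, hden, h0]; simp
      rw [gammaRatio, this]
      simp; positivity
    have hu0 : u ≠ 0 := by rintro h; rw [h] at h0; simp at h0
    have hu1 : u + 1 ≠ 0 := by
      intro h
      rw [eq_neg_of_add_eq_zero_left h] at h0
      exact h0 (by simpa using Gamma_neg_nat_eq_zero 1)
    have hb : (0 : ℝ) < 5 / 2 - x := by linarith
    have hv : 0 < ((z + κ) / 2).re := by
      have : ((z + κ) / 2).re = (x + κ) / 2 := by simp [hx]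
      rw [this]; positivity
    have key := norm_Gamma_mul_Gamma_le hv hb
    have e1 : (z + κ) / 2 + ((5 / 2 - x : ℝ) : ℂ) = u + 1 + 1 := by
      apply Complex.ext
      · simp [hu, ← hx]; ring
      · simp [hu]
    have e2 : ((z + κ) / 2).re = (x + κ) / 2 := by simp [hx]
    rw [e1, e2, show (x + κ) / 2 + (5 / 2 - x) = (5 - x + κ) / 2 by ring, Gamma_add_one _ hu1, Gamma_add_one _ hu0,
      norm_mul, norm_mul] at key
    have p2 : 0 < Real.Gamma ((5 - x + κ) / 2) := Real.Gamma_pos_of_pos (by linarith)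
    rw [← le_div_iff₀ p2] at key
    have hG0 : 0 < ‖Gamma u‖ := norm_pos_iff.2 h0
    have hCx := (le_abs_self _).trans (hC x hz)
    have hG1 : 0 < Real.Gamma ((x + κ) / 2) := Real.Gamma_pos_of_pos (by linarith)
    calc ‖gammaRatio κ z‖ = Real.pi ^ (-(x + κ) / 2) * ‖Gamma ((z + κ) / 2)‖ *
          (Real.pi ^ (-(1 - x + κ) / 2) * ‖Gamma u‖)⁻¹ := by
          rw [gammaRatio, norm_mul, norm_inv, hden, norm_Gammaℝ]; simp [hx]
      _ ≤ Real.pi ^ (-(x + κ) / 2) * (‖u + 1‖ * (‖u‖ * ‖Gamma u‖) * Real.Gamma ((x + κ) / 2) /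
            Real.Gamma ((5 - x + κ) / 2)) * (Real.pi ^ (-(1 - x + κ) / 2) * ‖Gamma u‖)⁻¹ := by gcongr
      _ = (Real.pi ^ (-(x + κ) / 2) / Real.pi ^ (-(1 - x + κ) / 2)) *
            (Real.Gamma ((x + κ) / 2) / Real.Gamma ((5 - x + κ) / 2)) * (‖u + 1‖ * ‖u‖) := by
          field_simp
      _ = Real.pi ^ (1 / 2 - x) *
            (Real.Gamma ((x + κ) / 2) / Real.Gamma ((5 - x + κ) / 2)) * (‖u + 1‖ * ‖u‖) := by
          rw [← Real.rpow_sub Real.pi_pos]; congr 3; ring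
      _ ≤ C * (2 * (3 + κ) ^ 2 * (1 + z.im ^ 2)) := by
          refine mul_le_mul hCx ?_ (by positivity) hC0
          have h1 : ‖u + 1‖ ≤ 3 + κ + |z.im| := (norm_add_le _ _).trans (by rw [norm_one]; linarith)
          calc ‖u + 1‖ * ‖u‖ ≤ (3 + κ + |z.im|) * (3 + κ + |z.im|) := by gcongr; linarith
            _ ≤ _ := by
              nlinarith [sq_abs z.im, abs_nonneg z.im, sq_nonneg (3 + κ - |z.im|), mul_nonneg hκ (sq_nonneg z.im),
                mul_nonneg (mul_nonneg hκ hκ) (sq_nonneg z.im)]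
      _ = _ := by ring

end GammaRatio

section DualWeight
open MeasureTheory Set Complex
open scoped FourierTransform

theorem integral_norm_sq_fourier_eq {h : ℝ → ℂ} (hc : Continuous h) (hi : Integrable h)
    (hF : Integrable (𝓕 h)) : ∫ v, ‖𝓕 h v‖ ^ 2 = ∫ v, ‖h v‖ ^ 2 := by
  have h1 : ∫ v, innerSL ℂ (𝓕 h v) (𝓕 h v) = ∫ v, innerSL ℂ (h v) (𝓕⁻ (𝓕 h) v) := by
    have := VectorFourier.integral_sesq_fourierIntegral_eq_neg_flip (innerSL ℂ (E := ℂ))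
      (L := innerₗ ℝ) Real.continuous_fourierChar continuous_inner hi hF
    rwa [flip_innerₗ] at this
  rw [hc.fourierInv_fourier_eq hi hF] at h1
  apply Complex.ofRealLI.injective
  simpa [← LinearIsometry.integral_comp_comm, inner_self_eq_norm_sq_to_K] using h1

theorem integral_norm_sq_fourierInv_eq {h : ℝ → ℂ} (hc : Continuous h) (hi : Integrable h)
    (hF : Integrable (𝓕⁻ h)) : ∫ v, ‖𝓕⁻ h v‖ ^ 2 = ∫ v, ‖h v‖ ^ 2 := by
  have e : (fun v => 𝓕⁻ h (-v)) = 𝓕 h := by ext v; rw [Real.fourierInv_eq_fourier_neg, neg_neg]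
  have hF' : Integrable (𝓕 h) := by rw [← e]; exact hF.comp_neg
  rw [← integral_norm_sq_fourier_eq hc hi hF', ← integral_neg_eq_self]
  simp only [← e]

theorem image_exp_neg : (fun u : ℝ => Real.exp (-u)) '' univ = Ioi 0 := by
  have : (fun u : ℝ => Real.exp (-u)) = Real.exp ∘ Neg.neg := rfl
  rw [this, image_comp, image_univ_of_surjective neg_surjective, image_univ, Real.range_exp]

theorem injOn_exp_neg : InjOn (fun u : ℝ => Real.exp (-u)) univ := fun a _ b _ h => by
  simpa using Real.exp_injective h

theorem hasDerivWithinAt_exp_neg (u : ℝ) (_ : u ∈ univ) :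
    HasDerivWithinAt (fun u : ℝ => Real.exp (-u)) (-Real.exp (-u)) univ u := by
  exact ((hasDerivAt_neg u).exp.congr_deriv (by simp)).hasDerivWithinAt

theorem integrableOn_Ioi_iff_exp_neg {E : Type*} [NormedAddCommGroup E] [NormedSpace ℝ E] {F : ℝ → E} :
    IntegrableOn F (Ioi 0) ↔ Integrable fun u : ℝ => Real.exp (-u) • F (Real.exp (-u)) := by
  rw [← image_exp_neg, integrableOn_image_iff_integrableOn_abs_deriv_smul MeasurableSet.univ
    hasDerivWithinAt_exp_neg injOn_exp_neg]
  simp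

theorem integral_Ioi_eq_exp_neg {E : Type*} [NormedAddCommGroup E] [NormedSpace ℝ E] (F : ℝ → E) :
    ∫ x in Ioi 0, F x = ∫ u : ℝ, Real.exp (-u) • F (Real.exp (-u)) := by
  rw [← image_exp_neg, integral_image_eq_integral_abs_deriv_smul MeasurableSet.univ
    hasDerivWithinAt_exp_neg injOn_exp_neg]
  simp

variable {g : ℝ → ℂ}

/-- The Mellin transform of the weight on the dual side of the summation formula. -/
noncomputable def dualMellin (g : ℝ → ℂ) (κ k : ℕ) (z : ℂ) : ℂ := mellin g (1 - z) * gammaRatio κ z ^ k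

/-- The weight on the dual side of the summation formula. -/
noncomputable def dualWeight (g : ℝ → ℂ) (κ k : ℕ) (y : ℝ) : ℂ := mellinInv (1 / 2 : ℝ) (dualMellin g κ k) y

noncomputable def dualWeightDeriv (g : ℝ → ℂ) (κ k : ℕ) (y : ℝ) : ℂ :=
  -(y : ℂ)⁻¹ * mellinInv (1 / 2 : ℝ) (fun s => dualMellin g κ k s * s) y

variable (hg : ContDiff ℝ ∞ g) (hs : Function.support g ⊆ Icc 1 2) (κ k : ℕ)
include hg hs

theorem stripRapid_dualMellin : StripRapid (1 / 4) 2 (dualMellin g κ k) := by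
  have := (stripRapid_mellin hg hs (1 - 2) (1 - 1 / 4)).one_sub
  simp only [sub_sub_cancel] at this
  exact this.mul ((stripPoly_gammaRatio κ).pow k)

theorem hasDerivAt_dualWeight {y : ℝ} (hy : 0 < y) :
    HasDerivAt (dualWeight g κ k) (dualWeightDeriv g κ k y) y :=
  (stripRapid_dualMellin hg hs κ k).hasDerivAt_mellinInv (by norm_num) hy

theorem continuousOn_dualWeightDeriv : ContinuousOn (dualWeightDeriv g κ k) (Ioi 0) := by
  refine ContinuousOn.mul (ContinuousOn.neg (ContinuousOn.inv₀ continuous_ofReal.continuousOn ?_)) ?_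
  · exact fun y hy => ofReal_ne_zero.2 (ne_of_gt hy)
  · exact fun y hy => (((stripRapid_dualMellin hg hs κ k).mul StripPoly.id).hasDerivAt_mellinInv
      (by norm_num) hy).continuousAt.continuousWithinAt

theorem exists_norm_dualWeight_le : ∃ B : ℝ, 0 ≤ B ∧ ∀ y : ℝ, 0 < y →
    ‖dualWeight g κ k y‖ ≤ B * y ^ (-(1 / 4) : ℝ) ∧ ‖dualWeight g κ k y‖ ≤ B * y ^ (-2 : ℝ) ∧
    ‖dualWeightDeriv g κ k y‖ ≤ B * y ^ (-(5 / 4) : ℝ) ∧ ‖dualWeightDeriv g κ k y‖ ≤ B * y ^ (-3 : ℝ) := by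
  have H := stripRapid_dualMellin hg hs κ k
  have H' := H.mul StripPoly.id
  obtain ⟨C, hC, h⟩ := H.exists_norm_mellinInv_le
  obtain ⟨D, hD, h'⟩ := H'.exists_norm_mellinInv_le
  have m1 : (1 / 2 : ℝ) ∈ Icc (1 / 4 : ℝ) 2 := by norm_num
  have m2 : (1 / 4 : ℝ) ∈ Icc (1 / 4 : ℝ) 2 := by norm_num
  have m3 : (2 : ℝ) ∈ Icc (1 / 4 : ℝ) 2 := by norm_num
  refine ⟨C + D, by positivity, fun y hy => ?_⟩
  have key : ∀ r : ℝ, r ∈ Icc (1 / 4 : ℝ) 2 → ‖dualWeight g κ k y‖ ≤ (C + D) * y ^ (-r) ∧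
      ‖dualWeightDeriv g κ k y‖ ≤ (C + D) * y ^ (-r - 1) := by
    intro r hr
    have p1 : 0 < y ^ (-r) := by positivity
    constructor
    · rw [dualWeight, H.mellinInv_eq m1 hr hy]
      refine (h r hr y hy).trans ?_
      gcongr; linarith
    · rw [dualWeightDeriv, H'.mellinInv_eq m1 hr hy, norm_mul, norm_neg, norm_inv, norm_real,
        Real.norm_of_nonneg hy.le, Real.rpow_sub_one hy.ne']
      calc y⁻¹ * _ ≤ y⁻¹ * (D * y ^ (-r)) := by gcongr; exact h' r hr y hy
        _ = D * (y ^ (-r) / y) := by ring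
        _ ≤ _ := by gcongr; linarith
  have k1 := key _ m2
  have k2 := key _ m3
  norm_num at k1 k2
  norm_num
  exact ⟨k1.1, k2.1, k1.2, k2.2⟩

theorem integral_norm_sq_dualWeight :
    ∫ y in Ioi 0, ‖dualWeight g κ k y‖ ^ 2 = ∫ y in Ioi 0, ‖g y‖ ^ 2 := by
  have H := stripRapid_dualMellin hg hs κ k
  have m1 : (1 / 2 : ℝ) ∈ Icc (1 / 4 : ℝ) 2 := by norm_num
  have hpi : 2 * Real.pi ≠ 0 := by positivity
  -- the Fourier transforms of both sides
  set h : ℝ → ℂ := fun u => dualMellin g κ k (((1 / 2 : ℝ) : ℂ) + 2 * Real.pi * u * I) with hh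
  set G : ℝ → ℂ := fun u => Real.exp (-(1 / 2) * u) • g (Real.exp (-u)) with hG
  have hhe : h = fun u : ℝ => (fun t : ℝ => dualMellin g κ k (((1 / 2 : ℝ) : ℂ) + t * I)) (2 * Real.pi * u) := by
    ext u; simp [hh]
  have hhc : Continuous h := by
    rw [hhe]
    exact (H.continuous_vertical m1).comp (continuous_const.mul continuous_id)
  have hhi : Integrable h := by
    rw [hhe]
    exact (H.verticalIntegrable m1).comp_mul_left' hpi
  have hdw : ∀ v : ℝ, 𝓕⁻ h v = Real.exp (-v / 2) • dualWeight g κ k (Real.exp (-v)) := by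
    intro v
    rw [dualWeight, mellinInv_eq_fourierInv _ _ (Real.exp_pos _), Real.log_exp, neg_neg, ← ofReal_neg,
      ← ofReal_cpow (Real.exp_pos _).le, ← Real.exp_mul, ← hh, smul_eq_mul, real_smul, ← mul_assoc, ← ofReal_mul,
      ← Real.exp_add]
    have : -v / 2 + -v * -(1 / 2) = 0 := by ring
    rw [this]; simp
  obtain ⟨B, hB, hb⟩ := exists_norm_dualWeight_le hg hs κ k
  have hdc : ContinuousOn (dualWeight g κ k) (Ioi 0) := fun y hy =>
    (hasDerivAt_dualWeight hg hs κ k hy).continuousAt.continuousWithinAt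
  have hFi : Integrable (𝓕⁻ h) := by
    have : IntegrableOn (fun y : ℝ => y ^ (-(1 / 2) : ℝ) • dualWeight g κ k y) (Ioi 0) := by
      have hcont : ContinuousOn (fun y : ℝ => y ^ (-(1 / 2) : ℝ) • dualWeight g κ k y) (Ioi 0) :=
        ContinuousOn.smul (fun y hy => (Real.continuousAt_rpow_const _ _ (Or.inl (ne_of_gt hy))).continuousWithinAt)
          hdc
      have hn : ∀ y : ℝ, 0 < y → |‖y ^ (-(1 / 2) : ℝ) • dualWeight g κ k y‖| = y ^ (-(1 / 2) : ℝ) * ‖dualWeight g κ k y‖ :=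
        fun y hy => by
          rw [abs_of_nonneg (norm_nonneg _), norm_smul, Real.norm_of_nonneg (by positivity)]
      refine (integrable_norm_iff (hcont.aestronglyMeasurable measurableSet_Ioi)).1
        (integrableOn_min_rpow (a := -(3 / 4)) (b := -(5 / 2)) (B := B) (by norm_num) (by norm_num)
        (hcont.norm.aestronglyMeasurable measurableSet_Ioi) (fun y hy => ?_) (fun y hy => ?_))
      · rw [hn y hy]
        calc _ ≤ y ^ (-(1 / 2) : ℝ) * (B * y ^ (-(1 / 4) : ℝ)) := by gcongr; exact (hb y hy).1
          _ = B * (y ^ (-(1 / 2) : ℝ) * y ^ (-(1 / 4) : ℝ)) := by ring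
          _ = _ := by rw [← Real.rpow_add hy]; norm_num
      · rw [hn y hy]
        calc _ ≤ y ^ (-(1 / 2) : ℝ) * (B * y ^ (-2 : ℝ)) := by gcongr; exact (hb y hy).2.1
          _ = B * (y ^ (-(1 / 2) : ℝ) * y ^ (-2 : ℝ)) := by ring
          _ = _ := by rw [← Real.rpow_add hy]; norm_num
    rw [integrableOn_Ioi_iff_exp_neg] at this
    refine this.congr (.of_forall fun v => ?_)
    simp only
    rw [hdw, smul_smul, ← Real.exp_mul, ← Real.exp_add]
    congr 2; ring
  have e1 : ∫ y in Ioi 0, ‖dualWeight g κ k y‖ ^ 2 = ∫ v, ‖h v‖ ^ 2 := by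
    rw [← integral_norm_sq_fourierInv_eq hhc hhi hFi, integral_Ioi_eq_exp_neg]
    refine integral_congr_ae (.of_forall fun v => ?_)
    simp only
    rw [hdw, norm_smul, Real.norm_of_nonneg (Real.exp_pos _).le, mul_pow, ← Real.exp_nat_mul, smul_eq_mul]
    congr 2; push_cast; ring
  have hGc : Continuous G := by
    have := hg.continuous
    fun_prop
  have hGi : Integrable G := by
    have := (mellinConvergent_of_support hg.continuous hs ((1 / 2 : ℝ) : ℂ)).1
    rw [MellinConvergent, integrableOn_Ioi_iff_exp_neg] at this
    refine this.congr (.of_forall fun v => ?_)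
    simp only [hG]
    rw [← ofReal_one, ← ofReal_sub, ← ofReal_cpow (Real.exp_pos _).le, ← Real.exp_mul, smul_eq_mul, real_smul,
      real_smul, ← mul_assoc, ← ofReal_mul, ← Real.exp_add]
    congr 3; ring
  have hm : ∀ t : ℝ, mellin g (((1 / 2 : ℝ) : ℂ) + t * I) = 𝓕 G (t / (2 * Real.pi)) := by
    intro t
    rw [mellin_eq_fourier, re_add_ofReal_mul_I, im_add_ofReal_mul_I]
  have hGF : Integrable (𝓕 G) := by
    have := ((stripRapid_mellin hg hs (1 / 4) 2).verticalIntegrable m1).comp_mul_left' hpi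
    refine this.congr (.of_forall fun v => ?_)
    simp only
    rw [hm, mul_div_cancel_left₀ _ hpi]
  have e2 : ∀ v, ‖h v‖ ^ 2 = ‖𝓕 G (-v)‖ ^ 2 := by
    intro v
    rw [hhe]
    simp only [dualMellin]
    rw [norm_mul, norm_pow, norm_gammaRatio_of_re_eq_half κ (by simp), one_pow, mul_one]
    have : (1 : ℂ) - (((1 / 2 : ℝ) : ℂ) + (2 * Real.pi * v : ℝ) * I) =
        ((1 / 2 : ℝ) : ℂ) + (2 * Real.pi * (-v) : ℝ) * I := by push_cast; ring
    rw [this, hm, mul_div_cancel_left₀ _ hpi]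
  rw [e1]
  simp only [e2]
  rw [integral_neg_eq_self (fun v => ‖𝓕 G v‖ ^ 2), integral_norm_sq_fourier_eq hGc hGi hGF, integral_Ioi_eq_exp_neg]
  refine integral_congr_ae (.of_forall fun v => ?_)
  simp only [hG]
  rw [norm_smul, Real.norm_of_nonneg (Real.exp_pos _).le, mul_pow, ← Real.exp_nat_mul, smul_eq_mul]
  congr 2; push_cast; ring

theorem hasDerivAt_norm_sq_dualWeight {y : ℝ} (hy : 0 < y) :
    HasDerivAt (fun y => ‖dualWeight g κ k y‖ ^ 2)
      (2 * inner ℝ (dualWeight g κ k y) (dualWeightDeriv g κ k y)) y :=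
  (hasDerivAt_dualWeight hg hs κ k hy).norm_sq

/-- The weighted sum of `τ_k²` with the squared modulus of the dual weight. -/
theorem exists_abs_tsum_tauSq_dualWeight_sub_le (hk : 2 ≤ k) :
    ∃ C : ℝ, 0 < C ∧ ∀ d : ℕ, d ≠ 0 → ∀ Y : ℝ, 1 ≤ Y →
      |∑' n : ℕ, tauSq k d n * ‖dualWeight g κ k (n / Y)‖ ^ 2 -
          arithConst k d * (Y * Real.log Y ^ (k ^ 2 - 1) / (k ^ 2 - 1)!) * ∫ y in Ioi 0, ‖g y‖ ^ 2| ≤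
        C * (4 + Real.log d) ^ (1 / 2 : ℝ) * arithConst k d * (Y * (1 + Real.log Y) ^ (k ^ 2 - 2)) := by
  obtain ⟨B, hB, hb⟩ := exists_norm_dualWeight_le hg hs κ k
  rw [← integral_norm_sq_dualWeight hg hs κ k]
  have hdc : ContinuousOn (dualWeight g κ k) (Ioi 0) := fun y hy =>
    (hasDerivAt_dualWeight hg hs κ k hy).continuousAt.continuousWithinAt
  have b1 : ∀ (e : ℝ) (y : ℝ), 0 < y → ‖dualWeight g κ k y‖ ≤ B * y ^ e →
      |‖dualWeight g κ k y‖ ^ 2| ≤ 2 * B ^ 2 * y ^ (2 * e) := by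
    intro e y hy h
    rw [abs_of_nonneg (by positivity), two_mul e, Real.rpow_add hy]
    calc ‖dualWeight g κ k y‖ ^ 2 ≤ (B * y ^ e) ^ 2 := by gcongr
      _ ≤ _ := by nlinarith [sq_nonneg (B * y ^ e)]
  have b2 : ∀ (e e' : ℝ) (y : ℝ), 0 < y → ‖dualWeight g κ k y‖ ≤ B * y ^ e →
      ‖dualWeightDeriv g κ k y‖ ≤ B * y ^ e' →
      |2 * inner ℝ (dualWeight g κ k y) (dualWeightDeriv g κ k y)| ≤ 2 * B ^ 2 * y ^ (e + e') := by
    intro e e' y hy h h'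
    rw [abs_mul, abs_two, Real.rpow_add hy]
    calc _ ≤ 2 * (‖dualWeight g κ k y‖ * ‖dualWeightDeriv g κ k y‖) := by
          gcongr; exact abs_real_inner_le_norm _ _
      _ ≤ 2 * ((B * y ^ e) * (B * y ^ e')) := by gcongr
      _ = _ := by ring
  refine exists_abs_tsum_tauSq_sub_le (B := 2 * B ^ 2) hk (fun y hy => hasDerivAt_norm_sq_dualWeight hg hs κ k hy)
    (continuousOn_const.mul (hdc.inner (continuousOn_dualWeightDeriv hg hs κ k))) ?_ ?_ ?_ ?_
  · intro y hy
    have := b1 _ y hy (hb y hy).1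
    norm_num at this ⊢; exact this
  · intro y hy
    have := b1 _ y hy (hb y hy).2.1
    norm_num at this ⊢; exact this
  · intro y hy
    have := b2 _ _ y hy (hb y hy).1 (hb y hy).2.2.1
    norm_num at this ⊢; exact this
  · intro y hy
    have := b2 _ _ y hy (hb y hy).2.1 (hb y hy).2.2.2
    norm_num at this ⊢; exact this

end DualWeight

section GaussSum
open Complex

variable {N : ℕ} [NeZero N]

theorem norm_gaussSum_eq_sqrt {χ : DirichletCharacter ℂ N} (hχ : χ.IsPrimitive) :
    ‖gaussSum χ (ZMod.stdAddChar (N := N))‖ = Real.sqrt N := by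
  set e := ZMod.stdAddChar (N := N)
  have hχ' : χ⁻¹.IsPrimitive := by
    rw [DirichletCharacter.isPrimitive_def, DirichletCharacter.conductor_inv]; exact hχ
  have h1 : ZMod.dft (ZMod.dft (χ : ZMod N → ℂ)) (-1) = N := by
    rw [ZMod.dft_dft]; simp
  have h2 : ZMod.dft (χ : ZMod N → ℂ) = fun j => (χ⁻¹ (-1) * gaussSum χ e) * χ⁻¹ j := by
    ext j
    rw [hχ.fourierTransform_eq_inv_mul_gaussSum, ← neg_one_mul j, map_mul, mul_right_comm]
  rw [h2, ZMod.dft_const_mul] at h1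
  beta_reduce at h1
  rw [hχ'.fourierTransform_eq_inv_mul_gaussSum] at h1
  have h3 : star (gaussSum χ e) = χ⁻¹ (-1) * gaussSum χ⁻¹ e := by
    have h := gaussSum_mulShift_eq χ⁻¹ e (-1)
    rw [Units.val_neg, Units.val_one, ← AddChar.inv_mulShift, inv_inv] at h
    rw [star_gaussSum_eq, h, MulChar.inv_apply_eq_inv']
    rcases χ.even_or_odd with h | h <;> rw [h] <;> norm_num
  have h4 : (gaussSum χ e * star (gaussSum χ e) : ℂ) = N := by
    rw [h3, ← h1]; simp; ring
  rw [Complex.star_def, Complex.mul_conj, Complex.normSq_eq_norm_sq] at h4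
  have h5 : ‖gaussSum χ e‖ ^ 2 = N := by exact_mod_cast h4
  rw [← h5, Real.sqrt_sq (norm_nonneg _)]

theorem norm_rootNumber_eq_one {χ : DirichletCharacter ℂ N} (hχ : χ.IsPrimitive) :
    ‖χ.rootNumber‖ = 1 := by
  have hN : (0 : ℝ) < N := by exact_mod_cast (NeZero.pos N)
  rw [DirichletCharacter.rootNumber, norm_div, norm_div, norm_pow, norm_I, one_pow, div_one,
    norm_gaussSum_eq_sqrt hχ, ← ofReal_natCast, norm_cpow_eq_rpow_re_of_pos hN, Real.sqrt_eq_rpow]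
  norm_num
  exact NeZero.ne N

end GaussSum

section LFunctionGrowth
open MeasureTheory Set Complex

variable {N : ℕ} [NeZero N] {χ : DirichletCharacter ℂ N}

theorem norm_sum_range_dirichletCharacter_le (hχ : χ ≠ 1) (n : ℕ) :
    ‖∑ i ∈ Finset.range n, χ (i : ZMod N)‖ ≤ N := by
  have hfull : ∑ i ∈ Finset.range N, χ (i : ZMod N) = 0 := by
    rw [← MulChar.sum_eq_zero_of_ne_one hχ]
    refine Finset.sum_bij' (fun i _ => (i : ZMod N)) (fun a _ => a.val) (fun _ _ => Finset.mem_univ _)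
      (fun a _ => Finset.mem_range.2 (ZMod.val_lt a)) (fun i hi => ZMod.val_cast_of_lt (Finset.mem_range.1 hi))
      (fun a _ => ZMod.natCast_zmod_val a) (fun _ _ => rfl)
  have hper : Function.Periodic (fun n : ℕ => ∑ i ∈ Finset.range n, χ (i : ZMod N)) N := by
    intro n
    simp only
    rw [add_comm n N, Finset.sum_range_add, hfull, zero_add]
    simp
  have h1 : ∑ i ∈ Finset.range n, χ (i : ZMod N) = ∑ i ∈ Finset.range (n % N), χ (i : ZMod N) :=
    (hper.map_mod_nat n).symm
  rw [h1]
  calc _ ≤ ∑ i ∈ Finset.range (n % N), ‖χ (i : ZMod N)‖ := norm_sum_le _ _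
    _ ≤ ∑ i ∈ Finset.range (n % N), 1 := Finset.sum_le_sum fun i _ => χ.norm_le_one _
    _ = ((n % N : ℕ) : ℝ) := by simp
    _ ≤ N := by exact_mod_cast (Nat.mod_lt _ (NeZero.pos N)).le

theorem norm_sum_Icc_dirichletCharacter_le (hχ : χ ≠ 1) (n : ℕ) :
    ‖∑ i ∈ Finset.Icc 1 n, χ (i : ZMod N)‖ ≤ N := by
  have h : ∑ i ∈ Finset.Icc 1 n, χ (i : ZMod N) = ∑ i ∈ Finset.range (n + 1), χ (i : ZMod N) := by
    have hN : N ≠ 1 := fun h => hχ (DirichletCharacter.level_one' χ h)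
    rw [Finset.range_eq_Ico, Finset.sum_eq_sum_Ico_succ_bot (by omega), Nat.cast_zero, χ.map_zero' hN, zero_add]
    rfl
  rw [h]
  exact norm_sum_range_dirichletCharacter_le hχ _

/-- The partial sums of the values of `χ`, as a function on the positive reals cut off at `1`. -/
noncomputable def charSum {N : ℕ} (χ : DirichletCharacter ℂ N) (t : ℝ) : ℂ :=
  (Ioi 1).indicator (fun t : ℝ => ∑ i ∈ Finset.Icc 1 ⌊t⌋₊, χ (i : ZMod N)) t

theorem norm_charSum_le (hχ : χ ≠ 1) (t : ℝ) : ‖charSum χ t‖ ≤ N := by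
  by_cases h : t ∈ Ioi (1 : ℝ)
  · rw [charSum, indicator_of_mem h]; exact norm_sum_Icc_dirichletCharacter_le hχ _
  · rw [charSum, indicator_of_notMem h, norm_zero]; positivity

theorem measurable_charSum {N : ℕ} {χ : DirichletCharacter ℂ N} : Measurable (charSum χ) := by
  refine Measurable.indicator ?_ measurableSet_Ioi
  exact (measurable_from_nat (f := fun n => ∑ i ∈ Finset.Icc 1 n, χ (i : ZMod N))).comp Nat.measurable_floor

theorem differentiableAt_mellin_charSum (hχ : χ ≠ 1) {s : ℂ} (hs : s.re < 0) :
    DifferentiableAt ℂ (mellin (charSum χ)) s := by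
  refine mellin_differentiableAt_of_isBigO_rpow (a := 0) (b := s.re - 1) ?_ ?_ hs ?_ (by linarith)
  · refine LocallyIntegrable.locallyIntegrableOn ?_ _
    refine (locallyIntegrable_const (N : ℝ)).mono measurable_charSum.aestronglyMeasurable (.of_forall fun t => ?_)
    simpa using norm_charSum_le hχ t
  · simp only [neg_zero, Real.rpow_zero]
    exact Asymptotics.IsBigO.of_bound N (.of_forall fun t => by simpa using norm_charSum_le hχ t)
  · refine (EventuallyEq.isBigO (f₂ := fun _ => (0 : ℂ)) ?_).trans (Asymptotics.isBigO_zero _ _)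
    filter_upwards [nhdsWithin_le_nhds (eventually_lt_nhds one_pos)] with x hx
    rw [charSum, indicator_of_notMem (by simpa using hx.le)]

theorem mellin_charSum {N : ℕ} {χ : DirichletCharacter ℂ N} (s : ℂ) :
    mellin (charSum χ) (-s) = ∫ t in Ioi (1 : ℝ), (∑ i ∈ Finset.Icc 1 ⌊t⌋₊, χ (i : ZMod N)) * (t : ℂ) ^ (-(s + 1)) := by
  rw [mellin]
  have h : ∀ t : ℝ, (t : ℂ) ^ (-s - 1) • charSum χ t =
      (Ioi 1).indicator (fun t : ℝ => (∑ i ∈ Finset.Icc 1 ⌊t⌋₊, χ (i : ZMod N)) * (t : ℂ) ^ (-(s + 1))) t := by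
    intro t
    by_cases ht : t ∈ Ioi (1 : ℝ)
    · rw [charSum, indicator_of_mem ht, indicator_of_mem ht, smul_eq_mul, mul_comm, neg_add, sub_eq_add_neg]
    · rw [charSum, indicator_of_notMem ht, indicator_of_notMem ht, smul_zero]
  simp only [h]
  rw [setIntegral_indicator measurableSet_Ioi, inter_eq_right.2 (Ioi_subset_Ioi zero_le_one)]

theorem LFunction_eq_mul_mellin (hχ : χ ≠ 1) {s : ℂ} (hs : 0 < s.re) :
    χ.LFunction s = s * mellin (charSum χ) (-s) := by
  have hopen : IsOpen {s : ℂ | 0 < s.re} := isOpen_lt continuous_const continuous_re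
  have hd1 : DifferentiableOn ℂ χ.LFunction {s : ℂ | 0 < s.re} :=
    (DirichletCharacter.differentiable_LFunction hχ).differentiableOn
  have hd2 : DifferentiableOn ℂ (fun s => s * mellin (charSum χ) (-s)) {s : ℂ | 0 < s.re} := fun s hs => by
    refine (DifferentiableAt.mul differentiableAt_id ?_).differentiableWithinAt
    have hs' : (-s).re < 0 := by simpa using hs
    exact (differentiableAt_mellin_charSum hχ hs').comp s differentiableAt_id.neg
  refine (hd1.analyticOnNhd hopen).eqOn_of_preconnected_of_eventuallyEq (hd2.analyticOnNhd hopen)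
    (convex_halfSpace_re_gt 0).isPreconnected (z₀ := 2) (by simp) ?_ hs
  have hnhds : {s : ℂ | 1 < s.re} ∈ 𝓝 (2 : ℂ) :=
    (isOpen_lt continuous_const continuous_re).mem_nhds (by simp)
  filter_upwards [hnhds] with z hz
  have hz' : 1 < z.re := hz
  rw [DirichletCharacter.LFunction_eq_LSeries χ hz', mellin_charSum,
    LSeries_eq_mul_integral (fun n : ℕ => χ (n : ZMod N)) (r := 0) le_rfl (by linarith)
      (DirichletCharacter.LSeriesSummable_of_one_lt_re χ hz')]
  simp only [Real.rpow_zero]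
  exact Asymptotics.IsBigO.of_bound N (.of_forall fun n => by
    simpa using norm_sum_Icc_dirichletCharacter_le hχ n)

theorem stripPoly_LFunction (hχ : χ ≠ 1) : StripPoly (1 / 2) 2 χ.LFunction := by
  refine ⟨(DirichletCharacter.differentiable_LFunction hχ).differentiableOn, ?_⟩
  obtain ⟨M, C, h⟩ := (StripPoly.id (a := 1 / 2) (b := 2)).growth
  refine ⟨M, C * (2 * N), fun s hs => ?_⟩
  have hs1 := hs.1
  rw [LFunction_eq_mul_mellin hχ (by linarith), norm_mul, mellin_charSum]
  have hint : IntegrableOn (fun t : ℝ => (N : ℝ) * t ^ (-(3 / 2) : ℝ)) (Ioi 1) :=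
    (integrableOn_Ioi_rpow_of_lt (by norm_num) one_pos).const_mul _
  have hb : ‖∫ t in Ioi (1 : ℝ), (∑ i ∈ Finset.Icc 1 ⌊t⌋₊, χ (i : ZMod N)) * (t : ℂ) ^ (-(s + 1))‖ ≤ 2 * N := by
    calc _ ≤ ∫ t in Ioi (1 : ℝ), (N : ℝ) * t ^ (-(3 / 2) : ℝ) := by
          refine norm_integral_le_of_norm_le hint ?_
          filter_upwards [ae_restrict_mem measurableSet_Ioi] with t ht
          have ht' : (1 : ℝ) < t := ht
          rw [norm_mul, norm_cpow_eq_rpow_re_of_pos (by linarith)]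
          gcongr
          · exact norm_sum_Icc_dirichletCharacter_le hχ _
          · exact ht'.le
          · simp; linarith
      _ = 2 * N := by
          rw [integral_const_mul, integral_Ioi_rpow_of_lt (by norm_num) one_pos]
          norm_num; ring
  calc _ ≤ C * (1 + s.im ^ 2) ^ M * (2 * N) := by
        gcongr
        · exact (norm_nonneg _).trans (h s hs)
        · exact h s hs
    _ = _ := by ring

end LFunctionGrowth

section Twist
open ArithmeticFunction Complex

variable {N : ℕ} (χ : DirichletCharacter ℂ N)

/-- The twist of an arithmetic function by a Dirichlet character. -/
noncomputable def twist (f : ArithmeticFunction ℝ) : ArithmeticFunction ℂ :=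
  ⟨fun n => χ (n : ZMod N) * (f n : ℂ), by simp⟩

theorem twist_apply (f : ArithmeticFunction ℝ) (n : ℕ) : twist χ f n = χ (n : ZMod N) * (f n : ℂ) := rfl

theorem twist_mul (f g : ArithmeticFunction ℝ) : twist χ (f * g) = twist χ f * twist χ g := by
  ext n
  simp only [twist_apply, ArithmeticFunction.mul_apply, ofReal_sum, Finset.mul_sum, ofReal_mul]
  refine Finset.sum_congr rfl fun x hx => ?_
  rw [← (Nat.mem_divisorsAntidiagonal.1 hx).1]
  push_cast
  rw [map_mul]
  ring

theorem twist_one : twist χ 1 = 1 := by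
  ext n
  rw [twist_apply, ArithmeticFunction.one_apply, ArithmeticFunction.one_apply]
  split_ifs with h <;> simp [h]

theorem twist_pow (f : ArithmeticFunction ℝ) (k : ℕ) : twist χ (f ^ k) = twist χ f ^ k := by
  induction k with
  | zero => simp [twist_one]
  | succ k ih => rw [pow_succ, pow_succ, twist_mul, ih]

theorem twist_prod {ι : Type*} (t : Finset ι) (f : ι → ArithmeticFunction ℝ) :
    twist χ (∏ i ∈ t, f i) = ∏ i ∈ t, twist χ (f i) := by
  classical
  induction t using Finset.induction_on with
  | empty => simp [twist_one]
  | insert i t hi ih => rw [Finset.prod_insert hi, Finset.prod_insert hi, twist_mul, ih]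

theorem norm_twist_le (f : ArithmeticFunction ℝ) (n : ℕ) : ‖twist χ f n‖ ≤ |f n| := by
  rw [twist_apply, norm_mul, norm_real, Real.norm_eq_abs]
  exact mul_le_of_le_one_left (abs_nonneg _) (χ.norm_le_one _)

theorem LSeries_arith_one (s : ℂ) : LSeries (fun n => (1 : ArithmeticFunction ℂ) n) s = 1 ∧
    LSeriesSummable (fun n => (1 : ArithmeticFunction ℂ) n) s := by
  have h : HasSum (LSeries.term (fun n => (1 : ArithmeticFunction ℂ) n) s) 1 := by
    have : HasSum (LSeries.term (fun n => (1 : ArithmeticFunction ℂ) n) s)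
      (LSeries.term (fun n => (1 : ArithmeticFunction ℂ) n) s 1) := hasSum_single 1 fun n hn => by
        rcases Nat.eq_zero_or_pos n with rfl | h0
        · simp
        · rw [LSeries.term_of_ne_zero h0.ne', ArithmeticFunction.one_apply_ne hn, zero_div]
    simpa using this
  exact ⟨h.tsum_eq, h.summable⟩

theorem LSeries_arith_prod {ι : Type*} (t : Finset ι) (f : ι → ArithmeticFunction ℂ) {s : ℂ}
    (h : ∀ i ∈ t, LSeriesSummable (fun n => f i n) s) :
    LSeries (fun n => (∏ i ∈ t, f i) n) s = ∏ i ∈ t, LSeries (fun n => f i n) s ∧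
    LSeriesSummable (fun n => (∏ i ∈ t, f i) n) s := by
  classical
  induction t using Finset.induction_on with
  | empty => simpa using LSeries_arith_one s
  | insert i t hi ih =>
    obtain ⟨h1, h2⟩ := ih fun j hj => h j (Finset.mem_insert_of_mem hj)
    have h3 := h i (Finset.mem_insert_self _ _)
    rw [Finset.prod_insert hi, Finset.prod_insert hi]
    exact ⟨by rw [LSeries_mul' h3 h2, h1], LSeriesSummable_mul h3 h2⟩

theorem LSeries_arith_pow (f : ArithmeticFunction ℂ) (k : ℕ) {s : ℂ} (h : LSeriesSummable (fun n => f n) s) :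
    LSeries (fun n => (f ^ k) n) s = LSeries (fun n => f n) s ^ k ∧
    LSeriesSummable (fun n => (f ^ k) n) s := by
  simpa using LSeries_arith_prod (Finset.range k) (fun _ => f) (s := s) fun _ _ => h

theorem LSeries_twist_zeta [NeZero N] {s : ℂ} (hs : 1 < s.re) :
    LSeries (fun n => twist χ ((zeta : ArithmeticFunction ℕ) : ArithmeticFunction ℝ) n) s = χ.LFunction s ∧
    LSeriesSummable (fun n => twist χ ((zeta : ArithmeticFunction ℕ) : ArithmeticFunction ℝ) n) s := by
  have h : ∀ {n : ℕ}, n ≠ 0 → twist χ ((zeta : ArithmeticFunction ℕ) : ArithmeticFunction ℝ) n = χ (n : ZMod N) := by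
    intro n hn
    simp [twist_apply, natCoe_apply, zeta_apply, hn]
  rw [LSeries_congr h, LSeriesSummable_congr s h, DirichletCharacter.LFunction_eq_LSeries χ hs]
  exact ⟨rfl, DirichletCharacter.LSeriesSummable_of_one_lt_re χ hs⟩

theorem LSeries_twist_divK [NeZero N] (k : ℕ) {s : ℂ} (hs : 1 < s.re) :
    LSeries (fun n => twist χ (divK k) n) s = χ.LFunction s ^ k ∧
    LSeriesSummable (fun n => twist χ (divK k) n) s := by
  obtain ⟨h1, h2⟩ := LSeries_twist_zeta χ hs
  rw [divK, twist_pow, ← h1]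
  exact LSeries_arith_pow _ k h2

theorem arith_sub_apply (f g : ArithmeticFunction ℝ) (n : ℕ) : (f - g) n = f n - g n := by
  have h : f = (f - g) + g := (sub_add_cancel f g).symm
  conv_rhs => rw [h, ArithmeticFunction.add_apply]
  ring

/-- The indicator function of `{p}` as an arithmetic function. -/
noncomputable def arithSingle (p : ℕ) : ArithmeticFunction ℝ :=
  ⟨fun n => if n = p ∧ n ≠ 0 then 1 else 0, by simp⟩

theorem arithSingle_apply (p n : ℕ) : arithSingle p n = if n = p ∧ n ≠ 0 then 1 else 0 := rfl

theorem arithSingle_mul_apply {p : ℕ} (hp : p ≠ 0) (g : ArithmeticFunction ℝ) (n : ℕ) :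
    (arithSingle p * g) n = if p ∣ n then g (n / p) else 0 := by
  rcases Nat.eq_zero_or_pos n with rfl | hn
  · simp
  rw [ArithmeticFunction.mul_apply]
  split_ifs with h
  · rw [Finset.sum_eq_single (p, n / p)]
    · simp [arithSingle_apply, hp]
    · rintro ⟨a, b⟩ hx hne
      have hab := (Nat.mem_divisorsAntidiagonal.1 hx).1
      rw [arithSingle_apply, if_neg, zero_mul]
      rintro ⟨h1, -⟩
      simp only at hab h1
      refine hne (Prod.ext h1 ?_)
      simp only
      rw [← hab, h1, Nat.mul_div_cancel_left _ (Nat.pos_of_ne_zero hp)]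
    · intro h'
      exact absurd (Nat.mem_divisorsAntidiagonal.2 ⟨Nat.mul_div_cancel' h, hn.ne'⟩) h'
  · refine Finset.sum_eq_zero fun x hx => ?_
    have hab := (Nat.mem_divisorsAntidiagonal.1 hx).1
    rw [arithSingle_apply, if_neg, zero_mul]
    rintro ⟨h1, -⟩
    exact h ⟨x.2, by rw [← hab, h1]⟩

/-- The arithmetic function `1 ↦ -1/p`, `p ↦ 1`. -/
noncomputable def dualPrime (p : ℕ) : ArithmeticFunction ℝ := arithSingle p - (p : ℝ)⁻¹ • 1

theorem dualPrime_mul_apply {p : ℕ} (hp : p ≠ 0) (g : ArithmeticFunction ℝ) (n : ℕ) :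
    (dualPrime p * g) n = (if p ∣ n then g (n / p) else 0) - (p : ℝ)⁻¹ * g n := by
  rw [dualPrime, sub_mul, smul_mul_assoc, one_mul, arith_sub_apply, arithSingle_mul_apply hp,
    ArithmeticFunction.smul_map, smul_eq_mul]

theorem LSeries_twist_dualPrime {p : ℕ} (hp : p.Prime) (s : ℂ) :
    LSeries (fun n => twist χ (dualPrime p) n) s = -(p : ℂ)⁻¹ + χ (p : ZMod N) * (p : ℂ) ^ (-s) ∧
    LSeriesSummable (fun n => twist χ (dualPrime p) n) s := by
  have hv : ∀ n, dualPrime p n = (if n = p ∧ n ≠ 0 then 1 else 0) - (p : ℝ)⁻¹ * if n = 1 then 1 else 0 := fun n => by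
    rw [dualPrime, arith_sub_apply, ArithmeticFunction.smul_map, arithSingle_apply, one_apply,
      smul_eq_mul]
  have h : HasSum (LSeries.term (fun n => twist χ (dualPrime p) n) s)
      (∑ n ∈ {1, p}, LSeries.term (fun n => twist χ (dualPrime p) n) s n) := by
    refine hasSum_sum_of_ne_finset_zero fun n hn => ?_
    simp only [Finset.mem_insert, Finset.mem_singleton, not_or] at hn
    rcases Nat.eq_zero_or_pos n with rfl | h0
    · simp
    · rw [LSeries.term_of_ne_zero h0.ne', twist_apply, hv]
      simp [hn.1, hn.2]
  rw [Finset.sum_pair hp.one_lt.ne, LSeries.term_of_ne_zero one_ne_zero, LSeries.term_of_ne_zero hp.ne_zero,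
    twist_apply, twist_apply, hv, hv] at h
  have e : χ ((1 : ℕ) : ZMod N) * (((if 1 = p ∧ 1 ≠ 0 then 1 else 0) - (p : ℝ)⁻¹ * if 1 = 1 then 1 else 0 : ℝ) : ℂ) /
      ((1 : ℕ) : ℂ) ^ s + χ (p : ZMod N) * (((if p = p ∧ p ≠ 0 then 1 else 0) - (p : ℝ)⁻¹ * if p = 1 then 1 else 0 : ℝ) : ℂ) /
      (p : ℂ) ^ s = -(p : ℂ)⁻¹ + χ (p : ZMod N) * (p : ℂ) ^ (-s) := by
    rw [cpow_neg, if_neg (fun h => hp.one_lt.ne h.1), if_pos rfl, if_pos ⟨rfl, hp.ne_zero⟩, if_neg hp.one_lt.ne']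
    simp [div_eq_mul_inv]
  rw [e] at h
  exact ⟨h.tsum_eq, h.summable⟩

/-- The coefficients on the dual side of the summation formula. -/
noncomputable def dualCoeff (P : Finset ℕ) (k : ℕ) : ArithmeticFunction ℝ := (∏ p ∈ P, dualPrime p) ^ k * divK k

theorem prod_dualPrime_aux {P : Finset ℕ} (hP : ∀ p ∈ P, p.Prime) (n : ℕ) :
    |(∏ p ∈ P, dualPrime p) n| ≤ 1 ∧ ((∏ p ∈ P, dualPrime p) n ≠ 0 → ∀ r : ℕ, r.Prime → r ∣ n → r ∈ P) := by
  induction P using Finset.induction_on generalizing n with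
  | empty =>
    rw [Finset.prod_empty, one_apply]
    split_ifs with h
    · subst h
      exact ⟨by simp, fun _ r hr h1 => absurd (Nat.dvd_one.1 h1) hr.ne_one⟩
    · simp
  | insert p P hp ih =>
    have hpp := hP p (Finset.mem_insert_self _ _)
    have ih' := fun m => ih (fun r hr => hP r (Finset.mem_insert_of_mem hr)) m
    rw [Finset.prod_insert hp, dualPrime_mul_apply hpp.ne_zero]
    have hp1 : (p : ℝ)⁻¹ ≤ 1 := inv_le_one_of_one_le₀ (by exact_mod_cast hpp.one_lt.le)
    have hp0 : 0 ≤ (p : ℝ)⁻¹ := by positivity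
    by_cases h : p ∣ n
    · have h0 : (∏ p ∈ P, dualPrime p) n = 0 := by
        by_contra hne
        exact hp ((ih' n).2 hne p hpp h)
      rw [if_pos h, h0, mul_zero, sub_zero]
      refine ⟨(ih' _).1, fun hne r hr hrn => ?_⟩
      obtain ⟨m, rfl⟩ := h
      rw [Nat.mul_div_cancel_left _ hpp.pos] at hne
      rcases (hr.dvd_mul).1 hrn with h1 | h1
      · rw [(Nat.prime_dvd_prime_iff_eq hr hpp).1 h1]; exact Finset.mem_insert_self _ _
      · exact Finset.mem_insert_of_mem ((ih' m).2 hne r hr h1)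
    · rw [if_neg h, zero_sub, abs_neg, abs_mul, abs_of_nonneg hp0]
      refine ⟨mul_le_one₀ hp1 (abs_nonneg _) (ih' n).1, fun hne r hr hrn => ?_⟩
      refine Finset.mem_insert_of_mem ((ih' n).2 (fun h1 => hne ?_) r hr hrn)
      rw [h1]; simp

theorem abs_dualCoeff_le {P : Finset ℕ} (hP : ∀ p ∈ P, p.Prime) (k n : ℕ) : |dualCoeff P k n| ≤ divK (2 * k) n := by
  have h1 : ∀ n, |(∏ p ∈ P, dualPrime p) n| ≤ ((zeta : ArithmeticFunction ℕ) : ArithmeticFunction ℝ) n := by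
    intro n
    rcases Nat.eq_zero_or_pos n with rfl | hn
    · simp
    · simpa [natCoe_apply, zeta_apply, hn.ne'] using (prod_dualPrime_aux hP n).1
  have h2 := abs_mul_arith_le (abs_pow_arith_le h1 k) (fun n => (abs_of_nonneg (divK_nonneg k n)).le) n
  rwa [two_mul, divK_add]

theorem LSeries_twist_dualCoeff [NeZero N] {P : Finset ℕ} (hP : ∀ p ∈ P, p.Prime) (k : ℕ) {s : ℂ} (hs : 1 < s.re) :
    LSeries (fun n => twist χ (dualCoeff P k) n) s =
      (χ.LFunction s * ∏ p ∈ P, (-(p : ℂ)⁻¹ + χ (p : ZMod N) * (p : ℂ) ^ (-s))) ^ k ∧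
    LSeriesSummable (fun n => twist χ (dualCoeff P k) n) s := by
  obtain ⟨h1, h2⟩ := LSeries_twist_divK χ k hs
  obtain ⟨h3, h4⟩ := LSeries_arith_prod P (fun p => twist χ (dualPrime p)) (s := s)
    fun p hp => (LSeries_twist_dualPrime χ (hP p hp) s).2
  obtain ⟨h5, h6⟩ := LSeries_arith_pow _ k h4
  rw [dualCoeff, twist_mul, twist_pow, twist_prod]
  refine ⟨?_, LSeriesSummable_mul h6 h2⟩
  rw [LSeries_mul' h6 h2, h5, h3, h1, mul_pow, mul_comm]
  congr 2
  exact Finset.prod_congr rfl fun p hp => (LSeries_twist_dualPrime χ (hP p hp) s).1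

end Twist

section DualFormula
open MeasureTheory Set Complex ArithmeticFunction

open Classical in
/-- The parity of a Dirichlet character: `0` if even, `1` if odd. -/
noncomputable def charParity {N : ℕ} (χ : DirichletCharacter ℂ N) : ℕ := if χ.Even then 0 else 1

theorem gammaFactor_eq_Gammaℝ {N : ℕ} (χ : DirichletCharacter ℂ N) (s : ℂ) :
    χ.gammaFactor s = Gammaℝ (s + charParity χ) := by
  rcases χ.even_or_odd with h | h
  · simp [h.gammaFactor_def, charParity, h]
  · simp [h.gammaFactor_def, charParity, h.not_even]

theorem charParity_inv {N : ℕ} (χ : DirichletCharacter ℂ N) : charParity χ⁻¹ = charParity χ := by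
  have : χ⁻¹.Even ↔ χ.Even := by
    rw [DirichletCharacter.Even, DirichletCharacter.Even, MulChar.inv_apply_eq_inv', inv_eq_one]
  unfold charParity
  split_ifs <;> simp_all

/-- The functional equation of a primitive Dirichlet L-function in asymmetric form. -/
theorem LFunction_one_sub_eq {q : ℕ} [NeZero q] (hq : q ≠ 1) {ψ : DirichletCharacter ℂ q} (hψ : ψ.IsPrimitive)
    {z : ℂ} (hz : 0 < z.re) :
    ψ.LFunction (1 - z) = ψ.rootNumber * (q : ℂ) ^ (z - 1 / 2) * gammaRatio (charParity ψ) z * ψ⁻¹.LFunction z := by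
  rw [DirichletCharacter.LFunction_eq_completed_div_gammaFactor ψ _ (Or.inr hq), hψ.completedLFunction_one_sub,
    DirichletCharacter.LFunction_eq_completed_div_gammaFactor ψ⁻¹ _ (Or.inr hq), gammaFactor_eq_Gammaℝ,
    gammaFactor_eq_Gammaℝ, charParity_inv, gammaRatio]
  have : Gammaℝ (z + charParity ψ) ≠ 0 := Gammaℝ_ne_zero_of_re_pos (by
    rw [add_re, natCast_re]; positivity)
  field_simp

theorem euler_factor_dual {q p : ℕ} (ψ : DirichletCharacter ℂ q) (hp : p.Prime) (hpq : p.Coprime q) (z : ℂ) :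
    1 - ψ (p : ZMod q) * (p : ℂ) ^ (-(1 - z)) =
      ψ (p : ZMod q) * (p : ℂ) ^ z * (-(p : ℂ)⁻¹ + ψ⁻¹ (p : ZMod q) * (p : ℂ) ^ (-z)) := by
  have hp0 : (p : ℂ) ≠ 0 := by exact_mod_cast hp.ne_zero
  have h1 : ψ (p : ZMod q) * ψ⁻¹ (p : ZMod q) = 1 := by
    have hu : IsUnit (p : ZMod q) := (ZMod.isUnit_iff_coprime p q).2 hpq
    rw [← MulChar.mul_apply, mul_inv_cancel, MulChar.one_apply hu]
  have h2 : (p : ℂ) ^ z * (p : ℂ) ^ (-z) = 1 := by rw [← cpow_add _ _ hp0, add_neg_cancel, cpow_zero]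
  have h3 : (p : ℂ) ^ (-(1 - z)) = (p : ℂ) ^ z * (p : ℂ)⁻¹ := by
    rw [neg_sub, cpow_sub _ _ hp0, cpow_one, div_eq_mul_inv]
  rw [h3]
  linear_combination (-(ψ (p : ZMod q) * ψ⁻¹ (p : ZMod q))) * h2 - h1

theorem prod_euler_factor_dual {q d : ℕ} (hd : d ≠ 0) (hqd : q ∣ d) (ψ : DirichletCharacter ℂ q) (z : ℂ) :
    ∏ p ∈ d.primeFactors, (1 - ψ (p : ZMod q) * (p : ℂ) ^ (-(1 - z))) =
      (∏ p ∈ d.primeFactors \ q.primeFactors, ψ (p : ZMod q)) *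
      ((∏ p ∈ d.primeFactors \ q.primeFactors, p : ℕ) : ℂ) ^ z *
      ∏ p ∈ d.primeFactors \ q.primeFactors, (-(p : ℂ)⁻¹ + ψ⁻¹ (p : ZMod q) * (p : ℂ) ^ (-z)) := by
  have hq : q ≠ 0 := ne_zero_of_dvd_ne_zero hd hqd
  have hsub : q.primeFactors ⊆ d.primeFactors := Nat.primeFactors_mono hqd hd
  rw [← Finset.prod_sdiff hsub]
  have h1 : ∏ p ∈ q.primeFactors, (1 - ψ (p : ZMod q) * (p : ℂ) ^ (-(1 - z))) = 1 := by
    refine Finset.prod_eq_one fun p hp => ?_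
    have : ψ (p : ZMod q) = 0 := by
      refine MulChar.map_nonunit _ fun hu => ?_
      have := (ZMod.isUnit_iff_coprime p q).1 hu
      exact (Nat.prime_of_mem_primeFactors hp).ne_one (Nat.Coprime.eq_one_of_dvd this (Nat.dvd_of_mem_primeFactors hp))
    rw [this, zero_mul, sub_zero]
  have h2 : ((∏ p ∈ d.primeFactors \ q.primeFactors, p : ℕ) : ℂ) ^ z =
      ∏ p ∈ d.primeFactors \ q.primeFactors, (p : ℂ) ^ z := by
    generalize d.primeFactors \ q.primeFactors = t
    induction t using Finset.induction_on with
    | empty => simp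
    | insert a t ha ih => rw [Finset.prod_insert ha, Finset.prod_insert ha, Nat.cast_mul, natCast_mul_natCast_cpow, ih]
  rw [h1, mul_one, h2, ← Finset.prod_mul_distrib, ← Finset.prod_mul_distrib]
  refine Finset.prod_congr rfl fun p hp => ?_
  have hp1 := Nat.prime_of_mem_primeFactors (Finset.mem_sdiff.1 hp).1
  refine euler_factor_dual ψ hp1 ((hp1.coprime_iff_not_dvd).2 fun h => (Finset.mem_sdiff.1 hp).2 ?_) z
  exact Nat.mem_primeFactors.2 ⟨hp1, h, hq⟩

theorem ofReal_pow_cpow {x : ℝ} (hx : 0 < x) (k : ℕ) (z : ℂ) : ((x ^ k : ℝ) : ℂ) ^ z = ((x : ℂ) ^ z) ^ k := by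
  induction k with
  | zero => simp
  | succ k ih => rw [pow_succ, ofReal_mul, mul_cpow_ofReal_nonneg (by positivity) hx.le, ih, pow_succ]

theorem mellinInv_congr {σ : ℝ} {f g : ℂ → ℂ} (h : ∀ t : ℝ, f (σ + t * I) = g (σ + t * I)) (x : ℝ) :
    mellinInv σ f x = mellinInv σ g x := by
  simp only [mellinInv, h]

theorem mellinInv_half_one_sub {f : ℂ → ℂ} {x : ℝ} (hx : 0 < x) :
    mellinInv (1 / 2 : ℝ) (fun s => f (1 - s)) x⁻¹ = x * mellinInv (1 / 2 : ℝ) f x := by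
  simp only [mellinInv]
  rw [mul_smul_comm, ← integral_const_mul]
  congr 1
  rw [← integral_neg_eq_self]
  refine integral_congr_ae (.of_forall fun t => ?_)
  have hx0 : (x : ℂ) ≠ 0 := ofReal_ne_zero.2 hx.ne'
  have e1 : (1 : ℂ) - (((1 / 2 : ℝ) : ℂ) + ((-t : ℝ) : ℂ) * I) = ((1 / 2 : ℝ) : ℂ) + t * I := by push_cast; ring
  have e2 : -(((1 / 2 : ℝ) : ℂ) + ((-t : ℝ) : ℂ) * I) = -(1 - (((1 / 2 : ℝ) : ℂ) + t * I)) := by push_cast; ring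
  simp only [smul_eq_mul]
  rw [e1, e2, ofReal_inv, inv_cpow _ _ (by rw [arg_ofReal_of_nonneg hx.le]; exact Real.pi_ne_zero.symm), cpow_neg,
    inv_inv, cpow_sub _ _ hx0, cpow_one, cpow_neg]
  field_simp

variable {g : ℝ → ℂ} (hg : ContDiff ℝ ∞ g) (hs : Function.support g ⊆ Icc 1 2) (k : ℕ)
include hg hs

theorem tsum_twist_divK_eq_mellinInv {N : ℕ} [NeZero N] {χ : DirichletCharacter ℂ N} (hχ : χ ≠ 1) {X : ℝ}
    (hX : 0 < X) : ∑' n : ℕ, twist χ (divK k) n * g (n / X) =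
      mellinInv (1 / 2 : ℝ) (fun s => mellin g s * χ.LFunction s ^ k) X⁻¹ := by
  have hW := stripRapid_mellin hg hs (1 / 2) 2
  have h2 : (2 : ℝ) ∈ Icc (1 / 2 : ℝ) 2 := by norm_num
  have hA := hW.mul ((stripPoly_LFunction hχ).pow k)
  have h := hasSum_mellinInv (c := fun n => twist χ (divK k) n) (σ := 2)
    (LSeries_twist_divK χ k (by norm_num)).2 (by simp) (hW.verticalIntegrable h2) hX
  have hinv : ∀ n : ℕ, twist χ (divK k) n * mellinInv 2 (mellin g) (n / X) = twist χ (divK k) n * g (n / X) := by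
    intro n
    rcases Nat.eq_zero_or_pos n with rfl | hn
    · simp
    · have hn0 : (0 : ℝ) < n := by exact_mod_cast hn
      rw [mellinInv_mellin_eq 2 g (by positivity) (mellinConvergent_of_support hg.continuous hs _).1
        (hW.verticalIntegrable h2) hg.continuous.continuousAt]
  simp only [hinv] at h
  rw [h.tsum_eq, hA.mellinInv_eq (σ₁ := 1 / 2) (by norm_num) h2 (by positivity)]
  refine mellinInv_congr (fun t => ?_) _
  rw [(LSeries_twist_divK χ k (by rw [re_add_ofReal_mul_I]; norm_num)).1]

/-- The summation formula dual to `∑ τ_k(n) χ(n) g(n/X)`, with `χ` induced by the primitive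
character `ψ`. -/
theorem norm_tsum_twist_divK_eq {q d : ℕ} [NeZero q] [NeZero d] (hq : q ≠ 1) (hqd : q ∣ d)
    {ψ : DirichletCharacter ℂ q} (hψ : ψ.IsPrimitive) {X : ℝ} (hX : 0 < X) :
    ‖∑' n : ℕ, twist (DirichletCharacter.changeLevel hqd ψ) (divK k) n * g (n / X)‖ =
      X / (q : ℝ) ^ ((k : ℝ) / 2) * ‖∑' n : ℕ, twist ψ⁻¹ (dualCoeff (d.primeFactors \ q.primeFactors) k) n *
        dualWeight g (charParity ψ) k
          (n / (((q * ∏ p ∈ d.primeFactors \ q.primeFactors, p : ℕ) : ℝ) ^ k / X))‖ := by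
  set P := d.primeFactors \ q.primeFactors with hP
  have hPp : ∀ p ∈ P, p.Prime := fun p hp => Nat.prime_of_mem_primeFactors (Finset.mem_sdiff.1 hp).1
  set e := ∏ p ∈ P, p with he
  have he0 : e ≠ 0 := Finset.prod_ne_zero_iff.2 fun p hp => (hPp p hp).ne_zero
  have hq0 : q ≠ 0 := NeZero.ne q
  set M : ℝ := ((q * e : ℕ) : ℝ) ^ k / X with hM
  have hqe : (0 : ℝ) < (q * e : ℕ) := by
    have : 0 < q * e := Nat.pos_of_ne_zero (mul_ne_zero hq0 he0)
    exact_mod_cast this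
  have hM0 : 0 < M := by positivity
  set κ := charParity ψ
  have hψ1 : ψ ≠ 1 := by
    intro h
    rw [DirichletCharacter.isPrimitive_def, h, DirichletCharacter.conductor_one] at hψ
    exact hq hψ.symm
  have hψ1' : ψ⁻¹ ≠ 1 := inv_ne_one.2 hψ1
  have hχ1 : DirichletCharacter.changeLevel hqd ψ ≠ 1 := fun h => hψ1 ((DirichletCharacter.changeLevel_eq_one_iff hqd).1 h)
  set E : ℂ → ℂ := fun z => (ψ⁻¹.LFunction z * ∏ p ∈ P, (-(p : ℂ)⁻¹ + ψ⁻¹ (p : ZMod q) * (p : ℂ) ^ (-z))) ^ k with hE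
  have hEp : StripPoly (1 / 2) 2 E := by
    refine ((stripPoly_LFunction hψ1').mul (StripPoly.prod P fun p hp => ?_)).pow k
    have hp0 : (0 : ℝ) < p := by exact_mod_cast (hPp p hp).pos
    have h1 : StripPoly (1 / 2) 2 fun z : ℂ => ((p : ℝ) : ℂ) ^ (-z) :=
      StripPoly.const_cpow hp0 differentiable_neg ⟨2, fun s hs => by
        rw [neg_re, abs_neg]; exact abs_le.2 ⟨by linarith [hs.1], hs.2⟩⟩
    have h2 := ((StripPoly.const (ψ⁻¹ (p : ZMod q))).mul h1).sub (StripPoly.const (p : ℂ)⁻¹)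
    have h3 : (fun z : ℂ => -(p : ℂ)⁻¹ + ψ⁻¹ (p : ZMod q) * (p : ℂ) ^ (-z)) =
        fun z : ℂ => ψ⁻¹ (p : ZMod q) * ((p : ℝ) : ℂ) ^ (-z) - (p : ℂ)⁻¹ := by
      ext z; push_cast; ring
    rw [h3]
    exact h2
  have hΦ := (stripRapid_dualMellin hg hs κ k).mono (a' := 1 / 2) (b' := 2) (by norm_num) le_rfl
  have hB := hΦ.mul hEp
  have h12 : (1 / 2 : ℝ) ∈ Icc (1 / 2 : ℝ) 2 := by norm_num
  have h2 : (2 : ℝ) ∈ Icc (1 / 2 : ℝ) 2 := by norm_num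
  set c₀ : ℂ := (ψ.rootNumber * (q : ℂ) ^ (-(1 / 2) : ℂ) * ∏ p ∈ P, ψ (p : ZMod q)) ^ k with hc₀
  have hc₀n : ‖c₀‖ = ((q : ℝ) ^ ((k : ℝ) / 2))⁻¹ := by
    have hq' : (0 : ℝ) < q := by exact_mod_cast Nat.pos_of_ne_zero hq0
    have hprod : ‖∏ p ∈ P, ψ (p : ZMod q)‖ = 1 := by
      rw [norm_prod]
      refine Finset.prod_eq_one fun p hp => ?_
      refine DirichletCharacter.unit_norm_eq_one ψ (ZMod.unitOfCoprime p (((hPp p hp).coprime_iff_not_dvd).2 fun h =>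
        (Finset.mem_sdiff.1 hp).2 (Nat.mem_primeFactors.2 ⟨hPp p hp, h, hq0⟩)))
    rw [hc₀, norm_pow, norm_mul, norm_mul, norm_rootNumber_eq_one hψ, hprod, one_mul, mul_one, ← ofReal_natCast,
      norm_cpow_eq_rpow_re_of_pos hq', ← Real.rpow_natCast, ← Real.rpow_mul hq'.le, ← Real.rpow_neg hq'.le]
    congr 1
    have : (-(1 / 2) : ℂ).re = -(1 / 2) := by norm_num
    rw [this]; ring
  have hpt : ∀ z : ℂ, 0 < z.re → mellin g (1 - z) * (DirichletCharacter.changeLevel hqd ψ).LFunction (1 - z) ^ k =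
      c₀ * ((((q * e : ℕ) : ℝ) ^ k : ℝ) : ℂ) ^ z * (dualMellin g κ k z * E z) := by
    intro z hz
    have hqz : (q : ℂ) ^ (z - 1 / 2) = (q : ℂ) ^ (-(1 / 2) : ℂ) * (q : ℂ) ^ z := by
      rw [← cpow_add _ _ (by exact_mod_cast hq0)]; ring_nf
    have hqez : ((((q * e : ℕ) : ℝ) ^ k : ℝ) : ℂ) ^ z = ((q : ℂ) ^ z * (e : ℂ) ^ z) ^ k := by
      rw [ofReal_pow_cpow hqe, ofReal_natCast, Nat.cast_mul, natCast_mul_natCast_cpow]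
    rw [DirichletCharacter.LFunction_changeLevel hqd ψ (Or.inl hψ1), prod_euler_factor_dual (NeZero.ne d) hqd,
      LFunction_one_sub_eq hq hψ hz, hqz, hqez, hc₀, dualMellin, hE, ← hP, ← he]
    simp only [mul_pow]
    ring
  rw [tsum_twist_divK_eq_mellinInv hg hs k hχ1 hX]
  have step : mellinInv (1 / 2 : ℝ) (fun s => mellin g s * (DirichletCharacter.changeLevel hqd ψ).LFunction s ^ k) X⁻¹
      = X * (c₀ * mellinInv (1 / 2 : ℝ) (fun z => dualMellin g κ k z * E z) M⁻¹) := by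
    have h := mellinInv_half_one_sub (x := X) hX (f := fun z => mellin g (1 - z) *
      (DirichletCharacter.changeLevel hqd ψ).LFunction (1 - z) ^ k)
    simp only [sub_sub_cancel] at h
    rw [h]
    congr 1
    simp only [mellinInv]
    rw [mul_smul_comm, ← integral_const_mul]
    congr 1
    refine integral_congr_ae (.of_forall fun t => ?_)
    simp only [smul_eq_mul]
    rw [hpt _ (by rw [re_add_ofReal_mul_I]; norm_num)]
    generalize ((1 / 2 : ℝ) : ℂ) + t * I = v
    have e1 : ((M⁻¹ : ℝ) : ℂ) ^ (-v) = ((((q * e : ℕ) : ℝ) ^ k : ℝ) : ℂ) ^ v * (X : ℂ) ^ (-v) := by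
      rw [ofReal_inv, inv_cpow _ _ (by rw [arg_ofReal_of_nonneg hM0.le]; exact Real.pi_ne_zero.symm), cpow_neg, inv_inv,
        hM, div_eq_mul_inv, ofReal_mul, mul_cpow_ofReal_nonneg (by positivity) (by positivity), ofReal_inv (r := X),
        inv_cpow _ _ (by rw [arg_ofReal_of_nonneg hX.le]; exact Real.pi_ne_zero.symm), ← cpow_neg]
    rw [e1]
    ring
  have hdual := hasSum_mellinInv (c := fun n => twist ψ⁻¹ (dualCoeff P k) n) (σ := 2)
    (LSeries_twist_dualCoeff ψ⁻¹ hPp k (by norm_num)).2 (by simp) (hΦ.verticalIntegrable h2) hM0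
  have hdw : ∀ n : ℕ, twist ψ⁻¹ (dualCoeff P k) n * mellinInv 2 (dualMellin g κ k) (n / M) =
      twist ψ⁻¹ (dualCoeff P k) n * dualWeight g κ k (n / M) := by
    intro n
    rcases Nat.eq_zero_or_pos n with rfl | hn
    · simp
    · have hn0 : (0 : ℝ) < n := by exact_mod_cast hn
      rw [dualWeight, hΦ.mellinInv_eq h12 h2 (by positivity)]
  simp only [hdw] at hdual
  have hlast : mellinInv 2 (fun s => dualMellin g κ k s * E s) M⁻¹ =
      mellinInv 2 (fun s => dualMellin g κ k s * LSeries (fun n => twist ψ⁻¹ (dualCoeff P k) n) s) M⁻¹ := by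
    refine mellinInv_congr (fun t => ?_) _
    rw [(LSeries_twist_dualCoeff ψ⁻¹ hPp k (by rw [re_add_ofReal_mul_I]; norm_num)).1]
  rw [step, hB.mellinInv_eq h12 h2 (inv_pos.2 hM0), hlast, hdual.tsum_eq, norm_mul, norm_mul, norm_real,
    Real.norm_of_nonneg hX.le, hc₀n]
  ring

end DualFormula

section OffDiagonal

/-- A decreasing weight on the positive reals, the derivative of `√t / (1 + √t)`. -/
noncomputable def decayWeight (t : ℝ) : ℝ := 1 / (2 * √t * (1 + √t) ^ 2)

theorem decayWeight_nonneg (t : ℝ) : 0 ≤ decayWeight t := by unfold decayWeight; positivity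

theorem decayWeight_zero : decayWeight 0 = 0 := by simp [decayWeight]

theorem decayWeight_anti {s t : ℝ} (hs : 0 < s) (h : s ≤ t) : decayWeight t ≤ decayWeight s := by
  unfold decayWeight
  have h1 : 0 < √s := Real.sqrt_pos.2 hs
  have h2 := Real.sqrt_le_sqrt h
  gcongr

theorem sum_range_decayWeight_le {θ : ℝ} (hθ : 0 < θ) (N : ℕ) :
    ∑ j ∈ Finset.range N, decayWeight (θ * (j + 1 : ℕ)) ≤ 1 / θ := by
  set G : ℕ → ℝ := fun j => √(θ * j) / (1 + √(θ * j)) with hG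
  have hstep : ∀ j : ℕ, θ * decayWeight (θ * (j + 1 : ℕ)) ≤ G (j + 1) - G j := by
    intro j
    simp only [hG, decayWeight]
    set a := √(θ * j) with ha
    set b := √(θ * (j + 1 : ℕ)) with hb
    have ha0 : 0 ≤ a := Real.sqrt_nonneg _
    have hb0 : 0 < b := Real.sqrt_pos.2 (by positivity)
    have hab : a ≤ b := Real.sqrt_le_sqrt (by push_cast; nlinarith)
    have hsq : b ^ 2 - a ^ 2 = θ := by
      rw [ha, hb, Real.sq_sqrt (by positivity), Real.sq_sqrt (by positivity)]; push_cast; ring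
    have e : b / (1 + b) - a / (1 + a) = θ / ((a + b) * ((1 + a) * (1 + b))) := by
      rw [← hsq]; field_simp; ring
    rw [e, mul_one_div]
    refine div_le_div_of_nonneg_left hθ.le (by positivity) ?_
    calc (a + b) * ((1 + a) * (1 + b)) ≤ (b + b) * ((1 + b) * (1 + b)) := by gcongr
      _ = _ := by ring
  have hG1 : G N ≤ 1 := by
    simp only [hG]
    rw [div_le_one (by positivity)]; linarith
  have hG0 : G 0 = 0 := by simp [hG]
  have := Finset.sum_le_sum fun j (_ : j ∈ Finset.range N) => hstep j
  rw [Finset.sum_range_sub, hG0, sub_zero, ← Finset.mul_sum] at this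
  rw [le_div_iff₀ hθ, mul_comm]
  linarith

theorem sum_decayWeight_le {θ : ℝ} (hθ : 0 < θ) (S : Finset ℕ) (j : ℕ → ℕ) (hj : Set.InjOn j S)
    (hj1 : ∀ n ∈ S, 1 ≤ j n) (x : ℕ → ℝ) (hx : ∀ n ∈ S, θ * j n ≤ x n) :
    ∑ n ∈ S, decayWeight (x n) ≤ 1 / θ := by
  refine le_trans ?_ (sum_range_decayWeight_le hθ (S.sup j))
  calc ∑ n ∈ S, decayWeight (x n) ≤ ∑ n ∈ S, decayWeight (θ * (j n - 1 + 1 : ℕ)) := by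
        refine Finset.sum_le_sum fun n hn => ?_
        rw [Nat.sub_add_cancel (hj1 n hn)]
        refine decayWeight_anti ?_ (hx n hn)
        have := hj1 n hn
        positivity
    _ = ∑ i ∈ S.image (fun n => j n - 1), decayWeight (θ * (i + 1 : ℕ)) := by
        rw [Finset.sum_image]
        intro a ha b hb hab
        have h1 := hj1 a ha
        have h2 := hj1 b hb
        exact hj ha hb (by simp only at hab; omega)
    _ ≤ _ := by
        refine Finset.sum_le_sum_of_subset_of_nonneg (fun i hi => ?_) fun _ _ _ => decayWeight_nonneg _
        obtain ⟨n, hn, rfl⟩ := Finset.mem_image.1 hi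
        have h1 := hj1 n hn
        have h2 : j n ≤ S.sup j := Finset.le_sup hn
        exact Finset.mem_range.2 (by omega)

theorem sum_range_decayWeight_div_le {M : ℝ} (hM : 0 < M) (N : ℕ) :
    ∑ n ∈ Finset.range N, decayWeight (n / M) ≤ M := by
  rw [← Finset.sum_filter_add_sum_filter_not _ (fun n => 1 ≤ n)]
  have h0 : ∑ n ∈ (Finset.range N).filter (fun n => ¬ 1 ≤ n), decayWeight (n / M) = 0 := by
    refine Finset.sum_eq_zero fun n hn => ?_
    have : n = 0 := by have := (Finset.mem_filter.1 hn).2; omega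
    subst this; simp [decayWeight_zero]
  rw [h0, add_zero]
  have := sum_decayWeight_le (θ := 1 / M) (by positivity) ((Finset.range N).filter (fun n => 1 ≤ n)) id
    (fun _ _ _ _ h => h) (fun n hn => (Finset.mem_filter.1 hn).2) (fun n => n / M)
    (fun n _ => by simp only [id]; rw [one_div, inv_mul_eq_div])
  simpa using this

theorem sum_decayWeight_congr_le {M : ℝ} (hM : 0 < M) {r : ℕ} (hr : 0 < r) (N m : ℕ) :
    ∑ n ∈ (Finset.range N).filter (fun n => m < n ∧ (r ∣ n - m ∨ r ∣ m + n)), decayWeight (n / M) ≤ 3 * (M / r) := by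
  have hr' : (0 : ℝ) < r := by exact_mod_cast hr
  have hsub : (Finset.range N).filter (fun n => m < n ∧ (r ∣ n - m ∨ r ∣ m + n)) ⊆
      (Finset.range N).filter (fun n => m < n ∧ r ∣ n - m) ∪
      (Finset.range N).filter (fun n => m < n ∧ r ∣ m + n) := by
    intro n hn
    simp only [Finset.mem_filter, Finset.mem_union] at hn ⊢
    tauto
  refine (Finset.sum_le_sum_of_subset_of_nonneg hsub fun _ _ _ => decayWeight_nonneg _).trans ?_
  refine (le_of_add_le_of_nonneg_left (Finset.sum_union_inter (s₁ := (Finset.range N).filter (fun n => m < n ∧ r ∣ n - m))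
    (s₂ := (Finset.range N).filter (fun n => m < n ∧ r ∣ m + n)) (f := fun n : ℕ => decayWeight (n / M))).le
    (Finset.sum_nonneg fun _ _ => decayWeight_nonneg _)).trans ?_
  have h1 : ∑ n ∈ (Finset.range N).filter (fun n => m < n ∧ r ∣ n - m), decayWeight (n / M) ≤ 1 / (r / M) := by
    refine sum_decayWeight_le (by positivity) _ (fun n => (n - m) / r) ?_ ?_ _ ?_
    · intro a ha b hb hab
      simp only [Finset.coe_filter, Set.mem_ofPred_eq] at ha hb hab
      obtain ⟨x, hx⟩ := ha.2.2
      obtain ⟨y, hy⟩ := hb.2.2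
      rw [hx, hy, Nat.mul_div_cancel_left _ hr, Nat.mul_div_cancel_left _ hr] at hab
      subst hab; omega
    · intro n hn
      have hn := (Finset.mem_filter.1 hn).2
      exact Nat.div_pos (Nat.le_of_dvd (by omega) hn.2) hr
    · intro n hn
      have hn := (Finset.mem_filter.1 hn).2
      rw [div_mul_eq_mul_div]
      gcongr
      have : r * ((n - m) / r) ≤ n := (Nat.mul_div_le _ _).trans (Nat.sub_le _ _)
      exact_mod_cast this
  have h2 : ∑ n ∈ (Finset.range N).filter (fun n => m < n ∧ r ∣ m + n), decayWeight (n / M) ≤ 1 / (r / (2 * M)) := by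
    refine sum_decayWeight_le (by positivity) _ (fun n => (m + n) / r) ?_ ?_ _ ?_
    · intro a ha b hb hab
      simp only [Finset.coe_filter, Set.mem_ofPred_eq] at ha hb hab
      obtain ⟨x, hx⟩ := ha.2.2
      obtain ⟨y, hy⟩ := hb.2.2
      rw [hx, hy, Nat.mul_div_cancel_left _ hr, Nat.mul_div_cancel_left _ hr] at hab
      subst hab; omega
    · intro n hn
      have hn := (Finset.mem_filter.1 hn).2
      exact Nat.div_pos (Nat.le_of_dvd (by omega) hn.2) hr
    · intro n hn
      have hn := (Finset.mem_filter.1 hn).2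
      have : r * ((m + n) / r) ≤ 2 * n := (Nat.mul_div_le _ _).trans (by omega)
      have h3 : (r : ℝ) * ((m + n) / r : ℕ) ≤ 2 * n := by exact_mod_cast this
      rw [div_mul_eq_mul_div, div_le_div_iff₀ (by positivity) hM]
      nlinarith
  calc _ ≤ 1 / (r / M) + 1 / (r / (2 * M)) := add_le_add h1 h2
    _ = _ := by field_simp; ring

/-- The pairs of distinct integers congruent up to sign modulo `r` contribute `≪ M ^ 2 / r`. -/
theorem sum_offDiag_decayWeight_le {M : ℝ} (hM : 0 < M) {r : ℕ} (hr : 0 < r) (N : ℕ) :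
    ∑ x ∈ ((Finset.range N) ×ˢ (Finset.range N)).filter
        (fun x => x.1 < x.2 ∧ (r ∣ x.2 - x.1 ∨ r ∣ x.1 + x.2)), decayWeight (x.1 / M) * decayWeight (x.2 / M)
      ≤ 3 * (M ^ 2 / r) := by
  rw [Finset.sum_filter, Finset.sum_product]
  calc _ ≤ ∑ m ∈ Finset.range N, decayWeight (m / M) * (3 * (M / r)) := by
        refine Finset.sum_le_sum fun m _ => ?_
        dsimp only
        rw [← Finset.sum_filter, ← Finset.mul_sum]
        exact mul_le_mul_of_nonneg_left (sum_decayWeight_congr_le hM hr N m) (decayWeight_nonneg _)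
    _ = (∑ m ∈ Finset.range N, decayWeight (m / M)) * (3 * (M / r)) := by rw [Finset.sum_mul]
    _ ≤ M * (3 * (M / r)) := by
        gcongr
        exact sum_range_decayWeight_div_le hM N
    _ = _ := by ring

end OffDiagonal

section PrimitiveCharacters

open Classical in
/-- The primitive Dirichlet characters modulo `q` of given parity. -/
noncomputable def primChars (q κ : ℕ) : Finset (DirichletCharacter ℂ q) :=
  Finset.univ.filter fun ψ => ψ.IsPrimitive ∧ charParity ψ = κ

theorem mem_primChars {q κ : ℕ} {ψ : DirichletCharacter ℂ q} :
    ψ ∈ primChars q κ ↔ ψ.IsPrimitive ∧ charParity ψ = κ := by simp [primChars]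

theorem charParity_le_one {q : ℕ} (ψ : DirichletCharacter ℂ q) : charParity ψ ≤ 1 := by
  unfold charParity; split_ifs <;> simp

theorem charParity_changeLevel {q d : ℕ} (hqd : q ∣ d) (ψ : DirichletCharacter ℂ q) :
    charParity (DirichletCharacter.changeLevel hqd ψ) = charParity ψ := by
  have h : DirichletCharacter.changeLevel hqd ψ (-1) = ψ (-1) := by
    have := DirichletCharacter.changeLevel_eq_cast_of_dvd' ψ hqd (a := -1) isCoprime_one_left.neg_left
    simpa using this
  unfold charParity DirichletCharacter.Even
  rw [h]

theorem changeLevel_natCast {q d : ℕ} (hqd : q ∣ d) (ψ : DirichletCharacter ℂ q) {n : ℕ} (hn : n.Coprime d) :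
    DirichletCharacter.changeLevel hqd ψ n = ψ n := by
  have := DirichletCharacter.changeLevel_eq_cast_of_dvd' ψ hqd (a := n) (Nat.isCoprime_iff_coprime.2 hn)
  simpa using this

open Classical in
theorem sum_conductor_eq {q d κ : ℕ} [NeZero d] (hqd : q ∣ d) {E : Type*} [AddCommMonoid E]
    (f : DirichletCharacter ℂ d → E) :
    ∑ χ ∈ Finset.univ.filter (fun χ : DirichletCharacter ℂ d => χ.conductor = q ∧ charParity χ = κ), f χ =
      ∑ ψ ∈ primChars q κ, f (DirichletCharacter.changeLevel hqd ψ) := by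
  symm
  refine Finset.sum_bij (fun ψ _ => DirichletCharacter.changeLevel hqd ψ) ?_ ?_ ?_ ?_
  · intro ψ hψ
    rw [mem_primChars] at hψ
    simp only [Finset.mem_filter, Finset.mem_univ, true_and]
    rw [DirichletCharacter.conductor_changeLevel, charParity_changeLevel]
    exact hψ
  · intro a _ b _ h
    exact DirichletCharacter.changeLevel_injective hqd h
  · intro χ hχ
    simp only [Finset.mem_filter, Finset.mem_univ, true_and] at hχ
    obtain ⟨h1, h2⟩ := hχ
    subst h1
    refine ⟨χ.primitiveCharacter, ?_, DirichletCharacter.changeLevel_primitiveCharacter χ⟩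
    rw [mem_primChars]
    refine ⟨χ.primitiveCharacter_isPrimitive, ?_⟩
    rw [← charParity_changeLevel hqd, DirichletCharacter.changeLevel_primitiveCharacter, h2]
  · intros; rfl

open Classical in
theorem sum_parity_eq_sum_divisors {d κ : ℕ} [NeZero d] {E : Type*} [AddCommMonoid E]
    (f : DirichletCharacter ℂ d → E) :
    ∑ χ ∈ Finset.univ.filter (fun χ : DirichletCharacter ℂ d => charParity χ = κ), f χ =
      ∑ q ∈ d.divisors,
        ∑ χ ∈ Finset.univ.filter (fun χ : DirichletCharacter ℂ d => χ.conductor = q ∧ charParity χ = κ), f χ := by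
  rw [← Finset.sum_fiberwise_of_maps_to (g := fun χ : DirichletCharacter ℂ d => χ.conductor) (t := d.divisors)
    (fun χ _ => Nat.mem_divisors.2 ⟨χ.conductor_dvd_level, NeZero.ne d⟩)]
  refine Finset.sum_congr rfl fun q _ => ?_
  rw [Finset.filter_filter]
  exact Finset.sum_congr (by ext χ; simp [and_comm]) fun _ _ => rfl

theorem inv_apply_natCast_mul {q : ℕ} (ψ : DirichletCharacter ℂ q) {n : ℕ} (hn : n.Coprime q) :
    ψ⁻¹ (n : ZMod q) * ψ (n : ZMod q) = 1 := by
  have h : IsUnit (n : ZMod q) := (ZMod.isUnit_iff_coprime n q).2 hn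
  rw [← MulChar.mul_apply, inv_mul_cancel, MulChar.one_apply h]

open Classical in
theorem sum_parity_inv_mul {r κ m n : ℕ} [NeZero r] (hκ : κ ≤ 1) (hm : m.Coprime r) :
    2 * ∑ χ ∈ Finset.univ.filter (fun χ : DirichletCharacter ℂ r => charParity χ = κ),
      χ⁻¹ (m : ZMod r) * χ (n : ZMod r) =
    (if (m : ZMod r) = n then (r.totient : ℂ) else 0) +
      (-1) ^ κ * (if (m : ZMod r) = -n then (r.totient : ℂ) else 0) := by
  have hu : IsUnit (m : ZMod r) := (ZMod.isUnit_iff_coprime m r).2 hm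
  have hinv : ∀ χ : DirichletCharacter ℂ r, χ⁻¹ (m : ZMod r) = χ ((m : ZMod r)⁻¹) := by
    intro χ
    have h1 := inv_apply_natCast_mul χ hm
    have h2 : χ ((m : ZMod r)⁻¹) * χ (m : ZMod r) = 1 := by
      rw [← map_mul, mul_comm, ZMod.coe_mul_inv_eq_one m hm, map_one]
    have h3 : χ (m : ZMod r) ≠ 0 := right_ne_zero_of_mul_eq_one h1
    exact mul_right_cancel₀ h3 (h1.trans h2.symm)
  rw [← DirichletCharacter.sum_char_inv_mul_char_eq ℂ hu, ← DirichletCharacter.sum_char_inv_mul_char_eq ℂ hu,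
    Finset.mul_sum, Finset.mul_sum, Finset.sum_filter, ← Finset.sum_add_distrib]
  refine Finset.sum_congr rfl fun χ _ => ?_
  rw [hinv]
  rcases χ.even_or_odd with h | h
  · rw [h.eval_neg]
    have : charParity χ = 0 := by simp [charParity, h]
    rw [this]
    rcases Nat.le_one_iff_eq_zero_or_eq_one.1 hκ with rfl | rfl
    · simp; ring
    · simp
  · rw [h.eval_neg]
    have : charParity χ = 1 := by simp [charParity, h.not_even]
    rw [this]
    rcases Nat.le_one_iff_eq_zero_or_eq_one.1 hκ with rfl | rfl
    · simp
    · simp; ring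

open Classical in
theorem norm_sum_parity_le {r κ m n : ℕ} [NeZero r] (hκ : κ ≤ 1) (hm : m.Coprime r) (hmn : m < n) :
    ‖∑ χ ∈ Finset.univ.filter (fun χ : DirichletCharacter ℂ r => charParity χ = κ),
      χ⁻¹ (m : ZMod r) * χ (n : ZMod r)‖ ≤ if r ∣ n - m ∨ r ∣ m + n then (r.totient : ℝ) else 0 := by
  have h := congrArg norm (sum_parity_inv_mul (n := n) hκ hm)
  rw [norm_mul] at h
  have h1 : (m : ZMod r) = n ↔ r ∣ n - m := by
    rw [ZMod.natCast_eq_natCast_iff]; exact Nat.modEq_iff_dvd' hmn.le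
  have h2 : (m : ZMod r) = -n ↔ r ∣ m + n := by
    rw [eq_neg_iff_add_eq_zero, ← Nat.cast_add, ZMod.natCast_eq_zero_iff]
  have h3 := norm_add_le (if (m : ZMod r) = n then (r.totient : ℂ) else 0)
      ((-1) ^ κ * (if (m : ZMod r) = -n then (r.totient : ℂ) else 0))
  rw [← h, norm_mul, norm_pow, norm_neg, norm_one, one_pow, one_mul] at h3
  simp only [Complex.norm_ofNat, h1, h2] at h3
  by_cases ha : r ∣ n - m <;> by_cases hb : r ∣ m + n <;> simp [ha, hb] at h3 ⊢
  · linarith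
  · have : (0 : ℝ) ≤ r.totient := by positivity
    linarith
  · have : (0 : ℝ) ≤ r.totient := by positivity
    linarith
  · exact norm_le_zero_iff.1 (by linarith)

theorem norm_sum_primChars_le {q κ m n : ℕ} [NeZero q] (hκ : κ ≤ 1) (hm : m.Coprime q) (hn : n.Coprime q) (hmn : m < n) :
    ‖∑ ψ ∈ primChars q κ, ψ⁻¹ (m : ZMod q) * ψ (n : ZMod q)‖ ≤
      ∑ r ∈ q.divisors, if r ∣ n - m ∨ r ∣ m + n then (r.totient : ℝ) else 0 := by
  classical
  have key := (ArithmeticFunction.sum_eq_iff_sum_mul_moebius_eq_on (R := ℂ)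
    (f := fun r => ∑ ψ ∈ primChars r κ, ψ⁻¹ (m : ZMod r) * ψ (n : ZMod r))
    (g := fun r => ∑ χ ∈ Finset.univ.filter (fun χ : DirichletCharacter ℂ r => charParity χ = κ),
      χ⁻¹ (m : ZMod r) * χ (n : ZMod r)) {r | r ∣ q} (fun _ _ h1 h2 => h1.trans h2)).1 ?_ q (NeZero.pos q)
      (dvd_refl q)
  · rw [← key]
    refine (norm_sum_le _ _).trans ?_
    rw [Nat.sum_divisorsAntidiagonal' (f := fun a b : ℕ => ‖((ArithmeticFunction.moebius a : ℤ) : ℂ) *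
      ∑ χ ∈ Finset.univ.filter (fun χ : DirichletCharacter ℂ b => charParity χ = κ),
      χ⁻¹ (m : ZMod b) * χ (n : ZMod b)‖)]
    refine Finset.sum_le_sum fun r hr => ?_
    have hrq := Nat.dvd_of_mem_divisors hr
    have : NeZero r := ⟨fun h => by subst h; exact NeZero.ne q (zero_dvd_iff.1 hrq)⟩
    rw [norm_mul]
    refine (mul_le_of_le_one_left (norm_nonneg _) ?_).trans (norm_sum_parity_le hκ (hm.coprime_dvd_right hrq) hmn)
    rw [Complex.norm_intCast]
    exact_mod_cast ArithmeticFunction.abs_moebius_le_one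
  · intro r hr0 hrq
    have : NeZero r := ⟨hr0.ne'⟩
    change r ∣ q at hrq
    rw [sum_parity_eq_sum_divisors]
    refine Finset.sum_congr rfl fun t ht => ?_
    have htr := Nat.dvd_of_mem_divisors ht
    rw [sum_conductor_eq htr]
    refine Finset.sum_congr rfl fun ψ _ => ?_
    rw [← map_inv, changeLevel_natCast htr _ (hm.coprime_dvd_right hrq),
      changeLevel_natCast htr _ (hn.coprime_dvd_right hrq)]

end PrimitiveCharacters

section CharacterVariance

theorem sum_offDiag_kernel_le {q κ : ℕ} [NeZero q] (hκ : κ ≤ 1) {M B : ℝ} (hM : 0 < M) (b : ℕ → ℂ)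
    (hb : ∀ n, ‖b n‖ ≤ B * decayWeight (n / M)) (N : ℕ) :
    ∑ x ∈ ((Finset.range N) ×ˢ (Finset.range N)).filter (fun x => x.1 < x.2),
      ‖b x.1‖ * ‖b x.2‖ * ‖∑ ψ ∈ primChars q κ, ψ⁻¹ (x.1 : ZMod q) * ψ (x.2 : ZMod q)‖ ≤
      3 * q.divisors.card * B ^ 2 * M ^ 2 := by
  calc _ ≤ ∑ x ∈ ((Finset.range N) ×ˢ (Finset.range N)).filter (fun x => x.1 < x.2),
        ∑ r ∈ q.divisors, (B ^ 2 * r.totient) * (if r ∣ x.2 - x.1 ∨ r ∣ x.1 + x.2 then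
          (decayWeight (x.1 / M) * decayWeight (x.2 / M)) else 0) := by
        refine Finset.sum_le_sum fun x hx => ?_
        have hx := (Finset.mem_filter.1 hx).2
        by_cases hc : x.1.Coprime q ∧ x.2.Coprime q
        · calc _ ≤ (B * decayWeight (x.1 / M)) * (B * decayWeight (x.2 / M)) *
                ∑ r ∈ q.divisors, (if r ∣ x.2 - x.1 ∨ r ∣ x.1 + x.2 then (r.totient : ℝ) else 0) := by
                have h1 := hb x.1
                have h2 := hb x.2
                have h3 := norm_sum_primChars_le (κ := κ) hκ hc.1 hc.2 hx
                have h4 := (norm_nonneg _).trans h1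
                have h5 := mul_nonneg h4 ((norm_nonneg _).trans h2)
                gcongr
            _ = _ := by
                rw [Finset.mul_sum]
                refine Finset.sum_congr rfl fun r _ => ?_
                split_ifs <;> ring
        · have h0 : ∑ ψ ∈ primChars q κ, ψ⁻¹ (x.1 : ZMod q) * ψ (x.2 : ZMod q) = 0 := by
            refine Finset.sum_eq_zero fun ψ _ => ?_
            rw [not_and_or] at hc
            rcases hc with hc | hc
            · rw [MulChar.map_nonunit ψ⁻¹ (fun h => hc ((ZMod.isUnit_iff_coprime _ _).1 h)), zero_mul]
            · rw [MulChar.map_nonunit ψ (fun h => hc ((ZMod.isUnit_iff_coprime _ _).1 h)), mul_zero]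
          rw [h0, norm_zero, mul_zero]
          refine Finset.sum_nonneg fun r _ => mul_nonneg (by positivity) ?_
          split_ifs
          · exact mul_nonneg (decayWeight_nonneg _) (decayWeight_nonneg _)
          · exact le_rfl
    _ = ∑ r ∈ q.divisors, (B ^ 2 * r.totient) * ∑ x ∈ ((Finset.range N) ×ˢ (Finset.range N)).filter
        (fun x => x.1 < x.2 ∧ (r ∣ x.2 - x.1 ∨ r ∣ x.1 + x.2)), decayWeight (x.1 / M) * decayWeight (x.2 / M) := by
        rw [Finset.sum_comm]
        refine Finset.sum_congr rfl fun r _ => ?_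
        rw [← Finset.mul_sum, ← Finset.sum_filter, Finset.filter_filter]
    _ ≤ ∑ r ∈ q.divisors, 3 * B ^ 2 * M ^ 2 := by
        refine Finset.sum_le_sum fun r hr => ?_
        have hr0 : 0 < r := Nat.pos_of_mem_divisors hr
        calc _ ≤ (B ^ 2 * r.totient) * (3 * (M ^ 2 / r)) :=
              mul_le_mul_of_nonneg_left (sum_offDiag_decayWeight_le hM hr0 N) (by positivity)
          _ = (r.totient / r) * (3 * B ^ 2 * M ^ 2) := by ring
          _ ≤ 1 * (3 * B ^ 2 * M ^ 2) := by
              gcongr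
              rw [div_le_one (by positivity)]
              exact_mod_cast Nat.totient_le r
          _ = _ := one_mul _
    _ = _ := by rw [Finset.sum_const, nsmul_eq_mul]; ring

theorem conj_inv_apply {q : ℕ} [NeZero q] (ψ : DirichletCharacter ℂ q) (a : ZMod q) :
    (starRingEnd ℂ) (ψ⁻¹ a) = ψ a := by
  rw [← MulChar.star_eq_inv, MulChar.star_apply]; simp

theorem norm_kernel_comm {q κ : ℕ} [NeZero q] (m n : ℕ) :
    ‖∑ ψ ∈ primChars q κ, ψ⁻¹ (m : ZMod q) * ψ (n : ZMod q)‖ =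
      ‖∑ ψ ∈ primChars q κ, ψ⁻¹ (n : ZMod q) * ψ (m : ZMod q)‖ := by
  rw [← Complex.norm_conj, map_sum]
  congr 1
  refine Finset.sum_congr rfl fun ψ _ => ?_
  rw [map_mul, conj_inv_apply, ← conj_inv_apply ψ (n : ZMod q), Complex.conj_conj, mul_comm]

theorem abs_sum_primChars_range_sub_le {q κ : ℕ} [NeZero q] (hκ : κ ≤ 1) {M B : ℝ} (hM : 0 < M) (b : ℕ → ℂ)
    (hb : ∀ n, ‖b n‖ ≤ B * decayWeight (n / M)) (N : ℕ) :
    |∑ ψ ∈ primChars q κ, ‖∑ n ∈ Finset.range N, ψ⁻¹ (n : ZMod q) * b n‖ ^ 2 -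
      (primChars q κ).card * ∑ n ∈ Finset.range N, (if n.Coprime q then ‖b n‖ ^ 2 else 0)| ≤
      6 * q.divisors.card * B ^ 2 * M ^ 2 := by
  set K : ℕ → ℕ → ℂ := fun m n => ∑ ψ ∈ primChars q κ, ψ⁻¹ (m : ZMod q) * ψ (n : ZMod q) with hK
  set T : ℕ × ℕ → ℂ := fun x => b x.1 * (starRingEnd ℂ) (b x.2) * K x.1 x.2 with hT
  have hexp : ((∑ ψ ∈ primChars q κ, ‖∑ n ∈ Finset.range N, ψ⁻¹ (n : ZMod q) * b n‖ ^ 2 : ℝ) : ℂ) =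
      ∑ x ∈ (Finset.range N) ×ˢ (Finset.range N), T x := by
    push_cast
    simp only [hT, hK, Finset.mul_sum]
    rw [Finset.sum_comm]
    refine Finset.sum_congr rfl fun ψ _ => ?_
    rw [← Complex.mul_conj', map_sum, Finset.sum_mul_sum, ← Finset.sum_product']
    refine Finset.sum_congr rfl fun x _ => ?_
    rw [map_mul, conj_inv_apply]; ring
  have hdiag : (((primChars q κ).card * ∑ n ∈ Finset.range N, (if n.Coprime q then ‖b n‖ ^ 2 else 0) : ℝ) : ℂ) =
      ∑ x ∈ ((Finset.range N) ×ˢ (Finset.range N)).filter (fun x => x.1 = x.2), T x := by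
    rw [Finset.sum_filter, Finset.sum_product]
    push_cast
    rw [Finset.mul_sum]
    refine Finset.sum_congr rfl fun n hn => ?_
    rw [Finset.sum_ite_eq (Finset.range N) n (fun y => T (n, y)), if_pos hn]
    simp only [hT, hK]
    rw [Complex.mul_conj']
    by_cases hc : n.Coprime q
    · rw [if_pos hc, Finset.sum_congr rfl fun ψ _ => inv_apply_natCast_mul ψ hc]
      simp; ring
    · rw [if_neg hc, Finset.sum_eq_zero fun ψ _ => by
        rw [MulChar.map_nonunit ψ (fun h => hc ((ZMod.isUnit_iff_coprime _ _).1 h)), mul_zero]]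
      simp
  have hsplit : ∑ x ∈ (Finset.range N) ×ˢ (Finset.range N), T x -
      ∑ x ∈ ((Finset.range N) ×ˢ (Finset.range N)).filter (fun x => x.1 = x.2), T x =
      ∑ x ∈ ((Finset.range N) ×ˢ (Finset.range N)).filter (fun x => x.1 < x.2), T x +
      ∑ x ∈ ((Finset.range N) ×ˢ (Finset.range N)).filter (fun x => x.1 < x.2), T x.swap := by
    have e : ∑ x ∈ ((Finset.range N) ×ˢ (Finset.range N)).filter (fun x => x.1 < x.2), T x.swap =
        ∑ x ∈ ((Finset.range N) ×ˢ (Finset.range N)).filter (fun x => x.2 < x.1), T x := by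
      refine Finset.sum_nbij' Prod.swap Prod.swap ?_ ?_ ?_ ?_ ?_ <;> intro x hx <;> simp_all
    rw [e, Finset.sum_filter, Finset.sum_filter, Finset.sum_filter, ← Finset.sum_sub_distrib, ← Finset.sum_add_distrib]
    refine Finset.sum_congr rfl fun x _ => ?_
    rcases lt_trichotomy x.1 x.2 with h | h | h
    · simp [h, h.ne, h.not_gt]
    · simp [h]
    · simp [h, h.ne', h.not_gt]
  rw [← Real.norm_eq_abs, ← Complex.norm_real, Complex.ofReal_sub, hexp, hdiag, hsplit]
  have hbound := sum_offDiag_kernel_le hκ hM b hb N (q := q)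
  have h1 : ‖∑ x ∈ ((Finset.range N) ×ˢ (Finset.range N)).filter (fun x => x.1 < x.2), T x‖ ≤
      3 * q.divisors.card * B ^ 2 * M ^ 2 := by
    refine (norm_sum_le _ _).trans (le_trans (le_of_eq ?_) hbound)
    refine Finset.sum_congr rfl fun x _ => ?_
    simp only [hT, hK, norm_mul, Complex.norm_conj]
  have h2 : ‖∑ x ∈ ((Finset.range N) ×ˢ (Finset.range N)).filter (fun x => x.1 < x.2), T x.swap‖ ≤
      3 * q.divisors.card * B ^ 2 * M ^ 2 := by
    refine (norm_sum_le _ _).trans (le_trans (le_of_eq ?_) hbound)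
    refine Finset.sum_congr rfl fun x _ => ?_
    simp only [hT, hK, norm_mul, Complex.norm_conj, Prod.fst_swap, Prod.snd_swap]
    rw [norm_kernel_comm, mul_comm ‖b x.2‖]
  calc _ ≤ _ := norm_add_le _ _
    _ ≤ _ := by linarith

theorem summable_of_le_decayWeight {M B : ℝ} (hM : 0 < M) {b : ℕ → ℂ}
    (hb : ∀ n, ‖b n‖ ≤ B * decayWeight (n / M)) : Summable b := by
  refine Summable.of_norm_bounded (g := fun n : ℕ => B * decayWeight (n / M)) (Summable.mul_left _ ?_) hb
  exact summable_of_sum_range_le (fun _ => decayWeight_nonneg _) (sum_range_decayWeight_div_le hM)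

theorem summable_sq_of_summable {b : ℕ → ℂ} (h : Summable b) : Summable fun n => ‖b n‖ ^ 2 := by
  have := summable_mul_of_summable_norm h.norm.norm h.norm.norm
  exact (this.comp_injective (i := fun n : ℕ => (n, n)) fun a b h => (Prod.ext_iff.1 h).1).congr fun n => (sq _).symm

/-- The mean square of a rapidly decaying character sum over the primitive characters of given parity. -/
theorem abs_sum_primChars_tsum_sub_le {q κ : ℕ} [NeZero q] (hκ : κ ≤ 1) {M B : ℝ} (hM : 0 < M) (b : ℕ → ℂ)
    (hb : ∀ n, ‖b n‖ ≤ B * decayWeight (n / M)) :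
    |∑ ψ ∈ primChars q κ, ‖∑' n : ℕ, ψ⁻¹ (n : ZMod q) * b n‖ ^ 2 -
      (primChars q κ).card * ∑' n : ℕ, (if n.Coprime q then ‖b n‖ ^ 2 else 0)| ≤
      6 * q.divisors.card * B ^ 2 * M ^ 2 := by
  have hs := summable_of_le_decayWeight hM hb
  have h1 : ∀ ψ : DirichletCharacter ℂ q, Tendsto (fun N => ∑ n ∈ Finset.range N, ψ⁻¹ (n : ZMod q) * b n) atTop
      (𝓝 (∑' n : ℕ, ψ⁻¹ (n : ZMod q) * b n)) := fun ψ => by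
    refine (Summable.of_norm_bounded hs.norm fun n => ?_).hasSum.tendsto_sum_nat
    rw [norm_mul]
    exact mul_le_of_le_one_left (norm_nonneg _) (ψ⁻¹.norm_le_one _)
  have h2 : Tendsto (fun N => ∑ n ∈ Finset.range N, (if n.Coprime q then ‖b n‖ ^ 2 else 0)) atTop
      (𝓝 (∑' n : ℕ, (if n.Coprime q then ‖b n‖ ^ 2 else 0))) := by
    refine (Summable.of_nonneg_of_le (fun n => ?_) (fun n => ?_) (summable_sq_of_summable hs)).hasSum.tendsto_sum_nat
    · split_ifs <;> positivity
    · split_ifs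
      · exact le_rfl
      · positivity
  refine le_of_tendsto ((tendsto_finsetSum _ fun ψ _ => ((h1 ψ).norm.pow 2)).sub (h2.const_mul _)).abs
    (Eventually.of_forall fun N => abs_sum_primChars_range_sub_le hκ hM b hb N)

end CharacterVariance

section VarianceIdentity

theorem sum_Icc_zmod {d : ℕ} [NeZero d] {E : Type*} [AddCommMonoid E] (h : ZMod d → E) :
    ∑ a ∈ Finset.Icc 1 d, h (a : ZMod d) = ∑ x : ZMod d, h x := by
  have hd := NeZero.pos d
  refine Finset.sum_nbij (fun a : ℕ => (a : ZMod d)) (fun _ _ => Finset.mem_univ _) ?_ ?_ fun _ _ => rfl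
  · intro a ha b hb hab
    simp only [Finset.coe_Icc, Set.mem_Icc] at ha hb
    have h1 : a ≡ b [MOD d] := (ZMod.natCast_eq_natCast_iff _ _ _).1 hab
    rcases le_total a b with h | h
    · have := (Nat.modEq_iff_dvd' h).1 h1
      rcases Nat.eq_zero_or_pos (b - a) with h0 | h0
      · omega
      · have := Nat.le_of_dvd h0 this; omega
    · have := (Nat.modEq_iff_dvd' h).1 h1.symm
      rcases Nat.eq_zero_or_pos (a - b) with h0 | h0
      · omega
      · have := Nat.le_of_dvd h0 this; omega
  · intro x _
    by_cases hx : x = 0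
    · exact ⟨d, by simp only [Finset.coe_Icc, Set.mem_Icc]; omega, by simp [hx]⟩
    · refine ⟨x.val, ?_, by simp⟩
      simp only [Finset.coe_Icc, Set.mem_Icc]
      exact ⟨Nat.one_le_iff_ne_zero.2 ((ZMod.val_ne_zero x).2 hx), (ZMod.val_lt x).le⟩

theorem sum_coprime_char_mul {d : ℕ} [NeZero d] (χ χ' : DirichletCharacter ℂ d) :
    ∑ a ∈ (Finset.Icc 1 d).filter (fun a => a.Coprime d), χ⁻¹ (a : ZMod d) * χ' (a : ZMod d) =
      if χ = χ' then (d.totient : ℂ) else 0 := by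
  rw [Finset.sum_filter_of_ne]
  · rw [sum_Icc_zmod (fun x => χ⁻¹ x * χ' x)]
    simp only [← MulChar.mul_apply]
    split_ifs with h
    · rw [h, inv_mul_cancel, MulChar.sum_one_eq_card_units, ZMod.card_units_eq_totient]
    · exact MulChar.sum_eq_zero_of_ne_one fun h' => h (inv_mul_eq_one.1 h')
  · intro a _ ha
    by_contra hc
    exact ha (by rw [MulChar.map_nonunit χ' (fun h => hc ((ZMod.isUnit_iff_coprime _ _).1 h)), mul_zero])

theorem discrepancy_eq {d : ℕ} [NeZero d] (f : ℕ → ℂ) (N : ℕ) {a : ℕ} (ha : a.Coprime d) :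
    (∑ n ∈ Finset.range N, if n ≡ a [MOD d] then f n else 0) -
      1 / (d.totient : ℂ) * ∑ n ∈ Finset.range N, (if n.Coprime d then f n else 0) =
    1 / (d.totient : ℂ) * ∑ χ ∈ Finset.univ.erase (1 : DirichletCharacter ℂ d),
      χ⁻¹ (a : ZMod d) * ∑ n ∈ Finset.range N, χ (n : ZMod d) * f n := by
  classical
  have hφ : (d.totient : ℂ) ≠ 0 := by exact_mod_cast (Nat.totient_pos.2 (NeZero.pos d)).ne'
  have hu : IsUnit (a : ZMod d) := (ZMod.isUnit_iff_coprime a d).2 ha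
  rw [Finset.sum_erase_eq_sub (Finset.mem_univ _), mul_sub]
  congr 1
  · simp only [Finset.mul_sum]
    rw [Finset.sum_comm]
    refine Finset.sum_congr rfl fun n _ => ?_
    have h := DirichletCharacter.sum_char_inv_mul_char_eq ℂ hu (n : ZMod d)
    have hinv : ∀ χ : DirichletCharacter ℂ d, χ⁻¹ (a : ZMod d) = χ ((a : ZMod d)⁻¹) := by
      intro χ
      have h1 := inv_apply_natCast_mul χ ha
      have h2 : χ ((a : ZMod d)⁻¹) * χ (a : ZMod d) = 1 := by
        rw [← map_mul, mul_comm, ZMod.coe_mul_inv_eq_one a ha, map_one]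
      exact mul_right_cancel₀ (right_ne_zero_of_mul_eq_one h1) (h1.trans h2.symm)
    have h3 : (n ≡ a [MOD d]) ↔ (a : ZMod d) = n := by
      rw [ZMod.natCast_eq_natCast_iff]; exact Nat.ModEq.comm
    calc (if n ≡ a [MOD d] then f n else 0) = 1 / (d.totient : ℂ) * ((if (a : ZMod d) = n then (d.totient : ℂ) else 0) * f n) := by
          simp only [h3]
          split_ifs
          · field_simp
          · simp
      _ = _ := by
          rw [← h, Finset.sum_mul, Finset.mul_sum]
          refine Finset.sum_congr rfl fun χ _ => ?_
          rw [hinv]; ring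
  · congr 1
    rw [inv_one, MulChar.one_apply hu, one_mul]
    refine Finset.sum_congr rfl fun n _ => ?_
    split_ifs with h
    · rw [MulChar.one_apply ((ZMod.isUnit_iff_coprime n d).2 h), one_mul]
    · rw [MulChar.map_nonunit _ (fun h' => h ((ZMod.isUnit_iff_coprime _ _).1 h')), zero_mul]

theorem sum_coprime_norm_sq_char_sum {d : ℕ} [NeZero d] (s : Finset (DirichletCharacter ℂ d))
    (c : DirichletCharacter ℂ d → ℂ) :
    ∑ a ∈ (Finset.Icc 1 d).filter (fun a => a.Coprime d), ‖∑ χ ∈ s, χ⁻¹ (a : ZMod d) * c χ‖ ^ 2 =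
      d.totient * ∑ χ ∈ s, ‖c χ‖ ^ 2 := by
  classical
  apply Complex.ofReal_injective
  push_cast
  calc _ = ∑ a ∈ (Finset.Icc 1 d).filter (fun a => a.Coprime d), ∑ χ ∈ s, ∑ χ' ∈ s,
        (χ⁻¹ (a : ZMod d) * χ' (a : ZMod d)) * (c χ * (starRingEnd ℂ) (c χ')) := by
        refine Finset.sum_congr rfl fun a _ => ?_
        rw [← Complex.mul_conj', map_sum, Finset.sum_mul_sum]
        refine Finset.sum_congr rfl fun χ _ => Finset.sum_congr rfl fun χ' _ => ?_
        rw [map_mul, conj_inv_apply]; ring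
    _ = ∑ χ ∈ s, ∑ χ' ∈ s, (if χ = χ' then (d.totient : ℂ) else 0) * (c χ * (starRingEnd ℂ) (c χ')) := by
        rw [Finset.sum_comm]
        refine Finset.sum_congr rfl fun χ _ => ?_
        rw [Finset.sum_comm]
        refine Finset.sum_congr rfl fun χ' _ => ?_
        rw [← sum_coprime_char_mul, Finset.sum_mul]
    _ = _ := by
        rw [Finset.mul_sum]
        refine Finset.sum_congr rfl fun χ hχ => ?_
        simp only [ite_mul, zero_mul]
        rw [Finset.sum_ite_eq, if_pos hχ, Complex.mul_conj']

/-- The variance as a mean square over the nontrivial characters. -/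
theorem smoothVariance_eq {w : ℝ → ℝ} (hs : Function.support w ⊆ Set.Icc 1 2) (k : ℕ) {X : ℝ} (hX : 0 < X)
    (d : ℕ) [NeZero d] :
    smoothVariance w k X d = 1 / (d.totient : ℝ) * ∑ χ ∈ Finset.univ.erase (1 : DirichletCharacter ℂ d),
      ‖∑' n : ℕ, twist χ (divK k) n * ((w (n / X) : ℝ) : ℂ)‖ ^ 2 := by
  have hφ : (d.totient : ℝ) ≠ 0 := by exact_mod_cast (Nat.totient_pos.2 (NeZero.pos d)).ne'
  set N := ⌈2 * X⌉₊ + 1 with hN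
  have hw : ∀ n ∉ Finset.range N, w (n / X) = 0 := by
    intro n hn
    by_contra h
    have h1 := (hs h).2
    rw [div_le_iff₀ hX] at h1
    have h2 : (n : ℝ) ≤ ⌈2 * X⌉₊ := h1.trans (Nat.le_ceil _)
    have h3 : n ≤ ⌈2 * X⌉₊ := by exact_mod_cast h2
    exact hn (Finset.mem_range.2 (by omega))
  have hS : ∀ χ : DirichletCharacter ℂ d, ∑' n : ℕ, twist χ (divK k) n * ((w (n / X) : ℝ) : ℂ) =
      ∑ n ∈ Finset.range N, χ (n : ZMod d) * ((tauK k n * w (n / X) : ℝ) : ℂ) := by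
    intro χ
    rw [tsum_eq_sum (s := Finset.range N) fun n hn => by rw [hw n hn]; simp]
    refine Finset.sum_congr rfl fun n _ => ?_
    rw [twist_apply, tauK_eq_divK]; push_cast; ring
  have hΔ : ∀ a : ℕ, a.Coprime d → ((smoothDelta w (fun n => (tauK k n : ℝ)) X d a : ℝ) : ℂ) =
      1 / (d.totient : ℂ) * ∑ χ ∈ Finset.univ.erase (1 : DirichletCharacter ℂ d),
      χ⁻¹ (a : ZMod d) * ∑' n : ℕ, twist χ (divK k) n * ((w (n / X) : ℝ) : ℂ) := by
    intro a ha
    simp only [hS]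
    rw [← discrepancy_eq _ N ha, smoothDelta, tsum_eq_sum (s := Finset.range N) fun n hn => by rw [hw n hn]; simp,
      tsum_eq_sum (s := Finset.range N) fun n hn => by rw [hw n hn]; simp]
    push_cast
    refine congrArg₂ _ (Finset.sum_congr rfl fun n _ => ?_) (congrArg _ (Finset.sum_congr rfl fun n _ => ?_)) <;>
      split_ifs <;> simp
  rw [smoothVariance]
  calc _ = ∑ a ∈ (Finset.Icc 1 d).filter (fun a => a.Coprime d), (1 / (d.totient : ℝ)) ^ 2 *
        ‖∑ χ ∈ Finset.univ.erase (1 : DirichletCharacter ℂ d),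
          χ⁻¹ (a : ZMod d) * ∑' n : ℕ, twist χ (divK k) n * ((w (n / X) : ℝ) : ℂ)‖ ^ 2 := by
        refine Finset.sum_congr rfl fun a ha => ?_
        rw [← Real.norm_eq_abs, ← Complex.norm_real, hΔ a (Finset.mem_filter.1 ha).2, norm_mul, mul_pow]
        congr 2
        rw [norm_div, norm_one, Complex.norm_natCast]
    _ = _ := by
        rw [← Finset.mul_sum, sum_coprime_norm_sq_char_sum]
        field_simp

end VarianceIdentity

section Isometry

/-- Summability of `∑ c(n)² / n`. -/
def HarmonicSq (c : ArithmeticFunction ℝ) : Prop := Summable fun n : ℕ => c n ^ 2 * (n : ℝ)⁻¹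

/-- The weighted square norm `∑ c(n)² / n`. -/
noncomputable def harmonicNorm (c : ArithmeticFunction ℝ) : ℝ := ∑' n : ℕ, c n ^ 2 * (n : ℝ)⁻¹

theorem hasSum_shift_sq {p : ℕ} (hp : p ≠ 0) {c : ArithmeticFunction ℝ} (hc : HarmonicSq c) :
    HasSum (fun n : ℕ => (arithSingle p * c) n ^ 2 * (n : ℝ)⁻¹) (harmonicNorm c * (p : ℝ)⁻¹) := by
  have hp' : (p : ℝ) ≠ 0 := by exact_mod_cast hp
  have hinj : Function.Injective fun m : ℕ => p * m := fun a b h => Nat.eq_of_mul_eq_mul_left (Nat.pos_of_ne_zero hp) h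
  rw [← hinj.hasSum_iff]
  · refine (hc.hasSum.mul_right (p : ℝ)⁻¹).congr_fun fun m => ?_
    simp only [Function.comp]
    rw [arithSingle_mul_apply hp, if_pos (dvd_mul_right _ _), Nat.mul_div_cancel_left _ (Nat.pos_of_ne_zero hp)]
    push_cast
    rw [mul_inv]; ring
  · intro n hn
    rw [arithSingle_mul_apply hp, if_neg]
    · simp
    · rintro ⟨m, rfl⟩
      exact hn ⟨m, rfl⟩

theorem harmonic_isometry_prime {p : ℕ} (hp : p ≠ 0) {c : ArithmeticFunction ℝ} (hc : HarmonicSq c) :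
    HarmonicSq (dualPrime p * c) ∧ HarmonicSq ((1 - arithSingle p) * c) ∧
      harmonicNorm (dualPrime p * c) = (p : ℝ)⁻¹ * harmonicNorm ((1 - arithSingle p) * c) := by
  have hp' : (p : ℝ) ≠ 0 := by exact_mod_cast hp
  have h1 := hc.hasSum
  have h2 := hasSum_shift_sq hp hc
  have h3 : Summable fun n : ℕ => c n * (arithSingle p * c) n * (n : ℝ)⁻¹ := by
    refine Summable.of_norm_bounded (h1.summable.add h2.summable) fun n => ?_
    rw [norm_mul, norm_mul, Real.norm_eq_abs, Real.norm_eq_abs, Real.norm_of_nonneg (by positivity), ← add_mul]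
    gcongr
    rw [← sq_abs (c n), ← sq_abs ((arithSingle p * c) n)]
    nlinarith [sq_nonneg (|c n| - |(arithSingle p * c) n|), sq_nonneg (|c n|), sq_nonneg (|(arithSingle p * c) n|)]
  have e1 : ∀ n, (dualPrime p * c) n = (arithSingle p * c) n - (p : ℝ)⁻¹ * c n := fun n => by
    rw [dualPrime_mul_apply hp, arithSingle_mul_apply hp]
  have e2 : ∀ n, ((1 - arithSingle p) * c) n = c n - (arithSingle p * c) n := fun n => by
    rw [sub_mul, one_mul, arith_sub_apply]
  have a1 : HasSum (fun n : ℕ => (dualPrime p * c) n ^ 2 * (n : ℝ)⁻¹) _ :=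
    ((h2.sub (h3.hasSum.mul_left (2 * (p : ℝ)⁻¹))).add (h1.mul_left ((p : ℝ)⁻¹ ^ 2))).congr_fun fun n => by
      rw [e1]; ring
  have a2 : HasSum (fun n : ℕ => ((1 - arithSingle p) * c) n ^ 2 * (n : ℝ)⁻¹) _ :=
    ((h1.sub (h3.hasSum.mul_left 2)).add h2).congr_fun fun n => by rw [e2]; ring
  refine ⟨a1.summable, a2.summable, ?_⟩
  rw [show harmonicNorm (dualPrime p * c) = _ from a1.tsum_eq,
    show harmonicNorm ((1 - arithSingle p) * c) = _ from a2.tsum_eq]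
  simp only [harmonicNorm]
  ring

/-- Convolution by `A` and by `B` change the weighted norm in the constant proportion `r`. -/
def IsoPair (A B : ArithmeticFunction ℝ) (r : ℝ) : Prop :=
  ∀ c, HarmonicSq c → HarmonicSq (A * c) ∧ HarmonicSq (B * c) ∧ harmonicNorm (A * c) = r * harmonicNorm (B * c)

theorem IsoPair.one : IsoPair 1 1 1 := fun c hc => by simp [hc]

theorem IsoPair.mul {A B A' B' : ArithmeticFunction ℝ} {r r' : ℝ} (h : IsoPair A B r) (h' : IsoPair A' B' r') :
    IsoPair (A * A') (B * B') (r * r') := fun c hc => by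
  obtain ⟨h1, h2, h3⟩ := h _ (h' c hc).1
  obtain ⟨h4, h5, h6⟩ := h' _ (h c hc).2.1
  refine ⟨by rwa [mul_assoc], by rwa [mul_comm B, mul_assoc], ?_⟩
  rw [mul_assoc, h3, mul_left_comm, h6, mul_comm B B', mul_assoc, mul_assoc]

theorem IsoPair.pow {A B : ArithmeticFunction ℝ} {r : ℝ} (h : IsoPair A B r) (k : ℕ) :
    IsoPair (A ^ k) (B ^ k) (r ^ k) := by
  induction k with
  | zero => simpa using IsoPair.one
  | succ k ih => rw [pow_succ, pow_succ, pow_succ]; exact ih.mul h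

theorem IsoPair.prod {P : Finset ℕ} (hP : ∀ p ∈ P, p ≠ 0) :
    IsoPair (∏ p ∈ P, dualPrime p) (∏ p ∈ P, (1 - arithSingle p)) (∏ p ∈ P, (p : ℝ)⁻¹) := by
  induction P using Finset.induction_on with
  | empty => simpa using IsoPair.one
  | insert p P hp ih =>
    rw [Finset.prod_insert hp, Finset.prod_insert hp, Finset.prod_insert hp]
    exact IsoPair.mul (fun c hc => harmonic_isometry_prime (hP p (Finset.mem_insert_self _ _)) hc)
      (ih fun r hr => hP r (Finset.mem_insert_of_mem hr))

end Isometry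

section SmoothSplitting

/-- The `k`-fold divisor function restricted to integers all of whose prime factors lie in `P`. -/
noncomputable def divSmooth (P : Finset ℕ) (k : ℕ) : ArithmeticFunction ℝ :=
  restr (· ∈ Nat.factoredNumbers P) (divK k)

/-- The part of `dualCoeff P k` supported on the integers all of whose prime factors lie in `P`. -/
noncomputable def dualSmooth (P : Finset ℕ) (k : ℕ) : ArithmeticFunction ℝ :=
  (∏ p ∈ P, dualPrime p) ^ k * divSmooth P k

theorem mem_factoredNumbers_iff {P : Finset ℕ} {n : ℕ} : n ∈ Nat.factoredNumbers P ↔ ∀ p, p.Prime → p ∣ n → p ∈ P :=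
  Nat.mem_factoredNumbers'

theorem one_mem_factoredNumbers (P : Finset ℕ) : 1 ∈ Nat.factoredNumbers P := by
  rw [mem_factoredNumbers_iff]
  exact fun p hp h => absurd (Nat.dvd_one.1 h) hp.ne_one

theorem divSmooth_eq_pow (P : Finset ℕ) (k : ℕ) : divSmooth P k = divSmooth P 1 ^ k := by
  rw [divSmooth, divSmooth, divK, divK, pow_one,
    restr_pow (P := (· ∈ Nat.factoredNumbers P)) (mem_factoredNumbers_mul_iff P) (one_mem_factoredNumbers P)]

theorem divSmooth_nonneg (P : Finset ℕ) (k n : ℕ) : 0 ≤ divSmooth P k n := by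
  rw [divSmooth, restr_apply]; split_ifs; exacts [divK_nonneg _ _, le_rfl]

theorem prod_one_sub_mul_divSmooth {P : Finset ℕ} (hP : ∀ p ∈ P, p.Prime) :
    (∏ p ∈ P, (1 - arithSingle p)) * divSmooth P 1 = 1 := by
  induction P using Finset.induction_on with
  | empty =>
    rw [Finset.prod_empty, one_mul, divSmooth]
    ext n
    rw [ArithmeticFunction.one_apply]
    split_ifs with h
    · subst h
      rw [restr_of (P := (· ∈ Nat.factoredNumbers ∅)) _ (one_mem_factoredNumbers _), divK_one_left one_ne_zero]
    · rcases eq_or_ne n 0 with rfl | h0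
      · simp
      rw [restr_of_not (P := (· ∈ Nat.factoredNumbers ∅))]
      intro h'
      obtain ⟨p, hp, hpn⟩ := Nat.exists_prime_and_dvd h
      exact absurd (mem_factoredNumbers_iff.1 h' p hp hpn) (Finset.notMem_empty _)
  | insert p P hp ih =>
    have hpp := hP p (Finset.mem_insert_self _ _)
    rw [Finset.prod_insert hp, mul_comm (1 - arithSingle p), mul_assoc]
    have key : (1 - arithSingle p) * divSmooth (insert p P) 1 = divSmooth P 1 := by
      ext n
      rcases eq_or_ne n 0 with rfl | h0
      · simp
      rw [sub_mul, one_mul, arith_sub_apply, arithSingle_mul_apply hpp.ne_zero, divSmooth, divSmooth]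
      by_cases hd : p ∣ n
      · obtain ⟨m, rfl⟩ := hd
        have hm : m ≠ 0 := right_ne_zero_of_mul h0
        have h1 : p * m ∈ Nat.factoredNumbers (insert p P) ↔ m ∈ Nat.factoredNumbers (insert p P) := by
          rw [mem_factoredNumbers_mul_iff _ _ _ hpp.ne_zero hm, and_iff_right]
          rw [mem_factoredNumbers_iff]
          intro r hr hrp
          rw [(Nat.prime_dvd_prime_iff_eq hr hpp).1 hrp]
          exact Finset.mem_insert_self _ _
        rw [if_pos (dvd_mul_right _ _), Nat.mul_div_cancel_left _ hpp.pos,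
          restr_of_not (P := (· ∈ Nat.factoredNumbers P)) _
            (fun h => hp (mem_factoredNumbers_iff.1 h p hpp (dvd_mul_right _ _)))]
        classical
        simp only [restr_apply, h1, divK_one_left hm, divK_one_left h0, sub_self]
      · have h1 : n ∈ Nat.factoredNumbers (insert p P) ↔ n ∈ Nat.factoredNumbers P := by
          rw [mem_factoredNumbers_iff, mem_factoredNumbers_iff]
          refine forall_congr' fun r => forall_congr' fun hr => forall_congr' fun hrn => ?_
          rw [Finset.mem_insert, or_iff_right]
          rintro rfl
          exact hd hrn
        rw [if_neg hd, sub_zero]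
        by_cases h2 : n ∈ Nat.factoredNumbers P
        · rw [restr_of (P := (· ∈ Nat.factoredNumbers (insert p P))) _ (h1.2 h2),
            restr_of (P := (· ∈ Nat.factoredNumbers P)) _ h2]
        · rw [restr_of_not (P := (· ∈ Nat.factoredNumbers (insert p P))) _ (mt h1.1 h2),
            restr_of_not (P := (· ∈ Nat.factoredNumbers P)) _ h2]
    rw [key]
    exact ih fun r hr => hP r (Finset.mem_insert_of_mem hr)

end SmoothSplitting

section SmoothSplitting

theorem divSmooth_sq_le (P : Finset ℕ) (k n : ℕ) : divSmooth P k n ^ 2 ≤ divSmooth P (k ^ 2) n := by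
  classical
  simp only [divSmooth, restr_apply]
  split_ifs
  · exact divK_sq_le k n
  · simp

theorem summable_divSmooth (P : Finset ℕ) {σ : ℝ} (hσ : 0 < σ) (k : ℕ) :
    Summable fun n : ℕ => divSmooth P k n * (n : ℝ) ^ (-σ) := (hasSum_smooth P hσ k).summable

theorem harmonicSq_divSmooth (P : Finset ℕ) (k : ℕ) : HarmonicSq (divSmooth P k) := by
  refine Summable.of_nonneg_of_le (fun n => by positivity) (fun n => ?_) (summable_divSmooth P one_pos (k ^ 2))
  rw [Real.rpow_neg_one]
  gcongr
  exact divSmooth_sq_le P k n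

theorem harmonicNorm_one : harmonicNorm 1 = 1 := by
  rw [harmonicNorm, tsum_eq_single 1]
  · simp
  · intro n hn
    simp [hn]

/-- The weighted norm of `dualSmooth`. -/
theorem hasSum_dualSmooth_sq {P : Finset ℕ} (hP : ∀ p ∈ P, p.Prime) (k : ℕ) :
    HasSum (fun n : ℕ => dualSmooth P k n ^ 2 * (n : ℝ)⁻¹) (((∏ p ∈ P, (p : ℝ)) ^ k)⁻¹) := by
  obtain ⟨h1, -, h3⟩ := ((IsoPair.prod fun p hp => (hP p hp).ne_zero).pow k) _ (harmonicSq_divSmooth P k)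
  have e : harmonicNorm (dualSmooth P k) = ((∏ p ∈ P, (p : ℝ)) ^ k)⁻¹ := by
    rw [dualSmooth, h3, divSmooth_eq_pow, ← mul_pow, prod_one_sub_mul_divSmooth hP, one_pow, harmonicNorm_one,
      mul_one, Finset.prod_inv_distrib, inv_pow]
  rw [← e]
  exact h1.hasSum

theorem support_prod_dualPrime_pow {P : Finset ℕ} (hP : ∀ p ∈ P, p.Prime) (k : ℕ) :
    restr (· ∈ Nat.factoredNumbers P) ((∏ p ∈ P, dualPrime p) ^ k) = (∏ p ∈ P, dualPrime p) ^ k := by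
  rw [restr_pow (mem_factoredNumbers_mul_iff P) (one_mem_factoredNumbers P)]
  congr 1
  ext n
  by_cases h : n ∈ Nat.factoredNumbers P
  · rw [restr_of (P := (· ∈ Nat.factoredNumbers P)) _ h]
  · rw [restr_of_not (P := (· ∈ Nat.factoredNumbers P)) _ h]
    by_contra h0
    exact h (mem_factoredNumbers_iff.2 ((prod_dualPrime_aux hP n).2 (Ne.symm h0)))

theorem restr_dualSmooth {P : Finset ℕ} (hP : ∀ p ∈ P, p.Prime) (k : ℕ) :
    restr (· ∈ Nat.factoredNumbers P) (dualSmooth P k) = dualSmooth P k := by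
  rw [dualSmooth, restr_mul (mem_factoredNumbers_mul_iff P), support_prod_dualPrime_pow hP, divSmooth]
  congr 1
  ext n
  classical
  simp only [restr_apply]
  split_ifs <;> rfl

theorem dualSmooth_eq_zero {P : Finset ℕ} (hP : ∀ p ∈ P, p.Prime) (k : ℕ) {n : ℕ} (h : n ∉ Nat.factoredNumbers P) :
    dualSmooth P k n = 0 := by
  rw [← restr_dualSmooth hP, restr_of_not (P := (· ∈ Nat.factoredNumbers P)) _ h]

theorem abs_dualSmooth_sq_le {P : Finset ℕ} (hP : ∀ p ∈ P, p.Prime) (k n : ℕ) :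
    dualSmooth P k n ^ 2 ≤ divSmooth P (4 * k ^ 2) n := by
  by_cases h : n ∈ Nat.factoredNumbers P
  · rw [divSmooth, restr_of (P := (· ∈ Nat.factoredNumbers P)) _ h]
    have h1 : ∀ n, |(∏ p ∈ P, dualPrime p) n| ≤ ((ArithmeticFunction.zeta : ArithmeticFunction ℕ) : ArithmeticFunction ℝ) n := by
      intro n
      rcases Nat.eq_zero_or_pos n with rfl | hn
      · simp
      · simpa [ArithmeticFunction.natCoe_apply, ArithmeticFunction.zeta_apply, hn.ne'] using (prod_dualPrime_aux hP n).1
    have h2 : ∀ n, |divSmooth P k n| ≤ divK k n := fun n => by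
      rw [abs_of_nonneg (divSmooth_nonneg _ _ _), divSmooth]
      classical
      rw [restr_apply]
      split_ifs
      · exact le_rfl
      · exact divK_nonneg _ _
    have h3 := abs_mul_arith_le (abs_pow_arith_le h1 k) h2 n
    have h4 : |dualSmooth P k n| ≤ divK (2 * k) n := by
      rw [two_mul, divK_add]; exact h3
    rw [← sq_abs]
    refine (pow_le_pow_left₀ (abs_nonneg _) h4 2).trans ((divK_sq_le _ _).trans (le_of_eq ?_))
    rw [show (2 * k) ^ 2 = 4 * k ^ 2 by ring]
  · rw [dualSmooth_eq_zero hP k h]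
    simp [divSmooth_nonneg]

/-- The values of a convolution of functions supported on coprime sets of integers. -/
theorem arith_mul_split {P : Finset ℕ} {f g : ArithmeticFunction ℝ} (hf : ∀ n, f n ≠ 0 → n ∈ Nat.factoredNumbers P)
    (hg : ∀ n, g n ≠ 0 → ∀ p, p.Prime → p ∣ n → p ∉ P) {v m : ℕ} (hv : v ∈ Nat.factoredNumbers P) (hm0 : m ≠ 0)
    (hm : ∀ p, p.Prime → p ∣ m → p ∉ P) : (f * g) (v * m) = f v * g m := by
  have hv0 := Nat.ne_zero_of_mem_factoredNumbers hv
  rw [ArithmeticFunction.mul_apply, Finset.sum_eq_single (v, m)]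
  · rintro ⟨x, y⟩ hxy hne
    by_contra h
    have hx := hf x (left_ne_zero_of_mul h)
    have hy := hg y (right_ne_zero_of_mul h)
    obtain ⟨hxy, -⟩ := Nat.mem_divisorsAntidiagonal.1 hxy
    simp only at hxy hx hy
    have c1 : x.Coprime m := Nat.Coprime.symm (Nat.coprime_of_dvd fun p hp h1 h2 => hm p hp h1 (mem_factoredNumbers_iff.1 hx p hp h2))
    have c2 : v.Coprime y := Nat.Coprime.symm (Nat.coprime_of_dvd fun p hp h1 h2 => hy p hp h1 (mem_factoredNumbers_iff.1 hv p hp h2))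
    have d1 : x ∣ v := c1.dvd_of_dvd_mul_right (hxy ▸ dvd_mul_right x y)
    have d2 : v ∣ x := c2.dvd_of_dvd_mul_right (hxy ▸ dvd_mul_right v m)
    have e1 : x = v := Nat.dvd_antisymm d1 d2
    subst e1
    exact hne (by rw [Nat.eq_of_mul_eq_mul_left (Nat.pos_of_ne_zero hv0) hxy])
  · intro h
    exact absurd (Nat.mem_divisorsAntidiagonal.2 ⟨rfl, mul_ne_zero hv0 hm0⟩) h

theorem exists_smooth_split (P : Finset ℕ) {n : ℕ} (hn : n ≠ 0) :
    ∃ v m, v * m = n ∧ v ∈ Nat.factoredNumbers P ∧ m ≠ 0 ∧ v.Coprime m ∧ (∀ p, p.Prime → p ∣ m → p ∉ P) := by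
  obtain ⟨a, b, hab, hc, ha, hb⟩ := exists_coprime_split (· ∈ P) hn
  exact ⟨a, b, hab, mem_factoredNumbers_iff.2 ha, by rintro rfl; exact hn (by rw [← hab, mul_zero]), hc, hb⟩

theorem divK_eq_divSmooth_mul (P : Finset ℕ) (k : ℕ) :
    divK k = divSmooth P k * restr (fun n => ∀ p, p.Prime → p ∣ n → p ∉ P) (divK k) := by
  ext n
  rcases eq_or_ne n 0 with rfl | hn
  · simp
  obtain ⟨v, m, rfl, hv, hm0, hc, hm⟩ := exists_smooth_split P hn
  rw [arith_mul_split (P := P) _ _ hv hm0 hm, (divK_isMultiplicative k).map_mul_of_coprime hc, divSmooth,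
    restr_of (P := (· ∈ Nat.factoredNumbers P)) _ hv, restr_of (P := fun n => ∀ p, p.Prime → p ∣ n → p ∉ P) _ hm]
  · intro n h
    by_contra h'
    exact h (restr_of_not (P := (· ∈ Nat.factoredNumbers P)) _ h')
  · intro n h
    by_contra h'
    exact h (restr_of_not (P := fun n => ∀ p, p.Prime → p ∣ n → p ∉ P) _ h')

theorem dualCoeff_mul_apply {P : Finset ℕ} (hP : ∀ p ∈ P, p.Prime) (k : ℕ) {v m : ℕ} (hv : v ∈ Nat.factoredNumbers P) (hm0 : m ≠ 0)
    (hm : ∀ p, p.Prime → p ∣ m → p ∉ P) : dualCoeff P k (v * m) = dualSmooth P k v * divK k m := by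
  rw [dualCoeff, divK_eq_divSmooth_mul P, ← mul_assoc, ← dualSmooth,
    arith_mul_split (P := P) _ _ hv hm0 hm, ← divK_eq_divSmooth_mul P,
    restr_of (P := fun n => ∀ p, p.Prime → p ∣ n → p ∉ P) _ hm]
  · intro n h
    by_contra h'
    exact h (dualSmooth_eq_zero hP k h')
  · intro n h
    by_contra h'
    exact h (restr_of_not (P := fun n => ∀ p, p.Prime → p ∣ n → p ∉ P) _ h')

/-- The squares of the dual coefficients on the integers coprime to `q`, as a convolution. -/
theorem dualCoeff_sq_eq {q d : ℕ} (hd : d ≠ 0) (hqd : q ∣ d) (k n : ℕ) :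
    (if n.Coprime q then dualCoeff (d.primeFactors \ q.primeFactors) k n ^ 2 else 0) =
      (ArithmeticFunction.pmul (dualSmooth (d.primeFactors \ q.primeFactors) k)
        (dualSmooth (d.primeFactors \ q.primeFactors) k) * tauSq k d) n := by
  set P := d.primeFactors \ q.primeFactors with hPdef
  have hq : q ≠ 0 := by rintro rfl; exact hd (zero_dvd_iff.1 hqd)
  have hP : ∀ p ∈ P, p.Prime := fun p hp => Nat.prime_of_mem_primeFactors (Finset.mem_sdiff.1 hp).1
  rcases eq_or_ne n 0 with rfl | hn
  · simp
  obtain ⟨v, m, rfl, hv, hm0, hc, hm⟩ := exists_smooth_split P hn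
  rw [arith_mul_split (P := P) _ _ hv hm0 hm, dualCoeff_mul_apply hP k hv hm0 hm, ArithmeticFunction.pmul_apply, tauSq]
  · have h1 : (v * m).Coprime q ↔ m.Coprime d := by
      rw [Nat.coprime_mul_iff_left]
      constructor
      · rintro ⟨-, h⟩
        refine Nat.coprime_of_dvd fun p hp hpm hpd => ?_
        refine hm p hp hpm (Finset.mem_sdiff.2 ⟨Nat.mem_primeFactors.2 ⟨hp, hpd, hd⟩, fun h' => ?_⟩)
        exact Nat.not_coprime_of_dvd_of_dvd hp.one_lt hpm (Nat.dvd_of_mem_primeFactors h') h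
      · intro h
        refine ⟨Nat.coprime_of_dvd fun p hp hpv hpq => ?_, h.coprime_dvd_right hqd⟩
        exact (Finset.mem_sdiff.1 (mem_factoredNumbers_iff.1 hv p hp hpv)).2 (Nat.mem_primeFactors.2 ⟨hp, hpq, hq⟩)
    by_cases h : m.Coprime d
    · rw [if_pos (h1.2 h), restr_of (P := (·.Coprime d)) _ h, ArithmeticFunction.pmul_apply]; ring
    · rw [if_neg (mt h1.1 h), restr_of_not (P := (·.Coprime d)) _ h, mul_zero]
  · intro n h
    by_contra h'
    rw [ArithmeticFunction.pmul_apply, dualSmooth_eq_zero hP k h'] at h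
    simp at h
  · intro n h p hp hpn hpP
    refine h (restr_of_not (P := (·.Coprime d)) _ fun hnd => ?_)
    exact Nat.not_coprime_of_dvd_of_dvd hp.one_lt hpn (Nat.dvd_of_mem_primeFactors (Finset.mem_sdiff.1 hpP).1) hnd

end SmoothSplitting

section Diagonal

/-- The sum of `τ_k(m)² Φ(m/Y)` over the integers `m` coprime to `d`. -/
noncomputable def diagSum (Φ : ℝ → ℝ) (k d : ℕ) (Y : ℝ) : ℝ := ∑' m : ℕ, tauSq k d m * Φ (m / Y)

/-- The decay of the squared modulus of a dual weight. -/
structure DualDecay (Φ : ℝ → ℝ) (B : ℝ) : Prop where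
  nonneg : ∀ y, 0 ≤ Φ y
  le_small : ∀ y, 0 < y → Φ y ≤ B * y ^ (-(1 / 2) : ℝ)
  le_large : ∀ y, 0 < y → Φ y ≤ B * y ^ (-4 : ℝ)

theorem DualDecay.const_nonneg {Φ : ℝ → ℝ} {B : ℝ} (h : DualDecay Φ B) : 0 ≤ B := by
  have := (h.nonneg 1).trans (h.le_large 1 one_pos)
  simpa using this

theorem DualDecay.le_rpow {Φ : ℝ → ℝ} {B : ℝ} (h : DualDecay Φ B) {s : ℝ} (h1 : 1 / 2 ≤ s) (h2 : s ≤ 4) {y : ℝ} (hy : 0 < y) :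
    Φ y ≤ B * y ^ (-s) := by
  rcases le_total y 1 with hy1 | hy1
  · exact (h.le_small y hy).trans (mul_le_mul_of_nonneg_left
      (Real.rpow_le_rpow_of_exponent_ge hy hy1 (by linarith)) h.const_nonneg)
  · exact (h.le_large y hy).trans (mul_le_mul_of_nonneg_left
      (Real.rpow_le_rpow_of_exponent_le hy1 (by linarith)) h.const_nonneg)

theorem tauSq_mul_weight_le {Φ : ℝ → ℝ} {B : ℝ} (h : DualDecay Φ B) {s : ℝ} (h1 : 1 / 2 ≤ s) (h2 : s ≤ 4) (k d m : ℕ) {Y : ℝ}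
    (hY : 0 < Y) : tauSq k d m * Φ (m / Y) ≤ B * Y ^ s * (tauSq k 1 m * (m : ℝ) ^ (-s)) := by
  rcases Nat.eq_zero_or_pos m with rfl | hm
  · simp
  have hm' : (0 : ℝ) < m := by exact_mod_cast hm
  have h3 : tauSq k d m ≤ tauSq k 1 m := by
    rw [tauSq_eq, tauSq_eq, if_pos (Nat.coprime_one_right m)]
    split_ifs
    · exact le_rfl
    · positivity
  calc tauSq k d m * Φ (m / Y) ≤ tauSq k 1 m * (B * (m / Y) ^ (-s)) := by
        gcongr
        · exact h.nonneg _
        · exact tauSq_nonneg _ _ _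
        · exact h.le_rpow h1 h2 (by positivity)
    _ = _ := by
        rw [Real.div_rpow hm'.le hY.le, Real.rpow_neg hY.le s]
        field_simp

theorem summable_tauSq_mul_weight {Φ : ℝ → ℝ} {B : ℝ} (h : DualDecay Φ B) (k d : ℕ) {Y : ℝ} (hY : 0 < Y) :
    Summable fun m : ℕ => tauSq k d m * Φ (m / Y) :=
  Summable.of_nonneg_of_le (fun m => mul_nonneg (tauSq_nonneg _ _ _) (h.nonneg _))
    (fun m => tauSq_mul_weight_le h (s := 2) (by norm_num) (by norm_num) k d m hY)
    ((hasSum_tauSq k one_ne_zero (by norm_num)).summable.mul_left _)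

theorem diagSum_nonneg {Φ : ℝ → ℝ} {B : ℝ} (h : DualDecay Φ B) (k d : ℕ) (Y : ℝ) : 0 ≤ diagSum Φ k d Y :=
  tsum_nonneg fun _ => mul_nonneg (tauSq_nonneg _ _ _) (h.nonneg _)

theorem exists_diagSum_le {Φ : ℝ → ℝ} {B : ℝ} (h : DualDecay Φ B) (k : ℕ) {ε : ℝ} (hε : 0 < ε) (hε1 : ε ≤ 1) :
    ∃ C : ℝ, 0 ≤ C ∧ ∀ d : ℕ, ∀ Y : ℝ, 0 < Y → diagSum Φ k d Y ≤ C * Y ^ (1 + ε) := by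
  have hs := (hasSum_tauSq k one_ne_zero (s := 1 + ε) (by linarith)).summable
  refine ⟨B * ∑' m : ℕ, tauSq k 1 m * (m : ℝ) ^ (-(1 + ε)), mul_nonneg h.const_nonneg
    (tsum_nonneg fun m => mul_nonneg (tauSq_nonneg _ _ _) (by positivity)), fun d Y hY => ?_⟩
  calc diagSum Φ k d Y ≤ ∑' m : ℕ, B * Y ^ (1 + ε) * (tauSq k 1 m * (m : ℝ) ^ (-(1 + ε))) :=
        (summable_tauSq_mul_weight h k d hY).tsum_le_tsum
          (fun m => tauSq_mul_weight_le h (by linarith) (by linarith) k d m hY) (hs.mul_left _)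
    _ = _ := by rw [tsum_mul_left]; ring

theorem summable_dualSmooth_sq {P : Finset ℕ} (hP : ∀ p ∈ P, p.Prime) (k : ℕ) {σ : ℝ} (hσ : 0 < σ) :
    Summable fun v : ℕ => dualSmooth P k v ^ 2 * (v : ℝ) ^ (-σ) :=
  Summable.of_nonneg_of_le (fun v => by positivity)
    (fun v => mul_le_mul_of_nonneg_right (abs_dualSmooth_sq_le hP k v) (by positivity))
    (summable_divSmooth P hσ (4 * k ^ 2))

theorem hasSum_dualSmooth_diagSum {Φ : ℝ → ℝ} {B : ℝ} (h : DualDecay Φ B) {P : Finset ℕ} (hP : ∀ p ∈ P, p.Prime) (k d : ℕ)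
    {M : ℝ} (hM : 0 < M) :
    HasSum (fun v : ℕ => dualSmooth P k v ^ 2 * diagSum Φ k d (M / v))
      (∑' n : ℕ, (ArithmeticFunction.pmul (dualSmooth P k) (dualSmooth P k) * tauSq k d) n * Φ (n / M)) := by
  set A := ArithmeticFunction.pmul (dualSmooth P k) (dualSmooth P k) with hA
  have hA' : ∀ v, A v = dualSmooth P k v ^ 2 := fun v => by rw [hA, ArithmeticFunction.pmul_apply, sq]
  have hsum : Summable fun x : ℕ × ℕ => A x.1 * tauSq k d x.2 * Φ ((x.1 * x.2 : ℕ) / M) := by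
    have h1 := summable_mul_of_summable_norm (summable_dualSmooth_sq hP k (σ := 2) (by norm_num)).norm
      (hasSum_tauSq k one_ne_zero (s := 2) (by norm_num)).summable.norm
    refine Summable.of_nonneg_of_le (fun x => ?_) (fun x => ?_) (h1.mul_left (B * M ^ (2 : ℝ)))
    · rw [hA']
      exact mul_nonneg (mul_nonneg (sq_nonneg _) (tauSq_nonneg _ _ _)) (h.nonneg _)
    · rw [hA']
      rcases Nat.eq_zero_or_pos x.1 with h0 | h0
      · rw [h0]; simp
      have h0' : (0 : ℝ) < x.1 := by exact_mod_cast h0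
      have := tauSq_mul_weight_le h (s := 2) (by norm_num) (by norm_num) k d x.2 (Y := M / x.1) (by positivity)
      have e : ((x.1 * x.2 : ℕ) : ℝ) / M = x.2 / (M / x.1) := by push_cast; field_simp
      rw [e, mul_assoc]
      calc _ ≤ dualSmooth P k x.1 ^ 2 * (B * (M / x.1) ^ (2 : ℝ) * (tauSq k 1 x.2 * (x.2 : ℝ) ^ (-2 : ℝ))) := by gcongr
        _ = _ := by rw [Real.div_rpow hM.le h0'.le, Real.rpow_neg h0'.le]; ring
  have h2 := hasSum_mul_arith A (tauSq k d) (fun n : ℕ => Φ (n / M)) hsum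
  rw [h2.tsum_eq, hsum.tsum_prod]
  have h3 := hsum.prod
  refine h3.hasSum.congr_fun fun v => ?_
  simp only
  rw [hA']
  rcases Nat.eq_zero_or_pos v with rfl | h0
  · simp
  have h0' : (0 : ℝ) < v := by exact_mod_cast h0
  rw [diagSum, ← tsum_mul_left]
  refine tsum_congr fun m => ?_
  have e : ((v * m : ℕ) : ℝ) / M = m / (M / v) := by push_cast; field_simp
  rw [e, mul_assoc]

/-- The diagonal term on the dual side. -/
theorem tsum_dualCoeff_sq_eq {Φ : ℝ → ℝ} {B : ℝ} (h : DualDecay Φ B) {q d : ℕ} (hd : d ≠ 0) (hqd : q ∣ d) (k : ℕ)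
    {M : ℝ} (hM : 0 < M) :
    HasSum (fun v : ℕ => dualSmooth (d.primeFactors \ q.primeFactors) k v ^ 2 * diagSum Φ k d (M / v))
    (∑' n : ℕ, (if n.Coprime q then dualCoeff (d.primeFactors \ q.primeFactors) k n ^ 2 * Φ (n / M) else 0)) := by
  have hP : ∀ p ∈ d.primeFactors \ q.primeFactors, p.Prime := fun p hp =>
    Nat.prime_of_mem_primeFactors (Finset.mem_sdiff.1 hp).1
  have := hasSum_dualSmooth_diagSum h hP k d hM
  convert this using 3 with n
  rw [← dualCoeff_sq_eq hd hqd]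
  split_ifs <;> simp

end Diagonal

section DiagonalAsymptotic

theorem tsum_dualSmooth_sq_half_le {P : Finset ℕ} (hP : ∀ p ∈ P, p.Prime) (k : ℕ) :
    ∑' v : ℕ, dualSmooth P k v ^ 2 * (v : ℝ) ^ (-(1 / 2) : ℝ) ≤ ((2 : ℝ) ^ P.card) ^ (8 * k ^ 2) := by
  have h := hasSum_smooth P (σ := 1 / 2) (by norm_num) (4 * k ^ 2)
  refine ((summable_dualSmooth_sq hP k (σ := 1 / 2) (by norm_num)).tsum_le_tsum
    (fun v => mul_le_mul_of_nonneg_right (abs_dualSmooth_sq_le hP k v) (by positivity)) h.summable).trans ?_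
  rw [show ∑' v : ℕ, divSmooth P (4 * k ^ 2) v * (v : ℝ) ^ (-(1 / 2) : ℝ) = _ from h.tsum_eq]
  have h1 : ∏ p ∈ P.filter Nat.Prime, (1 - (p : ℝ) ^ (-(1 / 2) : ℝ))⁻¹ ≤ 4 ^ P.card := by
    rw [Finset.filter_true_of_mem hP]
    refine (Finset.prod_le_prod (g := fun _ => (4 : ℝ)) (fun p hp => ?_) fun p hp => ?_).trans_eq (by rw [Finset.prod_const])
    · exact inv_nonneg.2 (sub_nonneg.2 (Real.rpow_le_one_of_one_le_of_nonpos
        (by exact_mod_cast (hP p hp).one_lt.le) (by norm_num)))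
    have hp2 : (2 : ℝ) ≤ p := by exact_mod_cast (hP p hp).two_le
    have h2 : (p : ℝ) ^ (-(1 / 2) : ℝ) ≤ 3 / 4 := by
      have h3 : ((p : ℝ) ^ (-(1 / 2) : ℝ)) ^ 2 ≤ (3 / 4) ^ 2 := by
        rw [← Real.rpow_natCast, ← Real.rpow_mul (by positivity)]
        norm_num
        rw [Real.rpow_neg_one]
        exact (inv_anti₀ (by norm_num) hp2).trans (by norm_num)
      exact le_of_sq_le_sq h3 (by norm_num)
    exact (inv_anti₀ (by norm_num : (0 : ℝ) < 1 / 4) (by linarith)).trans (by norm_num)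
  have h0 : 0 ≤ ∏ p ∈ P.filter Nat.Prime, (1 - (p : ℝ) ^ (-(1 / 2) : ℝ))⁻¹ := by
    refine Finset.prod_nonneg fun p hp => inv_nonneg.2 (sub_nonneg.2 ?_)
    exact Real.rpow_le_one_of_one_le_of_nonpos (by exact_mod_cast (Finset.mem_filter.1 hp).2.one_lt.le) (by norm_num)
  calc _ ≤ ((4 : ℝ) ^ P.card) ^ (4 * k ^ 2) := pow_le_pow_left₀ h0 h1 _
    _ = _ := by
      rw [show (4 : ℝ) = 2 ^ 2 by norm_num, ← pow_mul, ← pow_mul, ← pow_mul]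
      congr 1; ring

theorem abs_pow_div_factorial_sub_le {n : ℕ} {L l t : ℝ} (hl : 0 ≤ l) (hlL : l ≤ L) (ht : L - l ≤ t) :
    |l ^ n / (n ! : ℝ) - L ^ n / (n ! : ℝ)| ≤ t * (1 + L) ^ (n - 1) := by
  have h1 := abs_pow_sub_pow_le l L n
  rw [← sub_div, abs_div, abs_of_pos (by positivity : (0 : ℝ) < n !), div_le_iff₀ (by positivity)]
  rw [abs_of_nonneg hl, abs_of_nonneg (hl.trans hlL), max_eq_right hlL, abs_sub_comm l L, abs_of_nonneg (sub_nonneg.2 hlL)] at h1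
  have h2 : (n : ℝ) ≤ n ! := by exact_mod_cast Nat.self_le_factorial n
  have hL : 0 ≤ L := hl.trans hlL
  have ht0 : 0 ≤ t := (sub_nonneg.2 hlL).trans ht
  calc _ ≤ (L - l) * n * L ^ (n - 1) := h1
    _ ≤ t * n ! * (1 + L) ^ (n - 1) := by gcongr; linarith
    _ = _ := by ring

/-- The asymptotic evaluation of `diagSum` with a logarithmic saving. -/
def DiagAsymp (Φ : ℝ → ℝ) (k : ℕ) (C : ℝ) : Prop := ∀ d : ℕ, d ≠ 0 → ∀ Y : ℝ, 1 ≤ Y →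
  |diagSum Φ k d Y - arithConst k d * (Y * Real.log Y ^ (k ^ 2 - 1) / (k ^ 2 - 1)!)| ≤
    C * (4 + Real.log d) ^ (1 / 2 : ℝ) * arithConst k d * (Y * (1 + Real.log Y) ^ (k ^ 2 - 2))

theorem exists_abs_diagSum_div_sub_le {Φ : ℝ → ℝ} {B C₁ : ℝ} (h : DualDecay Φ B) {k : ℕ} (hC₁ : 0 ≤ C₁)
    (hA : DiagAsymp Φ k C₁) {ε : ℝ} (hε : 0 < ε) (hε1 : ε ≤ 1) :
    ∃ C : ℝ, 0 ≤ C ∧ ∀ d : ℕ, d ≠ 0 → ∀ M V : ℝ, 1 ≤ V → V ≤ M → ∀ v : ℕ, v ≠ 0 →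
      |diagSum Φ k d (M / v) - arithConst k d * (M / v * (Real.log M ^ (k ^ 2 - 1) / (k ^ 2 - 1)!))| ≤
        arithConst k d * M * (((1 + Real.log M) ^ (k ^ 2 - 2) * (C * (4 + Real.log d) ^ (1 / 2 : ℝ) + Real.log V)) * (v : ℝ)⁻¹ +
          (C * (4 + Real.log d) ^ (1 / 4 : ℝ) * M ^ ε + Real.log M ^ (k ^ 2 - 1)) * V ^ (-(1 / 2) : ℝ) * (v : ℝ) ^ (-(1 / 2) : ℝ)) := by
  obtain ⟨C₂, hC₂, hS⟩ := exists_diagSum_le h k hε hε1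
  obtain ⟨C₃, hC₃, h3⟩ := exists_one_le_arithConst_mul k
  refine ⟨max C₁ (C₂ * C₃), le_max_of_le_left hC₁, fun d hd M V hV hVM v hv => ?_⟩
  have ha := arithConst_pos k hd
  have hv1 : (1 : ℝ) ≤ v := by exact_mod_cast Nat.one_le_iff_ne_zero.2 hv
  have hM : 1 ≤ M := hV.trans hVM
  have hL : 0 ≤ Real.log M := Real.log_nonneg hM
  have hlV : 0 ≤ Real.log V := Real.log_nonneg hV
  have hΛ : 0 ≤ Real.log d := Real.log_natCast_nonneg d
  set a := arithConst k d
  set L := Real.log M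
  set C := max C₁ (C₂ * C₃)
  have hC1 : C₁ ≤ C := le_max_left _ _
  have hC2 : C₂ * C₃ ≤ C := le_max_right _ _
  have hC0 : 0 ≤ C := hC₁.trans hC1
  rcases le_or_gt (v : ℝ) V with hvV | hvV
  · have hY : 1 ≤ M / v := by rw [one_le_div (by positivity)]; exact hvV.trans hVM
    have hlog : Real.log (M / v) = L - Real.log v := Real.log_div (by positivity) (by positivity)
    have hlv : 0 ≤ Real.log v := Real.log_nonneg hv1
    have hlvV : Real.log v ≤ Real.log V := Real.log_le_log (by positivity) hvV
    have h1 := hA d hd (M / v) hY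
    have hl0 : 0 ≤ Real.log (M / v) := Real.log_nonneg hY
    have h2 := abs_pow_div_factorial_sub_le (n := k ^ 2 - 1) (L := L) (l := Real.log (M / v)) (t := Real.log V) hl0
      (by linarith) (by linarith)
    rw [Nat.sub_sub] at h2
    have h4 : |diagSum Φ k d (M / v) - a * (M / v * (L ^ (k ^ 2 - 1) / (k ^ 2 - 1)!))| ≤
        C₁ * (4 + Real.log d) ^ (1 / 2 : ℝ) * a * (M / v * (1 + Real.log (M / v)) ^ (k ^ 2 - 2)) +
        a * (M / v) * (Real.log V * (1 + L) ^ (k ^ 2 - (1 + 1))) := by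
      have e : diagSum Φ k d (M / v) - a * (M / v * (L ^ (k ^ 2 - 1) / (k ^ 2 - 1)!)) =
        (diagSum Φ k d (M / v) - a * (M / v * Real.log (M / v) ^ (k ^ 2 - 1) / (k ^ 2 - 1)!)) +
        a * (M / v) * (Real.log (M / v) ^ (k ^ 2 - 1) / (k ^ 2 - 1)! - L ^ (k ^ 2 - 1) / (k ^ 2 - 1)!) := by ring
      rw [e]
      refine (abs_add_le _ _).trans (add_le_add h1 ?_)
      rw [abs_mul, abs_of_nonneg (by positivity)]
      gcongr
    refine h4.trans ?_
    have h5 : 0 ≤ a * M * ((C * (4 + Real.log d) ^ (1 / 4 : ℝ) * M ^ ε + L ^ (k ^ 2 - 1)) * V ^ (-(1 / 2) : ℝ) * (v : ℝ) ^ (-(1 / 2) : ℝ)) := by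
      positivity
    rw [mul_add (a * M)]
    refine le_add_of_le_of_nonneg ?_ h5
    calc _ ≤ C * (4 + Real.log d) ^ (1 / 2 : ℝ) * a * (M / v * (1 + L) ^ (k ^ 2 - 2)) +
        a * (M / v) * (Real.log V * (1 + L) ^ (k ^ 2 - 2)) := by gcongr; linarith
      _ = _ := by ring
  · have h1 := hS d (M / v) (by positivity)
    have h2 : 1 ≤ V ^ (-(1 / 2) : ℝ) * (v : ℝ) ^ (1 / 2 : ℝ) := by
      rw [Real.rpow_neg (by positivity), ← div_eq_inv_mul, one_le_div (by positivity)]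
      exact Real.rpow_le_rpow (by positivity) hvV.le (by norm_num)
    have hfac : (1 : ℝ) ≤ (k ^ 2 - 1)! := by exact_mod_cast Nat.one_le_iff_ne_zero.2 (Nat.factorial_ne_zero _)
    have h4 : |diagSum Φ k d (M / v) - a * (M / v * (L ^ (k ^ 2 - 1) / (k ^ 2 - 1)!))| ≤
        a * M * (C * (4 + Real.log d) ^ (1 / 4 : ℝ) * M ^ ε + L ^ (k ^ 2 - 1)) * (v : ℝ)⁻¹ := by
      rw [abs_le]
      have e1 : diagSum Φ k d (M / v) ≤ a * M * (C * (4 + Real.log d) ^ (1 / 4 : ℝ) * M ^ ε) * (v : ℝ)⁻¹ := by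
        calc diagSum Φ k d (M / v) ≤ C₂ * (M / v) ^ (1 + ε) := h1
          _ = C₂ * (M / v) * (M / v) ^ ε := by rw [Real.rpow_add (by positivity), Real.rpow_one]; ring
          _ ≤ C₂ * (M / v) * M ^ ε := by
              gcongr
              exact div_le_self (by positivity) hv1
          _ = C₂ * (M / v) * M ^ ε * 1 := (mul_one _).symm
          _ ≤ C₂ * (M / v) * M ^ ε * (C₃ * (4 + Real.log d) ^ (1 / 4 : ℝ) * a) := by
              gcongr
              exact h3 d hd
          _ = (C₂ * C₃) * (a * M * ((4 + Real.log d) ^ (1 / 4 : ℝ) * M ^ ε) * (v : ℝ)⁻¹) := by ring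
          _ ≤ C * (a * M * ((4 + Real.log d) ^ (1 / 4 : ℝ) * M ^ ε) * (v : ℝ)⁻¹) := by gcongr
          _ = _ := by ring
      have e2 : a * (M / v * (L ^ (k ^ 2 - 1) / (k ^ 2 - 1)!)) ≤ a * M * L ^ (k ^ 2 - 1) * (v : ℝ)⁻¹ := by
        calc _ ≤ a * (M / v * (L ^ (k ^ 2 - 1) / 1)) := by gcongr
          _ = _ := by ring
      have e3 := diagSum_nonneg h k d (M / v)
      have e4 : 0 ≤ a * M * (C * (4 + Real.log d) ^ (1 / 4 : ℝ) * M ^ ε) * (v : ℝ)⁻¹ := by positivity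
      have e5 : 0 ≤ a * (M / v * (L ^ (k ^ 2 - 1) / (k ^ 2 - 1)!)) := by positivity
      have e6 : 0 ≤ a * M * L ^ (k ^ 2 - 1) * (v : ℝ)⁻¹ := by positivity
      have e7 : a * M * (C * (4 + Real.log d) ^ (1 / 4 : ℝ) * M ^ ε + L ^ (k ^ 2 - 1)) * (v : ℝ)⁻¹ =
        a * M * (C * (4 + Real.log d) ^ (1 / 4 : ℝ) * M ^ ε) * (v : ℝ)⁻¹ + a * M * L ^ (k ^ 2 - 1) * (v : ℝ)⁻¹ := by ring
      constructor <;> rw [e7] <;> linarith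
    refine h4.trans ?_
    have h5 : 0 ≤ a * M * (((1 + L) ^ (k ^ 2 - 2) * (C * (4 + Real.log d) ^ (1 / 2 : ℝ) + Real.log V)) * (v : ℝ)⁻¹) := by positivity
    rw [mul_add (a * M) (_ * (v : ℝ)⁻¹)]
    refine le_add_of_nonneg_of_le h5 ?_
    have e8 : (v : ℝ)⁻¹ * (v : ℝ) ^ (1 / 2 : ℝ) = (v : ℝ) ^ (-(1 / 2) : ℝ) := by
      rw [← Real.rpow_neg_one, ← Real.rpow_add (by positivity)]; norm_num
    calc _ = a * M * (C * (4 + Real.log d) ^ (1 / 4 : ℝ) * M ^ ε + L ^ (k ^ 2 - 1)) * (v : ℝ)⁻¹ * 1 := (mul_one _).symm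
      _ ≤ a * M * (C * (4 + Real.log d) ^ (1 / 4 : ℝ) * M ^ ε + L ^ (k ^ 2 - 1)) * (v : ℝ)⁻¹ * (V ^ (-(1 / 2) : ℝ) * (v : ℝ) ^ (1 / 2 : ℝ)) := by gcongr
      _ = _ := by rw [← e8]; ring

/-- The diagonal term on the dual side, asymptotically. -/
theorem exists_abs_dual_diagonal_sub_le {Φ : ℝ → ℝ} {B C₁ : ℝ} (h : DualDecay Φ B) {k : ℕ} (hC₁ : 0 ≤ C₁)
    (hA : DiagAsymp Φ k C₁) {ε : ℝ} (hε : 0 < ε) (hε1 : ε ≤ 1) :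
    ∃ C : ℝ, 0 ≤ C ∧ ∀ d : ℕ, d ≠ 0 → ∀ P : Finset ℕ, (∀ p ∈ P, p.Prime) → ∀ M V : ℝ, 1 ≤ V → V ≤ M →
      |∑' v : ℕ, dualSmooth P k v ^ 2 * diagSum Φ k d (M / v) -
        arithConst k d * (M / (∏ p ∈ P, (p : ℝ)) ^ k * (Real.log M ^ (k ^ 2 - 1) / (k ^ 2 - 1)!))| ≤
        arithConst k d * M * (((1 + Real.log M) ^ (k ^ 2 - 2) * (C * (4 + Real.log d) ^ (1 / 2 : ℝ) + Real.log V)) /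
            (∏ p ∈ P, (p : ℝ)) ^ k +
          (C * (4 + Real.log d) ^ (1 / 4 : ℝ) * M ^ ε + Real.log M ^ (k ^ 2 - 1)) * V ^ (-(1 / 2) : ℝ) *
            ((2 : ℝ) ^ P.card) ^ (8 * k ^ 2)) := by
  obtain ⟨C, hC, hb⟩ := exists_abs_diagSum_div_sub_le h hC₁ hA hε hε1
  refine ⟨C, hC, fun d hd P hP M V hV hVM => ?_⟩
  have ha := arithConst_pos k hd
  have hM : 1 ≤ M := hV.trans hVM
  have hL : 0 ≤ Real.log M := Real.log_nonneg hM
  have hΛ : 0 ≤ Real.log d := Real.log_natCast_nonneg d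
  have h1 := hasSum_dualSmooth_diagSum h hP k d (M := M) (by positivity)
  have h2 := hasSum_dualSmooth_sq hP k
  have h3 := h2.mul_left (arithConst k d * (M * (Real.log M ^ (k ^ 2 - 1) / (k ^ 2 - 1)!)))
  have h4 := (summable_dualSmooth_sq hP k (σ := 1 / 2) (by norm_num))
  set E1 := (1 + Real.log M) ^ (k ^ 2 - 2) * (C * (4 + Real.log d) ^ (1 / 2 : ℝ) + Real.log V)
  set E2 := (C * (4 + Real.log d) ^ (1 / 4 : ℝ) * M ^ ε + Real.log M ^ (k ^ 2 - 1)) * V ^ (-(1 / 2) : ℝ) with hE2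
  have hE2' : 0 ≤ E2 := by positivity
  have h5 := ((h2.mul_left E1).add (h4.hasSum.mul_left E2)).mul_left (arithConst k d * M)
  have h6 := h1.sub h3
  rw [h1.tsum_eq]
  have e : arithConst k d * (M / (∏ p ∈ P, (p : ℝ)) ^ k * (Real.log M ^ (k ^ 2 - 1) / (k ^ 2 - 1)!)) =
    arithConst k d * (M * (Real.log M ^ (k ^ 2 - 1) / (k ^ 2 - 1)!)) * ((∏ p ∈ P, (p : ℝ)) ^ k)⁻¹ := by ring
  rw [e, ← h6.tsum_eq, ← Real.norm_eq_abs]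
  refine (tsum_of_norm_bounded h5 fun v => ?_).trans ?_
  · rcases Nat.eq_zero_or_pos v with rfl | h0
    · simp
    have := hb d hd M V hV hVM v h0.ne'
    rw [Real.norm_eq_abs]
    have e1 : dualSmooth P k v ^ 2 * diagSum Φ k d (M / v) -
        arithConst k d * (M * (Real.log M ^ (k ^ 2 - 1) / (k ^ 2 - 1)!)) * (dualSmooth P k v ^ 2 * (v : ℝ)⁻¹) =
      dualSmooth P k v ^ 2 * (diagSum Φ k d (M / v) - arithConst k d * (M / v * (Real.log M ^ (k ^ 2 - 1) / (k ^ 2 - 1)!))) := by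
      ring
    rw [e1, abs_mul, abs_of_nonneg (sq_nonneg _)]
    calc _ ≤ _ := mul_le_mul_of_nonneg_left this (sq_nonneg _)
      _ = _ := by ring
  · rw [← div_eq_mul_inv]
    have := tsum_dualSmooth_sq_half_le hP k
    gcongr

end DiagonalAsymptotic

section DualWeightBounds

theorem rpow_neg_half_le_decayWeight {y : ℝ} (hy : 0 < y) (hy1 : y ≤ 1) : y ^ (-(1 / 2) : ℝ) ≤ 8 * decayWeight y := by
  have h1 : √y ≤ 1 := Real.sqrt_le_one.2 hy1
  have h0 : 0 < √y := Real.sqrt_pos.2 hy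
  rw [Real.rpow_neg hy.le, ← Real.sqrt_eq_rpow, decayWeight, mul_one_div, ← one_div, div_le_div_iff₀ h0 (by positivity)]
  have : (1 + √y) ^ 2 ≤ 2 ^ 2 := by gcongr; linarith
  nlinarith

theorem rpow_neg_three_half_le_decayWeight {y : ℝ} (hy1 : 1 ≤ y) : y ^ (-(3 / 2) : ℝ) ≤ 8 * decayWeight y := by
  have hy : 0 < y := by linarith
  have h1 : 1 ≤ √y := Real.one_le_sqrt.2 hy1
  have e : y ^ (3 / 2 : ℝ) = √y ^ 3 := by
    rw [Real.sqrt_eq_rpow, ← Real.rpow_natCast, ← Real.rpow_mul hy.le]; norm_num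
  rw [Real.rpow_neg hy.le, e, decayWeight, mul_one_div, ← one_div, div_le_div_iff₀ (by positivity) (by positivity)]
  have : (1 + √y) ^ 2 ≤ (2 * √y) ^ 2 := by gcongr; linarith
  nlinarith

variable {g : ℝ → ℂ} (hg : ContDiff ℝ ∞ g) (hs : Function.support g ⊆ Set.Icc 1 2) (k : ℕ)
include hg hs

theorem exists_dualWeight_bounds : ∃ B : ℝ, 0 ≤ B ∧ ∀ κ ≤ 1, ∀ y : ℝ, 0 < y →
    ‖dualWeight g κ k y‖ ≤ B * y ^ (-(1 / 4) : ℝ) ∧ ‖dualWeight g κ k y‖ ≤ B * y ^ (-2 : ℝ) := by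
  obtain ⟨B0, h0, hB0⟩ := exists_norm_dualWeight_le hg hs 0 k
  obtain ⟨B1, h1, hB1⟩ := exists_norm_dualWeight_le hg hs 1 k
  refine ⟨max B0 B1, le_max_of_le_left h0, fun κ hκ y hy => ?_⟩
  rcases Nat.le_one_iff_eq_zero_or_eq_one.1 hκ with rfl | rfl
  · exact ⟨(hB0 y hy).1.trans (by gcongr; exact le_max_left _ _), (hB0 y hy).2.1.trans (by gcongr; exact le_max_left _ _)⟩
  · exact ⟨(hB1 y hy).1.trans (by gcongr; exact le_max_right _ _), (hB1 y hy).2.1.trans (by gcongr; exact le_max_right _ _)⟩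

theorem exists_dualDecay : ∃ B : ℝ, ∀ κ ≤ 1, DualDecay (fun y => ‖dualWeight g κ k y‖ ^ 2) B := by
  obtain ⟨B, hB, h⟩ := exists_dualWeight_bounds hg hs k
  refine ⟨B ^ 2, fun κ hκ => ⟨fun y => sq_nonneg _, fun y hy => ?_, fun y hy => ?_⟩⟩
  · refine (pow_le_pow_left₀ (norm_nonneg _) (h κ hκ y hy).1 2).trans_eq ?_
    rw [mul_pow, ← Real.rpow_natCast (y ^ _), ← Real.rpow_mul hy.le]; norm_num
  · refine (pow_le_pow_left₀ (norm_nonneg _) (h κ hκ y hy).2 2).trans_eq ?_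
    rw [mul_pow, ← Real.rpow_natCast (y ^ _), ← Real.rpow_mul hy.le]; norm_num

theorem exists_norm_coeff_mul_dualWeight_le (J : ℕ) {ε : ℝ} (hε : 0 < ε) (hε1 : ε ≤ 1 / 2) :
    ∃ B : ℝ, 0 ≤ B ∧ ∀ κ ≤ 1, ∀ c : ArithmeticFunction ℝ, (∀ n, |c n| ≤ divK J n) → ∀ M : ℝ, 0 < M → ∀ n : ℕ,
      ‖(c n : ℂ) * dualWeight g κ k (n / M)‖ ≤ B * M ^ ε * decayWeight (n / M) := by
  obtain ⟨B, hB, h⟩ := exists_dualWeight_bounds hg hs k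
  obtain ⟨C, hC, hc'⟩ := exists_divK_le J hε
  refine ⟨C * (8 * B), by positivity, fun κ hκ c hc M hM n => ?_⟩
  rcases Nat.eq_zero_or_pos n with rfl | hn
  · simp [decayWeight_zero]
  have hn' : (0 : ℝ) < n := by exact_mod_cast hn
  set y : ℝ := n / M with hy
  have hy0 : 0 < y := by positivity
  have e : (n : ℝ) = M * y := by rw [hy]; field_simp
  have h1 : y ^ ε * ‖dualWeight g κ k y‖ ≤ 8 * B * decayWeight y := by
    rcases le_total y 1 with hy1 | hy1
    · calc _ ≤ y ^ ε * (B * y ^ (-(1 / 4) : ℝ)) := by gcongr; exact (h κ hκ y hy0).1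
        _ = B * y ^ (ε + -(1 / 4)) := by rw [Real.rpow_add hy0]; ring
        _ ≤ B * y ^ (-(1 / 2) : ℝ) := by
            gcongr ?_ * ?_
            exact Real.rpow_le_rpow_of_exponent_ge hy0 hy1 (by linarith)
        _ ≤ B * (8 * decayWeight y) := by gcongr; exact rpow_neg_half_le_decayWeight hy0 hy1
        _ = _ := by ring
    · calc _ ≤ y ^ ε * (B * y ^ (-2 : ℝ)) := by gcongr; exact (h κ hκ y hy0).2
        _ = B * y ^ (ε + -2) := by rw [Real.rpow_add hy0]; ring
        _ ≤ B * y ^ (-(3 / 2) : ℝ) := by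
            gcongr ?_ * ?_
            exact Real.rpow_le_rpow_of_exponent_le hy1 (by linarith)
        _ ≤ B * (8 * decayWeight y) := by gcongr; exact rpow_neg_three_half_le_decayWeight hy1
        _ = _ := by ring
  rw [norm_mul, Complex.norm_real, Real.norm_eq_abs]
  calc _ ≤ (C * (n : ℝ) ^ ε) * ‖dualWeight g κ k y‖ := by
        gcongr
        exact (hc n).trans (hc' n hn.ne')
    _ = C * M ^ ε * (y ^ ε * ‖dualWeight g κ k y‖) := by
        rw [e, Real.mul_rpow hM.le hy0.le]; ring
    _ ≤ C * M ^ ε * (8 * B * decayWeight y) := by gcongr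
    _ = _ := by ring

end DualWeightBounds

section ConductorSums

/-- The mean square over the characters modulo `d` of conductor `q` and parity `κ`. -/
noncomputable def conductorSum (g : ℝ → ℂ) (k : ℕ) (X : ℝ) (d q κ : ℕ) : ℝ :=
  open Classical in
  ∑ χ ∈ Finset.univ.filter (fun χ : DirichletCharacter ℂ d => χ.conductor = q ∧ charParity χ = κ),
    ‖∑' n : ℕ, twist χ (divK k) n * g (n / X)‖ ^ 2

/-- The length of the dual sum for characters modulo `d` of conductor `q`. -/
noncomputable def dualLength (k : ℕ) (X : ℝ) (d q : ℕ) : ℝ :=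
  ((q * ∏ p ∈ d.primeFactors \ q.primeFactors, p : ℕ) : ℝ) ^ k / X

theorem conductorSum_nonneg (g : ℝ → ℂ) (k : ℕ) (X : ℝ) (d q κ : ℕ) : 0 ≤ conductorSum g k X d q κ :=
  Finset.sum_nonneg fun _ _ => sq_nonneg _

theorem prod_sdiff_primeFactors_pos (d q : ℕ) : 0 < ∏ p ∈ d.primeFactors \ q.primeFactors, p :=
  Finset.prod_pos fun _ hp => (Nat.prime_of_mem_primeFactors (Finset.mem_sdiff.1 hp).1).pos

theorem dualLength_pos (k : ℕ) {X : ℝ} (hX : 0 < X) (d : ℕ) {q : ℕ} (hq : q ≠ 0) : 0 < dualLength k X d q := by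
  have := prod_sdiff_primeFactors_pos d q
  have h2 : 0 < q * ∏ p ∈ d.primeFactors \ q.primeFactors, p := Nat.mul_pos (Nat.pos_of_ne_zero hq) this
  have h3 : (0 : ℝ) < (q * ∏ p ∈ d.primeFactors \ q.primeFactors, p : ℕ) := by exact_mod_cast h2
  unfold dualLength
  positivity

variable {g : ℝ → ℂ} (hg : ContDiff ℝ ∞ g) (hs : Function.support g ⊆ Set.Icc 1 2) (k : ℕ)
include hg hs

theorem conductorSum_eq {d q : ℕ} (κ : ℕ) (hd : d ≠ 0) (hqd : q ∣ d) (hq1 : q ≠ 1) {X : ℝ} (hX : 0 < X) :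
    conductorSum g k X d q κ = X ^ 2 / (q : ℝ) ^ k * ∑ ψ ∈ primChars q κ,
      ‖∑' n : ℕ, ψ⁻¹ (n : ZMod q) * ((dualCoeff (d.primeFactors \ q.primeFactors) k n : ℂ) *
        dualWeight g κ k (n / dualLength k X d q))‖ ^ 2 := by
  have hq0 : q ≠ 0 := by rintro rfl; exact hd (zero_dvd_iff.1 hqd)
  have : NeZero d := ⟨hd⟩
  have : NeZero q := ⟨hq0⟩
  rw [conductorSum, sum_conductor_eq hqd, Finset.mul_sum]
  refine Finset.sum_congr rfl fun ψ hψ => ?_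
  obtain ⟨h1, h2⟩ := mem_primChars.1 hψ
  rw [norm_tsum_twist_divK_eq hg hs k hq1 hqd h1 hX, mul_pow, h2]
  congr 1
  · rw [div_pow, ← Real.rpow_natCast (_ ^ _), ← Real.rpow_mul (by positivity)]
    congr 1
    rw [← Real.rpow_natCast]
    congr 1
    push_cast; ring
  · congr 2
    refine tsum_congr fun n => ?_
    rw [twist_apply, mul_assoc]; rfl

/-- The mean square over the characters of given conductor and its diagonal term. -/
theorem exists_abs_conductorSum_sub_le {ε : ℝ} (hε : 0 < ε) (hε1 : ε ≤ 1 / 2) : ∃ B : ℝ, 0 ≤ B ∧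
    ∀ d q κ : ℕ, κ ≤ 1 → d ≠ 0 → q ∣ d → q ≠ 1 → ∀ X : ℝ, 0 < X →
      |conductorSum g k X d q κ - X ^ 2 / (q : ℝ) ^ k * ((primChars q κ).card *
        ∑' v : ℕ, dualSmooth (d.primeFactors \ q.primeFactors) k v ^ 2 *
          diagSum (fun y => ‖dualWeight g κ k y‖ ^ 2) k d (dualLength k X d q / v))| ≤
      X ^ 2 / (q : ℝ) ^ k * (B * q.divisors.card * dualLength k X d q ^ (2 + 2 * ε)) := by
  obtain ⟨B, hB, h⟩ := exists_norm_coeff_mul_dualWeight_le hg hs k (2 * k) hε hε1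
  obtain ⟨B', hdec⟩ := exists_dualDecay hg hs k
  refine ⟨6 * B ^ 2, by positivity, fun d q κ hκ hd hqd hq1 X hX => ?_⟩
  have hq0 : q ≠ 0 := by rintro rfl; exact hd (zero_dvd_iff.1 hqd)
  have : NeZero q := ⟨hq0⟩
  have hM := dualLength_pos k hX d hq0
  set M := dualLength k X d q
  have hP : ∀ p ∈ d.primeFactors \ q.primeFactors, p.Prime := fun p hp =>
    Nat.prime_of_mem_primeFactors (Finset.mem_sdiff.1 hp).1
  have h1 := abs_sum_primChars_tsum_sub_le hκ hM _ (h κ hκ _ (abs_dualCoeff_le hP k) M hM) (q := q)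
  have e : ∑' n : ℕ, (if n.Coprime q then ‖((dualCoeff (d.primeFactors \ q.primeFactors) k n : ℝ) : ℂ) *
      dualWeight g κ k (n / M)‖ ^ 2 else 0) =
      ∑' v : ℕ, dualSmooth (d.primeFactors \ q.primeFactors) k v ^ 2 *
          diagSum (fun y => ‖dualWeight g κ k y‖ ^ 2) k d (M / v) := by
    rw [(tsum_dualCoeff_sq_eq (hdec κ hκ) hd hqd k hM).tsum_eq]
    refine tsum_congr fun n => ?_
    split_ifs
    · rw [norm_mul, mul_pow, Complex.norm_real, Real.norm_eq_abs, sq_abs]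
    · rfl
  rw [e] at h1
  rw [conductorSum_eq hg hs k κ hd hqd hq1 hX, ← mul_sub, abs_mul, abs_of_nonneg (by positivity)]
  refine mul_le_mul_of_nonneg_left (h1.trans_eq ?_) (by positivity)
  rw [Real.rpow_add hM, mul_comm 2 ε, Real.rpow_mul hM.le, Real.rpow_two, Real.rpow_two]
  ring

end ConductorSums

section DualPolynomial

/-- The arithmetic function vanishes outside the divisors of `a`. -/
def SupportedOnDivisors (f : ArithmeticFunction ℝ) (a : ℕ) : Prop := ∀ n, f n ≠ 0 → n ∣ a

theorem SupportedOnDivisors.one : SupportedOnDivisors 1 1 := fun n hn => by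
  by_contra h
  refine hn ?_
  rw [ArithmeticFunction.one_apply, if_neg]
  rintro rfl
  exact h dvd_rfl

theorem SupportedOnDivisors.mul {f g : ArithmeticFunction ℝ} {a b : ℕ} (hf : SupportedOnDivisors f a)
    (hg : SupportedOnDivisors g b) : SupportedOnDivisors (f * g) (a * b) := fun n hn => by
  rw [ArithmeticFunction.mul_apply] at hn
  obtain ⟨x, hx, hne⟩ := Finset.exists_ne_zero_of_sum_ne_zero hn
  rw [← (Nat.mem_divisorsAntidiagonal.1 hx).1]
  exact mul_dvd_mul (hf _ (left_ne_zero_of_mul hne)) (hg _ (right_ne_zero_of_mul hne))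

theorem SupportedOnDivisors.pow {f : ArithmeticFunction ℝ} {a : ℕ} (hf : SupportedOnDivisors f a) (k : ℕ) :
    SupportedOnDivisors (f ^ k) (a ^ k) := by
  induction k with
  | zero => simpa using SupportedOnDivisors.one
  | succ k ih => rw [pow_succ, pow_succ]; exact ih.mul hf

theorem supportedOnDivisors_prod_dualPrime (P : Finset ℕ) (hP : ∀ p ∈ P, p ≠ 0) :
    SupportedOnDivisors (∏ p ∈ P, dualPrime p) (∏ p ∈ P, p) := by
  induction P using Finset.induction_on with
  | empty => simpa using SupportedOnDivisors.one
  | insert p P hp ih =>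
    rw [Finset.prod_insert hp, Finset.prod_insert hp]
    refine SupportedOnDivisors.mul (fun n hn => ?_) (ih fun r hr => hP r (Finset.mem_insert_of_mem hr))
    by_contra h
    refine hn ?_
    rw [dualPrime, arith_sub_apply, ArithmeticFunction.smul_map, arithSingle_apply, ArithmeticFunction.one_apply,
      if_neg (show ¬ (n = p ∧ n ≠ 0) from fun h' => h (by rw [h'.1])),
      if_neg (show ¬ n = 1 from fun h' => h (by rw [h']; exact one_dvd _))]
    simp

/-- A nonnegative majorant of `dualPrime p`. -/
noncomputable def absDualPrime (p : ℕ) : ArithmeticFunction ℝ := arithSingle p + (p : ℝ)⁻¹ • 1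

theorem abs_dualPrime_le (p n : ℕ) : |dualPrime p n| ≤ absDualPrime p n := by
  rw [dualPrime, absDualPrime, arith_sub_apply, ArithmeticFunction.add_apply, ArithmeticFunction.smul_map,
    arithSingle_apply, ArithmeticFunction.one_apply]
  refine (abs_sub _ _).trans (le_of_eq ?_)
  congr 1
  · split_ifs <;> simp
  · split_ifs <;> simp

theorem abs_prod_dualPrime_le (P : Finset ℕ) (n : ℕ) : |(∏ p ∈ P, dualPrime p) n| ≤ (∏ p ∈ P, absDualPrime p) n := by
  induction P using Finset.induction_on generalizing n with
  | empty =>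
    rw [Finset.prod_empty, Finset.prod_empty, ArithmeticFunction.one_apply]
    split_ifs <;> simp
  | insert p P hp ih =>
    rw [Finset.prod_insert hp, Finset.prod_insert hp]
    exact abs_mul_arith_le (abs_dualPrime_le p) ih n

theorem hasSum_arith_one_rpow (σ : ℝ) : HasSum (fun n : ℕ => (1 : ArithmeticFunction ℝ) n * (n : ℝ) ^ (-σ)) 1 := by
  convert hasSum_ite_eq (1 : ℕ) (1 : ℝ) using 2 with n
  rw [ArithmeticFunction.one_apply]
  split_ifs with h
  · subst h; simp
  · simp

theorem hasSum_absDualPrime {p : ℕ} (hp : p ≠ 0) (σ : ℝ) :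
    HasSum (fun n : ℕ => absDualPrime p n * (n : ℝ) ^ (-σ)) ((p : ℝ) ^ (-σ) + (p : ℝ)⁻¹) := by
  have h1 : HasSum (fun n : ℕ => arithSingle p n * (n : ℝ) ^ (-σ)) ((p : ℝ) ^ (-σ)) := by
    convert hasSum_ite_eq (p : ℕ) ((p : ℝ) ^ (-σ)) using 2 with n
    rw [arithSingle_apply]
    by_cases h : n = p
    · subst h; simp [hp]
    · simp [h]
  have h2 := h1.add ((hasSum_arith_one_rpow σ).mul_left (p : ℝ)⁻¹)
  rw [mul_one] at h2
  refine h2.congr_fun fun n => ?_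
  rw [absDualPrime, ArithmeticFunction.add_apply, ArithmeticFunction.smul_map, smul_eq_mul]
  ring

theorem hasSum_absDual_pow {P : Finset ℕ} (hP : ∀ p ∈ P, p ≠ 0) (k : ℕ) (σ : ℝ) :
    HasSum (fun n : ℕ => ((∏ p ∈ P, absDualPrime p) ^ k) n * (n : ℝ) ^ (-σ))
      ((∏ p ∈ P, ((p : ℝ) ^ (-σ) + (p : ℝ)⁻¹)) ^ k) := by
  have h : HasSum (fun n : ℕ => (∏ p ∈ P, absDualPrime p) n * (n : ℝ) ^ (-σ))
      (∏ p ∈ P, ((p : ℝ) ^ (-σ) + (p : ℝ)⁻¹)) := by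
    induction P using Finset.induction_on with
    | empty => simpa using hasSum_arith_one_rpow σ
    | insert p P hp ih =>
      rw [Finset.prod_insert hp, Finset.prod_insert hp]
      exact hasSum_mul_arith_rpow (hasSum_absDualPrime (hP p (Finset.mem_insert_self _ _)) σ)
        (ih fun r hr => hP r (Finset.mem_insert_of_mem hr))
  induction k with
  | zero => simpa using hasSum_arith_one_rpow σ
  | succ k ih => rw [pow_succ, pow_succ]; exact hasSum_mul_arith_rpow ih h

theorem sum_abs_dual_pow_le {P : Finset ℕ} (hP : ∀ p ∈ P, p ≠ 0) (k : ℕ) (S : Finset ℕ) :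
    ∑ v ∈ S, |((∏ p ∈ P, dualPrime p) ^ k) v| ≤ ((2 : ℝ) ^ P.card) ^ k := by
  have h := hasSum_absDual_pow hP k 0
  have h0 : ∀ n, |((∏ p ∈ P, dualPrime p) ^ k) n| ≤ ((∏ p ∈ P, absDualPrime p) ^ k) n :=
    abs_pow_arith_le (abs_prod_dualPrime_le P) k
  calc _ ≤ ∑ v ∈ S, ((∏ p ∈ P, absDualPrime p) ^ k) v * (v : ℝ) ^ (-0 : ℝ) := by
        refine Finset.sum_le_sum fun v _ => ?_
        simpa using h0 v
    _ ≤ _ := sum_le_hasSum _ (fun v _ => mul_nonneg ((abs_nonneg _).trans (h0 v)) (by positivity)) h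
    _ ≤ _ := by
        refine pow_le_pow_left₀ (Finset.prod_nonneg fun _ _ => by positivity) ?_ k
        refine (Finset.prod_le_prod (g := fun _ => (2 : ℝ)) (fun _ _ => by positivity) fun p hp => ?_).trans_eq (by rw [Finset.prod_const])
        have : (p : ℝ)⁻¹ ≤ 1 := inv_le_one_of_one_le₀ (by exact_mod_cast Nat.one_le_iff_ne_zero.2 (hP p hp))
        simp
        linarith

theorem sum_abs_dual_pow_div_le {P : Finset ℕ} (hP : ∀ p ∈ P, p ≠ 0) (k : ℕ) (S : Finset ℕ) :
    ∑ v ∈ S, |((∏ p ∈ P, dualPrime p) ^ k) v| * (v : ℝ)⁻¹ ≤ ((2 : ℝ) ^ P.card) ^ k / (∏ p ∈ P, (p : ℝ)) ^ k := by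
  have h := hasSum_absDual_pow hP k 1
  have h0 : ∀ n, |((∏ p ∈ P, dualPrime p) ^ k) n| ≤ ((∏ p ∈ P, absDualPrime p) ^ k) n :=
    abs_pow_arith_le (abs_prod_dualPrime_le P) k
  calc _ ≤ ∑ v ∈ S, ((∏ p ∈ P, absDualPrime p) ^ k) v * (v : ℝ) ^ (-1 : ℝ) := by
        refine Finset.sum_le_sum fun v _ => ?_
        rw [Real.rpow_neg_one]
        exact mul_le_mul_of_nonneg_right (h0 v) (by positivity)
    _ ≤ _ := sum_le_hasSum _ (fun v _ => mul_nonneg ((abs_nonneg _).trans (h0 v)) (by positivity)) h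
    _ = _ := by
        rw [← div_pow]
        congr 1
        rw [← Finset.prod_const, ← Finset.prod_div_distrib]
        refine Finset.prod_congr rfl fun p _ => ?_
        rw [Real.rpow_neg_one]; ring

end DualPolynomial

section SmallConductor

variable {g : ℝ → ℂ} (hg : ContDiff ℝ ∞ g) (hs : Function.support g ⊆ Set.Icc 1 2) (k : ℕ)

theorem card_primChars_le {q κ : ℕ} [NeZero q] : (primChars q κ).card ≤ q.totient := by
  rw [← DirichletCharacter.card_eq_totient_of_hasEnoughRootsOfUnity ℂ q, Nat.card_eq_fintype_card]
  exact Finset.card_le_univ _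

theorem prod_sdiff_mul_dvd {d q : ℕ} (hd : d ≠ 0) (hqd : q ∣ d) : q * ∏ p ∈ d.primeFactors \ q.primeFactors, p ∣ d := by
  have hq0 : q ≠ 0 := by rintro rfl; exact hd (zero_dvd_iff.1 hqd)
  refine Nat.Coprime.mul_dvd_of_dvd_of_dvd (Nat.Coprime.prod_right fun p hp => ?_) hqd
    ((Finset.prod_dvd_prod_of_subset _ _ _ Finset.sdiff_subset).trans (Nat.prod_primeFactors_dvd d))
  have hpp := Nat.prime_of_mem_primeFactors (Finset.mem_sdiff.1 hp).1
  exact ((Nat.Prime.coprime_iff_not_dvd hpp).2 fun h =>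
    (Finset.mem_sdiff.1 hp).2 (Nat.mem_primeFactors.2 ⟨hpp, h, hq0⟩)).symm

theorem two_pow_card_primeFactors_le_card_divisors {d : ℕ} (hd : d ≠ 0) : 2 ^ d.primeFactors.card ≤ d.divisors.card := by
  rw [Nat.card_divisors hd, ← Finset.prod_const]
  refine Finset.prod_le_prod' fun p hp => ?_
  have := (Nat.prime_of_mem_primeFactors hp).factorization_pos_of_dvd hd (Nat.dvd_of_mem_primeFactors hp)
  omega

include hg hs

theorem tsum_twist_dual_convolution {q κ : ℕ} (hκ : κ ≤ 1) {P : Finset ℕ} (hP : ∀ p ∈ P, p ≠ 0)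
    (χ : DirichletCharacter ℂ q) {M : ℝ} (hM : 0 < M) :
    ∑' n : ℕ, χ (n : ZMod q) * ((dualCoeff P k n : ℂ) * dualWeight g κ k (n / M)) =
      ∑ v ∈ ((∏ p ∈ P, p) ^ k).divisors, χ (v : ZMod q) * (((∏ p ∈ P, dualPrime p) ^ k) v : ℂ) *
        ∑' m : ℕ, χ (m : ZMod q) * ((divK k m : ℂ) * dualWeight g κ k (m / (M / v))) := by
  obtain ⟨B, hB, hb⟩ := exists_dualWeight_bounds hg hs k
  set lam := (∏ p ∈ P, dualPrime p) ^ k with hlam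
  have hsupp : ∀ v ∉ ((∏ p ∈ P, p) ^ k).divisors, lam v = 0 := by
    intro v hv
    by_contra h
    exact hv (Nat.mem_divisors.2 ⟨((supportedOnDivisors_prod_dualPrime P hP).pow k) v h,
      pow_ne_zero _ (Finset.prod_ne_zero_iff.2 hP)⟩)
  have hsum : Summable fun x : ℕ × ℕ => twist χ lam x.1 * twist χ (divK k) x.2 * dualWeight g κ k ((x.1 * x.2 : ℕ) / M) := by
    have h1 : Summable fun v : ℕ => lam v * (v : ℝ) ^ (-2 : ℝ) :=
      summable_of_ne_finset_zero (s := ((∏ p ∈ P, p) ^ k).divisors) fun v hv => by rw [hsupp v hv, zero_mul]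
    have h2 := (hasSum_divK k (s := 2) (by norm_num)).summable
    have h3 := (summable_mul_of_summable_norm h1.norm h2.norm).norm
    refine Summable.of_norm_bounded (h3.mul_left (B * M ^ (2 : ℝ))) fun x => ?_
    rcases Nat.eq_zero_or_pos x.1 with h0 | h0
    · simp [h0]
    rcases Nat.eq_zero_or_pos x.2 with h0' | h0'
    · simp [h0']
    have p1 : (0 : ℝ) < x.1 := by exact_mod_cast h0
    have p2 : (0 : ℝ) < x.2 := by exact_mod_cast h0'
    have h4 := (hb κ hκ ((x.1 * x.2 : ℕ) / M) (by push_cast; positivity)).2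
    rw [norm_mul, norm_mul]
    calc _ ≤ |lam x.1| * |divK k x.2| * (B * ((x.1 * x.2 : ℕ) / M) ^ (-2 : ℝ)) := by
          gcongr
          · exact norm_twist_le _ _ _
          · exact norm_twist_le _ _ _
      _ = _ := by
          push_cast
          rw [Real.div_rpow (by positivity) hM.le, Real.mul_rpow p1.le p2.le, Real.rpow_neg hM.le, Real.norm_eq_abs,
            abs_mul, abs_mul, abs_mul, abs_of_nonneg (Real.rpow_nonneg p1.le _), abs_of_nonneg (Real.rpow_nonneg p2.le _),
            div_inv_eq_mul]
          ring
  have h1 := hasSum_mul_arith (twist χ lam) (twist χ (divK k)) (fun n : ℕ => dualWeight g κ k (n / M)) hsum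
  rw [← twist_mul, hlam, ← dualCoeff, ← hlam] at h1
  have e1 : ∀ n : ℕ, χ (n : ZMod q) * ((dualCoeff P k n : ℂ) * dualWeight g κ k (n / M)) =
      twist χ (dualCoeff P k) n * dualWeight g κ k (n / M) := fun n => by rw [twist_apply]; ring
  simp only [e1]
  rw [h1.tsum_eq, hsum.tsum_prod, tsum_eq_sum (s := ((∏ p ∈ P, p) ^ k).divisors) fun v hv => by
    simp [twist_apply, hsupp v hv]]
  refine Finset.sum_congr rfl fun v hv => ?_
  have hv0 : (v : ℝ) ≠ 0 := by exact_mod_cast (Nat.pos_of_mem_divisors hv).ne'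
  rw [← tsum_mul_left]
  refine tsum_congr fun m => ?_
  have e2 : ((v * m : ℕ) : ℝ) / M = m / (M / v) := by push_cast; field_simp
  rw [e2, twist_apply, twist_apply]; ring

theorem exists_sum_primChars_divK_le {ε : ℝ} (hε : 0 < ε) (hε1 : ε ≤ 1 / 2) : ∃ C : ℝ, 0 ≤ C ∧
    ∀ q κ : ℕ, κ ≤ 1 → q ≠ 0 → ∀ Z M : ℝ, 1 ≤ Z → 0 < M → M ≤ Z →
      ∑ ψ ∈ primChars q κ, ‖∑' m : ℕ, ψ⁻¹ (m : ZMod q) * ((divK k m : ℂ) * dualWeight g κ k (m / M))‖ ^ 2 ≤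
        C * Z ^ (2 * ε) * q.divisors.card * (q * M + M ^ 2) := by
  obtain ⟨B, hB, h⟩ := exists_norm_coeff_mul_dualWeight_le hg hs k k hε hε1
  obtain ⟨B', hdec⟩ := exists_dualDecay hg hs k
  obtain ⟨C0, hC0, h0⟩ := exists_diagSum_le (hdec 0 zero_le_one) k hε (by linarith)
  obtain ⟨C1, hC1, h1⟩ := exists_diagSum_le (hdec 1 le_rfl) k hε (by linarith)
  refine ⟨C0 + C1 + 6 * B ^ 2, by positivity, fun q κ hκ hq0 Z M hZ hM hMZ => ?_⟩
  have : NeZero q := ⟨hq0⟩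
  have hdiag : ∀ d, diagSum (fun y => ‖dualWeight g κ k y‖ ^ 2) k d M ≤ (C0 + C1) * M ^ (1 + ε) := by
    intro d
    rcases Nat.le_one_iff_eq_zero_or_eq_one.1 hκ with rfl | rfl
    · exact (h0 d M hM).trans (by gcongr; linarith)
    · exact (h1 d M hM).trans (by gcongr; linarith)
  have h2 := abs_sum_primChars_tsum_sub_le hκ hM _
    (h κ hκ (divK k) (fun n => (abs_of_nonneg (divK_nonneg k n)).le) M hM) (q := q)
  have h3 : ∑' n : ℕ, (if n.Coprime q then ‖((divK k n : ℝ) : ℂ) * dualWeight g κ k (n / M)‖ ^ 2 else 0) =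
      diagSum (fun y => ‖dualWeight g κ k y‖ ^ 2) k q M := by
    refine tsum_congr fun n => ?_
    rw [tauSq_eq, tauK_eq_divK]
    split_ifs
    · rw [norm_mul, mul_pow, Complex.norm_real, Real.norm_eq_abs, sq_abs]
    · simp
  rw [h3] at h2
  have h4 := (abs_le.1 h2).2
  have hτ : (1 : ℝ) ≤ q.divisors.card := by
    exact_mod_cast Finset.card_pos.2 ⟨1, Nat.one_mem_divisors.2 hq0⟩
  have hcard : ((primChars q κ).card : ℝ) ≤ q := by
    exact_mod_cast card_primChars_le.trans (Nat.totient_le q)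
  have hMε : M ^ ε ≤ Z ^ ε := Real.rpow_le_rpow hM.le hMZ hε.le
  have hZε : 1 ≤ Z ^ ε := Real.one_le_rpow hZ hε.le
  have e : Z ^ (2 * ε) = (Z ^ ε) ^ 2 := by rw [mul_comm, Real.rpow_mul (by linarith), Real.rpow_two]
  have h5 : (primChars q κ).card * diagSum (fun y => ‖dualWeight g κ k y‖ ^ 2) k q M ≤
      (C0 + C1) * Z ^ (2 * ε) * q.divisors.card * (q * M) := by
    calc _ ≤ (q : ℝ) * ((C0 + C1) * M ^ (1 + ε)) := by
          gcongr
          · exact tsum_nonneg fun m => mul_nonneg (tauSq_nonneg _ _ _) (sq_nonneg _)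
          · exact hdiag q
      _ = (C0 + C1) * (M ^ ε * 1) * 1 * (q * M) := by rw [Real.rpow_add hM, Real.rpow_one]; ring
      _ ≤ (C0 + C1) * (Z ^ ε * Z ^ ε) * q.divisors.card * (q * M) := by gcongr
      _ = _ := by rw [e]; ring
  have h6 : 6 * q.divisors.card * (B * M ^ ε) ^ 2 * M ^ 2 ≤ 6 * B ^ 2 * Z ^ (2 * ε) * q.divisors.card * M ^ 2 := by
    calc _ ≤ 6 * q.divisors.card * (B * Z ^ ε) ^ 2 * M ^ 2 := by gcongr
      _ = _ := by rw [e]; ring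
  have h7 : 0 ≤ (C0 + C1) * Z ^ (2 * ε) * q.divisors.card * M ^ 2 := by positivity
  have h8 : 0 ≤ 6 * B ^ 2 * Z ^ (2 * ε) * q.divisors.card * (q * M) := by positivity
  calc _ ≤ (C0 + C1) * Z ^ (2 * ε) * q.divisors.card * (q * M) +
        6 * B ^ 2 * Z ^ (2 * ε) * q.divisors.card * M ^ 2 := by linarith
    _ ≤ ((C0 + C1) * Z ^ (2 * ε) * q.divisors.card * (q * M) + 6 * B ^ 2 * Z ^ (2 * ε) * q.divisors.card * M ^ 2) +
        ((C0 + C1) * Z ^ (2 * ε) * q.divisors.card * M ^ 2 + 6 * B ^ 2 * Z ^ (2 * ε) * q.divisors.card * (q * M)) := by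
        linarith
    _ = _ := by ring

/-- The mean square over the characters modulo `d` of conductor `q`, upper bound. -/
theorem exists_conductorSum_le {ε : ℝ} (hε : 0 < ε) (hε1 : ε ≤ 1 / 2) : ∃ C : ℝ, 0 ≤ C ∧
    ∀ d q κ : ℕ, κ ≤ 1 → d ≠ 0 → q ∣ d → q ≠ 1 → ∀ X : ℝ, 1 ≤ X →
      conductorSum g k X d q κ ≤ C * ((d : ℝ) ^ k) ^ (2 * ε) * (d.divisors.card : ℝ) ^ (2 * k + 1) * (X * q + (q : ℝ) ^ k) := by
  obtain ⟨C, hC, h⟩ := exists_sum_primChars_divK_le hg hs k hε hε1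
  refine ⟨C, hC, fun d q κ hκ hd hqd hq1 X hX => ?_⟩
  have hq0 : q ≠ 0 := by rintro rfl; exact hd (zero_dvd_iff.1 hqd)
  have hq0' : (0 : ℝ) < q := by positivity
  set P := d.primeFactors \ q.primeFactors with hPdef
  have hPp : ∀ p ∈ P, p.Prime := fun p hp => Nat.prime_of_mem_primeFactors (Finset.mem_sdiff.1 hp).1
  have hP : ∀ p ∈ P, p ≠ 0 := fun p hp => (hPp p hp).ne_zero
  have hM := dualLength_pos k (by linarith : 0 < X) d hq0
  set M := dualLength k X d q with hMdef
  have he : (0 : ℝ) < ∏ p ∈ P, (p : ℝ) := Finset.prod_pos fun p hp => by exact_mod_cast (hPp p hp).pos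
  have hMe : M = ((q : ℝ) * ∏ p ∈ P, (p : ℝ)) ^ k / X := by rw [hMdef, dualLength]; push_cast; rfl
  have hZ : (1 : ℝ) ≤ (d : ℝ) ^ k := one_le_pow₀ (by exact_mod_cast Nat.one_le_iff_ne_zero.2 hd)
  have hMZ : M ≤ (d : ℝ) ^ k := by
    rw [hMdef, dualLength]
    refine (div_le_self (by positivity) hX).trans ?_
    gcongr
    exact Nat.le_of_dvd (Nat.pos_of_ne_zero hd) (prod_sdiff_mul_dvd hd hqd)
  set Z := (d : ℝ) ^ k
  set S := ((∏ p ∈ P, p) ^ k).divisors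
  set lam := (∏ p ∈ P, dualPrime p) ^ k
  set U : ℕ → DirichletCharacter ℂ q → ℂ := fun v ψ =>
    ∑' m : ℕ, ψ⁻¹ (m : ZMod q) * ((divK k m : ℂ) * dualWeight g κ k (m / (M / v))) with hU
  set T : ℝ := (2 : ℝ) ^ P.card with hT
  have hT0 : 0 < T := by positivity
  have hcs : ∀ ψ : DirichletCharacter ℂ q, ‖∑' n : ℕ, ψ⁻¹ (n : ZMod q) * ((dualCoeff P k n : ℂ) * dualWeight g κ k (n / M))‖ ^ 2 ≤
      (∑ v ∈ S, |lam v| * (v : ℝ)⁻¹) * ∑ v ∈ S, |lam v| * v * ‖U v ψ‖ ^ 2 := by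
    intro ψ
    rw [tsum_twist_dual_convolution hg hs k hκ hP ψ⁻¹ hM]
    refine (pow_le_pow_left₀ (norm_nonneg _) (norm_sum_le (E := ℂ) _ _) 2).trans ?_
    calc _ ≤ (∑ v ∈ S, |lam v| * ‖U v ψ‖) ^ 2 := by
          gcongr with v hv
          rw [norm_mul, norm_mul, Complex.norm_real, Real.norm_eq_abs]
          gcongr
          exact mul_le_of_le_one_left (abs_nonneg _) (ψ⁻¹.norm_le_one _)
      _ ≤ _ := by
          refine Finset.sum_sq_le_sum_mul_sum_of_sq_le_mul S (fun v _ => by positivity) (fun v _ => by positivity) fun v hv => ?_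
          have : (v : ℝ) ≠ 0 := by exact_mod_cast (Nat.pos_of_mem_divisors hv).ne'
          exact le_of_eq (by field_simp)
  have hτ1 : (1 : ℝ) ≤ d.divisors.card := by
    exact_mod_cast Finset.card_pos.2 ⟨1, Nat.one_mem_divisors.2 hd⟩
  have hTτ : T ≤ d.divisors.card := by
    have h1 : P.card ≤ d.primeFactors.card := Finset.card_le_card Finset.sdiff_subset
    have := (Nat.pow_le_pow_right two_pos h1).trans (two_pow_card_primeFactors_le_card_divisors hd)
    rw [hT]; exact_mod_cast this
  have hqτ : (q.divisors.card : ℝ) ≤ d.divisors.card := by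
    exact_mod_cast Finset.card_le_card (Nat.divisors_subset_of_dvd hd hqd)
  rw [conductorSum_eq hg hs k κ hd hqd hq1 (by linarith)]
  calc _ ≤ X ^ 2 / (q : ℝ) ^ k * ∑ ψ ∈ primChars q κ, (∑ v ∈ S, |lam v| * (v : ℝ)⁻¹) * ∑ v ∈ S, |lam v| * v * ‖U v ψ‖ ^ 2 := by
        gcongr with ψ _
        exact hcs ψ
    _ = X ^ 2 / (q : ℝ) ^ k * ((∑ v ∈ S, |lam v| * (v : ℝ)⁻¹) * ∑ v ∈ S, |lam v| * v * ∑ ψ ∈ primChars q κ, ‖U v ψ‖ ^ 2) := by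
        rw [← Finset.mul_sum, Finset.sum_comm]
        simp only [Finset.mul_sum]
    _ ≤ X ^ 2 / (q : ℝ) ^ k * ((T ^ k / (∏ p ∈ P, (p : ℝ)) ^ k) * ∑ v ∈ S, |lam v| * v *
        (C * Z ^ (2 * ε) * d.divisors.card * (q * (M / v) + (M / v) ^ 2))) := by
        gcongr with v hv
        · exact sum_abs_dual_pow_div_le hP k S
        · have hv0 : (1 : ℝ) ≤ v := by exact_mod_cast Nat.pos_of_mem_divisors hv
          refine (h q κ hκ hq0 Z (M / v) hZ (by positivity) ((div_le_self hM.le hv0).trans hMZ)).trans ?_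
          gcongr
    _ = X ^ 2 / (q : ℝ) ^ k * ((T ^ k / (∏ p ∈ P, (p : ℝ)) ^ k) * (C * Z ^ (2 * ε) * d.divisors.card *
        (q * M * (∑ v ∈ S, |lam v|) + M ^ 2 * ∑ v ∈ S, |lam v| * (v : ℝ)⁻¹))) := by
        congr 2
        rw [Finset.mul_sum, Finset.mul_sum, ← Finset.sum_add_distrib, Finset.mul_sum]
        refine Finset.sum_congr rfl fun v hv => ?_
        have : (v : ℝ) ≠ 0 := by exact_mod_cast (Nat.pos_of_mem_divisors hv).ne'
        field_simp
    _ ≤ X ^ 2 / (q : ℝ) ^ k * ((T ^ k / (∏ p ∈ P, (p : ℝ)) ^ k) * (C * Z ^ (2 * ε) * d.divisors.card *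
        (q * M * T ^ k + M ^ 2 * (T ^ k / (∏ p ∈ P, (p : ℝ)) ^ k)))) := by
        gcongr
        · exact sum_abs_dual_pow_le hP k S
        · exact sum_abs_dual_pow_div_le hP k S
    _ = C * Z ^ (2 * ε) * (T ^ (2 * k) * d.divisors.card) * (X * q + (q : ℝ) ^ k) := by
        rw [hMe, mul_pow, mul_comm 2 k, pow_mul]
        have : X ≠ 0 := by linarith
        field_simp
    _ ≤ C * Z ^ (2 * ε) * ((d.divisors.card : ℝ) ^ (2 * k) * d.divisors.card) * (X * q + (q : ℝ) ^ k) := by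
        gcongr
    _ = _ := by rw [pow_succ]

end SmallConductor

section DivisorEstimates

theorem exists_card_divisors_pow_le (J : ℕ) {ε : ℝ} (hε : 0 < ε) :
    ∃ C : ℝ, 1 ≤ C ∧ ∀ n : ℕ, n ≠ 0 → (n.divisors.card : ℝ) ^ J ≤ C * (n : ℝ) ^ ε := by
  obtain ⟨C, hC, h⟩ := exists_card_divisors_le (ε := ε / (J + 1)) (by positivity)
  refine ⟨C ^ J, one_le_pow₀ hC, fun n hn => ?_⟩
  have hn1 : (1 : ℝ) ≤ n := by exact_mod_cast Nat.one_le_iff_ne_zero.2 hn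
  refine (pow_le_pow_left₀ (by positivity) (h n hn) J).trans ?_
  rw [mul_pow, ← Real.rpow_natCast ((n : ℝ) ^ _), ← Real.rpow_mul (by positivity)]
  refine mul_le_mul_of_nonneg_left (Real.rpow_le_rpow_of_exponent_le hn1 ?_) (by positivity)
  rw [div_mul_eq_mul_div, div_le_iff₀ (by positivity)]
  nlinarith

theorem le_totient_mul_card_divisors {d : ℕ} (hd : d ≠ 0) : d ≤ d.totient * d.divisors.card := by
  have h1 := Nat.totient_mul_prod_primeFactors d
  have h2 : ∏ p ∈ d.primeFactors, p ≤ d.divisors.card * ∏ p ∈ d.primeFactors, (p - 1) := by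
    refine le_trans ?_ (Nat.mul_le_mul_right _ (two_pow_card_primeFactors_le_card_divisors hd))
    rw [← Finset.prod_const, ← Finset.prod_mul_distrib]
    refine Finset.prod_le_prod' fun p hp => ?_
    have := (Nat.prime_of_mem_primeFactors hp).two_le
    omega
  have h3 : 0 < ∏ p ∈ d.primeFactors, (p - 1) := Finset.prod_pos fun p hp => by
    have := (Nat.prime_of_mem_primeFactors hp).two_le
    omega
  refine Nat.le_of_mul_le_mul_right ?_ h3
  calc d * ∏ p ∈ d.primeFactors, (p - 1) = d.totient * ∏ p ∈ d.primeFactors, p := h1.symm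
    _ ≤ d.totient * (d.divisors.card * ∏ p ∈ d.primeFactors, (p - 1)) := Nat.mul_le_mul_left _ h2
    _ = _ := by ring

theorem one_div_totient_le {d : ℕ} (hd : d ≠ 0) : 1 / (d.totient : ℝ) ≤ d.divisors.card / d := by
  have h1 : (0 : ℝ) < d.totient := by exact_mod_cast Nat.totient_pos.2 (Nat.pos_of_ne_zero hd)
  have h2 : (0 : ℝ) < d := by exact_mod_cast Nat.pos_of_ne_zero hd
  rw [div_le_div_iff₀ h1 h2]
  have := le_totient_mul_card_divisors hd
  rw [one_mul, mul_comm]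
  exact_mod_cast this

theorem eventually_const_mul_rpow_neg_le (C : ℝ) {θ ε : ℝ} (hθ : 0 < θ) (hε : 0 < ε) :
    ∀ᶠ d : ℕ in atTop, C * (d : ℝ) ^ (-θ) ≤ ε := by
  have h := ((tendsto_rpow_neg_atTop hθ).comp tendsto_natCast_atTop_atTop).const_mul C
  rw [mul_zero] at h
  exact (h.eventually (gt_mem_nhds hε)).mono fun d hd => le_of_lt hd

theorem eventually_const_mul_log_rpow_neg_le (C : ℝ) {θ ε : ℝ} (hθ : 0 < θ) (hε : 0 < ε) :
    ∀ᶠ d : ℕ in atTop, C * (Real.log d) ^ (-θ) ≤ ε := by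
  have h := ((tendsto_rpow_neg_atTop hθ).comp (Real.tendsto_log_atTop.comp tendsto_natCast_atTop_atTop)).const_mul C
  rw [mul_zero] at h
  exact (h.eventually (gt_mem_nhds hε)).mono fun d hd => le_of_lt hd

end DivisorEstimates

section VarianceDecomposition

theorem sum_parity_range_two {d : ℕ} {E : Type*} [AddCommMonoid E] (f : DirichletCharacter ℂ d → E) :
    open Classical in
    ∑ κ ∈ Finset.range 2, ∑ χ ∈ Finset.univ.filter (fun χ : DirichletCharacter ℂ d => charParity χ = κ), f χ = ∑ χ, f χ := by
  classical
  exact Finset.sum_fiberwise_of_maps_to (fun χ _ => Finset.mem_range.2 (Nat.lt_succ_of_le (charParity_le_one χ))) f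

theorem totient_eq_sum_card_primChars {d : ℕ} (hd : d ≠ 0) :
    (d.totient : ℝ) = ∑ q ∈ d.divisors, ∑ κ ∈ Finset.range 2, ((primChars q κ).card : ℝ) := by
  classical
  have : NeZero d := ⟨hd⟩
  have h1 : (d.totient : ℝ) = ∑ χ : DirichletCharacter ℂ d, (1 : ℝ) := by
    rw [← DirichletCharacter.card_eq_totient_of_hasEnoughRootsOfUnity ℂ d, Nat.card_eq_fintype_card]
    simp
  rw [h1, ← sum_parity_range_two, Finset.sum_comm]
  refine Finset.sum_congr rfl fun κ _ => ?_
  rw [sum_parity_eq_sum_divisors]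
  refine Finset.sum_congr rfl fun q hq => ?_
  rw [sum_conductor_eq (Nat.dvd_of_mem_divisors hq)]
  simp

theorem smoothVariance_eq_sum_conductorSum {w : ℝ → ℝ} (hs : Function.support w ⊆ Set.Icc 1 2) (k : ℕ) {X : ℝ} (hX : 0 < X)
    {d : ℕ} (hd : d ≠ 0) :
    smoothVariance w k X d = 1 / (d.totient : ℝ) * ∑ q ∈ d.divisors.erase 1, ∑ κ ∈ Finset.range 2,
      conductorSum (fun y => (w y : ℂ)) k X d q κ := by
  classical
  have : NeZero d := ⟨hd⟩
  rw [smoothVariance_eq hs k hX d]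
  congr 1
  set F : DirichletCharacter ℂ d → ℝ := fun χ => if χ = 1 then 0 else
    ‖∑' n : ℕ, twist χ (divK k) n * ((w (n / X) : ℝ) : ℂ)‖ ^ 2 with hF
  have h1 : ∑ χ ∈ Finset.univ.erase (1 : DirichletCharacter ℂ d),
      ‖∑' n : ℕ, twist χ (divK k) n * ((w (n / X) : ℝ) : ℂ)‖ ^ 2 = ∑ χ, F χ := by
    rw [← Finset.add_sum_erase _ F (Finset.mem_univ (1 : DirichletCharacter ℂ d))]
    simp only [hF, if_true, zero_add]
    refine Finset.sum_congr rfl fun χ hχ => ?_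
    rw [if_neg (Finset.ne_of_mem_erase hχ)]
  rw [h1, ← sum_parity_range_two F, Finset.sum_comm]
  refine Finset.sum_congr rfl fun κ _ => ?_
  rw [sum_parity_eq_sum_divisors, ← Finset.add_sum_erase _ _ (Nat.one_mem_divisors.2 hd),
    Finset.sum_eq_zero (s := Finset.univ.filter _), zero_add]
  · refine Finset.sum_congr rfl fun q hq => Finset.sum_congr rfl fun χ hχ => ?_
    have h2 : χ.conductor = q := (Finset.mem_filter.1 hχ).2.1
    simp only [hF]
    rw [if_neg]
    rintro rfl
    rw [DirichletCharacter.conductor_one] at h2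
    exact Finset.ne_of_mem_erase hq h2.symm
  · intro χ hχ
    have h2 : χ.conductor = 1 := (Finset.mem_filter.1 hχ).2.1
    simp only [hF]
    rw [if_pos ((DirichletCharacter.eq_one_iff_conductor_eq_one (χ := χ)).2 h2)]

theorem sum_card_primChars_le (q : ℕ) (hq : q ≠ 0) : ∑ κ ∈ Finset.range 2, ((primChars q κ).card : ℝ) ≤ q := by
  refine le_trans ?_ (Nat.cast_le.2 (Nat.totient_le q))
  rw [totient_eq_sum_card_primChars hq]
  exact Finset.single_le_sum (f := fun q => ∑ κ ∈ Finset.range 2, ((primChars q κ).card : ℝ))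
    (fun _ _ => Finset.sum_nonneg fun _ _ => Nat.cast_nonneg _) (Nat.mem_divisors_self q hq)

end VarianceDecomposition

section LargeConductor

theorem dualLength_bounds {k d q : ℕ} {c η : ℝ} (hd : 1 < d) (hqd : q ∣ d) (hq : (d : ℝ) ^ (1 - η) ≤ q) :
    Real.log (dualLength k ((d : ℝ) ^ c) d q) ≤ (k - c) * Real.log d ∧
    (k - c) * Real.log d - k * η * Real.log d ≤ Real.log (dualLength k ((d : ℝ) ^ c) d q) ∧
    (∏ p ∈ d.primeFactors \ q.primeFactors, (p : ℝ)) ≤ (d : ℝ) ^ η := by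
  have hd0 : (0 : ℝ) < d := by exact_mod_cast (zero_lt_one.trans hd)
  have hdne : d ≠ 0 := by omega
  have hq0 : (0 : ℝ) < q := (Real.rpow_pos_of_pos hd0 _).trans_le hq
  set E := ∏ p ∈ d.primeFactors \ q.primeFactors, p with hE
  have hE0 : 0 < E := prod_sdiff_primeFactors_pos d q
  have hE1 : (1 : ℝ) ≤ E := by exact_mod_cast hE0
  have hqE : (q : ℝ) * E ≤ d := by exact_mod_cast Nat.le_of_dvd (Nat.pos_of_ne_zero hdne) (prod_sdiff_mul_dvd hdne hqd)
  have hqE2 : (d : ℝ) ^ (1 - η) ≤ q * E := hq.trans (le_mul_of_one_le_right hq0.le hE1)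
  have hlog : Real.log (dualLength k ((d : ℝ) ^ c) d q) = k * Real.log (q * E) - c * Real.log d := by
    rw [dualLength, ← hE, Real.log_div (by push_cast; positivity) (by positivity), Real.log_pow, Real.log_rpow hd0]
    push_cast; rfl
  have h1 : Real.log (q * E) ≤ Real.log d := Real.log_le_log (by positivity) hqE
  have h2 : (1 - η) * Real.log d ≤ Real.log (q * E) := by
    rw [← Real.log_rpow hd0]; exact Real.log_le_log (by positivity) hqE2
  have hk : (0 : ℝ) ≤ k := Nat.cast_nonneg k
  refine ⟨?_, ?_, ?_⟩
  · rw [hlog]; nlinarith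
  · rw [hlog]; nlinarith
  · have e : (∏ p ∈ d.primeFactors \ q.primeFactors, (p : ℝ)) = E := by rw [hE]; push_cast; rfl
    rw [e]
    have h3 : (d : ℝ) ^ (1 - η) * E ≤ (d : ℝ) ^ (1 - η) * (d : ℝ) ^ η := by
      rw [← Real.rpow_add hd0, sub_add_cancel, Real.rpow_one]
      exact (mul_le_mul_of_nonneg_right hq (by positivity)).trans hqE
    exact le_of_mul_le_mul_left h3 (by positivity)

set_option maxHeartbeats 1000000 in
theorem eventually_abs_diagonal_sub_le {Φ : ℝ → ℝ} {B C₁ : ℝ} (h : DualDecay Φ B) {k : ℕ} (hk : 2 ≤ k) (hC₁ : 0 ≤ C₁)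
    (hA : DiagAsymp Φ k C₁) {δ η ε : ℝ} (hδ1 : δ ≤ 1) (hη : 0 < η) (hkη : 5 * (k * η) ≤ δ) (hε : 0 < ε) :
    ∀ᶠ d : ℕ in atTop, ∀ c : ℝ, c ∈ Set.Icc ((k : ℝ) - 1 + δ) ((k : ℝ) - δ) → ∀ q : ℕ, q ∣ d → (d : ℝ) ^ (1 - η) ≤ q →
      |((d : ℝ) ^ c) ^ 2 / (q : ℝ) ^ k * ∑' v : ℕ, dualSmooth (d.primeFactors \ q.primeFactors) k v ^ 2 *
          diagSum Φ k d (dualLength k ((d : ℝ) ^ c) d q / v) -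
        arithConst k d * (d : ℝ) ^ c * (((k - c) * Real.log d) ^ (k ^ 2 - 1) / ((k ^ 2 - 1)! : ℝ))| ≤
      arithConst k d * (d : ℝ) ^ c * Real.log d ^ (k ^ 2 - 1) * (2 ^ (k ^ 2) * (5 * (k * η)) + ε) := by
  have hk0 : (0 : ℝ) < k := by exact_mod_cast (by omega : 0 < k)
  have hkη0 : 0 < k * η := by positivity
  obtain ⟨C, hC, hb⟩ := exists_abs_dual_diagonal_sub_le h hC₁ hA (ε := k * η / 4) (by positivity) (by linarith)
  obtain ⟨C', hC', hτ⟩ := exists_card_divisors_pow_le (8 * k ^ 2) (ε := k * η / 4) (by positivity)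
  filter_upwards [eventually_ge_atTop 3, eventually_const_mul_rpow_neg_le ((5 * C + 1) * C') (θ := k * η / 2) (by positivity) (half_pos hε),
    eventually_const_mul_log_rpow_neg_le (2 ^ (k ^ 2) * (3 * C)) (θ := 1 / 2) (by norm_num) (half_pos hε)] with d hd3 hev1 hev2
  rintro c ⟨hc1, hc2⟩ q hqd hq
  have hdne : d ≠ 0 := by omega
  have hd0 : (0 : ℝ) < d := by exact_mod_cast Nat.pos_of_ne_zero hdne
  have hd1 : (1 : ℝ) ≤ d := by exact_mod_cast (by omega : 1 ≤ d)
  have hq0 : (0 : ℝ) < q := (Real.rpow_pos_of_pos hd0 _).trans_le hq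
  obtain ⟨hL1, hL2, hEη⟩ := dualLength_bounds (k := k) (c := c) (by omega) hqd hq
  have hΛ : 1 ≤ Real.log d := by
    rw [Real.le_log_iff_exp_le hd0]
    refine Real.exp_one_lt_d9.le.trans (le_trans (by norm_num) (Nat.cast_le.2 hd3))
  set P := d.primeFactors \ q.primeFactors with hPdef
  have hP : ∀ p ∈ P, p.Prime := fun p hp => Nat.prime_of_mem_primeFactors (Finset.mem_sdiff.1 hp).1
  set X := (d : ℝ) ^ c with hX
  have hX0 : 0 < X := Real.rpow_pos_of_pos hd0 _
  have hM0 := dualLength_pos k hX0 d (q := q) (by rintro rfl; simp at hq0)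
  set M := dualLength k X d q with hM
  set E := ∏ p ∈ P, (p : ℝ) with hE
  have hE0 : 0 < E := Finset.prod_pos fun p hp => by exact_mod_cast (hP p hp).pos
  set Λ := Real.log d with hΛdef
  set a := arithConst k d
  have ha : 0 < a := arithConst_pos k hdne
  set V := (d : ℝ) ^ (4 * (k * η)) with hV
  have hlogV : Real.log V = 4 * (k * η) * Λ := Real.log_rpow hd0 _
  have hV1 : 1 ≤ V := Real.one_le_rpow hd1 (by positivity)
  have hVM : V ≤ M := by
    rw [← Real.log_le_log_iff (by positivity) hM0, hlogV]
    refine le_trans ?_ hL2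
    nlinarith
  have hL0 : 0 ≤ Real.log M := Real.log_nonneg (hV1.trans hVM)
  have hLΛ : Real.log M ≤ Λ := hL1.trans (by nlinarith)
  have hMd : M ≤ d := by rwa [← Real.log_le_log_iff hM0 hd0]
  have main := hb d hdne P hP M V hV1 hVM
  set D := ∑' v : ℕ, dualSmooth P k v ^ 2 * diagSum Φ k d (M / v)
  set L := Real.log M with hL
  set n := k ^ 2 - 1 with hn
  have hk4 : 4 ≤ k ^ 2 := by nlinarith
  have hn1 : k ^ 2 - 2 + 1 = n := by omega
  have hM' : X ^ 2 / (q : ℝ) ^ k * (M / E ^ k) = X := by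
    have : M = (q * E) ^ k / X := by rw [hM, dualLength, hE]; push_cast; rfl
    rw [this, mul_pow]
    field_simp
  have hΛn : Λ ≤ Λ ^ n := le_self_pow₀ hΛ (by omega)
  -- the error term with a logarithmic saving
  have hpow : ∀ x : ℝ, 0 ≤ x → x ≤ Λ → (1 + x) ^ (k ^ 2 - 2) ≤ 2 ^ (k ^ 2) * Λ ^ (k ^ 2 - 2) := by
    intro x hx hx'
    calc (1 + x) ^ (k ^ 2 - 2) ≤ (2 * Λ) ^ (k ^ 2 - 2) := by gcongr; linarith
      _ = 2 ^ (k ^ 2 - 2) * Λ ^ (k ^ 2 - 2) := mul_pow _ _ _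
      _ ≤ _ := by gcongr; norm_num; omega
  have hE1 : (1 + L) ^ (k ^ 2 - 2) * (C * (4 + Λ) ^ (1 / 2 : ℝ) + Real.log V) ≤
      Λ ^ n * (2 ^ (k ^ 2) * (3 * C) * Λ ^ (-(1 / 2) : ℝ) + 2 ^ (k ^ 2) * (4 * (k * η))) := by
    have h1 : (4 + Λ) ^ (1 / 2 : ℝ) ≤ 3 * (Λ * Λ ^ (-(1 / 2) : ℝ)) := by
      have e : Λ * Λ ^ (-(1 / 2) : ℝ) = Λ ^ (1 / 2 : ℝ) := by
        nth_rewrite 1 [← Real.rpow_one Λ]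
        rw [← Real.rpow_add (by linarith)]; norm_num
      rw [e]
      calc (4 + Λ) ^ (1 / 2 : ℝ) ≤ (9 * Λ) ^ (1 / 2 : ℝ) := Real.rpow_le_rpow (by linarith) (by linarith) (by norm_num)
        _ = 3 * Λ ^ (1 / 2 : ℝ) := by
          rw [Real.mul_rpow (by norm_num) (by linarith), show (9 : ℝ) = 3 ^ (2 : ℝ) by norm_num, ← Real.rpow_mul (by norm_num)]
          norm_num
    rw [hlogV]
    calc _ ≤ (2 ^ (k ^ 2) * Λ ^ (k ^ 2 - 2)) * (C * (3 * (Λ * Λ ^ (-(1 / 2) : ℝ))) + 4 * (k * η) * Λ) := by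
          gcongr
          exact hpow L hL0 hLΛ
      _ = _ := by rw [← hn1, pow_succ]; ring
  -- the error term with a power saving
  have hE2 : E ^ k * ((C * (4 + Λ) ^ (1 / 4 : ℝ) * M ^ (k * η / 4) + L ^ n) * V ^ (-(1 / 2) : ℝ) *
      ((2 : ℝ) ^ P.card) ^ (8 * k ^ 2)) ≤ Λ ^ n * ((5 * C + 1) * C' * (d : ℝ) ^ (-(k * η / 2))) := by
    have h1 : E ^ k ≤ (d : ℝ) ^ (k * η) := by
      calc E ^ k ≤ ((d : ℝ) ^ η) ^ k := by gcongr
        _ = _ := by rw [← Real.rpow_natCast, ← Real.rpow_mul hd0.le, mul_comm]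
    have h2 : (4 + Λ) ^ (1 / 4 : ℝ) ≤ 5 * Λ ^ n := by
      calc (4 + Λ) ^ (1 / 4 : ℝ) ≤ (4 + Λ) ^ (1 : ℝ) := Real.rpow_le_rpow_of_exponent_le (by linarith) (by norm_num)
        _ ≤ _ := by rw [Real.rpow_one]; linarith
    have h3 : M ^ (k * η / 4) ≤ (d : ℝ) ^ (k * η / 4) := Real.rpow_le_rpow hM0.le hMd (by positivity)
    have h4 : 1 ≤ (d : ℝ) ^ (k * η / 4) := Real.one_le_rpow hd1 (by positivity)
    have h5 : V ^ (-(1 / 2) : ℝ) = (d : ℝ) ^ (-(2 * (k * η))) := by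
      rw [hV, ← Real.rpow_mul hd0.le]; congr 1; ring
    have h6 : ((2 : ℝ) ^ P.card) ^ (8 * k ^ 2) ≤ C' * (d : ℝ) ^ (k * η / 4) := by
      refine le_trans ?_ (hτ d hdne)
      gcongr
      have h1 : P.card ≤ d.primeFactors.card := Finset.card_le_card Finset.sdiff_subset
      exact_mod_cast (Nat.pow_le_pow_right two_pos h1).trans (two_pow_card_primeFactors_le_card_divisors hdne)
    have h7 : L ^ n ≤ Λ ^ n * (d : ℝ) ^ (k * η / 4) :=
      (pow_le_pow_left₀ hL0 hLΛ n).trans (le_mul_of_one_le_right (by positivity) h4)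
    calc _ ≤ (d : ℝ) ^ (k * η) * ((C * (5 * Λ ^ n) * (d : ℝ) ^ (k * η / 4) + Λ ^ n * (d : ℝ) ^ (k * η / 4)) *
          (d : ℝ) ^ (-(2 * (k * η))) * (C' * (d : ℝ) ^ (k * η / 4))) := by
          rw [h5]; gcongr
      _ = Λ ^ n * ((5 * C + 1) * C' * ((d : ℝ) ^ (k * η) * (d : ℝ) ^ (k * η / 4) * (d : ℝ) ^ (-(2 * (k * η))) * (d : ℝ) ^ (k * η / 4))) := by
          ring
      _ = _ := by
          rw [← Real.rpow_add hd0, ← Real.rpow_add hd0, ← Real.rpow_add hd0]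
          congr 3; ring
  have hE3 : |L ^ n / (n ! : ℝ) - ((k - c) * Λ) ^ n / (n ! : ℝ)| ≤ Λ ^ n * (2 ^ (k ^ 2) * (k * η)) := by
    refine (abs_pow_div_factorial_sub_le hL0 hL1 (t := k * η * Λ) (by linarith)).trans ?_
    rw [show n - 1 = k ^ 2 - 2 by omega]
    calc _ ≤ k * η * Λ * (2 ^ (k ^ 2) * Λ ^ (k ^ 2 - 2)) := by
          gcongr
          exact hpow _ (hL0.trans hL1) (by nlinarith)
      _ = _ := by rw [← hn1, pow_succ]; ring
  have hfirst : |X ^ 2 / (q : ℝ) ^ k * D - a * X * (L ^ n / (n ! : ℝ))| ≤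
      a * X * ((1 + L) ^ (k ^ 2 - 2) * (C * (4 + Λ) ^ (1 / 2 : ℝ) + Real.log V) +
        E ^ k * ((C * (4 + Λ) ^ (1 / 4 : ℝ) * M ^ (k * η / 4) + L ^ n) * V ^ (-(1 / 2) : ℝ) *
      ((2 : ℝ) ^ P.card) ^ (8 * k ^ 2))) := by
    have e : X ^ 2 / (q : ℝ) ^ k * D - a * X * (L ^ n / (n ! : ℝ)) =
        X ^ 2 / (q : ℝ) ^ k * (D - a * (M / E ^ k * (L ^ n / (n ! : ℝ)))) := by
      rw [mul_sub]
      congr 1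
      conv_lhs => rw [← hM']
      ring
    rw [e, abs_mul, abs_of_nonneg (by positivity)]
    have alg : ∀ x y : ℝ, X ^ 2 / (q : ℝ) ^ k * (a * M * (x / E ^ k + y)) = a * X * (x + E ^ k * y) := by
      intro x y
      calc _ = a * (X ^ 2 / (q : ℝ) ^ k * (M / E ^ k)) * (x + E ^ k * y) := by field_simp
        _ = _ := by rw [hM']
    exact (mul_le_mul_of_nonneg_left main (by positivity)).trans (alg _ _).le
  have e : X ^ 2 / (q : ℝ) ^ k * D - a * X * (((k - c) * Λ) ^ n / (n ! : ℝ)) =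
      (X ^ 2 / (q : ℝ) ^ k * D - a * X * (L ^ n / (n ! : ℝ))) +
        a * X * (L ^ n / (n ! : ℝ) - ((k - c) * Λ) ^ n / (n ! : ℝ)) := by ring
  rw [e]
  refine (abs_add_le _ _).trans ?_
  rw [abs_mul (a * X), abs_of_nonneg (by positivity : 0 ≤ a * X)]
  calc _ ≤ a * X * (Λ ^ n * (2 ^ (k ^ 2) * (3 * C) * Λ ^ (-(1 / 2) : ℝ) + 2 ^ (k ^ 2) * (4 * (k * η))) +
        Λ ^ n * ((5 * C + 1) * C' * (d : ℝ) ^ (-(k * η / 2)))) + a * X * (Λ ^ n * (2 ^ (k ^ 2) * (k * η))) := by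
        refine add_le_add (hfirst.trans ?_) ?_ <;> gcongr
    _ = a * X * Λ ^ n * (2 ^ (k ^ 2) * (5 * (k * η)) + (2 ^ (k ^ 2) * (3 * C) * Λ ^ (-(1 / 2) : ℝ) +
        (5 * C + 1) * C' * (d : ℝ) ^ (-(k * η / 2)))) := by ring
    _ ≤ _ := by
        gcongr
        linarith

end LargeConductor

section VarianceAsymptotic

variable {g : ℝ → ℂ} (hg : ContDiff ℝ ∞ g) (hs : Function.support g ⊆ Set.Icc 1 2) {k : ℕ} (hk : 2 ≤ k)
  (hnorm : ∫ y in Set.Ioi 0, ‖g y‖ ^ 2 = 1)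
include hg hs hk hnorm

theorem exists_diagAsymp (κ : ℕ) : ∃ C : ℝ, 0 ≤ C ∧ DiagAsymp (fun y => ‖dualWeight g κ k y‖ ^ 2) k C := by
  obtain ⟨C, hC, h⟩ := exists_abs_tsum_tauSq_dualWeight_sub_le hg hs κ k hk
  refine ⟨C, hC.le, fun d hd Y hY => ?_⟩
  have := h d hd Y hY
  rwa [hnorm, mul_one] at this

theorem exists_eventually_abs_conductorSum_sub_le {δ η ε ε' : ℝ} (hδ1 : δ ≤ 1) (hη : 0 < η) (hkη : 5 * (k * η) ≤ δ)
    (hε : 0 < ε) (hε' : 0 < ε') (hε'1 : ε' ≤ 1 / 2) : ∃ C : ℝ, 0 ≤ C ∧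
    ∀ᶠ d : ℕ in atTop, ∀ c : ℝ, c ∈ Set.Icc ((k : ℝ) - 1 + δ) ((k : ℝ) - δ) → ∀ q : ℕ, q ∣ d → (d : ℝ) ^ (1 - η) ≤ q →
      q ≠ 1 → ∀ κ ≤ 1,
      |conductorSum g k ((d : ℝ) ^ c) d q κ - (primChars q κ).card *
        (arithConst k d * (d : ℝ) ^ c * (((k - c) * Real.log d) ^ (k ^ 2 - 1) / ((k ^ 2 - 1)! : ℝ)))| ≤
      (primChars q κ).card * (arithConst k d * (d : ℝ) ^ c * Real.log d ^ (k ^ 2 - 1) * (2 ^ (k ^ 2) * (5 * (k * η)) + ε)) +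
        C * d.divisors.card * (d : ℝ) ^ (k + k * η + 2 * ε') := by
  obtain ⟨B, hdec⟩ := exists_dualDecay hg hs k
  obtain ⟨C0, hC0, hA0⟩ := exists_diagAsymp hg hs hk hnorm 0
  obtain ⟨C1, hC1, hA1⟩ := exists_diagAsymp hg hs hk hnorm 1
  obtain ⟨C, hC, hoff⟩ := exists_abs_conductorSum_sub_le hg hs k hε' hε'1
  refine ⟨C, hC, ?_⟩
  have hk0 : (0 : ℝ) < k := by exact_mod_cast (by omega : 0 < k)
  filter_upwards [eventually_ge_atTop 2, eventually_abs_diagonal_sub_le (hdec 0 zero_le_one) hk hC0 hA0 hδ1 hη hkη hε,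
    eventually_abs_diagonal_sub_le (hdec 1 le_rfl) hk hC1 hA1 hδ1 hη hkη hε] with d hd2 h0 h1
  intro c hc q hqd hq hq1 κ hκ
  have hdne : d ≠ 0 := by omega
  have hd0 : (0 : ℝ) < d := by exact_mod_cast Nat.pos_of_ne_zero hdne
  have hd1 : (1 : ℝ) ≤ d := by exact_mod_cast (by omega : 1 ≤ d)
  have hq0 : (0 : ℝ) < q := (Real.rpow_pos_of_pos hd0 _).trans_le hq
  have hX0 : 0 < (d : ℝ) ^ c := Real.rpow_pos_of_pos hd0 _
  have hM0 := dualLength_pos k hX0 d (q := q) (by rintro rfl; simp at hq0)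
  obtain ⟨hL1, -, hEη⟩ := dualLength_bounds (k := k) (c := c) (by omega) hqd hq
  have hdiag : |((d : ℝ) ^ c) ^ 2 / (q : ℝ) ^ k * ∑' v : ℕ, dualSmooth (d.primeFactors \ q.primeFactors) k v ^ 2 *
          diagSum (fun y => ‖dualWeight g κ k y‖ ^ 2) k d (dualLength k ((d : ℝ) ^ c) d q / v) -
        arithConst k d * (d : ℝ) ^ c * (((k - c) * Real.log d) ^ (k ^ 2 - 1) / ((k ^ 2 - 1)! : ℝ))| ≤
      arithConst k d * (d : ℝ) ^ c * Real.log d ^ (k ^ 2 - 1) * (2 ^ (k ^ 2) * (5 * (k * η)) + ε) := by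
    rcases Nat.le_one_iff_eq_zero_or_eq_one.1 hκ with rfl | rfl
    · exact h0 c hc q hqd hq
    · exact h1 c hc q hqd hq
  have hcs := hoff d q κ hκ hdne hqd hq1 _ hX0
  set M := dualLength k ((d : ℝ) ^ c) d q with hM
  set X := (d : ℝ) ^ c
  set E := ∏ p ∈ d.primeFactors \ q.primeFactors, (p : ℝ) with hE
  have hE0 : 0 < E := Finset.prod_pos fun p hp => by
    exact_mod_cast (Nat.prime_of_mem_primeFactors (Finset.mem_sdiff.1 hp).1).pos
  have hMd : M ≤ d := by
    rw [← Real.log_le_log_iff hM0 hd0]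
    refine hL1.trans ?_
    have : 0 ≤ Real.log d := Real.log_natCast_nonneg d
    have h5 : (0 : ℝ) < k * η := by positivity
    nlinarith [hc.1]
  have hqE : (q : ℝ) * E ≤ d := by
    have := Nat.le_of_dvd (Nat.pos_of_ne_zero hdne) (prod_sdiff_mul_dvd hdne hqd)
    have h := (Nat.cast_le (α := ℝ)).2 this
    push_cast at h
    exact h
  have hMX : X ^ 2 / (q : ℝ) ^ k * M ^ 2 = (q * E) ^ k * E ^ k := by
    have : M = (q * E) ^ k / X := by rw [hM, dualLength, hE]; push_cast; rfl
    rw [this, mul_pow]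
    field_simp
  have herr : X ^ 2 / (q : ℝ) ^ k * (C * q.divisors.card * M ^ (2 + 2 * ε')) ≤
      C * d.divisors.card * (d : ℝ) ^ (k + k * η + 2 * ε') := by
    have hqτ : (q.divisors.card : ℝ) ≤ d.divisors.card := by
      exact_mod_cast Finset.card_le_card (Nat.divisors_subset_of_dvd hdne hqd)
    calc _ = C * q.divisors.card * ((X ^ 2 / (q : ℝ) ^ k * M ^ 2) * M ^ (2 * ε')) := by
          rw [Real.rpow_add hM0, Real.rpow_two]; ring
      _ = C * q.divisors.card * ((q * E) ^ k * E ^ k * M ^ (2 * ε')) := by rw [hMX]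
      _ ≤ C * d.divisors.card * ((d : ℝ) ^ k * ((d : ℝ) ^ η) ^ k * (d : ℝ) ^ (2 * ε')) := by gcongr
      _ = _ := by
          rw [← Real.rpow_natCast ((d : ℝ) ^ η), ← Real.rpow_mul hd0.le, ← Real.rpow_natCast (d : ℝ) k,
            ← Real.rpow_add hd0, ← Real.rpow_add hd0, mul_comm η]
  set S := ∑' v : ℕ, dualSmooth (d.primeFactors \ q.primeFactors) k v ^ 2 *
          diagSum (fun y => ‖dualWeight g κ k y‖ ^ 2) k d (M / v)
  set T := arithConst k d * X * (((k - c) * Real.log d) ^ (k ^ 2 - 1) / ((k ^ 2 - 1)! : ℝ))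
  have e : conductorSum g k X d q κ - (primChars q κ).card * T =
      (conductorSum g k X d q κ - X ^ 2 / (q : ℝ) ^ k * ((primChars q κ).card * S)) +
        (primChars q κ).card * (X ^ 2 / (q : ℝ) ^ k * S - T) := by ring
  rw [e]
  refine (abs_add_le _ _).trans ?_
  rw [abs_mul, Nat.abs_cast, add_comm]
  exact add_le_add (mul_le_mul_of_nonneg_left hdiag (Nat.cast_nonneg _)) (hcs.trans herr)

end VarianceAsymptotic

section VarianceComparison

/-- Comparison of the variance with a main term `T`, from estimates for each conductor. -/
theorem abs_smoothVariance_sub_le {w : ℝ → ℝ} (hs : Function.support w ⊆ Set.Icc 1 2) (k : ℕ) {X : ℝ} (hX : 0 < X)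
    {d : ℕ} (hd : d ≠ 0) {T Q R O S : ℝ} (hT : 0 ≤ T) (hQ : 1 ≤ Q) (hR : 0 ≤ R) (hO : 0 ≤ O) (hS : 0 ≤ S)
    (hlarge : ∀ q : ℕ, q ∣ d → Q ≤ q → q ≠ 1 → ∀ κ ≤ 1,
      |conductorSum (fun y => (w y : ℂ)) k X d q κ - (primChars q κ).card * T| ≤ (primChars q κ).card * R + O)
    (hsmall : ∀ q : ℕ, q ∣ d → q ≤ Q → q ≠ 1 → ∀ κ ≤ 1, conductorSum (fun y => (w y : ℂ)) k X d q κ ≤ S) :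
    |smoothVariance w k X d - T| ≤ R + (d.divisors.card : ℝ) ^ 2 / d * (2 * O + 2 * S + Q * T) := by
  have hφ : (0 : ℝ) < d.totient := by exact_mod_cast Nat.totient_pos.2 (Nat.pos_of_ne_zero hd)
  set N : ℕ → ℝ := fun q => ∑ κ ∈ Finset.range 2, ((primChars q κ).card : ℝ) with hN
  set W : ℕ → ℝ := fun q => ∑ κ ∈ Finset.range 2, conductorSum (fun y => (w y : ℂ)) k X d q κ with hW
  have hκ1 : ∀ κ ∈ Finset.range 2, κ ≤ 1 := fun κ hκ => by have := Finset.mem_range.1 hκ; omega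
  have hN0 : ∀ q, 0 ≤ N q := fun q => Finset.sum_nonneg fun _ _ => Nat.cast_nonneg _
  have hV : smoothVariance w k X d = 1 / (d.totient : ℝ) * ∑ q ∈ d.divisors.erase 1, W q :=
    smoothVariance_eq_sum_conductorSum hs k hX hd
  have hφN : (d.totient : ℝ) = ∑ q ∈ d.divisors, N q := totient_eq_sum_card_primChars hd
  have hterm : ∀ q ∈ d.divisors.erase 1, |W q - N q * T| ≤ N q * R + (2 * O + 2 * S + Q * T) := by
    intro q hq
    have hq1 := Finset.ne_of_mem_erase hq
    have hqd := Nat.dvd_of_mem_divisors (Finset.mem_of_mem_erase hq)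
    have hq0 : q ≠ 0 := by rintro rfl; exact hd (zero_dvd_iff.1 hqd)
    rcases le_total Q q with h | h
    · have e : W q - N q * T = ∑ κ ∈ Finset.range 2, (conductorSum (fun y => (w y : ℂ)) k X d q κ - (primChars q κ).card * T) := by
        rw [Finset.sum_sub_distrib, ← Finset.sum_mul]
      rw [e]
      refine (Finset.abs_sum_le_sum_abs _ _).trans ((Finset.sum_le_sum fun κ hκ =>
        hlarge q hqd h hq1 κ (hκ1 κ hκ)).trans ?_)
      rw [Finset.sum_add_distrib, ← Finset.sum_mul]
      simp only [Finset.sum_const, Finset.card_range, nsmul_eq_mul, Nat.cast_ofNat]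
      have : 0 ≤ Q * T := by positivity
      linarith
    · have h1 : W q ≤ 2 * S := by
        refine (Finset.sum_le_sum fun κ hκ => hsmall q hqd h hq1 κ (hκ1 κ hκ)).trans ?_
        simp
      have h2 : 0 ≤ W q := Finset.sum_nonneg fun _ _ => conductorSum_nonneg _ _ _ _ _ _
      have h3 : N q * T ≤ Q * T := by
        gcongr
        exact (sum_card_primChars_le q hq0).trans h
      have h4 : 0 ≤ N q * R := mul_nonneg (hN0 q) hR
      have h5 : 0 ≤ N q * T := mul_nonneg (hN0 q) hT
      rw [abs_le]
      constructor <;> linarith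
  have hmem : 1 ∈ d.divisors := Nat.one_mem_divisors.2 hd
  have hmain : |∑ q ∈ d.divisors.erase 1, W q - d.totient * T| ≤
      d.totient * R + d.divisors.card * (2 * O + 2 * S + Q * T) := by
    have e : ∑ q ∈ d.divisors.erase 1, W q - d.totient * T =
        ∑ q ∈ d.divisors.erase 1, (W q - N q * T) - N 1 * T := by
      rw [hφN, ← Finset.add_sum_erase _ N hmem, Finset.sum_sub_distrib, ← Finset.sum_mul]; ring
    have h1 : |N 1 * T| ≤ N 1 * R + (2 * O + 2 * S + Q * T) := by
      rw [abs_of_nonneg (mul_nonneg (hN0 1) hT)]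
      have h2 : N 1 * T ≤ Q * T := by
        gcongr
        exact (sum_card_primChars_le 1 one_ne_zero).trans (by simpa using hQ)
      have h3 := mul_nonneg (hN0 1) hR
      linarith
    rw [e]
    calc _ ≤ ∑ q ∈ d.divisors.erase 1, |W q - N q * T| + |N 1 * T| :=
          (abs_sub _ _).trans (add_le_add_left (Finset.abs_sum_le_sum_abs _ _) _)
      _ ≤ ∑ q ∈ d.divisors.erase 1, (N q * R + (2 * O + 2 * S + Q * T)) + (N 1 * R + (2 * O + 2 * S + Q * T)) :=
          add_le_add (Finset.sum_le_sum hterm) h1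
      _ = ∑ q ∈ d.divisors, (N q * R + (2 * O + 2 * S + Q * T)) := by
          rw [add_comm, Finset.add_sum_erase _ (fun q => N q * R + (2 * O + 2 * S + Q * T)) hmem]
      _ = _ := by
          rw [Finset.sum_add_distrib, ← Finset.sum_mul, ← hφN, Finset.sum_const, nsmul_eq_mul]
  have e : smoothVariance w k X d - T = 1 / (d.totient : ℝ) * (∑ q ∈ d.divisors.erase 1, W q - d.totient * T) := by
    rw [hV]; field_simp
  rw [e, abs_mul, abs_of_nonneg (by positivity)]
  have hB : 0 ≤ 2 * O + 2 * S + Q * T := by positivity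
  calc _ ≤ 1 / (d.totient : ℝ) * (d.totient * R + d.divisors.card * (2 * O + 2 * S + Q * T)) := by gcongr
    _ = R + 1 / (d.totient : ℝ) * (d.divisors.card * (2 * O + 2 * S + Q * T)) := by field_simp
    _ ≤ R + d.divisors.card / d * (d.divisors.card * (2 * O + 2 * S + Q * T)) := by
        have := mul_le_mul_of_nonneg_right (one_div_totient_le hd) (mul_nonneg (Nat.cast_nonneg d.divisors.card) hB)
        linarith
    _ = _ := by ring

end VarianceComparison

section MainTheorem

theorem le_mainTerm {k d : ℕ} {c δ C X : ℝ} (hk : 2 ≤ k) (hδ : 0 < δ) (hc : c ≤ k - δ) (hd : 3 ≤ d) (hX : 0 < X) (hC : 0 < C)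
    (ha : 1 ≤ C * (4 + Real.log d) ^ (1 / 4 : ℝ) * arithConst k d) :
    X ≤ 5 * C / (δ ^ (k ^ 2 - 1) / ((k ^ 2 - 1)! : ℝ)) *
      (arithConst k d * X * (((k - c) * Real.log d) ^ (k ^ 2 - 1) / ((k ^ 2 - 1)! : ℝ))) ∧
    arithConst k d * X * Real.log d ^ (k ^ 2 - 1) * (δ ^ (k ^ 2 - 1) / ((k ^ 2 - 1)! : ℝ)) ≤
      arithConst k d * X * (((k - c) * Real.log d) ^ (k ^ 2 - 1) / ((k ^ 2 - 1)! : ℝ)) ∧ 1 ≤ Real.log d := by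
  have hd0 : (0 : ℝ) < d := by exact_mod_cast (by omega : 0 < d)
  have hΛ : 1 ≤ Real.log d := by
    rw [Real.le_log_iff_exp_le hd0]
    refine Real.exp_one_lt_d9.le.trans (le_trans (by norm_num) (Nat.cast_le.2 hd))
  have ha0 : 0 < arithConst k d := arithConst_pos k (by omega)
  set Λ := Real.log d
  have hk4 : 4 ≤ k ^ 2 := by nlinarith
  set n := k ^ 2 - 1 with hn
  have hn0 : n ≠ 0 := by omega
  have h2 : arithConst k d * X * Λ ^ n * (δ ^ n / (n ! : ℝ)) ≤ arithConst k d * X * (((k - c) * Λ) ^ n / (n ! : ℝ)) := by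
    rw [mul_pow]
    calc _ = arithConst k d * X * (δ ^ n * Λ ^ n / (n ! : ℝ)) := by ring
      _ ≤ _ := by gcongr; linarith
  refine ⟨?_, h2, hΛ⟩
  have h3 : (4 + Λ) ^ (1 / 4 : ℝ) ≤ 5 * Λ ^ n := by
    calc (4 + Λ) ^ (1 / 4 : ℝ) ≤ (4 + Λ) ^ (1 : ℝ) := Real.rpow_le_rpow_of_exponent_le (by linarith) (by norm_num)
      _ ≤ 5 * Λ := by rw [Real.rpow_one]; linarith
      _ ≤ _ := by gcongr; exact le_self_pow₀ hΛ hn0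
  have hγ : 0 < δ ^ n / (n ! : ℝ) := by positivity
  calc X = 1 * X := (one_mul X).symm
    _ ≤ (C * (5 * Λ ^ n) * arithConst k d) * X := by
        gcongr
        exact ha.trans (by gcongr)
    _ = 5 * C / (δ ^ n / (n ! : ℝ)) * (arithConst k d * X * Λ ^ n * (δ ^ n / (n ! : ℝ))) := by field_simp
    _ ≤ _ := by gcongr

set_option maxHeartbeats 1000000 in
theorem eventually_abs_smoothVariance_sub_le {k : ℕ} (hk : 2 ≤ k) {w : ℝ → ℝ} (hw : ContDiff ℝ ∞ w)
    (hsupp : Function.support w ⊆ Set.Icc 1 2) (hnorm : ∫ y, w y ^ 2 = 1) {δ ε : ℝ} (hδ : 0 < δ) (hδ1 : δ ≤ 1) (hε : 0 < ε) :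
    ∀ᶠ d : ℕ in atTop, ∀ c : ℝ, c ∈ Set.Icc ((k : ℝ) - 1 + δ) ((k : ℝ) - δ) →
      |smoothVariance w k ((d : ℝ) ^ c) d -
        arithConst k d * (d : ℝ) ^ c * (((k - c) * Real.log d) ^ (k ^ 2 - 1) / ((k ^ 2 - 1)! : ℝ))| ≤
      ε * (arithConst k d * (d : ℝ) ^ c * (((k - c) * Real.log d) ^ (k ^ 2 - 1) / ((k ^ 2 - 1)! : ℝ))) := by
  have hg : ContDiff ℝ ∞ (fun y => (w y : ℂ)) := Complex.ofRealCLM.contDiff.comp hw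
  have hs : Function.support (fun y => (w y : ℂ)) ⊆ Set.Icc 1 2 := fun y hy => hsupp fun h => hy (by simp [h])
  have hgn : ∫ y in Set.Ioi 0, ‖(w y : ℂ)‖ ^ 2 = 1 := by
    rw [← hnorm, MeasureTheory.setIntegral_eq_integral_of_forall_compl_eq_zero]
    · refine MeasureTheory.integral_congr_ae (Eventually.of_forall fun y => ?_)
      simp only [Complex.norm_real, Real.norm_eq_abs, sq_abs]
    · intro y hy
      have : w y = 0 := by
        by_contra h
        exact hy (lt_of_lt_of_le one_pos (hsupp h).1)
      simp [this]
  have hk0 : (0 : ℝ) < k := by exact_mod_cast (by omega : 0 < k)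
  have hk1 : (1 : ℝ) ≤ k := by exact_mod_cast (by omega : 1 ≤ k)
  set n := k ^ 2 - 1 with hn
  set γ := δ ^ n / (n ! : ℝ) with hγ
  have hγ0 : 0 < γ := by positivity
  set r := ε * γ / 4 with hr
  have hr0 : 0 < r := by positivity
  set η := min (δ / (5 * k)) (r / (2 ^ (k ^ 2) * (5 * k))) with hηdef
  have hη : 0 < η := lt_min (by positivity) (by positivity)
  have hη1 : 5 * (k * η) ≤ δ := by
    have := min_le_left (δ / (5 * k)) (r / (2 ^ (k ^ 2) * (5 * k)))
    rw [← hηdef, le_div_iff₀ (by positivity)] at this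
    linarith
  have hη2 : 2 ^ (k ^ 2) * (5 * (k * η)) ≤ r := by
    have := min_le_right (δ / (5 * k)) (r / (2 ^ (k ^ 2) * (5 * k)))
    rw [← hηdef, le_div_iff₀ (by positivity)] at this
    linarith
  have hηk : η ≤ k * η := le_mul_of_one_le_left hη.le hk1
  obtain ⟨Co, hCo, hlarge⟩ := exists_eventually_abs_conductorSum_sub_le hg hs hk hgn hδ1 hη hη1 hr0
    (ε' := δ / 10) (by positivity) (by linarith)
  obtain ⟨Cs, hCs, hsmall⟩ := exists_conductorSum_le hg hs k (ε := η / (8 * k)) (by positivity) (by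
    rw [div_le_iff₀ (by positivity)]; nlinarith)
  obtain ⟨Ca, hCa, ha⟩ := exists_one_le_arithConst_mul k
  obtain ⟨D1, hD1, hτ1⟩ := exists_card_divisors_pow_le 3 (ε := δ / 10) (by positivity)
  obtain ⟨D2, hD2, hτ2⟩ := exists_card_divisors_pow_le (2 * k + 3) (ε := η / 4) (by positivity)
  obtain ⟨D3, hD3, hτ3⟩ := exists_card_divisors_pow_le 2 (ε := η / 2) (by positivity)
  filter_upwards [hlarge, eventually_ge_atTop 3,
    eventually_const_mul_rpow_neg_le (2 * Co * D1 * (5 * Ca / γ)) (θ := δ / 2) (half_pos hδ) (by positivity : 0 < ε / 8),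
    eventually_const_mul_rpow_neg_le (4 * Cs * D2 * (5 * Ca / γ)) (θ := η / 2) (half_pos hη) (by positivity : 0 < ε / 8),
    eventually_const_mul_rpow_neg_le D3 (θ := η / 2) (half_pos hη) (by positivity : 0 < ε / 8)] with d hL hd3 hev1 hev2 hev3
  intro c hc
  have hdne : d ≠ 0 := by omega
  have hd0 : (0 : ℝ) < d := by exact_mod_cast Nat.pos_of_ne_zero hdne
  have hd1 : (1 : ℝ) ≤ d := by exact_mod_cast (by omega : 1 ≤ d)
  have hX0 : 0 < (d : ℝ) ^ c := Real.rpow_pos_of_pos hd0 _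
  have hX1 : 1 ≤ (d : ℝ) ^ c := Real.one_le_rpow hd1 (by linarith [hc.1])
  obtain ⟨hXT, hγT, hΛ⟩ := le_mainTerm hk hδ hc.2 hd3 hX0 hCa (ha d hdne)
  have hkc : 0 ≤ (k : ℝ) - c := by linarith [hc.2]
  have ha0 : 0 < arithConst k d := arithConst_pos k hdne
  rw [← hn, ← hγ] at hXT hγT
  set Λ := Real.log d
  set T := arithConst k d * (d : ℝ) ^ c * (((k - c) * Λ) ^ n / (n ! : ℝ)) with hT
  have hT0 : 0 ≤ T := by positivity
  set Q := (d : ℝ) ^ (1 - η) with hQ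
  have hQ1 : 1 ≤ Q := Real.one_le_rpow hd1 (by linarith)
  set τ : ℝ := (d.divisors.card : ℝ) with hτ
  set O := Co * τ * (d : ℝ) ^ (k + k * η + 2 * (δ / 10)) with hO
  set S := Cs * ((d : ℝ) ^ k) ^ (2 * (η / (8 * k))) * τ ^ (2 * k + 1) * ((d : ℝ) ^ c * Q + Q ^ k) with hS
  have key := abs_smoothVariance_sub_le hsupp k hX0 hdne (T := T) (Q := Q)
    (R := arithConst k d * (d : ℝ) ^ c * Λ ^ n * (2 ^ (k ^ 2) * (5 * (k * η)) + r)) (O := O) (S := S)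
    hT0 hQ1 (by positivity) (by positivity) (by positivity)
    (fun q hqd hq hq1 κ hκ => hL c hc q hqd hq hq1 κ hκ)
    (fun q hqd hq hq1 κ hκ => (hsmall d q κ hκ hdne hqd hq1 _ hX1).trans (by rw [hS]; gcongr))
  refine key.trans ?_
  have b1 : arithConst k d * (d : ℝ) ^ c * Λ ^ n * (2 ^ (k ^ 2) * (5 * (k * η)) + r) ≤ ε / 2 * T := by
    calc _ ≤ arithConst k d * (d : ℝ) ^ c * Λ ^ n * (r + r) := by gcongr
      _ = ε / 2 * (arithConst k d * (d : ℝ) ^ c * Λ ^ n * γ) := by rw [hr]; ring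
      _ ≤ _ := by gcongr
  have b2 : τ ^ 2 / d * (2 * O) ≤ ε / 8 * T := by
    calc τ ^ 2 / d * (2 * O) = 2 * Co * τ ^ 3 * ((d : ℝ) ^ (k + k * η + 2 * (δ / 10)) * (d : ℝ) ^ (-1 : ℝ)) := by
          rw [hO, Real.rpow_neg_one]; ring
      _ ≤ 2 * Co * (D1 * (d : ℝ) ^ (δ / 10)) * ((d : ℝ) ^ (k + k * η + 2 * (δ / 10)) * (d : ℝ) ^ (-1 : ℝ)) := by
          gcongr
          exact hτ1 d hdne
      _ = 2 * Co * D1 * (d : ℝ) ^ (δ / 10 + (k + k * η + 2 * (δ / 10) + -1)) := by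
          rw [Real.rpow_add hd0 (δ / 10), Real.rpow_add hd0 (k + k * η + 2 * (δ / 10))]; ring
      _ ≤ 2 * Co * D1 * (d : ℝ) ^ (c + -(δ / 2)) := by
          refine mul_le_mul_of_nonneg_left (Real.rpow_le_rpow_of_exponent_le hd1 ?_) (by positivity)
          linarith [hc.1]
      _ = 2 * Co * D1 * (d : ℝ) ^ (-(δ / 2)) * (d : ℝ) ^ c := by rw [Real.rpow_add hd0]; ring
      _ ≤ 2 * Co * D1 * (d : ℝ) ^ (-(δ / 2)) * (5 * Ca / γ * T) := by gcongr
      _ = (2 * Co * D1 * (5 * Ca / γ) * (d : ℝ) ^ (-(δ / 2))) * T := by ring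
      _ ≤ _ := by gcongr
  have b3 : τ ^ 2 / d * (2 * S) ≤ ε / 8 * T := by
    have e1 : ((d : ℝ) ^ k) ^ (2 * (η / (8 * k))) = (d : ℝ) ^ (η / 4) := by
      rw [← Real.rpow_natCast, ← Real.rpow_mul hd0.le]
      congr 1
      field_simp
      norm_num
    have e2 : (d : ℝ) ^ c * Q * (d : ℝ) ^ (-1 : ℝ) = (d : ℝ) ^ (c + -η) := by
      rw [hQ, ← Real.rpow_add hd0, ← Real.rpow_add hd0]; congr 1; ring
    have e3 : Q ^ k * (d : ℝ) ^ (-1 : ℝ) ≤ (d : ℝ) ^ (c + -η) := by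
      rw [hQ, ← Real.rpow_natCast, ← Real.rpow_mul hd0.le, ← Real.rpow_add hd0]
      refine Real.rpow_le_rpow_of_exponent_le hd1 ?_
      linarith [hc.1]
    calc τ ^ 2 / d * (2 * S) = 2 * Cs * τ ^ (2 * k + 3) * (d : ℝ) ^ (η / 4) *
          ((d : ℝ) ^ c * Q * (d : ℝ) ^ (-1 : ℝ) + Q ^ k * (d : ℝ) ^ (-1 : ℝ)) := by
          rw [hS, e1, Real.rpow_neg_one]; ring
      _ ≤ 2 * Cs * (D2 * (d : ℝ) ^ (η / 4)) * (d : ℝ) ^ (η / 4) * ((d : ℝ) ^ (c + -η) + (d : ℝ) ^ (c + -η)) := by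
          rw [e2]
          gcongr
          exact hτ2 d hdne
      _ = 4 * Cs * D2 * ((d : ℝ) ^ (η / 4) * (d : ℝ) ^ (η / 4) * (d : ℝ) ^ (-η)) * (d : ℝ) ^ c := by
          rw [Real.rpow_add hd0]; ring
      _ = 4 * Cs * D2 * (d : ℝ) ^ (-(η / 2)) * (d : ℝ) ^ c := by
          rw [← Real.rpow_add hd0, ← Real.rpow_add hd0]
          congr 3; ring
      _ ≤ 4 * Cs * D2 * (d : ℝ) ^ (-(η / 2)) * (5 * Ca / γ * T) := by gcongr
      _ = (4 * Cs * D2 * (5 * Ca / γ) * (d : ℝ) ^ (-(η / 2))) * T := by ring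
      _ ≤ _ := by gcongr
  have b4 : τ ^ 2 / d * (Q * T) ≤ ε / 8 * T := by
    calc τ ^ 2 / d * (Q * T) = τ ^ 2 * (Q * (d : ℝ) ^ (-1 : ℝ)) * T := by rw [Real.rpow_neg_one]; ring
      _ ≤ (D3 * (d : ℝ) ^ (η / 2)) * (Q * (d : ℝ) ^ (-1 : ℝ)) * T := by
          gcongr
          exact hτ3 d hdne
      _ = D3 * (d : ℝ) ^ (-(η / 2)) * T := by
          rw [hQ, ← Real.rpow_add hd0, mul_assoc D3, ← Real.rpow_add hd0]
          congr 3; ring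
      _ ≤ _ := by gcongr
  have hεT : 0 ≤ ε * T := by positivity
  linarith [mul_add (τ ^ 2 / (d : ℝ)) (2 * O + 2 * S) (Q * T), mul_add (τ ^ 2 / (d : ℝ)) (2 * O) (2 * S)]

theorem corollary2 (k : ℕ) (hk : 3 ≤ k) (w : ℝ → ℝ) (hw : ContDiff ℝ ∞ w)
    (hsupp : Function.support w ⊆ Set.Icc 1 2) (hnorm : ∫ y, w y ^ 2 = 1) :
    -- the series and the limit that define `a_k(d)` converge
    (∀ d : ℕ, 1 ≤ d →
      (∀ s : ℝ, 1 < s → Summable (tauSqTerm k d s)) ∧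
      Tendsto (fun s : ℝ => (s - 1) ^ (k ^ 2) * ∑' n : ℕ, tauSqTerm k d s n)
        (𝓝[>] (1 : ℝ)) (𝓝 (arithConst k d))) ∧
    -- the asymptotic, with `X = d ^ c`, uniformly for `c` in compact subsets of `(k-1, k)`
    (∀ δ : ℝ, 0 < δ → ∀ ε : ℝ, 0 < ε → ∃ D : ℕ, ∀ d : ℕ, D ≤ d →
      ∀ c : ℝ, c ∈ Set.Icc ((k : ℝ) - 1 + δ) ((k : ℝ) - δ) →
        |smoothVariance w k ((d : ℝ) ^ c) d
            - arithConst k d * gammaK k c * (d : ℝ) ^ c * Real.log d ^ (k ^ 2 - 1)|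
          ≤ ε * (arithConst k d * gammaK k c * (d : ℝ) ^ c * Real.log d ^ (k ^ 2 - 1))) := by
  refine ⟨fun d hd => ⟨fun s hs => ?_, arithConst_eq k (show d ≠ 0 by omega) ▸ tendsto_tauSqTerm k (show d ≠ 0 by omega)⟩, fun δ hδ ε hε => ?_⟩
  · exact (hasSum_tauSq k (by omega) hs).summable.congr fun n => (tauSqTerm_eq k d s n).symm
  · obtain ⟨D, hD⟩ := eventually_atTop.1 (eventually_abs_smoothVariance_sub_le (k := k) (by omega) hw hsupp hnorm
      (δ := min δ 1) (lt_min hδ one_pos) (min_le_right _ _) hε)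
    refine ⟨D, fun d hd c hc => ?_⟩
    have hmin := min_le_left δ 1
    have h := hD d hd c ⟨by linarith [hc.1], by linarith [hc.2]⟩
    have e : arithConst k d * gammaK k c * (d : ℝ) ^ c * Real.log d ^ (k ^ 2 - 1) =
        arithConst k d * (d : ℝ) ^ c * (((k - c) * Real.log d) ^ (k ^ 2 - 1) / ((k ^ 2 - 1)! : ℝ)) := by
      rw [gammaK, mul_pow]; ring
    rw [e]
    exact h

end MainTheorem
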